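/- Let $V$ be a complete discrete valuation ring with uniformizer $\pi$ and fraction field $K$, and let $\epsilon=|\pi|\in(0,1)$. Let $R$ be a finitely generated, torsion-free, commutative $V$-algebra, and put $R^e=R\otimes_V R$ and $\underline R=K\otimes_V R$. *Bornologies.* A bornology on a $V$-module $X$ is a family of "bounded" subsets that contains all finite subsets and is closed under subsets, finite unions and generated $V$-submodules; it is a $K$-vector space bornology if $X$ is a $K$-vector space and multiplication by $\pi^{-1}$ is bounded. The fine bornology consists of the subsets of finitely generated submodules. The completion of a bornological algebra is the separated quotient of the inductive limit of the $\pi$-adic completions of its bounded $V$-submodules. For a bornological algebra $A$, the completed tensor power $A^{\hat\otimes n}$ is the completion of $A^{\otimes_V n}$ for the bornology generated by the images of $S^{\otimes n}$ with $S\subseteq A$ a bounded submodule. *Weak completion.* $R^\dagger$ is the algebra of all elements $\sum_{j\ge0}\pi^jw_j$ of the $\pi$-adic completion $\varprojlim R/\pi^jR$ with $w_j\in M^{\kappa_j}$ for some finitely generated $V$-submodule $M\subseteq R$ with $1\in M$ and some $\kappa_j\le c(j+1)$, where $c$ is a constant; a subset of $R^\dagger$ is bounded if the same $M$ and $c$ work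 for all its elements. $R^\dagger$ is an $(R^e)^\dagger$-module through the homomorphism $\mu^\dagger\colon(R^e)^\dagger\to R^\dagger$ induced by the multiplication $\mu\colon R^e\to R$. *Tube completions.* For a bornological $K$-algebra, a $V$-submodule $M$ and $r>0$, put $r\star M=\pi^{\lceil\log_\epsilon r\rceil}M$, and let the spectral radius $\varrho(M)$ be the infimum of all $r>0$ for which $\sum_{n\ge0}r^{-n}\star M^n$ is bounded. Let $R$ carry the fine bornology. For an ideal $J\triangleleft R$ with $\pi\in J$ and $\alpha\in[0,1]$, let $\widehat{\underline R}_{J,\alpha}$ be the completion of $\underline R$ for the smallest $K$-vector space bornology for which $\varrho(M)\le\epsilon^\alpha$ for all bounded $V$-submodules $M\subseteq J$ (viewed in $\underline R$). *Complexes.* For a commutative $V$-algebra $A$ let $(C(A),b)$ be the Hochschild complex of $A$-modules, $C_n(A)=A^{\otimes_V n+1}$, and $(B(A),b')$ the bar complex, $B_n(A)=A^{\otimes_V n+2}$, a complex of $A\otimes_V A$-modules through the outer factors; for $A=R^\dagger$ and $A=\widehat{\underline R}_{J,\alpha}$ the tensor powers are replaced by the completed ones. $HH_*(A)$ is the homology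 of $C(A)$. (a) The complex $(R^e)^\dagger\otimes_{R^e}B(R)$, augmented by $c\otimes(a\otimes b)\mapsto c\cdot ab$, is a resolution of $R^\dagger$ by flat $(R^e)^\dagger$-modules. There is an isomorphism of bornological algebras $(R^e)^\dagger\cong R^\dagger\hat\otimes R^\dagger$ extending the canonical maps from $R^e$, under which $\mu^\dagger$ corresponds to $a\otimes b\mapsto ab$, and, through it, $B(R^\dagger)$ augmented by the multiplication $R^\dagger\hat\otimes R^\dagger\to R^\dagger$ is also a resolution of $R^\dagger$ by flat $(R^e)^\dagger$-modules. The natural map $C(R)\to C(R^\dagger)$ induces a quasi-isomorphism $R^\dagger\otimes_R(C(R),b)\to(C(R^\dagger),b)$, and the natural map $HH_*(R)\to HH_*(R^\dagger)$ induces isomorphisms $$R^\dagger\otimes_R HH_n(R)\cong HH_n(R^\dagger)\qquad(n\ge0).$$ (b) For every ideal $J\triangleleft R$ with $\pi\in J$ and every rational $\alpha\in[0,1]$, the canonical maps $$\widehat{\underline R}_{J,\alpha}\otimes_{\underline R}HH_n(\underline R)\to HH_n(\widehat{\underline R}_{J,\alpha})\qquad(n\ge0)$$ are isomorphisms. -/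

import Mathlib

open CategoryTheory
open scoped TensorProduct Pointwise

universe u

noncomputable section

namespace BornHH

/-! ### Convex bornologies -/

section Bornology

variable (V : Type*) [CommRing V]

/-- A (convex) bornology on a `V`-module: the `V`-submodule generated by a bounded set is bounded. -/
structure ConvexBornology (X : Type*) [AddCommGroup X] [Module V X] extends Bornology X where
  isBounded_span : ∀ S : Set X, Bornology.IsBounded S →
    Bornology.IsBounded (Submodule.span V S : Set X)

variable {V}

namespace ConvexBornology

variable {X : Type*} [AddCommGroup X] [Module V X]

/-- The bounded subsets of a convex bornology. -/
def Bdd (𝓑 : ConvexBornology V X) (S : Set X) : Prop :=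
  @Bornology.IsBounded X 𝓑.toBornology S

variable (𝓑 : ConvexBornology V X)

lemma Bdd.subset {𝓑 : ConvexBornology V X} {S T : Set X} (hT : 𝓑.Bdd T) (h : S ⊆ T) : 𝓑.Bdd S :=
  @Bornology.IsBounded.subset X 𝓑.toBornology _ _ hT h

lemma Bdd.union {𝓑 : ConvexBornology V X} {S T : Set X} (hS : 𝓑.Bdd S) (hT : 𝓑.Bdd T) :
    𝓑.Bdd (S ∪ T) :=
  @Bornology.IsBounded.union X 𝓑.toBornology _ _ hS hT

lemma Bdd.span {𝓑 : ConvexBornology V X} {S : Set X} (hS : 𝓑.Bdd S) :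
    𝓑.Bdd (Submodule.span V S : Set X) :=
  𝓑.isBounded_span S hS

lemma bdd_finite {S : Set X} (hS : S.Finite) : 𝓑.Bdd S :=
  @Set.Finite.isBounded X 𝓑.toBornology _ hS

lemma Bdd.sup {𝓑 : ConvexBornology V X} {S T : Submodule V X} (hS : 𝓑.Bdd S) (hT : 𝓑.Bdd T) :
    𝓑.Bdd (S ⊔ T : Submodule V X) := by
  have h := (hS.union hT).span
  rwa [Submodule.span_union, Submodule.span_eq, Submodule.span_eq] at h

/-- A convex bornology from its bounded sets. -/
def ofBdd (B : Set (Set X)) (finite_mem : ∀ S : Set X, S.Finite → S ∈ B)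
    (subset_mem : ∀ S ∈ B, ∀ T ⊆ S, T ∈ B) (union_mem : ∀ S ∈ B, ∀ T ∈ B, S ∪ T ∈ B)
    (span_mem : ∀ S ∈ B, (Submodule.span V S : Set X) ∈ B) : ConvexBornology V X where
  toBornology := Bornology.ofBounded B (finite_mem _ Set.finite_empty) subset_mem union_mem
    (fun x => finite_mem _ (Set.finite_singleton x))
  isBounded_span S hS := by
    rw [Bornology.isBounded_ofBounded_iff] at hS ⊢
    exact span_mem S hS

lemma bdd_ofBdd {B : Set (Set X)} {h₁ h₂ h₃ h₄} (S : Set X) :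
    (ofBdd (V := V) B h₁ h₂ h₃ h₄).Bdd S ↔ S ∈ B :=
  Bornology.isBounded_ofBounded_iff (sUnion_univ := fun x => h₁ _ (Set.finite_singleton x)) _

lemma exists_finite_subset {P : Set (Submodule V X)} (cover : ∀ x, ∃ M ∈ P, x ∈ M)
    (dir : ∀ M ∈ P, ∀ N ∈ P, ∃ L ∈ P, M ≤ L ∧ N ≤ L) {S : Set X} (hS : S.Finite) :
    ∃ M ∈ P, S ⊆ M := by
  induction S, hS using Set.Finite.induction_on with
  | empty =>
    obtain ⟨M, hM, -⟩ := cover 0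
    exact ⟨M, hM, Set.empty_subset _⟩
  | @insert a S _ _ ih =>
    obtain ⟨M, hM, hSM⟩ := ih
    obtain ⟨N, hN, haN⟩ := cover a
    obtain ⟨L, hL, h₁, h₂⟩ := dir M hM N hN
    refine ⟨L, hL, Set.insert_subset (h₂ haN) (hSM.trans h₁)⟩

/-- The convex bornology whose bounded sets are the subsets of the members of a directed covering
family of submodules. -/
def ofSubmodules (P : Set (Submodule V X)) (cover : ∀ x, ∃ M ∈ P, x ∈ M)
    (dir : ∀ M ∈ P, ∀ N ∈ P, ∃ L ∈ P, M ≤ L ∧ N ≤ L) : ConvexBornology V X :=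
  ofBdd {S | ∃ M ∈ P, S ⊆ M}
    (fun _ hS => exists_finite_subset cover dir hS)
    (fun _ ⟨M, hM, hS⟩ _ hT => ⟨M, hM, hT.trans hS⟩)
    (fun _ ⟨M, hM, hS⟩ _ ⟨N, hN, hT⟩ => by
      obtain ⟨L, hL, h₁, h₂⟩ := dir M hM N hN
      exact ⟨L, hL, Set.union_subset (hS.trans h₁) (hT.trans h₂)⟩)
    (fun _ ⟨M, hM, hS⟩ => ⟨M, hM, Submodule.span_le.2 hS⟩)

lemma bdd_ofSubmodules {P : Set (Submodule V X)} {cover dir} (S : Set X) :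
    (ofSubmodules P cover dir).Bdd S ↔ ∃ M ∈ P, S ⊆ M :=
  bdd_ofBdd S

/-- For a submodule `S`, the sequence `x` `S`-converges to `y`: one has `x n - y ∈ δ n • S` for
a sequence `δ` in `V` tending to zero `π`-adically (after enlarging `S` by finitely many elements
this may be required for all `n`). -/
def ConvergesIn (π : V) (S : Submodule V X) (x : ℕ → X) (y : X) : Prop :=
  ∀ k : ℕ, ∃ N, ∀ n ≥ N, x n - y ∈ π ^ k • S

/-- Bornological convergence of a sequence. -/
def Converges (π : V) (x : ℕ → X) (y : X) : Prop :=
  ∃ S : Submodule V X, 𝓑.Bdd S ∧ ConvergesIn π S x y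

/-- `S`-Cauchy sequences in a submodule `S`. -/
def IsCauchyIn (π : V) (S : Submodule V X) (x : ℕ → X) : Prop :=
  (∀ n, x n ∈ S) ∧ ∀ k : ℕ, ∃ N, ∀ n ≥ N, ∀ m ≥ N, x n - x m ∈ π ^ k • S

/-- A submodule is bornologically closed if it contains all limits of its convergent sequences. -/
def IsClosedSubmodule (π : V) (N : Submodule V X) : Prop :=
  ∀ (x : ℕ → X) (y : X), (∀ n, x n ∈ N) → 𝓑.Converges π x y → y ∈ N

/-- The bornological closure of `{0}`: the smallest bornologically closed submodule. -/
def closureZero (π : V) : Submodule V X :=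
  sInf {N | 𝓑.IsClosedSubmodule π N}

lemma isClosedSubmodule_closureZero (π : V) : 𝓑.IsClosedSubmodule π (𝓑.closureZero π) := by
  intro x y hx hxy
  refine Submodule.mem_sInf.2 fun N hN => hN x y (fun n => ?_) hxy
  exact Submodule.mem_sInf.1 (hx n) N hN

/-- Boundedness of a linear map. -/
def BoundedMap {Y : Type*} [AddCommGroup Y] [Module V Y] (𝓑 : ConvexBornology V X)
    (𝓒 : ConvexBornology V Y) (f : X → Y) : Prop :=
  ∀ S, 𝓑.Bdd S → 𝓒.Bdd (f '' S)

variable {𝓑}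
variable {Y : Type*} [AddCommGroup Y] [Module V Y] {𝓒 : ConvexBornology V Y}

lemma map_pow_smul_mem (π : V) (f : X →ₗ[V] Y) {S : Submodule V X} {T : Submodule V Y}
    (h : ∀ s ∈ S, f s ∈ T) {k : ℕ} {x : X} (hx : x ∈ π ^ k • S) : f x ∈ π ^ k • T := by
  obtain ⟨s, hs, rfl⟩ := (Submodule.mem_smul_pointwise_iff_exists _ _ _).1 hx
  rw [map_smul]
  exact Submodule.smul_mem_pointwise_smul _ _ _ (h s hs)

lemma BoundedMap.exists_submodule {f : X →ₗ[V] Y} (hf : BoundedMap 𝓑 𝓒 f) {S : Submodule V X}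
    (hS : 𝓑.Bdd S) : 𝓒.Bdd (S.map f : Submodule V Y) := by
  simpa using hf S hS

lemma Converges.map {π : V} {f : X →ₗ[V] Y} (hf : BoundedMap 𝓑 𝓒 f) {x : ℕ → X} {y : X}
    (h : 𝓑.Converges π x y) : 𝓒.Converges π (fun n => f (x n)) (f y) := by
  obtain ⟨S, hS, h⟩ := h
  refine ⟨S.map f, hf.exists_submodule hS, fun k => ?_⟩
  obtain ⟨N, hN⟩ := h k
  refine ⟨N, fun n hn => ?_⟩
  rw [← map_sub]
  exact map_pow_smul_mem π f (fun s hs => Submodule.mem_map_of_mem hs) (hN n hn)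

lemma closureZero_le_comap (π : V) {f : X →ₗ[V] Y} (hf : BoundedMap 𝓑 𝓒 f) :
    𝓑.closureZero π ≤ (𝓒.closureZero π).comap f :=
  sInf_le fun x _ hx h =>
    𝓒.isClosedSubmodule_closureZero π (fun n => f (x n)) _ hx (h.map hf)

lemma IsCauchyIn.map {π : V} (f : X →ₗ[V] Y) {S : Submodule V X} {x : ℕ → X}
    (h : IsCauchyIn π S x) : IsCauchyIn π (S.map f) (fun n => f (x n)) := by
  refine ⟨fun n => Submodule.mem_map_of_mem (h.1 n), fun k => ?_⟩
  obtain ⟨N, hN⟩ := h.2 k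
  refine ⟨N, fun n hn m hm => ?_⟩
  rw [← map_sub]
  exact map_pow_smul_mem π f (fun s hs => Submodule.mem_map_of_mem hs) (hN n hn m hm)

lemma pow_smul_mono (π : V) {S T : Submodule V X} (h : S ≤ T) (k : ℕ) :
    π ^ k • S ≤ π ^ k • T := by
  intro x hx
  exact map_pow_smul_mem π LinearMap.id (fun s hs => h hs) hx

lemma IsCauchyIn.mono {π : V} {S T : Submodule V X} (hST : S ≤ T) {x : ℕ → X}
    (h : IsCauchyIn π S x) : IsCauchyIn π T x := by
  refine ⟨fun n => hST (h.1 n), fun k => ?_⟩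
  obtain ⟨N, hN⟩ := h.2 k
  exact ⟨N, fun n hn m hm => pow_smul_mono π hST k (hN n hn m hm)⟩

lemma ConvergesIn.mono {π : V} {S T : Submodule V X} (hST : S ≤ T) {x : ℕ → X} {y : X}
    (h : ConvergesIn π S x y) : ConvergesIn π T x y := by
  intro k
  obtain ⟨N, hN⟩ := h k
  exact ⟨N, fun n hn => pow_smul_mono π hST k (hN n hn)⟩

lemma isCauchyIn_const (π : V) {S : Submodule V X} {x : X} (hx : x ∈ S) :
    IsCauchyIn π S (fun _ => x) :=
  ⟨fun _ => hx, fun k => ⟨0, fun _ _ _ _ => by simp⟩⟩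

lemma IsCauchyIn.add {π : V} {S : Submodule V X} {x y : ℕ → X}
    (hx : IsCauchyIn π S x) (hy : IsCauchyIn π S y) : IsCauchyIn π S (x + y) := by
  refine ⟨fun n => S.add_mem (hx.1 n) (hy.1 n), fun k => ?_⟩
  obtain ⟨N, hN⟩ := hx.2 k
  obtain ⟨M, hM⟩ := hy.2 k
  refine ⟨max N M, fun n hn m hm => ?_⟩
  have h := add_mem (hN n (le_of_max_le_left hn) m (le_of_max_le_left hm))
    (hM n (le_of_max_le_right hn) m (le_of_max_le_right hm))
  have e : (x + y) n - (x + y) m = (x n - x m) + (y n - y m) := by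
    simp only [Pi.add_apply]; abel
  rwa [e]

lemma ConvergesIn.add {π : V} {S : Submodule V X} {x y : ℕ → X} {a b : X}
    (hx : ConvergesIn π S x a) (hy : ConvergesIn π S y b) : ConvergesIn π S (x + y) (a + b) := by
  intro k
  obtain ⟨N, hN⟩ := hx k
  obtain ⟨M, hM⟩ := hy k
  refine ⟨max N M, fun n hn => ?_⟩
  have h := add_mem (hN n (le_of_max_le_left hn)) (hM n (le_of_max_le_right hn))
  have e : (x + y) n - (a + b) = (x n - a) + (y n - b) := by
    simp only [Pi.add_apply]; abel
  rwa [e]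

end ConvexBornology

open ConvexBornology

variable (V)

/-- A commutative bornological `V`-algebra structure on `A`: a convex bornology for which the
multiplication is bounded. -/
structure AlgBornology (A : Type*) [CommRing A] [Algebra V A] extends ConvexBornology V A where
  bdd_mul : ∀ S T : Set A, toConvexBornology.Bdd S → toConvexBornology.Bdd T →
    toConvexBornology.Bdd (S * T)

variable {V}

namespace AlgBornology

variable {A : Type*} [CommRing A] [Algebra V A] {B : Type*} [CommRing B] [Algebra V B]

lemma bdd_mul_submodule (𝓑 : AlgBornology V A) {S T : Submodule V A} (hS : 𝓑.Bdd S)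
    (hT : 𝓑.Bdd T) : 𝓑.Bdd (S * T : Submodule V A) := by
  have h := (𝓑.bdd_mul S T hS hT).span
  rwa [← Submodule.mul_eq_span_mul_set] at h

/-- The bornology with bounded sets the subsets of members of a directed covering family of
submodules, multiplicatively directed as well. -/
def ofSubmodules (P : Set (Submodule V A)) (cover : ∀ x, ∃ M ∈ P, x ∈ M)
    (dir : ∀ M ∈ P, ∀ N ∈ P, ∃ L ∈ P, M ≤ L ∧ N ≤ L)
    (mul : ∀ M ∈ P, ∀ N ∈ P, ∃ L ∈ P, M * N ≤ L) : AlgBornology V A where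
  toConvexBornology := ConvexBornology.ofSubmodules P cover dir
  bdd_mul S T hS hT := by
    rw [bdd_ofSubmodules] at hS hT ⊢
    obtain ⟨M, hM, hS⟩ := hS
    obtain ⟨N, hN, hT⟩ := hT
    obtain ⟨L, hL, h⟩ := mul M hM N hN
    refine ⟨L, hL, ?_⟩
    rintro _ ⟨s, hs, t, ht, rfl⟩
    exact h (Submodule.mul_mem_mul (hS hs) (hT ht))

lemma bdd_ofSubmodules' {P : Set (Submodule V A)} {cover dir mul} (S : Set A) :
    (AlgBornology.ofSubmodules P cover dir mul).Bdd S ↔ ∃ M ∈ P, S ⊆ M :=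
  ConvexBornology.bdd_ofSubmodules (cover := cover) (dir := dir) S

/-- The fine bornology: bounded sets are the subsets of finitely generated submodules. -/
def fine (V A : Type*) [CommRing V] [CommRing A] [Algebra V A] : AlgBornology V A :=
  .ofSubmodules {M | M.FG}
    (fun x => ⟨_, Submodule.fg_span (Set.finite_singleton x), Submodule.mem_span_singleton_self x⟩)
    (fun M hM N hN => ⟨M ⊔ N, Submodule.FG.sup hM hN, le_sup_left, le_sup_right⟩)
    (fun M hM N hN => ⟨M * N, Submodule.FG.mul hM hN, le_rfl⟩)

/-- The quotient bornology along a surjective algebra homomorphism. -/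
def map (𝓑 : AlgBornology V A) (f : A →ₐ[V] B) (hf : Function.Surjective f) : AlgBornology V B :=
  .ofSubmodules {N | ∃ M : Submodule V A, 𝓑.Bdd M ∧ N = M.map f.toLinearMap}
    (fun x => by
      obtain ⟨a, rfl⟩ := hf x
      exact ⟨_, ⟨Submodule.span V {a}, (𝓑.bdd_finite (Set.finite_singleton a)).span, rfl⟩,
        Submodule.mem_map_of_mem (Submodule.mem_span_singleton_self a)⟩)
    (by
      rintro _ ⟨M, hM, rfl⟩ _ ⟨N, hN, rfl⟩
      exact ⟨_, ⟨M ⊔ N, hM.sup hN, rfl⟩, Submodule.map_mono le_sup_left,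
        Submodule.map_mono le_sup_right⟩)
    (by
      rintro _ ⟨M, hM, rfl⟩ _ ⟨N, hN, rfl⟩
      exact ⟨_, ⟨M * N, 𝓑.bdd_mul_submodule hM hN, rfl⟩, (Submodule.map_mul M N f).ge⟩)

/-! ### Bornological completion -/

lemma isCauchyIn_mul {π : V} {S T : Submodule V A} {x y : ℕ → A} (hx : IsCauchyIn π S x)
    (hy : IsCauchyIn π T y) : IsCauchyIn π (S * T) (x * y) := by
  refine ⟨fun n => Submodule.mul_mem_mul (hx.1 n) (hy.1 n), fun k => ?_⟩
  obtain ⟨N, hN⟩ := hx.2 k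
  obtain ⟨M, hM⟩ := hy.2 k
  refine ⟨max N M, fun n hn m hm => ?_⟩
  obtain ⟨s, hs, hs'⟩ := (Submodule.mem_smul_pointwise_iff_exists _ _ _).1
    (hN n (le_of_max_le_left hn) m (le_of_max_le_left hm))
  obtain ⟨t, ht, ht'⟩ := (Submodule.mem_smul_pointwise_iff_exists _ _ _).1
    (hM n (le_of_max_le_right hn) m (le_of_max_le_right hm))
  have e : (x * y) n - (x * y) m = π ^ k • (x n * t + s * y m) := by
    rw [smul_add, ← mul_smul_comm, ← smul_mul_assoc, hs', ht']
    simp only [Pi.mul_apply]; ring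
  rw [e]
  exact Submodule.smul_mem_pointwise_smul _ _ _
    (add_mem (Submodule.mul_mem_mul (hx.1 n) ht) (Submodule.mul_mem_mul hs (hy.1 m)))

/-- The Cauchy sequences in a bornological algebra. -/
def cauchy (π : V) (𝓑 : AlgBornology V A) : Subalgebra V (ℕ → A) where
  carrier := {x | ∃ S : Submodule V A, 𝓑.Bdd S ∧ IsCauchyIn π S x}
  mul_mem' := by
    rintro x y ⟨S, hS, hx⟩ ⟨T, hT, hy⟩
    exact ⟨S * T, 𝓑.bdd_mul_submodule hS hT, isCauchyIn_mul hx hy⟩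
  add_mem' := by
    rintro x y ⟨S, hS, hx⟩ ⟨T, hT, hy⟩
    exact ⟨S ⊔ T, hS.sup hT, (hx.mono le_sup_left).add (hy.mono le_sup_right)⟩
  algebraMap_mem' r := ⟨_, (𝓑.bdd_finite (Set.finite_singleton (algebraMap V A r))).span,
    isCauchyIn_const π (Submodule.mem_span_singleton_self _)⟩

/-- The ideal of null sequences, that is, sequences converging to `0`. -/
def null (π : V) (𝓑 : AlgBornology V A) : Ideal (cauchy π 𝓑) where
  carrier := {x | 𝓑.Converges π x.1 0}
  add_mem' := by
    rintro x y ⟨S, hS, hx⟩ ⟨T, hT, hy⟩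
    refine ⟨S ⊔ T, hS.sup hT, ?_⟩
    simpa using (hx.mono le_sup_left).add (hy.mono (T := S ⊔ T) le_sup_right)
  zero_mem' := ⟨⊥, by simpa using 𝓑.bdd_finite (Set.finite_singleton 0), fun k => ⟨0, by simp⟩⟩
  smul_mem' := by
    rintro ⟨x, S, hS, hx⟩ y ⟨T, hT, hy⟩
    refine ⟨S * T, 𝓑.bdd_mul_submodule hS hT, fun k => ?_⟩
    obtain ⟨N, hN⟩ := hy k
    refine ⟨N, fun n hn => ?_⟩
    obtain ⟨t, ht, ht'⟩ := (Submodule.mem_smul_pointwise_iff_exists _ _ _).1 (hN n hn)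
    rw [sub_zero] at ht'
    have e : (x * y.1) n - 0 = π ^ k • (x n * t) := by
      rw [sub_zero, ← mul_smul_comm, ht']; rfl
    change (x * y.1) n - 0 ∈ _
    rw [e]
    exact Submodule.smul_mem_pointwise_smul _ _ _ (Submodule.mul_mem_mul (hx.1 n) ht)

/-- Cauchy sequences modulo null sequences. This is the inductive limit of the `π`-adic completions
of the bounded submodules; it need not be separated. -/
def PreCompletion (π : V) (𝓑 : AlgBornology V A) : Type _ := cauchy π 𝓑 ⧸ null π 𝓑

namespace PreCompletion

variable (π : V) (𝓑 : AlgBornology V A)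

instance : CommRing (PreCompletion π 𝓑) := inferInstanceAs (CommRing (cauchy π 𝓑 ⧸ null π 𝓑))

instance : Algebra V (PreCompletion π 𝓑) := inferInstanceAs (Algebra V (cauchy π 𝓑 ⧸ null π 𝓑))

/-- The class of a Cauchy sequence. -/
def mk : cauchy π 𝓑 →ₐ[V] PreCompletion π 𝓑 := Ideal.Quotient.mkₐ V (null π 𝓑)

lemma mk_surjective : Function.Surjective (mk π 𝓑) := Ideal.Quotient.mkₐ_surjective V _

/-- For a submodule `S`, the classes of `S`-Cauchy sequences: the image of the
`π`-adic completion of `S`. -/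
def ball (S : Submodule V A) : Submodule V (PreCompletion π 𝓑) :=
  Submodule.map (mk π 𝓑).toLinearMap
    { carrier := {x | IsCauchyIn π S x.1}
      add_mem' := fun hx hy => hx.add hy
      zero_mem' := isCauchyIn_const π S.zero_mem
      smul_mem' := fun c _ hx =>
        IsCauchyIn.mono (Submodule.map_le_iff_le_comap.2 fun s hs => by
          simpa using S.smul_mem c hs) (IsCauchyIn.map (c • (LinearMap.id : A →ₗ[V] A)) hx) }

lemma mem_ball {S : Submodule V A} {z : PreCompletion π 𝓑} :
    z ∈ ball π 𝓑 S ↔ ∃ x : cauchy π 𝓑, IsCauchyIn π S x.1 ∧ mk π 𝓑 x = z := Iff.rfl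

lemma ball_mono {S T : Submodule V A} (h : S ≤ T) : ball π 𝓑 S ≤ ball π 𝓑 T := by
  rintro _ ⟨x, hx, rfl⟩
  exact ⟨x, IsCauchyIn.mono h hx, rfl⟩

/-- The inductive limit bornology. -/
def bornology : AlgBornology V (PreCompletion π 𝓑) :=
  .ofSubmodules {N | ∃ S : Submodule V A, 𝓑.Bdd S ∧ N = ball π 𝓑 S}
    (fun z => by
      obtain ⟨x, rfl⟩ := mk_surjective π 𝓑 z
      obtain ⟨S, hS, hx⟩ := x.2
      exact ⟨_, ⟨S, hS, rfl⟩, x, hx, rfl⟩)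
    (by
      rintro _ ⟨S, hS, rfl⟩ _ ⟨T, hT, rfl⟩
      exact ⟨_, ⟨S ⊔ T, hS.sup hT, rfl⟩, ball_mono _ _ le_sup_left, ball_mono _ _ le_sup_right⟩)
    (by
      rintro _ ⟨S, hS, rfl⟩ _ ⟨T, hT, rfl⟩
      refine ⟨_, ⟨S * T, 𝓑.bdd_mul_submodule hS hT, rfl⟩, Submodule.mul_le.2 ?_⟩
      rintro _ ⟨x, hx, rfl⟩ _ ⟨y, hy, rfl⟩
      exact ⟨x * y, isCauchyIn_mul hx hy, map_mul (mk π 𝓑) x y⟩)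

end PreCompletion

/-- The bornological closure of `{0}`, as an ideal. -/
def closureZeroIdeal (π : V) (𝓑 : AlgBornology V A) : Ideal A where
  __ := 𝓑.closureZero π
  smul_mem' := fun a x hx => by
    have h : BoundedMap 𝓑.toConvexBornology 𝓑.toConvexBornology (LinearMap.mulLeft V a) := by
      intro S hS
      refine (𝓑.bdd_mul {a} S (𝓑.bdd_finite (Set.finite_singleton a)) hS).subset ?_
      rintro _ ⟨s, hs, rfl⟩
      exact Set.mul_mem_mul rfl hs
    exact closureZero_le_comap π h hx

/-- The bornological completion: the separated quotient of the inductive limit of the `π`-adic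
completions of the bounded submodules. -/
def Completion (π : V) (𝓑 : AlgBornology V A) : Type _ :=
  PreCompletion π 𝓑 ⧸ closureZeroIdeal π (PreCompletion.bornology π 𝓑)

namespace Completion

variable (π : V) (𝓑 : AlgBornology V A) {𝓒 : AlgBornology V B}

instance : CommRing (Completion π 𝓑) :=
  inferInstanceAs (CommRing (_ ⧸ closureZeroIdeal π (PreCompletion.bornology π 𝓑)))

instance : Algebra V (Completion π 𝓑) :=
  inferInstanceAs (Algebra V (_ ⧸ closureZeroIdeal π (PreCompletion.bornology π 𝓑)))

/-- The separated quotient map. -/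
def proj : PreCompletion π 𝓑 →ₐ[V] Completion π 𝓑 := Ideal.Quotient.mkₐ V _

/-- The limit in the completion of a Cauchy sequence. -/
def mk : cauchy π 𝓑 →ₐ[V] Completion π 𝓑 := (proj π 𝓑).comp (PreCompletion.mk π 𝓑)

lemma proj_surjective : Function.Surjective (proj π 𝓑) := Ideal.Quotient.mkₐ_surjective V _

lemma mk_surjective : Function.Surjective (mk π 𝓑) :=
  (proj_surjective π 𝓑).comp (PreCompletion.mk_surjective π 𝓑)

/-- The bornology of the completion. -/
def bornology : AlgBornology V (Completion π 𝓑) :=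
  (PreCompletion.bornology π 𝓑).map (proj π 𝓑) (proj_surjective π 𝓑)

/-- Constant sequences. -/
def const : A →ₐ[V] cauchy π 𝓑 where
  toFun a := ⟨fun _ => a, _, (𝓑.bdd_finite (Set.finite_singleton a)).span,
    isCauchyIn_const π (Submodule.mem_span_singleton_self _)⟩
  map_one' := rfl
  map_mul' _ _ := rfl
  map_zero' := rfl
  map_add' _ _ := rfl
  commutes' _ := rfl

/-- The canonical map to the completion. -/
def of : A →ₐ[V] Completion π 𝓑 := (mk π 𝓑).comp (const π 𝓑)

variable {𝓑}

/-- Termwise application of a bounded homomorphism to Cauchy sequences. -/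
def cauchyMap (f : A →ₐ[V] B) (hf : BoundedMap 𝓑.toConvexBornology 𝓒.toConvexBornology f) :
    cauchy π 𝓑 →ₐ[V] cauchy π 𝓒 where
  toFun x := ⟨fun n => f (x.1 n), by
    obtain ⟨S, hS, hx⟩ := x.2
    exact ⟨S.map f.toLinearMap, BoundedMap.exists_submodule (f := f.toLinearMap) hf hS,
      hx.map f.toLinearMap⟩⟩
  map_one' := Subtype.ext (funext fun _ => map_one f)
  map_mul' _ _ := Subtype.ext (funext fun _ => map_mul f _ _)
  map_zero' := Subtype.ext (funext fun _ => map_zero f)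
  map_add' _ _ := Subtype.ext (funext fun _ => map_add f _ _)
  commutes' r := Subtype.ext (funext fun _ => f.commutes r)

/-- The map induced on `PreCompletion`. -/
def preMap (f : A →ₐ[V] B) (hf : BoundedMap 𝓑.toConvexBornology 𝓒.toConvexBornology f) :
    PreCompletion π 𝓑 →ₐ[V] PreCompletion π 𝓒 :=
  Ideal.quotientMapₐ (null π 𝓒) (cauchyMap π f hf) (by
    rintro x hx
    have h := Converges.map (f := f.toLinearMap) hf (show 𝓑.Converges π x.1 0 from hx)
    rw [map_zero] at h
    exact h)

lemma bounded_preMap (f : A →ₐ[V] B)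
    (hf : BoundedMap 𝓑.toConvexBornology 𝓒.toConvexBornology f) :
    BoundedMap (PreCompletion.bornology π 𝓑).toConvexBornology
      (PreCompletion.bornology π 𝓒).toConvexBornology (preMap π f hf) := by
  intro T hT
  obtain ⟨_, ⟨S, hS, rfl⟩, hT⟩ := (bdd_ofSubmodules' _).1 hT
  refine (bdd_ofSubmodules' _).2 ⟨_, ⟨S.map f.toLinearMap,
    BoundedMap.exists_submodule (f := f.toLinearMap) hf hS, rfl⟩, ?_⟩
  rintro _ ⟨z, hz, rfl⟩
  obtain ⟨x, hx, rfl⟩ := hT hz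
  exact ⟨cauchyMap π f hf x, IsCauchyIn.map f.toLinearMap hx, rfl⟩

/-- Functoriality of the completion for bounded homomorphisms. -/
def map (f : A →ₐ[V] B) (hf : BoundedMap 𝓑.toConvexBornology 𝓒.toConvexBornology f) :
    Completion π 𝓑 →ₐ[V] Completion π 𝓒 :=
  Ideal.quotientMapₐ (closureZeroIdeal π (PreCompletion.bornology π 𝓒)) (preMap π f hf)
    (closureZero_le_comap π (f := (preMap π f hf).toLinearMap) (bounded_preMap π f hf))

lemma map_mk (f : A →ₐ[V] B) (hf : BoundedMap 𝓑.toConvexBornology 𝓒.toConvexBornology f)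
    (x : cauchy π 𝓑) : map π f hf (mk π 𝓑 x) = mk π 𝓒 (cauchyMap π f hf x) := rfl

lemma map_of (f : A →ₐ[V] B) (hf : BoundedMap 𝓑.toConvexBornology 𝓒.toConvexBornology f)
    (a : A) : map π f hf (of π 𝓑 a) = of π 𝓒 (f a) := rfl

end Completion
end AlgBornology
end Bornology

/-! ### The weak (Monsky–Washnitzer) completion -/

section WeakCompletion

variable {V : Type*} [CommRing V] (π : V) (R : Type*) [CommRing R] [Algebra V R]
  {S : Type*} [CommRing S] [Algebra V S]

/-- The ideal `π R`. -/
def adicIdeal : Ideal R := Ideal.span {algebraMap V R π}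

/-- The projection from the `π`-adic completion of `R` to `R / π ^ n R`. -/
def adicEval (n : ℕ) : AdicCompletion (adicIdeal π R) R →ₐ[V] R ⧸ adicIdeal π R ^ n where
  __ := (AdicCompletion.evalₐ (adicIdeal π R) n).toRingHom
  commutes' r := AdicCompletion.evalₐ_of _ n (algebraMap V R r)

variable {R}

lemma adicEval_ext {x y : AdicCompletion (adicIdeal π R) R}
    (h : ∀ n, adicEval π R n x = adicEval π R n y) : x = y :=
  AdicCompletion.ext_evalₐ h

/-- The partial sums of `∑ π ^ j w j`. -/
def partialSum (w : ℕ → R) (n : ℕ) : R := ∑ j ∈ Finset.range n, π ^ j • w j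

/-- `z = ∑ π ^ j w j` in the `π`-adic completion of `R`. -/
def IsSeries (w : ℕ → R) (z : AdicCompletion (adicIdeal π R) R) : Prop :=
  ∀ n, adicEval π R n z = Ideal.Quotient.mk _ (partialSum π w n)

lemma IsSeries.add {w v : ℕ → R} {y z : AdicCompletion (adicIdeal π R) R}
    (hy : IsSeries π w y) (hz : IsSeries π v z) : IsSeries π (w + v) (y + z) := fun n => by
  rw [map_add, hy n, hz n, ← map_add]
  simp [partialSum, Finset.sum_add_distrib]

lemma IsSeries.smul (r : V) {w : ℕ → R} {z : AdicCompletion (adicIdeal π R) R}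
    (hz : IsSeries π w z) : IsSeries π (r • w) (r • z) := fun n => by
  rw [map_smul, hz n]
  change r • Ideal.Quotient.mkₐ V _ _ = Ideal.Quotient.mkₐ V _ _
  rw [← map_smul]
  simp [partialSum, Finset.smul_sum, smul_comm r]

lemma pow_smul_mem_adicIdeal {n k : ℕ} (h : n ≤ k) (x : R) : π ^ k • x ∈ adicIdeal π R ^ n := by
  rw [Algebra.smul_def, map_pow]
  exact Ideal.mul_mem_right _ _
    (Ideal.pow_le_pow_right h (Ideal.pow_mem_pow (Ideal.mem_span_singleton_self _) k))

lemma isSeries_single (x : R) :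
    IsSeries π (Pi.single 0 x) (AdicCompletion.of (adicIdeal π R) R x) := fun n => by
  refine (AdicCompletion.evalₐ_of _ n x).trans ?_
  rcases n with _ | n
  · refine (Ideal.Quotient.eq).2 ?_
    simp
  · congr 1
    rw [partialSum, Finset.sum_eq_single 0]
    · simp
    · intro j _ hj; simp [hj]
    · intro h; simp at h

lemma IsSeries.mul {w v : ℕ → R} {y z : AdicCompletion (adicIdeal π R) R}
    (hy : IsSeries π w y) (hz : IsSeries π v z) :
    IsSeries π (fun k => ∑ p ∈ Finset.HasAntidiagonal.antidiagonal k, w p.1 * v p.2) (y * z) := fun n => by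
  rw [map_mul, hy n, hz n, ← map_mul, Ideal.Quotient.eq]
  have h₁ : partialSum π w n * partialSum π v n =
      ∑ p ∈ Finset.range n ×ˢ Finset.range n, π ^ (p.1 + p.2) • (w p.1 * v p.2) := by
    rw [partialSum, partialSum, Finset.sum_mul_sum, ← Finset.sum_product']
    refine Finset.sum_congr rfl fun p _ => ?_
    rw [smul_mul_smul_comm, pow_add]
  have h₂ : partialSum π (fun k => ∑ p ∈ Finset.HasAntidiagonal.antidiagonal k, w p.1 * v p.2) n =
      ∑ p ∈ Finset.range n ×ˢ Finset.range n with p.1 + p.2 < n,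
        π ^ (p.1 + p.2) • (w p.1 * v p.2) := by
    rw [← Finset.sum_fiberwise_of_maps_to (s := _) (t := Finset.range n)
      (g := fun p : ℕ × ℕ => p.1 + p.2) (by
        intro p hp
        exact Finset.mem_range.2 (Finset.mem_filter.1 hp).2)]
    refine Finset.sum_congr rfl fun k hk => ?_
    rw [Finset.smul_sum]
    refine (Finset.sum_congr ?_ ?_)
    · ext p
      simp only [Finset.HasAntidiagonal.mem_antidiagonal, Finset.mem_filter, Finset.mem_product,
        Finset.mem_range] at hk ⊢
      omega
    · intro p hp
      simp only [Finset.mem_filter] at hp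
      rw [hp.2]
  rw [h₁, h₂, ← Finset.sum_filter_add_sum_filter_not (Finset.range n ×ˢ Finset.range n)
    (fun p => p.1 + p.2 < n), add_sub_cancel_left]
  refine Ideal.sum_mem _ fun p hp => pow_smul_mem_adicIdeal π ?_ _
  simp only [Finset.mem_filter] at hp
  omega

/-- The elements `∑ π ^ j w j` with `w j ∈ M ^ (c (j + 1))`. If `1 ∈ M`, then the powers of `M`
increase, so this allows `w j ∈ M ^ κ j` for all `κ j ≤ c (j + 1)`. -/
def weakBall (M : Submodule V R) (c : ℕ) : Submodule V (AdicCompletion (adicIdeal π R) R) where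
  carrier := {z | ∃ w : ℕ → R, (∀ j, w j ∈ M ^ (c * (j + 1))) ∧ IsSeries π w z}
  add_mem' := by
    rintro y z ⟨w, hw, hy⟩ ⟨v, hv, hz⟩
    exact ⟨w + v, fun j => add_mem (hw j) (hv j), hy.add π hz⟩
  zero_mem' := ⟨0, fun j => zero_mem _, fun n => by simp [partialSum]⟩
  smul_mem' := by
    rintro r z ⟨w, hw, hz⟩
    exact ⟨r • w, fun j => Submodule.smul_mem _ r (hw j), hz.smul π r⟩

lemma pow_mono_of_one_mem {M N : Submodule V R} (h : M ≤ N) (h1 : (1 : R) ∈ N) {m n : ℕ}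
    (hmn : m ≤ n) : M ^ m ≤ N ^ n :=
  (pow_le_pow_left' h m).trans (pow_le_pow_right' (Submodule.one_le.2 h1) hmn)

lemma weakBall_mono {M N : Submodule V R} (h : M ≤ N) (h1 : (1 : R) ∈ N) {c d : ℕ} (hcd : c ≤ d) :
    weakBall π M c ≤ weakBall π N d := by
  rintro z ⟨w, hw, hz⟩
  exact ⟨w, fun j => pow_mono_of_one_mem h h1 (Nat.mul_le_mul_right _ hcd) (hw j), hz⟩

lemma weakBall_mul {M N : Submodule V R} (hM : (1 : R) ∈ M) (c d : ℕ)
    {y z : AdicCompletion (adicIdeal π R) R} (hy : y ∈ weakBall π M c) (hz : z ∈ weakBall π N d) :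
    y * z ∈ weakBall π (M ⊔ N) (c + d) := by
  obtain ⟨w, hw, hy⟩ := hy
  obtain ⟨v, hv, hz⟩ := hz
  refine ⟨_, fun k => Submodule.sum_mem _ fun p hp => ?_, hy.mul π hz⟩
  rw [Finset.HasAntidiagonal.mem_antidiagonal] at hp
  have h1 : (1 : R) ∈ M ⊔ N := Submodule.mem_sup_left hM
  rw [add_mul, pow_add]
  refine Submodule.mul_mem_mul
    (pow_mono_of_one_mem le_sup_left h1 (Nat.mul_le_mul_left _ ?_) (hw _))
    (pow_mono_of_one_mem le_sup_right h1 (Nat.mul_le_mul_left _ ?_) (hv _)) <;> omega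

/-- The weak completion as a subalgebra of the `π`-adic completion. -/
def weakSubalgebra : Subalgebra V (AdicCompletion (adicIdeal π R) R) where
  carrier := {z | ∃ M : Submodule V R, M.FG ∧ (1 : R) ∈ M ∧ ∃ c, z ∈ weakBall π M c}
  mul_mem' := by
    rintro y z ⟨M, hM, hM1, c, hy⟩ ⟨N, hN, -, d, hz⟩
    exact ⟨M ⊔ N, hM.sup hN, Submodule.mem_sup_left hM1, c + d, weakBall_mul π hM1 c d hy hz⟩
  add_mem' := by
    rintro y z ⟨M, hM, hM1, c, hy⟩ ⟨N, hN, -, d, hz⟩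
    have h1 : (1 : R) ∈ M ⊔ N := Submodule.mem_sup_left hM1
    exact ⟨M ⊔ N, hM.sup hN, h1, max c d, add_mem
      (weakBall_mono π le_sup_left h1 (le_max_left _ _) hy)
      (weakBall_mono π le_sup_right h1 (le_max_right _ _) hz)⟩
  algebraMap_mem' r := by
    refine ⟨Submodule.span V {1}, Submodule.fg_span (Set.finite_singleton _),
      Submodule.mem_span_singleton_self _, 1, Pi.single 0 (algebraMap V R r), fun j => ?_,
      isSeries_single π _⟩
    rcases j with _ | j
    · simpa [Algebra.algebraMap_eq_smul_one] using
        Submodule.smul_mem _ r (Submodule.mem_span_singleton_self (1 : R))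
    · simp

variable (R)

/-- The weak completion `R†` of `R`: all elements of the `π`-adic completion of the form
`∑ π ^ j w j` with `w j ∈ M ^ κ j`, where `M ∋ 1` is a finitely generated `V`-submodule of `R` and
`κ j ≤ c (j + 1)` for a constant `c`. -/
def WeakCompletion : Type _ := weakSubalgebra (R := R) π

namespace WeakCompletion

instance : CommRing (WeakCompletion π R) := inferInstanceAs (CommRing (weakSubalgebra (R := R) π))

instance : Algebra V (WeakCompletion π R) :=
  inferInstanceAs (Algebra V (weakSubalgebra (R := R) π))

/-- The inclusion into the `π`-adic completion. -/
def val : WeakCompletion π R →ₐ[V] AdicCompletion (adicIdeal π R) R := (weakSubalgebra π).val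

/-- The bornology of the weak completion: `M` and `c` are fixed on a bounded set. -/
def bornology : AlgBornology V (WeakCompletion π R) :=
  .ofSubmodules {N | ∃ M : Submodule V R, M.FG ∧ (1 : R) ∈ M ∧ ∃ c,
      N = (weakBall π M c).comap (val π R).toLinearMap}
    (fun z => by
      obtain ⟨M, hM, hM1, c, hz⟩ := z.2
      exact ⟨_, ⟨M, hM, hM1, c, rfl⟩, hz⟩)
    (by
      rintro _ ⟨M, hM, hM1, c, rfl⟩ _ ⟨N, hN, -, d, rfl⟩
      have h1 : (1 : R) ∈ M ⊔ N := Submodule.mem_sup_left hM1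
      exact ⟨_, ⟨M ⊔ N, hM.sup hN, h1, max c d, rfl⟩,
        Submodule.comap_mono (weakBall_mono π le_sup_left h1 (le_max_left _ _)),
        Submodule.comap_mono (weakBall_mono π le_sup_right h1 (le_max_right _ _))⟩)
    (by
      rintro _ ⟨M, hM, hM1, c, rfl⟩ _ ⟨N, hN, -, d, rfl⟩
      exact ⟨_, ⟨M ⊔ N, hM.sup hN, Submodule.mem_sup_left hM1, c + d, rfl⟩,
        Submodule.mul_le.2 fun y hy z hz => weakBall_mul π hM1 c d hy hz⟩)

lemma of_mem_weakBall {M : Submodule V R} {x : R} (hx : x ∈ M) :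
    AdicCompletion.of (adicIdeal π R) R x ∈ weakBall π M 1 := by
  refine ⟨Pi.single 0 x, fun j => ?_, isSeries_single π _⟩
  rcases j with _ | j
  · simpa using hx
  · simp

/-- The canonical homomorphism `R → R†`. -/
def of : R →ₐ[V] WeakCompletion π R where
  toFun x := ⟨AdicCompletion.of (adicIdeal π R) R x,
    Submodule.span V {1, x}, Submodule.fg_span (by simp),
    Submodule.subset_span (by simp), 1,
    of_mem_weakBall π R (Submodule.subset_span (by simp))⟩
  map_one' := rfl
  map_mul' _ _ := rfl
  map_zero' := rfl
  map_add' _ _ := rfl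
  commutes' _ := rfl

lemma bounded_of : ConvexBornology.BoundedMap (AlgBornology.fine V R).toConvexBornology
    (bornology π R).toConvexBornology (of π R) := by
  intro T hT
  obtain ⟨M, hM, hT⟩ := (AlgBornology.bdd_ofSubmodules' _).1 hT
  refine (AlgBornology.bdd_ofSubmodules' _).2 ⟨_, ⟨M ⊔ Submodule.span V {1},
    Submodule.FG.sup hM (Submodule.fg_span (Set.finite_singleton _)),
    Submodule.mem_sup_right (Submodule.mem_span_singleton_self _), 1, rfl⟩, ?_⟩
  rintro _ ⟨x, hx, rfl⟩
  exact of_mem_weakBall π R (Submodule.mem_sup_left (hT hx))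

variable {R}

lemma adicIdeal_pow_le (f : R →ₐ[V] S) (n : ℕ) :
    adicIdeal π R ^ n ≤ (adicIdeal π S ^ n).comap f := by
  rw [← Ideal.map_le_iff_le_comap, Ideal.map_pow]
  refine Ideal.pow_right_mono ?_ n
  rw [adicIdeal, Ideal.map_span, Ideal.span_le, Set.image_singleton, Set.singleton_subset_iff]
  exact Ideal.subset_span (f.commutes π)

lemma adicEval_compat (f : R →ₐ[V] S) {m n : ℕ} (hle : m ≤ n) :
    (Ideal.Quotient.factorₐ V (Ideal.pow_le_pow_right (I := adicIdeal π S) hle)).comp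
      ((Ideal.quotientMapₐ _ f (adicIdeal_pow_le π f n)).comp (adicEval π R n)) =
      (Ideal.quotientMapₐ _ f (adicIdeal_pow_le π f m)).comp (adicEval π R m) := by
  ext z
  obtain ⟨x, rfl⟩ := AdicCompletion.mk_surjective _ _ z
  have h : adicEval π R m (AdicCompletion.mk _ _ x) = Ideal.Quotient.mk _ (x.val n) := by
    refine (AdicCompletion.evalₐ_mk _ m x).trans ?_
    have := x.2 hle
    rw [SModEq.sub_mem] at this
    refine Ideal.Quotient.eq.2 ?_
    simpa using this
  have h' : adicEval π R n (AdicCompletion.mk _ _ x) = Ideal.Quotient.mk _ (x.val n) :=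
    AdicCompletion.evalₐ_mk _ n x
  simp only [AlgHom.comp_apply, h, h']
  rfl

/-- The map induced by a homomorphism on `π`-adic completions. -/
def adicMap (f : R →ₐ[V] S) :
    AdicCompletion (adicIdeal π R) R →ₐ[V] AdicCompletion (adicIdeal π S) S :=
  AdicCompletion.liftAlgHom (adicIdeal π S)
    (fun n => (Ideal.quotientMapₐ _ f (adicIdeal_pow_le π f n)).comp (adicEval π R n))
    (adicEval_compat π f)

lemma adicEval_adicMap (f : R →ₐ[V] S) (n : ℕ) (z : AdicCompletion (adicIdeal π R) R) :
    adicEval π S n (adicMap π f z) =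
      Ideal.quotientMapₐ _ f (adicIdeal_pow_le π f n) (adicEval π R n z) :=
  AdicCompletion.evalₐ_liftAlgHom _ _ (adicEval_compat π f) n z

lemma adicMap_mem_weakBall (f : R →ₐ[V] S) {M : Submodule V R} {c : ℕ}
    {z : AdicCompletion (adicIdeal π R) R} (hz : z ∈ weakBall π M c) :
    adicMap π f z ∈ weakBall π (M.map f.toLinearMap) c := by
  obtain ⟨w, hw, hz⟩ := hz
  refine ⟨fun j => f (w j), fun j => ?_, fun n => ?_⟩
  · have h := Submodule.mem_map_of_mem (f := f.toLinearMap) (hw j)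
    rwa [Submodule.map_pow] at h
  · rw [adicEval_adicMap, hz n]
    change Ideal.Quotient.mk _ (f _) = _
    simp [partialSum]

/-- Functoriality of the weak completion. -/
def map (f : R →ₐ[V] S) : WeakCompletion π R →ₐ[V] WeakCompletion π S :=
  ((adicMap π f).comp (val π R)).codRestrict (weakSubalgebra π) (by
    rintro ⟨z, M, hM, hM1, c, hz⟩
    exact ⟨M.map f.toLinearMap, hM.map _, ⟨1, hM1, map_one f⟩, c, adicMap_mem_weakBall π f hz⟩)

end WeakCompletion
end WeakCompletion

/-! ### Tensor powers of commutative algebras -/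

section TensorPower

variable (V : Type u) [CommRing V] (A : Type u) [CommRing A] [Algebra V A]
  {B : Type u} [CommRing B] [Algebra V B]

/-- The `n`-fold tensor power over `V` of `A`. -/
abbrev TPow (n : ℕ) : Type u := ⨂[V] (_ : Fin n), A

variable {A}

/-- Multiply the entries along the fibres of `f`. -/
def merge {m n : ℕ} (f : Fin m → Fin n) (a : Fin m → A) : Fin n → A :=
  fun j => ∏ i with f i = j, a i

lemma merge_update {m n : ℕ} (f : Fin m → Fin n) (a : Fin m → A) (i : Fin m) (x : A) :
    merge f (Function.update a i x) =
      Function.update (merge f a) (f i) (x * ∏ k ∈ ({k | f k = f i} : Finset (Fin m)) \ {i}, a k) := by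
  ext j
  by_cases hj : j = f i
  · subst hj
    rw [Function.update_self, merge, Finset.prod_update_of_mem (by simp)]
  · rw [Function.update_of_ne hj, merge, merge, Finset.prod_update_of_notMem]
    simpa using fun h => hj h.symm

lemma merge_comp {l m n : ℕ} (f : Fin m → Fin n) (g : Fin l → Fin m) (a : Fin l → A) :
    merge f (merge g a) = merge (f ∘ g) a := by
  ext j
  unfold merge
  rw [← Finset.prod_fiberwise_of_maps_to (s := {i | (f ∘ g) i = j}) (t := {i | f i = j}) (g := g)
    (by simp)]
  refine Finset.prod_congr rfl fun i hi => Finset.prod_congr ?_ fun _ _ => rfl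
  ext k
  simp only [Finset.mem_filter, Finset.mem_univ, true_and, Function.comp_apply] at hi ⊢
  exact ⟨fun h => ⟨by rw [h, hi], h⟩, fun h => h.2⟩

lemma merge_id {n : ℕ} (a : Fin n → A) : merge id a = a := by
  ext j
  simp [merge, Finset.filter_eq']

lemma merge_mul {m n : ℕ} (f : Fin m → Fin n) (a b : Fin m → A) :
    merge f (a * b) = merge f a * merge f b := by
  ext j
  simp [merge, Finset.prod_mul_distrib]

namespace TPow

/-- The algebra homomorphism between tensor powers that multiplies the tensor factors along the
fibres of a map of index sets (an empty product being `1`). -/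
def map {m n : ℕ} (f : Fin m → Fin n) : TPow V A m →ₐ[V] TPow V A n :=
  PiTensorProduct.liftAlgHom
    { toFun := fun a => PiTensorProduct.tprod V (merge f a)
      map_update_add' := fun {inst} a i x y => by
        obtain rfl : inst = instDecidableEqFin m := Subsingleton.elim _ _
        rw [merge_update, merge_update, merge_update, add_mul, MultilinearMap.map_update_add]
      map_update_smul' := fun {inst} a i c x => by
        obtain rfl : inst = instDecidableEqFin m := Subsingleton.elim _ _
        rw [merge_update, merge_update, smul_mul_assoc, MultilinearMap.map_update_smul] }
    (by
      change PiTensorProduct.tprod V (merge f 1) = PiTensorProduct.tprod V 1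
      congr 1; ext j; simp [merge])
    (fun a b => by
      change PiTensorProduct.tprod V (merge f (a * b)) = _
      rw [merge_mul]
      exact (PiTensorProduct.tprod_mul_tprod _ _).symm)

@[simp] lemma map_tprod {m n : ℕ} (f : Fin m → Fin n) (a : Fin m → A) :
    map V f (PiTensorProduct.tprod V a) = PiTensorProduct.tprod V (merge f a) :=
  PiTensorProduct.lift.tprod a

variable {V}

lemma hom_ext {n : ℕ} {f g : TPow V A n →ₐ[V] B}
    (h : ∀ a, f (PiTensorProduct.tprod V a) = g (PiTensorProduct.tprod V a)) : f = g :=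
  AlgHom.toLinearMap_injective (PiTensorProduct.ext (MultilinearMap.ext h))

variable (V)

lemma map_comp {l m n : ℕ} (f : Fin m → Fin n) (g : Fin l → Fin m) :
    (map V f).comp (map V (A := A) g) = map V (f ∘ g) :=
  hom_ext fun a => by simp [merge_comp]

lemma map_id (n : ℕ) : map V (A := A) (id : Fin n → Fin n) = AlgHom.id V _ :=
  hom_ext fun a => by simp [merge_id]

variable {V}

/-- The `n`-fold tensor power of a homomorphism. -/
def mapHom (n : ℕ) (g : A →ₐ[V] B) : TPow V A n →ₐ[V] TPow V B n :=
  PiTensorProduct.liftAlgHom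
    ((PiTensorProduct.tprod V).compLinearMap (fun _ : Fin n => g.toLinearMap))
    (by
      change PiTensorProduct.tprod V _ = PiTensorProduct.tprod V 1
      congr 1; ext; simp)
    (fun a b => by
      simp only [MultilinearMap.compLinearMap_apply, PiTensorProduct.tprod_mul_tprod]
      congr 1; ext; simp)

@[simp] lemma mapHom_tprod (n : ℕ) (g : A →ₐ[V] B) (a : Fin n → A) :
    mapHom n g (PiTensorProduct.tprod V a) = PiTensorProduct.tprod V (fun i => g (a i)) :=
  PiTensorProduct.lift.tprod a

lemma mapHom_map {m n : ℕ} (g : A →ₐ[V] B) (f : Fin m → Fin n) :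
    (mapHom n g).comp (map V f) = (map V f).comp (mapHom m g) :=
  hom_ext fun a => by
    simp only [AlgHom.comp_apply, map_tprod, mapHom_tprod]
    congr 1; ext j; simp [merge]

/-- The span of the elementary tensors with entries in `S`: the image of `S ⊗ ⋯ ⊗ S`. -/
def pureSpan (n : ℕ) (S : Submodule V A) : Submodule V (TPow V A n) :=
  Submodule.span V {t | ∃ a : Fin n → A, (∀ i, a i ∈ S) ∧ t = PiTensorProduct.tprod V a}

lemma pureSpan_mono (n : ℕ) {S T : Submodule V A} (h : S ≤ T) : pureSpan n S ≤ pureSpan n T :=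
  Submodule.span_mono fun _ ⟨a, ha, e⟩ => ⟨a, fun i => h (ha i), e⟩

/-- The tensor product bornology: generated by the images of `S ⊗ ⋯ ⊗ S` for bounded submodules `S`
(which are cofinal among the images of `S₁ ⊗ ⋯ ⊗ Sₙ`). -/
def bornology (𝓑 : AlgBornology V A) (n : ℕ) : AlgBornology V (TPow V A n) :=
  .ofSubmodules {N | ∃ S : Submodule V A, 𝓑.Bdd S ∧ N = pureSpan n S}
    (fun x => by
      induction x using PiTensorProduct.induction_on with
      | smul_tprod r a =>
        exact ⟨_, ⟨Submodule.span V (Set.range a), (𝓑.bdd_finite (Set.finite_range a)).span, rfl⟩,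
          Submodule.smul_mem _ r (Submodule.subset_span
            ⟨a, fun i => Submodule.subset_span ⟨i, rfl⟩, rfl⟩)⟩
      | add x y hx hy =>
        obtain ⟨_, ⟨S, hS, rfl⟩, hx⟩ := hx
        obtain ⟨_, ⟨T, hT, rfl⟩, hy⟩ := hy
        exact ⟨_, ⟨S ⊔ T, hS.sup hT, rfl⟩, add_mem (pureSpan_mono n le_sup_left hx)
          (pureSpan_mono n le_sup_right hy)⟩)
    (by
      rintro _ ⟨S, hS, rfl⟩ _ ⟨T, hT, rfl⟩
      exact ⟨_, ⟨S ⊔ T, hS.sup hT, rfl⟩, pureSpan_mono n le_sup_left,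
        pureSpan_mono n le_sup_right⟩)
    (by
      rintro _ ⟨S, hS, rfl⟩ _ ⟨T, hT, rfl⟩
      refine ⟨_, ⟨S * T, 𝓑.bdd_mul_submodule hS hT, rfl⟩, ?_⟩
      rw [pureSpan, pureSpan, Submodule.span_mul_span, Submodule.span_le]
      rintro _ ⟨_, ⟨a, ha, rfl⟩, _, ⟨b, hb, rfl⟩, rfl⟩
      exact Submodule.subset_span ⟨a * b, fun i => Submodule.mul_mem_mul (ha i) (hb i),
        PiTensorProduct.tprod_mul_tprod a b⟩)

lemma bdd_pow (𝓑 : AlgBornology V A) {S : Submodule V A} (hS : 𝓑.Bdd S) (n : ℕ) :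
    𝓑.Bdd (S ^ n : Submodule V A) := by
  induction n with
  | zero =>
    rw [pow_zero, Submodule.one_eq_span]
    exact (𝓑.bdd_finite (Set.finite_singleton _)).span
  | succ n ih => rw [pow_succ]; exact 𝓑.bdd_mul_submodule ih hS

lemma prod_mem_pow {ι : Type*} (s : Finset ι) {a : ι → A} {S : Submodule V A}
    (h : ∀ i ∈ s, a i ∈ S) : ∏ i ∈ s, a i ∈ S ^ s.card := by
  classical
  induction s using Finset.induction_on with
  | empty => simpa using Submodule.one_le.1 (le_refl (1 : Submodule V A))
  | insert i s hi ih =>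
    rw [Finset.prod_insert hi, Finset.card_insert_of_notMem hi, pow_succ']
    exact Submodule.mul_mem_mul (h i (Finset.mem_insert_self i s))
      (ih fun j hj => h j (Finset.mem_insert_of_mem hj))

lemma bounded_map (𝓑 : AlgBornology V A) {m n : ℕ} (f : Fin m → Fin n) :
    ConvexBornology.BoundedMap (bornology 𝓑 m).toConvexBornology
      (bornology 𝓑 n).toConvexBornology (map V f) := by
  intro T hT
  obtain ⟨_, ⟨S, hS, rfl⟩, hT⟩ := (AlgBornology.bdd_ofSubmodules' _).1 hT
  have h1 : 𝓑.Bdd (1 : Submodule V A) := by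
    rw [Submodule.one_eq_span]
    exact (𝓑.bdd_finite (Set.finite_singleton _)).span
  refine (AlgBornology.bdd_ofSubmodules' _).2 ⟨_, ⟨(S ⊔ 1) ^ m, bdd_pow 𝓑 (hS.sup h1) m, rfl⟩, ?_⟩
  have key : pureSpan m S ≤ (pureSpan n ((S ⊔ 1) ^ m)).comap (map V f).toLinearMap := by
    refine Submodule.span_le.2 ?_
    rintro _ ⟨a, ha, rfl⟩
    refine Submodule.subset_span ⟨merge f a, fun j => ?_, map_tprod V f a⟩
    have h := prod_mem_pow {i | f i = j} (S := S ⊔ 1) (a := a)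
      (fun i _ => Submodule.mem_sup_left (ha i))
    refine pow_le_pow_right' (le_sup_right : (1 : Submodule V A) ≤ S ⊔ 1) ?_ h
    simpa using Finset.card_le_univ ({i | f i = j} : Finset (Fin m))
  rintro _ ⟨x, hx, rfl⟩
  exact key (hT hx)

lemma bounded_mapHom {𝓑 : AlgBornology V A} {𝓒 : AlgBornology V B} (n : ℕ) (g : A →ₐ[V] B)
    (hg : ConvexBornology.BoundedMap 𝓑.toConvexBornology 𝓒.toConvexBornology g) :
    ConvexBornology.BoundedMap (bornology 𝓑 n).toConvexBornology
      (bornology 𝓒 n).toConvexBornology (mapHom n g) := by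
  intro T hT
  obtain ⟨_, ⟨S, hS, rfl⟩, hT⟩ := (AlgBornology.bdd_ofSubmodules' _).1 hT
  refine (AlgBornology.bdd_ofSubmodules' _).2 ⟨_, ⟨S.map g.toLinearMap,
    ConvexBornology.BoundedMap.exists_submodule (f := g.toLinearMap) hg hS, rfl⟩, ?_⟩
  have key : pureSpan n S ≤ (pureSpan n (S.map g.toLinearMap)).comap (mapHom n g).toLinearMap := by
    refine Submodule.span_le.2 ?_
    rintro _ ⟨a, ha, rfl⟩
    exact Submodule.subset_span ⟨fun i => g (a i), fun i => ⟨a i, ha i, rfl⟩, mapHom_tprod n g a⟩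
  rintro _ ⟨x, hx, rfl⟩
  exact key (hT hx)

end TPow

/-- The completed tensor power `A ⊗̂ ⋯ ⊗̂ A` of a bornological algebra: the bornological completion
of the algebraic tensor power with the tensor product bornology. -/
abbrev CPow (π : V) (𝓑 : AlgBornology V A) (n : ℕ) : Type u :=
  AlgBornology.Completion π (TPow.bornology 𝓑 n)

/-- The completed version of `TPow.map`. -/
def CPow.map (π : V) (𝓑 : AlgBornology V A) {m n : ℕ} (f : Fin m → Fin n) :
    CPow V π 𝓑 m →ₐ[V] CPow V π 𝓑 n :=
  AlgBornology.Completion.map π (TPow.map V f) (TPow.bounded_map 𝓑 f)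

lemma CPow.map_comp (π : V) (𝓑 : AlgBornology V A) {l m n : ℕ} (f : Fin m → Fin n)
    (g : Fin l → Fin m) :
    (CPow.map V π 𝓑 f).comp (CPow.map V π 𝓑 g) = CPow.map V π 𝓑 (f ∘ g) := by
  ext z
  obtain ⟨x, rfl⟩ := AlgBornology.Completion.mk_surjective π _ z
  simp only [CPow.map, AlgHom.comp_apply, AlgBornology.Completion.map_mk]
  congr 1
  refine Subtype.ext (funext fun n => ?_)
  exact DFunLike.congr_fun (TPow.map_comp V f g) _

lemma CPow.map_id (π : V) (𝓑 : AlgBornology V A) (n : ℕ) :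
    CPow.map V π 𝓑 (id : Fin n → Fin n) = AlgHom.id V _ := by
  ext z
  obtain ⟨x, rfl⟩ := AlgBornology.Completion.mk_surjective π _ z
  simp only [CPow.map, AlgBornology.Completion.map_mk, AlgHom.id_apply]
  congr 1
  refine Subtype.ext (funext fun n => ?_)
  exact DFunLike.congr_fun (TPow.map_id V _) _

end TensorPower

/-! ### Extension of scalars for chain complexes of modules -/

section ExtendScalars

variable {A S : Type u} [CommRing A] [CommRing S] (f : A →+* S)

instance : (ModuleCat.extendScalars.{u, u, u} f).Additive :=
  (ModuleCat.extendRestrictScalarsAdj.{u, u, u} f).left_adjoint_additive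

/-- The complex `S ⊗_A C`. -/
abbrev extendComplex (C : ChainComplex (ModuleCat.{u} A) ℕ) : ChainComplex (ModuleCat.{u} S) ℕ :=
  ((ModuleCat.extendScalars.{u, u, u} f).mapHomologicalComplex _).obj C

/-- A complex of `S`-modules viewed as a complex of `A`-modules. -/
abbrev restrictComplex (D : ChainComplex (ModuleCat.{u} S) ℕ) : ChainComplex (ModuleCat.{u} A) ℕ :=
  ((ModuleCat.restrictScalars.{u, u, u} f).mapHomologicalComplex _).obj D

variable {f} {C : ChainComplex (ModuleCat.{u} A) ℕ} {D : ChainComplex (ModuleCat.{u} S) ℕ}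

/-- The chain map `S ⊗_A C → D`, `s ⊗ c ↦ s • φ c`, induced by an `A`-linear chain map
`φ : C → D`. -/
def extendHom (φ : C ⟶ restrictComplex f D) : extendComplex f C ⟶ D where
  f n := ((ModuleCat.extendRestrictScalarsAdj.{u, u, u} f).homEquiv (C.X n) (D.X n)).symm (φ.f n)
  comm' i j _ := by
    have h₁ := (ModuleCat.extendRestrictScalarsAdj.{u, u, u} f).homEquiv_naturality_right_symm
      (X := C.X i) (Y := D.X i) (Y' := D.X j) (φ.f i) (D.d i j)
    have h₂ := (ModuleCat.extendRestrictScalarsAdj.{u, u, u} f).homEquiv_naturality_left_symm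
      (X' := C.X i) (X := C.X j) (Y := D.X j) (C.d i j) (φ.f j)
    have h₃ := φ.comm i j
    exact h₁.symm.trans ((congrArg _ h₃).trans h₂)

/-- The map `S ⊗_A Hₙ(C) → Hₙ(D)`, `s ⊗ c ↦ s • Hₙ(φ)(c)`, induced by an `A`-linear chain map
`φ : C → D`. -/
def extendHomology (φ : C ⟶ restrictComplex f D) (n : ℕ) :
    (ModuleCat.extendScalars.{u, u, u} f).obj (C.homology n) ⟶ D.homology n :=
  ((ModuleCat.extendRestrictScalarsAdj.{u, u, u} f).homEquiv _ _).symm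
    (HomologicalComplex.homologyMap φ n ≫
      ((D.sc n).mapHomologyIso (ModuleCat.restrictScalars.{u, u, u} f)).hom)

/-- The complex `P` with the augmentation `ε` is a resolution of `N` by flat `S`-modules. -/
structure IsFlatResolution (P : ChainComplex (ModuleCat.{u} S) ℕ) {N : ModuleCat.{u} S}
    (ε : P.X 0 ⟶ N) : Prop where
  flat : ∀ n, Module.Flat S (P.X n)
  surjective : Function.Surjective ε
  exact_zero : Function.Exact (P.d 1 0) ε
  exact_succ : ∀ n, Function.Exact (P.d (n + 2) (n + 1)) (P.d (n + 1) n)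

end ExtendScalars

/-! ### The Hochschild complex and the bar complex -/

section Hochschild

/-- A functor from the finite sets `Fin n` and all maps between them to commutative `V`-algebras. -/
structure FinAlgebra (V : Type u) [CommRing V] where
  X : ℕ → Type u
  [commRing : ∀ n, CommRing (X n)]
  [algebra : ∀ n, Algebra V (X n)]
  map : ∀ {m n : ℕ}, (Fin m → Fin n) → (X m →ₐ[V] X n)
  map_id : ∀ n, map (id : Fin n → Fin n) = AlgHom.id V (X n)
  map_comp : ∀ {l m n : ℕ} (f : Fin m → Fin n) (g : Fin l → Fin m),
    (map f).comp (map g) = map (f ∘ g)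

attribute [instance] FinAlgebra.commRing FinAlgebra.algebra

variable {V : Type u} [CommRing V]

/-- Natural transformations. -/
structure FinAlgebra.Hom (F G : FinAlgebra V) where
  app : ∀ n, F.X n →ₐ[V] G.X n
  naturality : ∀ {m n : ℕ} (f : Fin m → Fin n), (app n).comp (F.map f) = (G.map f).comp (app m)

/-- The functor of tensor powers `n ↦ A ⊗ ⋯ ⊗ A`. -/
def tensorPowers (V : Type u) [CommRing V] (A : Type u) [CommRing A] [Algebra V A] :
    FinAlgebra V where
  X := TPow V A
  map f := TPow.map V (A := A) f
  map_id := TPow.map_id V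
  map_comp := TPow.map_comp V

/-- The functor of completed tensor powers `n ↦ A ⊗̂ ⋯ ⊗̂ A`. -/
def completedPowers (π : V) {A : Type u} [CommRing A] [Algebra V A] (𝓑 : AlgBornology V A) :
    FinAlgebra V where
  X := CPow V π 𝓑
  map f := CPow.map V π 𝓑 f
  map_id := CPow.map_id V π 𝓑
  map_comp := CPow.map_comp V π 𝓑

/-- The natural maps `a₁ ⊗ ⋯ ⊗ aₙ ↦ g a₁ ⊗ ⋯ ⊗ g aₙ` from the tensor powers of `A` to the
completed tensor powers of `B`. -/
def toCompletedPowers (π : V) {A : Type u} [CommRing A] [Algebra V A] {B : Type u} [CommRing B]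
    [Algebra V B] (𝓒 : AlgBornology V B) (g : A →ₐ[V] B) :
    (tensorPowers V A).Hom (completedPowers π 𝓒) where
  app n := (AlgBornology.Completion.of π (TPow.bornology 𝓒 n)).comp (TPow.mapHom n g)
  naturality {m n} f := by
    ext x : 1
    change AlgBornology.Completion.of π (TPow.bornology 𝓒 n) _ =
      AlgBornology.Completion.map π _ _ (AlgBornology.Completion.of π _ _)
    rw [AlgBornology.Completion.map_of]
    congr 1
    exact DFunLike.congr_fun (TPow.mapHom_map (V := V) g f) x

lemma sum_comp_sum_eq_zero {A X Y Z : Type*} [CommRing A] [AddCommGroup X] [AddCommGroup Y]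
    [AddCommGroup Z] [Module A X] [Module A Y] [Module A Z] (n : ℕ) (d : Fin (n + 2) → Y →ₗ[A] Z)
    (d' : Fin (n + 3) → X →ₗ[A] Y)
    (h : ∀ i j : Fin (n + 2), i ≤ j → d i ∘ₗ d' j.succ = d j ∘ₗ d' i.castSucc) :
    (∑ i : Fin (n + 2), (-1 : ℤ) ^ (i : ℕ) • d i) ∘ₗ
      (∑ j : Fin (n + 3), (-1 : ℤ) ^ (j : ℕ) • d' j) = 0 := by
  ext x
  simp only [LinearMap.comp_apply, LinearMap.sum_apply, map_sum, LinearMap.zero_apply]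
  rw [Finset.sum_comm, ← Finset.sum_product']
  let P := Fin (n + 2) × Fin (n + 3)
  let S : Finset P := {ij : P | (ij.2 : ℕ) ≤ (ij.1 : ℕ)}
  rw [Finset.univ_product_univ, ← Finset.sum_add_sum_compl S, ← eq_neg_iff_add_eq_zero,
    ← Finset.sum_neg_distrib]
  let φ : ∀ ij : P, ij ∈ S → P := fun ij hij =>
    (Fin.castLT ij.2 (lt_of_le_of_lt (Finset.mem_filter.mp hij).right (Fin.is_lt ij.1)), ij.1.succ)
  apply Finset.sum_bij φ
  · intro ij hij
    simp_rw [S, φ, Finset.compl_filter, Finset.mem_filter_univ, Fin.val_succ,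
      Fin.val_castLT] at hij ⊢
    lia
  · rintro ⟨i, j⟩ hij ⟨i', j'⟩ hij' h
    rw [Prod.mk_inj]
    exact ⟨by simpa [φ] using! congr_arg Prod.snd h,
      by simpa [φ, Fin.castSucc_castLT] using! congr_arg Fin.castSucc (congr_arg Prod.fst h)⟩
  · rintro ⟨i', j'⟩ hij'
    simp_rw [S, Finset.compl_filter, Finset.mem_filter_univ, not_le] at hij'
    refine ⟨(j'.pred <| ?_, Fin.castSucc i'), ?_, ?_⟩
    · rintro rfl
      simp only [Fin.val_zero, not_lt_zero] at hij'
    · simpa [S] using! Nat.le_sub_one_of_lt hij'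
    · simp only [φ, Fin.castLT_castSucc, Fin.succ_pred]
  · rintro ⟨i, j⟩ hij
    have hij' : (j : ℕ) ≤ i := (Finset.mem_filter.mp hij).2
    have key := h (Fin.castLT j (lt_of_le_of_lt hij' i.is_lt)) i hij'
    rw [Fin.castSucc_castLT] at key
    have key' := DFunLike.congr_fun key x
    simp only [LinearMap.comp_apply] at key'
    simp only [φ, LinearMap.smul_apply, map_zsmul, smul_smul, ← neg_smul, key', Fin.val_succ,
      Fin.val_castLT]
    congr 1
    ring

/-- The map of index sets underlying the `i`-th face `C_{n+1} → C_n` of the Hochschild complex: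
for `i ≤ n` it identifies `i` with `i + 1`, and for `i = n + 1` it identifies `n + 1` with `0`. -/
def hochschildFace (n : ℕ) (i j : Fin (n + 2)) : Fin (n + 1) :=
  ⟨if (j : ℕ) ≤ i then (if (j : ℕ) = n + 1 then 0 else j) else j - 1, by
    split_ifs <;> omega⟩

/-- The map of index sets underlying the `i`-th face `B_{n+1} → B_n` of the bar complex:
it identifies `i` with `i + 1`. -/
def barFace (n : ℕ) (i : Fin (n + 2)) (j : Fin (n + 3)) : Fin (n + 2) :=
  ⟨if (j : ℕ) ≤ i then j else j - 1, by split_ifs <;> omega⟩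

/-- The inclusion of the two end points. -/
def endpoints (n : ℕ) (j : Fin 2) : Fin (n + 2) := ⟨if (j : ℕ) = 0 then 0 else n + 1, by
    split_ifs <;> omega⟩

lemma hochschildFace_comp (n : ℕ) (i j : Fin (n + 2)) (h : i ≤ j) :
    hochschildFace n i ∘ hochschildFace (n + 1) j.succ =
      hochschildFace n j ∘ hochschildFace (n + 1) i.castSucc := by
  ext k
  have h' : (i : ℕ) ≤ j := h
  simp only [hochschildFace, Function.comp_apply, Fin.val_succ, Fin.val_castSucc]
  split_ifs <;> omega

lemma hochschildFace_zero (n : ℕ) (i : Fin (n + 2)) :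
    hochschildFace n i ∘ (fun _ : Fin 1 => 0) = fun _ => 0 := by
  ext k
  simp [hochschildFace]

lemma barFace_comp (n : ℕ) (i j : Fin (n + 2)) (h : i ≤ j) :
    barFace n i ∘ barFace (n + 1) j.succ = barFace n j ∘ barFace (n + 1) i.castSucc := by
  ext k
  have h' : (i : ℕ) ≤ j := h
  simp only [barFace, Function.comp_apply, Fin.val_succ, Fin.val_castSucc]
  split_ifs <;> omega

lemma barFace_endpoints (n : ℕ) (i : Fin (n + 2)) :
    barFace n i ∘ endpoints (n + 1) = endpoints n := by
  ext k
  have := i.2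
  simp only [barFace, endpoints, Function.comp_apply]
  split_ifs <;> omega

lemma endpoints_zero : endpoints 0 = id := by
  ext k
  fin_cases k <;> rfl

variable (F : FinAlgebra V) {A : Type u} [CommRing A] [Algebra V A] (u : A →ₐ[V] F.X 1)
  {E : Type u} [CommRing E] [Algebra V E] (v : E →ₐ[V] F.X 2)

/-- The Hochschild `n`-chains: `(n + 1)`-st tensor powers, as an `A`-algebra through the
zeroth tensor factor. -/
def HochschildChains (_ : A →ₐ[V] F.X 1) (n : ℕ) : Type u := F.X (n + 1)

namespace HochschildChains

instance (n : ℕ) : CommRing (HochschildChains F u n) := inferInstanceAs (CommRing (F.X (n + 1)))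

instance (n : ℕ) : Algebra A (HochschildChains F u n) :=
  ((F.map (fun _ : Fin 1 => (0 : Fin (n + 1)))).comp u).toRingHom.toAlgebra

/-- The face maps, as algebra homomorphisms. -/
def face (n : ℕ) (i : Fin (n + 2)) : HochschildChains F u (n + 1) →ₐ[A] HochschildChains F u n where
  __ := (F.map (hochschildFace n i)).toRingHom
  commutes' a := by
    have h := DFunLike.congr_fun (F.map_comp (hochschildFace n i) (fun _ : Fin 1 => 0)) (u a)
    rw [hochschildFace_zero] at h
    exact h

/-- The Hochschild boundary map `b`, the alternating sum of the face maps. -/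
def b (n : ℕ) : HochschildChains F u (n + 1) →ₗ[A] HochschildChains F u n :=
  ∑ i : Fin (n + 2), (-1 : ℤ) ^ (i : ℕ) • (face F u n i).toLinearMap

lemma b_apply (n : ℕ) (x : HochschildChains F u (n + 1)) :
    b F u n x = ∑ i : Fin (n + 2), (-1 : ℤ) ^ (i : ℕ) • face F u n i x := by
  simp [b]

lemma b_comp_b (n : ℕ) : b F u n ∘ₗ b F u (n + 1) = 0 :=
  sum_comp_sum_eq_zero n _ _ fun i j h => by
    ext x
    have h₁ := DFunLike.congr_fun (F.map_comp (hochschildFace n i) (hochschildFace (n + 1) j.succ)) x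
    have h₂ := DFunLike.congr_fun
      (F.map_comp (hochschildFace n j) (hochschildFace (n + 1) i.castSucc)) x
    rw [hochschildFace_comp n i j h, ← h₂] at h₁
    exact h₁

end HochschildChains

/-- The Hochschild complex. -/
def hochschildOf : ChainComplex (ModuleCat.{u} A) ℕ :=
  ChainComplex.of (fun n => ModuleCat.of A (HochschildChains F u n))
    (fun n => ModuleCat.ofHom (HochschildChains.b F u n))
    (fun n => ModuleCat.hom_ext (HochschildChains.b_comp_b F u n))

lemma hochschildOf_d (n : ℕ) :
    (hochschildOf F u).d (n + 1) n = ModuleCat.ofHom (HochschildChains.b F u n) :=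
  ChainComplex.of_d (fun n => ModuleCat.of A (HochschildChains F u n))
    (fun n => ModuleCat.ofHom (HochschildChains.b F u n)) _

/-- The `n`-th term of the bar complex: the `(n + 2)`-nd tensor power, as an algebra
through the first and last tensor factors. -/
def BarChains (_ : E →ₐ[V] F.X 2) (n : ℕ) : Type u := F.X (n + 2)

namespace BarChains

instance (n : ℕ) : CommRing (BarChains F v n) := inferInstanceAs (CommRing (F.X (n + 2)))

instance (n : ℕ) : Algebra E (BarChains F v n) :=
  ((F.map (endpoints n)).comp v).toRingHom.toAlgebra

/-- The face maps, as algebra homomorphisms. -/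
def face (n : ℕ) (i : Fin (n + 2)) : BarChains F v (n + 1) →ₐ[E] BarChains F v n where
  __ := (F.map (barFace n i)).toRingHom
  commutes' a := by
    have h := DFunLike.congr_fun (F.map_comp (barFace n i) (endpoints (n + 1))) (v a)
    rw [barFace_endpoints] at h
    exact h

/-- The boundary map `b'` of the bar complex, the alternating sum of the face maps. -/
def b' (n : ℕ) : BarChains F v (n + 1) →ₗ[E] BarChains F v n :=
  ∑ i : Fin (n + 2), (-1 : ℤ) ^ (i : ℕ) • (face F v n i).toLinearMap

lemma b'_comp_b' (n : ℕ) : b' F v n ∘ₗ b' F v (n + 1) = 0 :=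
  sum_comp_sum_eq_zero n _ _ fun i j h => by
    ext x
    have h₁ := DFunLike.congr_fun (F.map_comp (barFace n i) (barFace (n + 1) j.succ)) x
    have h₂ := DFunLike.congr_fun (F.map_comp (barFace n j) (barFace (n + 1) i.castSucc)) x
    rw [barFace_comp n i j h, ← h₂] at h₁
    exact h₁

end BarChains

/-- The bar complex. -/
def barOf : ChainComplex (ModuleCat.{u} E) ℕ :=
  ChainComplex.of (fun n => ModuleCat.of E (BarChains F v n))
    (fun n => ModuleCat.ofHom (BarChains.b' F v n))
    (fun n => ModuleCat.hom_ext (BarChains.b'_comp_b' F v n))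

/-- The chain map between Hochschild complexes induced by a natural transformation. -/
def hochschildMap {F G : FinAlgebra V} (η : F.Hom G) {S : Type u} [CommRing S] [Algebra V S]
    (f : A →ₐ[V] S) (u : A →ₐ[V] F.X 1) (w : S →ₐ[V] G.X 1)
    (h : w.comp f = (η.app 1).comp u) :
    hochschildOf F u ⟶ restrictComplex f.toRingHom (hochschildOf G w) where
  f n := ModuleCat.ofHom
    (Y := (ModuleCat.restrictScalars f.toRingHom).obj (ModuleCat.of S (HochschildChains G w n)))
    { toFun := fun x => (η.app (n + 1)).toFun x
      map_add' := fun x y => map_add (η.app (n + 1)) x y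
      map_smul' := fun a x => by
        have h₁ := DFunLike.congr_fun (η.naturality (fun _ : Fin 1 => (0 : Fin (n + 1)))) (u a)
        have h₂ : w (f a) = η.app 1 (u a) := DFunLike.congr_fun h a
        have h₃ := map_mul (η.app (n + 1)) (F.map (fun _ : Fin 1 => (0 : Fin (n + 1))) (u a)) x
        refine h₃.trans ?_
        rw [AlgHom.comp_apply, AlgHom.comp_apply, ← h₂] at h₁
        rw [h₁]
        rfl }
  comm' i j hij := by
    obtain rfl : j + 1 = i := hij
    have e₃ : (restrictComplex f.toRingHom (hochschildOf G w)).d (j + 1) j =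
        (ModuleCat.restrictScalars f.toRingHom).map ((hochschildOf G w).d (j + 1) j) := rfl
    rw [hochschildOf_d, e₃, hochschildOf_d]
    refine ModuleCat.hom_ext (LinearMap.ext fun x => ?_)
    change HochschildChains.b G w j (η.app (j + 2) x) = η.app (j + 1) (HochschildChains.b F u j x)
    refine (HochschildChains.b_apply G w j _).trans ?_
    refine Eq.trans ?_ (congrArg (η.app (j + 1)) (HochschildChains.b_apply F u j x)).symm
    refine Eq.trans (Finset.sum_congr rfl fun i _ => ?_) (map_sum (η.app (j + 1)) _ _).symm
    refine Eq.trans ?_ (map_zsmul (η.app (j + 1)) _ _).symm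
    exact congrArg _ (DFunLike.congr_fun (η.naturality (hochschildFace j i)) x).symm

end Hochschild

section Concrete

variable (V : Type u) [CommRing V] (A : Type u) [CommRing A] [Algebra V A]

/-- The identification of `A` with its first tensor power. -/
def TPow.single : A →ₐ[V] TPow V A 1 :=
  PiTensorProduct.singleAlgHom (R := V) (A := fun _ : Fin 1 => A) 0

/-- The map `A ⊗ A → A ⊗ A` from the binary tensor product to the second tensor power,
`a ⊗ b ↦ a ⊗ b`. -/
def TPow.pair : A ⊗[V] A →ₐ[V] TPow V A 2 :=
  Algebra.TensorProduct.productMap (PiTensorProduct.singleAlgHom (R := V) (A := fun _ : Fin 2 => A) 0)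
    (PiTensorProduct.singleAlgHom (R := V) (A := fun _ : Fin 2 => A) 1)

/-- The product map `a₁ ⊗ ⋯ ⊗ aₙ ↦ a₁ ⋯ aₙ`. -/
def TPow.prod (n : ℕ) : TPow V A n →ₐ[V] A :=
  PiTensorProduct.liftAlgHom (MultilinearMap.mkPiAlgebra V (Fin n) A)
    (by simp) (fun a b => by simp [Finset.prod_mul_distrib])

lemma TPow.prod_tprod (n : ℕ) (a : Fin n → A) :
    TPow.prod V A n (PiTensorProduct.tprod V a) = ∏ i, a i :=
  PiTensorProduct.lift.tprod a

lemma TPow.single_apply (a : A) : TPow.single V A a = PiTensorProduct.tprod V (fun _ => a) := by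
  rw [TPow.single, PiTensorProduct.singleAlgHom_apply]
  congr 1
  ext i
  simp [Subsingleton.elim i 0]

lemma TPow.pair_tmul (a b : A) : TPow.pair V A (a ⊗ₜ b) = PiTensorProduct.tprod V ![a, b] := by
  rw [TPow.pair, Algebra.TensorProduct.productMap_apply_tmul, PiTensorProduct.singleAlgHom_apply,
    PiTensorProduct.singleAlgHom_apply, PiTensorProduct.tprod_mul_tprod]
  congr 1
  ext i
  fin_cases i <;> simp

/-- `TPow.single`, as a map to the first term of `tensorPowers`. -/
def tensorSingle : A →ₐ[V] (tensorPowers V A).X 1 := TPow.single V A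

/-- `TPow.pair`, as a map to the second term of `tensorPowers`. -/
def tensorPair : A ⊗[V] A →ₐ[V] (tensorPowers V A).X 2 := TPow.pair V A

/-- The Hochschild complex `C(A)` of a commutative `V`-algebra, a complex of `A`-modules. -/
def hochschild : ChainComplex (ModuleCat.{u} A) ℕ :=
  hochschildOf (tensorPowers V A) (tensorSingle V A)

/-- The bar complex `B(A)` of a commutative `V`-algebra, a complex of `A ⊗ A`-modules. -/
def bar : ChainComplex (ModuleCat.{u} (A ⊗[V] A)) ℕ :=
  barOf (tensorPowers V A) (tensorPair V A)

variable {V A}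

/-- The canonical map from `A` to its first completed tensor power, an isomorphism if `A` is
complete. -/
def completedSingle (π : V) (𝓑 : AlgBornology V A) : A →ₐ[V] (completedPowers π 𝓑).X 1 :=
  (AlgBornology.Completion.of π (TPow.bornology 𝓑 1)).comp (TPow.single V A)

/-- The canonical map `A ⊗ A → A ⊗̂ A`. -/
def completedPair (π : V) (𝓑 : AlgBornology V A) : A ⊗[V] A →ₐ[V] (completedPowers π 𝓑).X 2 :=
  (AlgBornology.Completion.of π (TPow.bornology 𝓑 2)).comp (TPow.pair V A)

/-- The Hochschild complex of a complete bornological algebra, defined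
using completed tensor powers. -/
def completedHochschild (π : V) (𝓑 : AlgBornology V A) : ChainComplex (ModuleCat.{u} A) ℕ :=
  hochschildOf (completedPowers π 𝓑) (completedSingle π 𝓑)

/-- The bar complex of a complete bornological algebra, defined using completed tensor powers,
viewed as a complex of modules through a homomorphism `e : E → A ⊗̂ A`. -/
def completedBar (π : V) (𝓑 : AlgBornology V A) {E : Type u} [CommRing E] [Algebra V E]
    (e : E →ₐ[V] (completedPowers π 𝓑).X 2) : ChainComplex (ModuleCat.{u} E) ℕ :=
  barOf (completedPowers π 𝓑) e

/-- The natural chain map `C(A) → C(B)`, `a₀ ⊗ ⋯ ⊗ aₙ ↦ g a₀ ⊗ ⋯ ⊗ g aₙ`, from the algebraic to the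
completed Hochschild complex. -/
def hochschildComparison (π : V) {B : Type u} [CommRing B] [Algebra V B] (𝓒 : AlgBornology V B)
    (g : A →ₐ[V] B) :
    hochschild V A ⟶ restrictComplex g.toRingHom (completedHochschild π 𝓒) :=
  hochschildMap (toCompletedPowers π 𝓒 g) g _ _ (by
    ext a
    change AlgBornology.Completion.of π _ _ = AlgBornology.Completion.of π _ _
    refine congrArg _ ((TPow.single_apply V B (g a)).trans ?_)
    refine Eq.trans ?_ (congrArg (TPow.mapHom 1 g) (TPow.single_apply V A a)).symm
    rw [TPow.mapHom_tprod])

end Concrete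

/-! ### The bar complexes of a weak completion -/

section BarAugmentation

variable {V : Type u} [CommRing V] (π : V) (R : Type u) [CommRing R] [Algebra V R]

lemma WeakCompletion.map_of {S : Type u} [CommRing S] [Algebra V S] (f : R →ₐ[V] S) (x : R) :
    WeakCompletion.map π f (WeakCompletion.of π R x) = WeakCompletion.of π S (f x) := by
  refine Subtype.ext (adicEval_ext π fun n => ?_)
  exact (adicEval_adicMap π f n _).trans rfl

lemma prod_comp_pair : (TPow.prod V R 2).comp (TPow.pair V R) = Algebra.TensorProduct.lmul' V := by
  ext x
  · exact (congrArg (TPow.prod V R 2) (TPow.pair_tmul V R x 1)).trans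
      ((TPow.prod_tprod V R 2 _).trans (by simp))
  · exact (congrArg (TPow.prod V R 2) (TPow.pair_tmul V R 1 x)).trans
      ((TPow.prod_tprod V R 2 _).trans (by simp))

/-- The map `(R ⊗ R)† → R†` that extends the multiplication map `R ⊗ R → R`. -/
def mulDagger : WeakCompletion π (R ⊗[V] R) →ₐ[V] WeakCompletion π R :=
  WeakCompletion.map π (Algebra.TensorProduct.lmul' V)

/-- `R†` as a module over `(R ⊗ R)†`. -/
abbrev daggerModule : ModuleCat.{u} (WeakCompletion π (R ⊗[V] R)) :=
  (ModuleCat.restrictScalars (mulDagger π R).toRingHom).obj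
    (ModuleCat.of (WeakCompletion π R) (WeakCompletion π R))

/-- The complex `(R ⊗ R)† ⊗_{R ⊗ R} B(R)`. -/
abbrev extendedBar : ChainComplex (ModuleCat.{u} (WeakCompletion π (R ⊗[V] R))) ℕ :=
  extendComplex (WeakCompletion.of π (R ⊗[V] R)).toRingHom (bar V R)

/-- The augmentation `(R ⊗ R)† ⊗_{R ⊗ R} B₀(R) → R†`, `c ⊗ (a ⊗ b) ↦ c • (a * b)`. -/
def extendedBarAugmentation : (extendedBar π R).X 0 ⟶ daggerModule π R :=
  ((ModuleCat.extendRestrictScalarsAdj.{u, u, u}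
    (WeakCompletion.of π (R ⊗[V] R)).toRingHom).homEquiv ((bar V R).X 0) (daggerModule π R)).symm
    (ModuleCat.ofHom (X := BarChains (tensorPowers V R) (tensorPair V R) 0)
      (Y := (ModuleCat.restrictScalars (WeakCompletion.of π (R ⊗[V] R)).toRingHom).obj
        (daggerModule π R))
      { toFun := fun x => WeakCompletion.of π R (TPow.prod V R 2 x)
        map_add' := fun x y => (congrArg _ (map_add (TPow.prod V R 2) x y)).trans (map_add _ _ _)
        map_smul' := fun a x => by
          have h₁ : TPow.map V (endpoints 0) (TPow.pair V R a) = TPow.pair V R a := by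
            rw [endpoints_zero]
            exact DFunLike.congr_fun (TPow.map_id V 2) _
          have h₂ := map_mul (TPow.prod V R 2) (TPow.map V (endpoints 0) (TPow.pair V R a)) x
          have h₃ := DFunLike.congr_fun (prod_comp_pair (V := V) R) a
          rw [AlgHom.comp_apply] at h₃
          have h₅ := h₂.trans (congrArg (· * _) ((congrArg (TPow.prod V R 2) h₁).trans h₃))
          have h₄ := WeakCompletion.map_of π (R ⊗[V] R) (Algebra.TensorProduct.lmul' V) a
          refine (congrArg (WeakCompletion.of π R) h₅).trans ((map_mul _ _ _).trans ?_)
          rw [← h₄]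
          rfl })

variable {π R}

/-- The augmentation `B₀(R†) = R† ⊗̂ R† → R†`, for an identification
`e : (R ⊗ R)† ≃ R† ⊗̂ R†`. -/
def completedBarAugmentation
    (e : WeakCompletion π (R ⊗[V] R) ≃ₐ[V] (completedPowers π (WeakCompletion.bornology π R)).X 2) :
    (completedBar π (WeakCompletion.bornology π R) e.toAlgHom).X 0 ⟶ daggerModule π R :=
  ModuleCat.ofHom (X := BarChains (completedPowers π (WeakCompletion.bornology π R)) e.toAlgHom 0)
    (Y := daggerModule π R)
    { toFun := fun x => mulDagger π R (e.symm x)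
      map_add' := fun x y => (congrArg _ (map_add e.symm x y)).trans (map_add _ _ _)
      map_smul' := fun a x => by
        have h₁ : (completedPowers π (WeakCompletion.bornology π R)).map (endpoints 0) (e a) =
            e a := by
          rw [endpoints_zero, FinAlgebra.map_id]
          rfl
        have h₂ := map_mul e.symm
          ((completedPowers π (WeakCompletion.bornology π R)).map (endpoints 0) (e a)) x
        have h₃ := h₂.trans (congrArg (· * _) ((congrArg e.symm h₁).trans (e.symm_apply_apply a)))
        exact (congrArg (mulDagger π R) h₃).trans (map_mul _ _ _) }

end BarAugmentation

/-! ### Spectral radius and the bornologies of tubes -/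

section SpectralRadius

variable {V : Type u} [CommRing V] (K : Type u) [Field K] [Algebra V K] (ε : ℝ) (π : V)
  {X : Type u} [CommRing X] [Algebra V X] [Algebra K X] [IsScalarTower V K X]

/-- `r ⋆ M = π ^ ⌈log_ε r⌉ M`, where `ε = |π|`. -/
def scale (r : ℝ) (M : Submodule V X) : Submodule V X :=
  algebraMap V K π ^ ⌈Real.logb ε r⌉ • M

/-- The `V`-submodule `∑ₙ r⁻ⁿ ⋆ Mⁿ`. -/
def scaleSum (r : ℝ) (M : Submodule V X) : Submodule V X :=
  ⨆ n : ℕ, scale K ε π (r ^ n)⁻¹ (M ^ n)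

/-- The spectral radius of `M` with respect to a bornology. -/
def spectralRadius (𝓒 : ConvexBornology V X) (M : Submodule V X) : ENNReal :=
  ⨅ (r : ℝ) (_ : 0 < r ∧ 𝓒.Bdd (scaleSum K ε π r M)), ENNReal.ofReal r

/-- A bornology of a `K`-vector space: multiplication by `π⁻¹` is bounded. -/
def IsVectorSpaceBornology (𝓒 : ConvexBornology V X) : Prop :=
  ∀ S : Set X, 𝓒.Bdd S → 𝓒.Bdd ((algebraMap V K π)⁻¹ • S)

variable {K ε π}

lemma field_smul_mono (a : K) {M N : Submodule V X} (h : M ≤ N) : a • M ≤ a • N :=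
  Submodule.map_mono h

lemma zpow_smul_le (h0 : algebraMap V K π ≠ 0) {i j : ℤ} (h : j ≤ i) (M : Submodule V X) :
    algebraMap V K π ^ i • M ≤ algebraMap V K π ^ j • M := by
  obtain ⟨n, rfl⟩ := Int.le.dest h
  rw [zpow_add₀ h0, mul_smul]
  refine field_smul_mono _ ?_
  intro x hx
  obtain ⟨m, hm, rfl⟩ := (Submodule.mem_smul_pointwise_iff_exists _ _ _).1 hx
  rw [zpow_natCast, ← map_pow, algebraMap_smul]
  exact M.smul_mem _ hm

lemma scale_mono (h0 : algebraMap V K π ≠ 0) (hε0 : 0 < ε) (hε1 : ε < 1) {r s : ℝ} (hr : 0 < r)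
    (hrs : r ≤ s) {M N : Submodule V X} (hMN : M ≤ N) : scale K ε π r M ≤ scale K ε π s N := by
  refine (field_smul_mono _ hMN).trans (zpow_smul_le h0 (Int.ceil_mono ?_) N)
  exact (Real.logb_le_logb_of_base_lt_one hε0 hε1 (hr.trans_le hrs) hr).2 hrs

lemma scaleSum_mono (h0 : algebraMap V K π ≠ 0) (hε0 : 0 < ε) (hε1 : ε < 1) {r s : ℝ} (hr : 0 < r)
    (hrs : r ≤ s) {M N : Submodule V X} (hMN : M ≤ N) :
    scaleSum K ε π s M ≤ scaleSum K ε π r N :=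
  iSup_mono fun n => scale_mono h0 hε0 hε1 (by have := hr.trans_le hrs; positivity)
    (by gcongr) (pow_le_pow_left' hMN n)

lemma smul_mul_smul_submodule (a b : K) (M N : Submodule V X) :
    (a • M) * (b • N) ≤ (a * b) • (M * N) := by
  refine Submodule.mul_le.2 fun x hx y hy => ?_
  obtain ⟨m, hm, rfl⟩ := (Submodule.mem_smul_pointwise_iff_exists _ _ _).1 hx
  obtain ⟨n, hn, rfl⟩ := (Submodule.mem_smul_pointwise_iff_exists _ _ _).1 hy
  rw [smul_mul_smul_comm]
  exact Submodule.smul_mem_pointwise_smul _ _ _ (Submodule.mul_mem_mul hm hn)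

lemma scaleSum_mul_le (h0 : algebraMap V K π ≠ 0) {r : ℝ} (hr : 0 < r) (M : Submodule V X) :
    scaleSum K ε π r M * scaleSum K ε π r M ≤ scaleSum K ε π r M := by
  rw [scaleSum, Submodule.iSup_mul]
  refine iSup_le fun m => ?_
  rw [Submodule.mul_iSup]
  refine iSup_le fun n => ?_
  refine le_trans ?_ (le_iSup _ (m + n))
  refine (smul_mul_smul_submodule _ _ _ _).trans ?_
  rw [← zpow_add₀ h0, ← pow_add]
  refine zpow_smul_le h0 ?_ _
  have e : (r ^ (m + n))⁻¹ = (r ^ m)⁻¹ * (r ^ n)⁻¹ := by rw [pow_add, mul_inv]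
  rw [e, Real.logb_mul (by positivity) (by positivity)]
  exact Int.ceil_add_le _ _

lemma IsVectorSpaceBornology.bdd_zpow_smul {𝓒 : ConvexBornology V X}
    (h : IsVectorSpaceBornology K π 𝓒) (h0 : algebraMap V K π ≠ 0) {N : Submodule V X}
    (hN : 𝓒.Bdd N) (l : ℤ) : 𝓒.Bdd (algebraMap V K π ^ l • N : Submodule V X) := by
  have key : ∀ n : ℕ, 𝓒.Bdd (algebraMap V K π ^ (-(n : ℤ)) • N : Submodule V X) := by
    intro n
    induction n with
    | zero => simpa using hN
    | succ n ih =>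
      have e : algebraMap V K π ^ (-((n + 1 : ℕ) : ℤ)) =
          (algebraMap V K π)⁻¹ * algebraMap V K π ^ (-(n : ℤ)) := by
        rw [← zpow_neg_one, ← zpow_add₀ h0]
        congr 1
        push_cast
        ring
      rw [e, mul_smul, Submodule.coe_pointwise_smul]
      exact h _ ih
  exact (key l.natAbs).subset (zpow_smul_le h0 (by omega) N)

end SpectralRadius

section Tube

variable {V : Type u} [CommRing V] (K : Type u) [Field K] [Algebra V K] (ε : ℝ) (π : V)
  {R : Type u} [CommRing R] [Algebra V R] (𝓑 : AlgBornology V R) (J : Ideal R) (α : ℝ)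

/-- The image in `K ⊗ R` of a submodule of `R`. -/
def image (M : Submodule V R) : Submodule V (K ⊗[V] R) :=
  M.map (Algebra.TensorProduct.includeRight : R →ₐ[V] K ⊗[V] R).toLinearMap

/-- `K`-vector space bornologies on `K ⊗ R` for which the bounded `V`-submodules of `R` that are
contained in `J` have spectral radius at most `ε ^ α`. -/
def IsAdmissible (𝓒 : ConvexBornology V (K ⊗[V] R)) : Prop :=
  IsVectorSpaceBornology K π 𝓒 ∧ ∀ M : Submodule V R, 𝓑.Bdd M → (M : Set R) ⊆ J →
    spectralRadius K ε π 𝓒 (image K M) ≤ ENNReal.ofReal (ε ^ α)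

/-- The intersection of all admissible bornologies. -/
def tubeConvexBornology : ConvexBornology V (K ⊗[V] R) :=
  .ofBdd {S | ∀ 𝓒 : ConvexBornology V (K ⊗[V] R), IsAdmissible K ε π 𝓑 J α 𝓒 → 𝓒.Bdd S}
    (fun _ hS 𝓒 _ => 𝓒.bdd_finite hS) (fun _ hS _ hT 𝓒 h => (hS 𝓒 h).subset hT)
    (fun _ hS _ hT 𝓒 h => (hS 𝓒 h).union (hT 𝓒 h)) (fun _ hS 𝓒 h => (hS 𝓒 h).span)

variable {K ε π 𝓑 J α}

lemma image_mono {M N : Submodule V R} (h : M ≤ N) : image K M ≤ image K N := Submodule.map_mono h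

lemma image_sup_left (M N : Submodule V R) : image K M ≤ image K (M ⊔ N) := image_mono le_sup_left

lemma image_sup_right (M N : Submodule V R) : image K N ≤ image K (M ⊔ N) :=
  image_mono le_sup_right

lemma sup_subset {M N : Submodule V R} (hM : (M : Set R) ⊆ J) (hN : (N : Set R) ⊆ J) :
    ((M ⊔ N : Submodule V R) : Set R) ⊆ J :=
  sup_le (c := J.restrictScalars V) hM hN

variable (K ε π 𝓑 J α) in
/-- A cofinal family of bounded submodules for `tubeConvexBornology`. -/
def tubeFamily : Set (Submodule V (K ⊗[V] R)) :=
  {N | ∃ (l : ℤ) (r : ℝ) (M : Submodule V R), ε ^ α < r ∧ 𝓑.Bdd M ∧ (M : Set R) ⊆ J ∧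
    N = algebraMap V K π ^ l • scaleSum K ε π r (image K M)}

lemma tubeFamily_dir (h0 : algebraMap V K π ≠ 0) (hε0 : 0 < ε) (hε1 : ε < 1) :
    ∀ M ∈ tubeFamily K ε π 𝓑 J α, ∀ N ∈ tubeFamily K ε π 𝓑 J α,
      ∃ L ∈ tubeFamily K ε π 𝓑 J α, M ≤ L ∧ N ≤ L := by
  rintro _ ⟨l, r, M, hr, hM, hMJ, rfl⟩ _ ⟨m, s, N, hs, hN, hNJ, rfl⟩
  have hpos := Real.rpow_pos_of_pos hε0 α
  have hmin : 0 < min r s := lt_min (hpos.trans hr) (hpos.trans hs)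
  refine ⟨_, ⟨min l m, min r s, M ⊔ N, lt_min hr hs, hM.sup hN, sup_subset hMJ hNJ, rfl⟩, ?_, ?_⟩
  · exact (zpow_smul_le h0 (min_le_left l m) _).trans (field_smul_mono _
      (scaleSum_mono h0 hε0 hε1 hmin (min_le_left _ _) (image_sup_left _ _)))
  · exact (zpow_smul_le h0 (min_le_right l m) _).trans (field_smul_mono _
      (scaleSum_mono h0 hε0 hε1 hmin (min_le_right _ _) (image_sup_right _ _)))

lemma tubeFamily_mul (h0 : algebraMap V K π ≠ 0) (hε0 : 0 < ε) (hε1 : ε < 1) :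
    ∀ M ∈ tubeFamily K ε π 𝓑 J α, ∀ N ∈ tubeFamily K ε π 𝓑 J α,
      ∃ L ∈ tubeFamily K ε π 𝓑 J α, M * N ≤ L := by
  rintro _ ⟨l, r, M, hr, hM, hMJ, rfl⟩ _ ⟨m, s, N, hs, hN, hNJ, rfl⟩
  have hpos := Real.rpow_pos_of_pos hε0 α
  have hmin : 0 < min r s := lt_min (hpos.trans hr) (hpos.trans hs)
  refine ⟨_, ⟨l + m, min r s, M ⊔ N, lt_min hr hs, hM.sup hN, sup_subset hMJ hNJ, rfl⟩, ?_⟩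
  refine (smul_mul_smul_submodule _ _ _ _).trans ?_
  rw [← zpow_add₀ h0]
  refine field_smul_mono _ (le_trans (mul_le_mul' ?_ ?_) (scaleSum_mul_le h0 hmin _))
  · exact scaleSum_mono h0 hε0 hε1 hmin (min_le_left _ _) (image_sup_left _ _)
  · exact scaleSum_mono h0 hε0 hε1 hmin (min_le_right _ _) (image_sup_right _ _)

lemma exists_pow_smul_mem [IsDomain V] [IsDiscreteValuationRing V] [IsFractionRing V K]
    (hπ : Irreducible π) (x : K ⊗[V] R) :
    ∃ (l : ℕ) (y : R), algebraMap V K π ^ l • x = (1 : K) ⊗ₜ[V] y := by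
  induction x using TensorProduct.induction_on with
  | zero => exact ⟨0, 0, by simp⟩
  | tmul k y =>
    obtain ⟨a, s, hs, rfl⟩ := IsFractionRing.div_surjective (A := V) k
    have hs0 : s ≠ 0 := nonZeroDivisors.ne_zero hs
    obtain ⟨n, w, hw⟩ := IsDiscreteValuationRing.eq_unit_mul_pow_irreducible hs0 hπ
    have hsK : algebraMap V K s ≠ 0 := by
      simpa using (map_ne_zero_iff _ (IsFractionRing.injective V K)).2 hs0
    refine ⟨n, (a * (w⁻¹ : Vˣ)) • y, ?_⟩
    have e : algebraMap V K π ^ n • (algebraMap V K a / algebraMap V K s) =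
        (a * (w⁻¹ : Vˣ)) • (1 : K) := by
      rw [smul_eq_mul, Algebra.smul_def, mul_one, mul_div_assoc', div_eq_iff hsK, ← map_pow,
        ← map_mul, ← map_mul, hw]
      congr 1
      have := w.inv_mul
      linear_combination (-(a * π ^ n)) * this
    rw [TensorProduct.smul_tmul', e, TensorProduct.smul_tmul]
  | add x y hx hy =>
    obtain ⟨l, a, ha⟩ := hx
    obtain ⟨m, b, hb⟩ := hy
    refine ⟨l + m, π ^ m • a + π ^ l • b, ?_⟩
    rw [smul_add, pow_add, mul_smul, smul_comm, ha, mul_smul, hb, TensorProduct.tmul_add]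
    simp only [← map_pow, algebraMap_smul, TensorProduct.tmul_smul]

lemma tubeFamily_cover [IsDomain V] [IsDiscreteValuationRing V] [IsFractionRing V K]
    (hπ : Irreducible π) (hJ : algebraMap V R π ∈ J) (x : K ⊗[V] R) :
    ∃ M ∈ tubeFamily K ε π 𝓑 J α, x ∈ M := by
  have h0 : algebraMap V K π ≠ 0 := (map_ne_zero_iff _ (IsFractionRing.injective V K)).2 hπ.ne_zero
  obtain ⟨l, y, hy⟩ := exists_pow_smul_mem (K := K) hπ x
  have hMJ : (Submodule.span V {algebraMap V R π * y} : Set R) ⊆ J :=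
    Submodule.span_le (p := J.restrictScalars V).2
      (Set.singleton_subset_iff.2 (J.mul_mem_right y hJ))
  refine ⟨_, ⟨-(l : ℤ) - 1 - ⌈Real.logb ε ((ε ^ α + 1) ^ 1)⁻¹⌉, ε ^ α + 1,
    Submodule.span V {algebraMap V R π * y}, by linarith,
    (𝓑.bdd_finite (Set.finite_singleton _)).span, hMJ, rfl⟩, ?_⟩
  have hm : (1 : K) ⊗ₜ[V] (algebraMap V R π * y) ∈
      image K (Submodule.span V {algebraMap V R π * y}) ^ 1 := by
    rw [pow_one]
    exact ⟨_, Submodule.mem_span_singleton_self _, rfl⟩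
  have hs := Submodule.smul_mem_pointwise_smul _
    (algebraMap V K π ^ ⌈Real.logb ε ((ε ^ α + 1) ^ 1)⁻¹⌉) _ hm
  have hs' := Submodule.smul_mem_pointwise_smul _
    (algebraMap V K π ^ (-(l : ℤ) - 1 - ⌈Real.logb ε ((ε ^ α + 1) ^ 1)⁻¹⌉)) _
    (Submodule.mem_iSup_of_mem (p := fun n : ℕ => scale K ε π ((ε ^ α + 1) ^ n)⁻¹
      (image K (Submodule.span V {algebraMap V R π * y}) ^ n)) 1 hs)
  have e : (1 : K) ⊗ₜ[V] (algebraMap V R π * y) = algebraMap V K π ^ (1 : ℤ) •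
      algebraMap V K π ^ (l : ℤ) • x := by
    rw [zpow_natCast, hy, zpow_one, algebraMap_smul, ← Algebra.smul_def, TensorProduct.tmul_smul]
  rw [smul_smul, e, smul_smul, smul_smul, ← zpow_add₀ h0, ← zpow_add₀ h0, ← zpow_add₀ h0] at hs'
  rw [show -(l : ℤ) - 1 - ⌈Real.logb ε ((ε ^ α + 1) ^ 1)⁻¹⌉ +
    ⌈Real.logb ε ((ε ^ α + 1) ^ 1)⁻¹⌉ + 1 + l = 0 by ring, zpow_zero, one_smul] at hs'
  exact hs'

lemma bdd_of_mem_tubeFamily (h0 : algebraMap V K π ≠ 0) (hε0 : 0 < ε) (hε1 : ε < 1)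
    {N : Submodule V (K ⊗[V] R)} (hN : N ∈ tubeFamily K ε π 𝓑 J α)
    {𝓒 : ConvexBornology V (K ⊗[V] R)} (h : IsAdmissible K ε π 𝓑 J α 𝓒) : 𝓒.Bdd N := by
  obtain ⟨l, r, M, hr, hM, hMJ, rfl⟩ := hN
  refine h.1.bdd_zpow_smul h0 ?_ l
  have hpos := Real.rpow_pos_of_pos hε0 α
  have h₁ := (h.2 M hM hMJ).trans_lt ((ENNReal.ofReal_lt_ofReal_iff (hpos.trans hr)).2 hr)
  simp only [spectralRadius, iInf_lt_iff] at h₁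
  obtain ⟨s, ⟨hs, hb⟩, hsr⟩ := h₁
  rw [ENNReal.ofReal_lt_ofReal_iff (hpos.trans hr)] at hsr
  exact hb.subset (scaleSum_mono h0 hε0 hε1 hs hsr.le le_rfl)

lemma bdd_tubeConvexBornology_iff [IsDomain V] [IsDiscreteValuationRing V] [IsFractionRing V K]
    (hπ : Irreducible π) (hε0 : 0 < ε) (hε1 : ε < 1) (hJ : algebraMap V R π ∈ J)
    (S : Set (K ⊗[V] R)) : (tubeConvexBornology K ε π 𝓑 J α).Bdd S ↔
      ∃ N ∈ tubeFamily K ε π 𝓑 J α, S ⊆ N := by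
  have h0 : algebraMap V K π ≠ 0 := (map_ne_zero_iff _ (IsFractionRing.injective V K)).2 hπ.ne_zero
  rw [tubeConvexBornology, ConvexBornology.bdd_ofBdd]
  refine ⟨fun h => ?_, fun ⟨N, hN, hS⟩ 𝓒 h => (bdd_of_mem_tubeFamily h0 hε0 hε1 hN h).subset hS⟩
  rw [← ConvexBornology.bdd_ofSubmodules (cover := tubeFamily_cover hπ hJ)
    (dir := tubeFamily_dir h0 hε0 hε1)]
  refine h _ ⟨fun T hT => ?_, fun M hM hMJ => ?_⟩
  · rw [ConvexBornology.bdd_ofSubmodules] at hT ⊢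
    obtain ⟨_, ⟨l, r, M, hr, hM, hMJ, rfl⟩, hT⟩ := hT
    refine ⟨_, ⟨-1 + l, r, M, hr, hM, hMJ, rfl⟩, ?_⟩
    rw [zpow_add₀ h0, zpow_neg_one, mul_smul, Submodule.coe_pointwise_smul]
    exact Set.smul_set_mono hT
  · have hpos := Real.rpow_pos_of_pos hε0 α
    refine ENNReal.le_of_forall_pos_le_add fun δ hδ _ => ?_
    refine (iInf₂_le (ε ^ α + δ) ⟨by positivity, ?_⟩).trans ?_
    · rw [ENNReal.ofReal_add hpos.le δ.coe_nonneg, ENNReal.ofReal_coe_nnreal]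
    · rw [ConvexBornology.bdd_ofSubmodules]
      refine ⟨_, ⟨0, ε ^ α + δ, M, ?_, hM, hMJ, rfl⟩, ?_⟩
      · have : (0 : ℝ) < δ := hδ
        linarith
      · rw [zpow_zero, one_smul]

/-- The smallest `K`-vector space bornology on `K ⊗ R` for which the bounded `V`-submodules of `R`
contained in `J` have spectral radius at most `ε ^ α`. Multiplication is bounded for it
because `π ∈ J`. -/
def tubeBornology [IsDomain V] [IsDiscreteValuationRing V] [IsFractionRing V K]
    (hπ : Irreducible π) (hε0 : 0 < ε) (hε1 : ε < 1) (𝓑 : AlgBornology V R)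
    (hJ : algebraMap V R π ∈ J) (α : ℝ) : AlgBornology V (K ⊗[V] R) where
  toConvexBornology := tubeConvexBornology K ε π 𝓑 J α
  bdd_mul S T hS hT := by
    have h0 : algebraMap V K π ≠ 0 :=
      (map_ne_zero_iff _ (IsFractionRing.injective V K)).2 hπ.ne_zero
    rw [bdd_tubeConvexBornology_iff hπ hε0 hε1 hJ] at hS hT ⊢
    obtain ⟨M, hM, hS⟩ := hS
    obtain ⟨N, hN, hT⟩ := hT
    obtain ⟨L, hL, h⟩ := tubeFamily_mul h0 hε0 hε1 M hM N hN
    refine ⟨L, hL, ?_⟩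
    rintro _ ⟨s, hs, t, ht, rfl⟩
    exact h (Submodule.mul_mem_mul (hS hs) (hT ht))

lemma isAdmissible_tubeConvexBornology (h0 : algebraMap V K π ≠ 0) (hε0 : 0 < ε) (hε1 : ε < 1) :
    IsAdmissible K ε π 𝓑 J α (tubeConvexBornology K ε π 𝓑 J α) := by
  refine ⟨fun T hT => ?_, fun M hM hMJ => ?_⟩
  · rw [tubeConvexBornology, ConvexBornology.bdd_ofBdd] at hT ⊢
    exact fun 𝓒 h => h.1 _ (hT 𝓒 h)
  · have hpos := Real.rpow_pos_of_pos hε0 α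
    refine ENNReal.le_of_forall_pos_le_add fun δ hδ _ => ?_
    refine (iInf₂_le (ε ^ α + δ) ⟨by positivity, ?_⟩).trans ?_
    · rw [ENNReal.ofReal_add hpos.le δ.coe_nonneg, ENNReal.ofReal_coe_nnreal]
    · rw [tubeConvexBornology, ConvexBornology.bdd_ofBdd]
      refine fun 𝓒 h => bdd_of_mem_tubeFamily h0 hε0 hε1 ⟨0, ε ^ α + δ, M, ?_, hM, hMJ, ?_⟩ h
      · have : (0 : ℝ) < δ := hδ
        linarith
      · rw [zpow_zero, one_smul]

end Tube

/-! ### The completions of tubes -/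

section TubeCompletion

variable {V : Type u} [CommRing V] [IsDomain V] [IsDiscreteValuationRing V] (K : Type u) [Field K]
  [Algebra V K] [IsFractionRing V K] {ε : ℝ} {π : V} (hπ : Irreducible π) (hε0 : 0 < ε)
  (hε1 : ε < 1) {R : Type u} [CommRing R] [Algebra V R] {J : Ideal R}
  (hJ : algebraMap V R π ∈ J) (α : ℝ)

/-- The completion of `K ⊗ R` for the smallest `K`-vector space bornology for which the bounded
submodules contained in `J` have spectral radius at most `ε ^ α`, where `R` carries the fine
bornology. -/
abbrev TubeCompletion : Type u :=
  AlgBornology.Completion π (tubeBornology (K := K) hπ hε0 hε1 (AlgBornology.fine V R) hJ α)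

/-- The canonical homomorphism to `TubeCompletion`. -/
def TubeCompletion.of : K ⊗[V] R →ₐ[V] TubeCompletion K hπ hε0 hε1 hJ α :=
  AlgBornology.Completion.of π _

/-- The bornology of `TubeCompletion`. -/
def TubeCompletion.bornology : AlgBornology V (TubeCompletion K hπ hε0 hε1 hJ α) :=
  AlgBornology.Completion.bornology π _

end TubeCompletion

end BornHH

end

/-! The comparison of Hochschild homology in (a) and in (b) is one theorem about the following
situation. Let `Q` be a finitely generated torsion-free `V`-algebra and let `s` divide `π`. Let `Q →
A` be the localization at `s`, and let `T` be a bornological algebra that is the localization at `s`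
of the weak completion `Q†`, also bornologically (`IsDaggerAway`). For (a), `s = 1`, `Q = A = R` and
`T = R†`. For (b), `s = π`, `A = K ⊗ R`, and with `α = p / q` and `G` a finite set of generators of
`J`, `Q` is the blow-up algebra `R[π⁻ᵖ Gᑫ]` inside `K ⊗ R`. The condition `ϱ ≤ ε ^ α` on `J` says
that `π⁻ᵖ Jᑫ` has spectral radius at most `1`, so up to powers of `π` the tube bornology is the one
that produces `Q†` (`isDaggerDense_blowUp`).

Commutative algebra. The Rees algebra of the filtration of `Q` by powers of a generating submodule
is Noetherian. Hence ideal membership and division by `π` can be realized with linear control of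
degrees (`IsGenerating.exists_bound`, `IsGenerating.exists_saturation`). A division algorithm with
this control shows that `Q†` is Noetherian (`WeakCompletion.isNoetherianRing`), and `π` lies in its
Jacobson radical. By Krull's intersection theorem and the equational criterion, a map that is
approximated modulo all powers of `π` by a flat map is then flat (`flat_of_flat_approximation`). So
weak completion preserves flat maps, `Q → Q†` is flat, and for a surjection the kernel of the
completed map is generated by the original kernel (`WeakCompletion.ker_map`).

Bornological analysis. For `n > 0` the completed tensor power `T ⊗̂ ⋯ ⊗̂ T` is again the
localization at `s` of the weak completion of `Q ⊗ ⋯ ⊗ Q` (`IsDaggerAway.isDaggerAway_powLift`).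
Together with the previous paragraph this makes all relevant maps between tensor powers flat and
identifies the kernels of the multiplication maps.

Homological algebra. The bar complex of `T` is a resolution because putting `1` in front contracts
it, and its terms are flat over `T ⊗̂ T`. The bar complex of `A`, extended along the flat map `A ⊗ A
→ T ⊗̂ T`, is another flat resolution of the same module. The cone of the comparison map is a
bounded below exact complex of flat modules, so it stays exact modulo the diagonal ideal
(`exact_mod_ideal`). Modulo the diagonal ideal the two resolutions become `T ⊗_A C(A)` and the
completed `C(T)`, which are therefore quasi-isomorphic (`quasiIso_hochschild`). Since `A → T` is
flat, extension of scalars commutes with homology, which gives the isomorphisms on `HH`. The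
statements about bar complexes in (a) are the resolutions used on the way. -/

noncomputable section

namespace BornHH

/-! ### Filtrations by powers of a generating submodule and their Rees algebras -/

section Filtration

variable {V : Type*} [CommRing V] {Q : Type*} [CommRing Q] [Algebra V Q]

open Polynomial in
/-- The Rees algebra of the filtration of `Q` by the powers of a submodule `M`. -/
def reesFiltration (M : Submodule V Q) : Subalgebra V Q[X] where
  carrier := {p | ∀ k, p.coeff k ∈ M ^ k}
  mul_mem' := by
    intro p q hp hq k
    rw [Polynomial.coeff_mul]
    refine Submodule.sum_mem _ fun x hx => ?_
    rw [Finset.HasAntidiagonal.mem_antidiagonal] at hx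
    rw [← hx, pow_add]
    exact Submodule.mul_mem_mul (hp _) (hq _)
  add_mem' := by
    intro p q hp hq k
    rw [Polynomial.coeff_add]
    exact add_mem (hp k) (hq k)
  algebraMap_mem' := by
    intro r k
    rw [Polynomial.algebraMap_apply, Polynomial.coeff_C]
    split_ifs with h
    · rw [h, pow_zero]
      exact Submodule.algebraMap_mem r
    · exact zero_mem _

lemma monomial_mem_reesFiltration {M : Submodule V Q} {k : ℕ} {x : Q} (hx : x ∈ M ^ k) :
    Polynomial.monomial k x ∈ reesFiltration M := by
  intro l
  rw [Polynomial.coeff_monomial]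
  split_ifs with h
  · rwa [← h]
  · exact zero_mem _

/-- An element of the `k`-th power of the span is a combination of products of `k` generators, so
its monomial of degree `k` is a combination of products of monomials of degree one. This gives
finite generation of the Rees algebra and hence the Noetherian property. -/
lemma reesFiltration_eq_adjoin (s : Set Q) :
    reesFiltration (Submodule.span V s) = Algebra.adjoin V (Polynomial.monomial 1 '' s) := by
  refine le_antisymm (fun p hp => ?_) (Algebra.adjoin_le ?_)
  · have key : ∀ k, ∀ x ∈ Submodule.span V s ^ k,
        Polynomial.monomial k x ∈ Algebra.adjoin V (Polynomial.monomial 1 '' s) := by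
      intro k x hx
      induction k generalizing x with
      | zero =>
        rw [pow_zero] at hx
        obtain ⟨r, rfl⟩ := Submodule.mem_one.1 hx
        exact Subalgebra.algebraMap_mem _ r
      | succ k ih =>
        rw [pow_succ] at hx
        induction hx using Submodule.mul_induction_on' with
        | mem_mul_mem m hm n hn =>
          rw [← Polynomial.monomial_mul_monomial]
          refine mul_mem (ih m hm) ?_
          clear hm
          induction hn using Submodule.span_induction with
          | mem x hx => exact Algebra.subset_adjoin ⟨x, hx, rfl⟩
          | zero => simp
          | add x y _ _ hx hy => rw [map_add]; exact add_mem hx hy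
          | smul r x _ hx => rw [← Polynomial.smul_monomial]; exact Subalgebra.smul_mem _ hx r
        | add x _ y _ hx hy => rw [map_add]; exact add_mem hx hy
    rw [p.as_sum_support]
    exact sum_mem fun k _ => key k _ (hp k)
  · rintro _ ⟨x, hx, rfl⟩
    exact monomial_mem_reesFiltration (by rw [pow_one]; exact Submodule.subset_span hx)

lemma isNoetherianRing_reesFiltration [IsNoetherianRing V] {M : Submodule V Q} (hM : M.FG) :
    IsNoetherianRing (reesFiltration M) := by
  obtain ⟨s, rfl⟩ := hM
  have h : (reesFiltration (Submodule.span V (s : Set Q))).FG := by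
    classical
    rw [reesFiltration_eq_adjoin]
    exact ⟨s.image (Polynomial.monomial 1), by simp⟩
  have : Algebra.FiniteType V (reesFiltration (Submodule.span V (s : Set Q))) :=
    (Subalgebra.fg_iff_finiteType _).1 h
  exact Algebra.FiniteType.isNoetherianRing V _

/-- `M` generates `Q` as a filtered algebra. -/
structure IsGenerating (M : Submodule V Q) : Prop where
  fg : M.FG
  one_mem : (1 : Q) ∈ M
  exhausts : ∀ x : Q, ∃ k, x ∈ M ^ k

lemma IsGenerating.pow_mono {M : Submodule V Q} (h : IsGenerating M) {m n : ℕ} (hmn : m ≤ n) :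
    M ^ m ≤ M ^ n := pow_mono_of_one_mem le_rfl h.one_mem hmn

lemma exists_isGenerating (V Q : Type*) [CommRing V] [CommRing Q] [Algebra V Q]
    [Algebra.FiniteType V Q] : ∃ M : Submodule V Q, IsGenerating M := by
  obtain ⟨s, hs⟩ := (Algebra.FiniteType.out : (⊤ : Subalgebra V Q).FG)
  let M : Submodule V Q := Submodule.span V (insert 1 (s : Set Q))
  have h1 : (1 : Q) ∈ M := Submodule.subset_span (Set.mem_insert _ _)
  refine ⟨M, Submodule.fg_span (s.finite_toSet.insert 1), h1, fun x => ?_⟩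
  have hx : x ∈ Algebra.adjoin V (s : Set Q) := hs ▸ Algebra.mem_top
  induction hx using Algebra.adjoin_induction with
  | mem x hx => exact ⟨1, by rw [pow_one]; exact Submodule.subset_span (Set.mem_insert_of_mem _ hx)⟩
  | algebraMap r => exact ⟨0, by rw [pow_zero]; exact Submodule.algebraMap_mem r⟩
  | add x y _ _ hx hy =>
    obtain ⟨k, hk⟩ := hx
    obtain ⟨l, hl⟩ := hy
    exact ⟨max k l, add_mem (pow_mono_of_one_mem le_rfl h1 (le_max_left k l) hk)
      (pow_mono_of_one_mem le_rfl h1 (le_max_right k l) hl)⟩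
  | mul x y _ _ hx hy =>
    obtain ⟨k, hk⟩ := hx
    obtain ⟨l, hl⟩ := hy
    exact ⟨k + l, by rw [pow_add]; exact Submodule.mul_mem_mul hk hl⟩

lemma IsGenerating.exists_pow {M : Submodule V Q} (h : IsGenerating M) {N : Submodule V Q}
    (hN : N.FG) : ∃ k, N ≤ M ^ k := by
  obtain ⟨s, rfl⟩ := hN
  choose f hf using h.exhausts
  refine ⟨s.sup f, Submodule.span_le.2 fun x hx => h.pow_mono (Finset.le_sup hx) (hf x)⟩

lemma IsGenerating.exists_pow_finite {M : Submodule V Q} (h : IsGenerating M) {ι : Type*} [Finite ι]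
    (x : ι → Q) : ∃ k, ∀ i, x i ∈ M ^ k := by
  obtain ⟨k, hk⟩ := h.exists_pow (Submodule.fg_span (R := V) (Set.finite_range x))
  exact ⟨k, fun i => hk (Submodule.subset_span ⟨i, rfl⟩)⟩

/-- Elements of an ideal are combinations of the generators with control on the degree of the
coefficients. -/
lemma IsGenerating.exists_bound [IsNoetherianRing V] {M : Submodule V Q} (h : IsGenerating M)
    {ι : Type*} [Fintype ι] (g : ι → Q) :
    ∃ c : ℕ, ∀ k, ∀ x ∈ M ^ k, x ∈ Ideal.span (Set.range g) →
      ∃ a : ι → Q, (∀ i, a i ∈ M ^ (k + c)) ∧ x = ∑ i, a i * g i := by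
  classical
  have := isNoetherianRing_reesFiltration h.fg
  -- The ideal is homogenized inside the Rees algebra. Its finitely many generators have finitely
  -- many coefficients, and `c` bounds the degrees of the cofactors that express them through `g`.
  let I : Ideal (reesFiltration M) :=
    { carrier := {p | ∀ k, p.1.coeff k ∈ Ideal.span (Set.range g)}
      add_mem' := fun {p q} hp hq k => by
        change (p.1 + q.1).coeff k ∈ _
        rw [Polynomial.coeff_add]
        exact add_mem (hp k) (hq k)
      zero_mem' := fun k => by
        change (0 : Polynomial Q).coeff k ∈ _
        simp
      smul_mem' := fun p q hq k => by
        change (p.1 * q.1).coeff k ∈ _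
        rw [Polynomial.coeff_mul]
        exact sum_mem fun x _ => Ideal.mul_mem_left _ _ (hq _) }
  obtain ⟨s, hs⟩ := (isNoetherianRing_iff_ideal_fg _).1 this I
  have hcoeff : ∀ (p : s) (k : ℕ), ∃ a : ι → Q, p.1.1.coeff k = ∑ i, a i * g i := by
    intro p k
    have hp : p.1 ∈ I := hs ▸ Ideal.subset_span p.2
    obtain ⟨a, ha⟩ := (Submodule.mem_span_range_iff_exists_fun Q).1 (hp k)
    exact ⟨a, ha.symm⟩
  choose a ha using hcoeff
  let N := s.sup fun p => p.1.natDegree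
  obtain ⟨c, hc⟩ := h.exists_pow_finite (fun x : s × Fin (N + 1) × ι => a x.1 x.2.1 x.2.2)
  refine ⟨c, fun k x hx hxg => ?_⟩
  let X : reesFiltration M := ⟨Polynomial.monomial k x, monomial_mem_reesFiltration hx⟩
  have hX : X ∈ Ideal.span (s : Set (reesFiltration M)) := by
    rw [hs]
    intro l
    change (Polynomial.monomial k x).coeff l ∈ _
    rw [Polynomial.coeff_monomial]
    split_ifs
    · exact hxg
    · exact zero_mem _
  obtain ⟨b, -, hb⟩ := Submodule.mem_span_finset.1 hX
  have hb' : Polynomial.monomial k x = ∑ p ∈ s, (b p).1 * p.1 := by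
    have := congrArg (Subtype.val) hb
    rw [← show X.1 = Polynomial.monomial k x from rfl, ← this]
    simp
  have e := congrArg (fun p => p.coeff k) hb'
  simp only [Polynomial.coeff_monomial, if_true, Polynomial.finsetSum_coeff,
    Polynomial.coeff_mul] at e
  -- This is the coefficient of degree `k` of `∑ b p * p`, with the coefficients of `p` replaced by
  -- their cofactors. Coefficients of `p` beyond `N` vanish, whence the value `0` there. The factors
  -- from `b` have degree at most `k` and the cofactors lie in `M ^ c`.
  refine ⟨fun i => ∑ p : s, ∑ z ∈ Finset.HasAntidiagonal.antidiagonal k,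
    (b p).1.coeff z.1 * if z.2 ≤ N then a p z.2 i else 0, fun i => ?_, ?_⟩
  · refine sum_mem fun p _ => sum_mem fun z hz => ?_
    rw [Finset.HasAntidiagonal.mem_antidiagonal] at hz
    split_ifs with hzN
    · rw [pow_add]
      refine Submodule.mul_mem_mul (h.pow_mono (by omega) ((b p).2 z.1)) ?_
      exact hc (p, ⟨z.2, by omega⟩, i)
    · simp
  · rw [e, ← Finset.sum_coe_sort s]
    simp only [Finset.sum_mul]
    refine Eq.trans (Finset.sum_congr rfl fun p _ => ?_) Finset.sum_comm
    refine Eq.trans (Finset.sum_congr rfl fun z _ => ?_) Finset.sum_comm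
    split_ifs with hzN
    · rw [ha p z.2, Finset.mul_sum]
      exact Finset.sum_congr rfl fun i _ => (mul_assoc _ _ _).symm
    · rw [Polynomial.coeff_eq_zero_of_natDegree_lt (p := p.1.1)]
      · simp
      · exact lt_of_le_of_lt (Finset.le_sup (f := fun p : reesFiltration M => p.1.natDegree) p.2)
          (not_le.1 hzN)

/-- If `π ^ n y` has degree `k`, then the degree of `y` is bounded linearly. -/
lemma IsGenerating.exists_saturation [IsNoetherianRing V] {M : Submodule V Q}
    (h : IsGenerating M) {π : V} (htf : ∀ x : Q, π • x = 0 → x = 0) :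
    ∃ c : ℕ, ∀ n k, ∀ y : Q, π ^ n • y ∈ M ^ k → y ∈ M ^ (k + c * n) := by
  -- For the principal ideal `(π)` the bound says that one division by `π` costs `c` in degree; by
  -- torsion-freeness the cofactor is the quotient itself. The claim follows by induction on the
  -- number of divisions.
  obtain ⟨c, hc⟩ := h.exists_bound (fun _ : Unit => algebraMap V Q π)
  refine ⟨c, fun n => ?_⟩
  induction n with
  | zero => intro k y hy; simpa using hy
  | succ n ih =>
    intro k y hy
    rw [pow_succ', mul_smul] at hy
    have hy' : π • (π ^ n • y) ∈ Ideal.span (Set.range fun _ : Unit => algebraMap V Q π) := by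
      rw [Algebra.smul_def π]
      exact Ideal.mul_mem_right _ _ (Ideal.subset_span ⟨(), rfl⟩)
    obtain ⟨a, ha, e⟩ := hc k _ hy hy'
    have e' : π ^ n • y = a () := by
      rw [← sub_eq_zero]
      refine htf _ ?_
      rw [smul_sub, e, sub_eq_zero, Algebra.smul_def π]
      simp [mul_comm]
    have := ih (k + c) y (e' ▸ ha ())
    rwa [show k + c * (n + 1) = k + c + c * n by ring]

end Filtration

/-! ### Series, reductions and units in a weak completion -/

namespace WeakCompletion

section Basics

variable {V : Type*} [CommRing V] {π : V} {Q : Type*} [CommRing Q] [Algebra V Q]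

lemma mem_adicIdeal_pow {n : ℕ} {x : Q} : x ∈ adicIdeal π Q ^ n ↔ ∃ y : Q, x = π ^ n • y := by
  rw [adicIdeal, Ideal.span_singleton_pow, Ideal.mem_span_singleton]
  simp only [Algebra.smul_def, map_pow]
  rfl

variable (π) in
/-- `z = ∑ π ^ j u j` in the weak completion. -/
def HasSeries (u : ℕ → Q) (z : WeakCompletion π Q) : Prop := IsSeries π u (val π Q z)

variable (π Q) in
/-- Reduction modulo `π ^ n`. -/
def eval (n : ℕ) : WeakCompletion π Q →ₐ[V] Q ⧸ adicIdeal π Q ^ n := (adicEval π Q n).comp (val π Q)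

lemma eval_ext {x y : WeakCompletion π Q} (h : ∀ n, eval π Q n x = eval π Q n y) : x = y :=
  Subtype.ext (adicEval_ext π h)

@[simp] lemma eval_of (n : ℕ) (q : Q) : eval π Q n (of π Q q) = Ideal.Quotient.mk _ q :=
  AdicCompletion.evalₐ_of _ n q

lemma HasSeries.eval {u : ℕ → Q} {z : WeakCompletion π Q} (h : HasSeries π u z) (n : ℕ) :
    eval π Q n z = Ideal.Quotient.mk _ (partialSum π u n) := h n

lemma HasSeries.unique {u : ℕ → Q} {x y : WeakCompletion π Q} (hx : HasSeries π u x)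
    (hy : HasSeries π u y) : x = y :=
  eval_ext fun n => (hx.eval n).trans (hy.eval n).symm

lemma HasSeries.add {u v : ℕ → Q} {x y : WeakCompletion π Q} (hx : HasSeries π u x)
    (hy : HasSeries π v y) : HasSeries π (u + v) (x + y) := IsSeries.add π hx hy

lemma HasSeries.smul (r : V) {u : ℕ → Q} {x : WeakCompletion π Q} (hx : HasSeries π u x) :
    HasSeries π (r • u) (r • x) := IsSeries.smul π r hx

lemma HasSeries.sub {u v : ℕ → Q} {x y : WeakCompletion π Q} (hx : HasSeries π u x)
    (hy : HasSeries π v y) : HasSeries π (u - v) (x - y) := by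
  have := hx.add (hy.smul (-1))
  simpa [sub_eq_add_neg] using this

lemma HasSeries.mul {u v : ℕ → Q} {x y : WeakCompletion π Q} (hx : HasSeries π u x)
    (hy : HasSeries π v y) : HasSeries π
      (fun k => ∑ p ∈ Finset.HasAntidiagonal.antidiagonal k, u p.1 * v p.2) (x * y) :=
  IsSeries.mul π hx hy

lemma hasSeries_of (q : Q) : HasSeries π (Pi.single 0 q) (of π Q q) := isSeries_single π q

lemma partialSum_succ (u : ℕ → Q) (n : ℕ) :
    partialSum π u (n + 1) = partialSum π u n + π ^ n • u n := Finset.sum_range_succ _ _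

lemma partialSum_add (u : ℕ → Q) (m n : ℕ) :
    partialSum π u (m + n) = partialSum π u m + π ^ m • partialSum π (fun k => u (k + m)) n := by
  rw [partialSum, Finset.sum_range_add, partialSum, partialSum, Finset.smul_sum]
  congr 1
  refine Finset.sum_congr rfl fun k _ => ?_
  rw [smul_smul, ← pow_add, add_comm k m]

lemma exists_hasSeries {M : Submodule V Q} (hM : M.FG) (h1 : (1 : Q) ∈ M) {a d : ℕ} {u : ℕ → Q}
    (hu : ∀ k, u k ∈ M ^ (a * k + d)) : ∃ z : WeakCompletion π Q, HasSeries π u z := by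
  let s : AdicCompletion.AdicCauchySequence (adicIdeal π Q) Q :=
    AdicCompletion.AdicCauchySequence.mk _ _ (partialSum π u) (fun n => by
      rw [SModEq.sub_mem, partialSum_succ, sub_add_cancel_left, Ideal.smul_eq_mul, Ideal.mul_top]
      exact neg_mem (pow_smul_mem_adicIdeal π le_rfl _))
  have hs : IsSeries π u (AdicCompletion.mk _ _ s) := fun n => AdicCompletion.evalₐ_mk _ n s
  exact ⟨⟨_, M, hM, h1, a + d, u, fun j => pow_mono_of_one_mem le_rfl h1 (by
    rw [add_mul, mul_add, mul_add]; omega) (hu j), hs⟩, hs⟩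

/-- Shifting the digits keeps the slope `a` of the growth bound and changes only its constant, so
the remainder belongs to the weak completion and not merely to the `π`-adic one. -/
lemma HasSeries.exists_tail {M : Submodule V Q} (hM : M.FG) (h1 : (1 : Q) ∈ M) {a d : ℕ}
    {u : ℕ → Q} (hu : ∀ k, u k ∈ M ^ (a * k + d)) {z : WeakCompletion π Q}
    (hz : HasSeries π u z) (n : ℕ) : ∃ z' : WeakCompletion π Q,
      HasSeries π (fun k => u (k + n)) z' ∧ z = of π Q (partialSum π u n) + π ^ n • z' := by
  obtain ⟨z', hz'⟩ := exists_hasSeries (π := π) hM h1 (a := a) (d := a * n + d)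
    (u := fun k => u (k + n)) (fun k => by
      have := hu (k + n)
      rwa [mul_add, add_assoc] at this)
  refine ⟨z', hz', eval_ext fun m => ?_⟩
  rw [map_add, map_smul, eval_of, hz.eval, hz'.eval]
  change _ = Ideal.Quotient.mkₐ V (adicIdeal π Q ^ m) _ +
    π ^ n • Ideal.Quotient.mkₐ V (adicIdeal π Q ^ m) _
  rw [← map_smul, ← map_add, ← partialSum_add, Ideal.Quotient.mkₐ_eq_mk, Ideal.Quotient.eq,
    add_comm n m, partialSum_add, sub_add_cancel_left]
  exact neg_mem (pow_smul_mem_adicIdeal π le_rfl _)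

lemma exists_series (z : WeakCompletion π Q) : ∃ (M : Submodule V Q) (c : ℕ) (u : ℕ → Q),
    M.FG ∧ (1 : Q) ∈ M ∧ (∀ k, u k ∈ M ^ (c * (k + 1))) ∧ HasSeries π u z := by
  obtain ⟨M, hM, h1, c, u, hu, hz⟩ := z.2
  exact ⟨M, c, u, hM, h1, hu, hz⟩

lemma exists_digits {M : Submodule V Q} (hM : IsGenerating M) (z : WeakCompletion π Q) :
    ∃ (c : ℕ) (u : ℕ → Q), (∀ k, u k ∈ M ^ (c * k + c)) ∧ HasSeries π u z := by
  obtain ⟨N, c, u, hN, h1, hu, hz⟩ := exists_series z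
  obtain ⟨d, hd⟩ := hM.exists_pow hN
  refine ⟨d * c, u, fun k => ?_, hz⟩
  have := pow_le_pow_left' hd (c * (k + 1)) (hu k)
  rwa [← pow_mul, ← mul_assoc, mul_add, mul_one] at this

lemma exists_eq_of_add (z : WeakCompletion π Q) (n : ℕ) :
    ∃ (q : Q) (z' : WeakCompletion π Q), z = of π Q q + π ^ n • z' := by
  obtain ⟨M, c, u, hM, h1, hu, hz⟩ := exists_series z
  obtain ⟨z', -, h⟩ := hz.exists_tail hM h1 (a := c) (d := c) (fun k => by
    have := hu k; rwa [mul_add, mul_one] at this) n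
  exact ⟨_, z', h⟩

lemma eval_pow_smul (n : ℕ) (z : WeakCompletion π Q) : eval π Q n (π ^ n • z) = 0 := by
  obtain ⟨q, z', rfl⟩ := exists_eq_of_add z 0
  obtain ⟨x, hx⟩ := Ideal.Quotient.mk_surjective (eval π Q n (of π Q q + π ^ 0 • z'))
  rw [map_smul, ← hx]
  change π ^ n • Ideal.Quotient.mkₐ V _ x = 0
  rw [← map_smul, Ideal.Quotient.mkₐ_eq_mk, Ideal.Quotient.eq_zero_iff_mem]
  exact pow_smul_mem_adicIdeal π le_rfl _

lemma eval_eq_zero_iff {n : ℕ} {z : WeakCompletion π Q} :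
    eval π Q n z = 0 ↔ ∃ z', z = π ^ n • z' := by
  refine ⟨fun h => ?_, ?_⟩
  · obtain ⟨q, z', rfl⟩ := exists_eq_of_add z n
    rw [map_add, eval_pow_smul, add_zero, eval_of, Ideal.Quotient.eq_zero_iff_mem,
      mem_adicIdeal_pow] at h
    obtain ⟨y, rfl⟩ := h
    exact ⟨of π Q y + z', by rw [map_smul, smul_add]⟩
  · rintro ⟨z', rfl⟩
    exact eval_pow_smul n z'

/-- Together with `exists_eq_of_add` this says that `Q` and its weak completion have the same
quotients modulo powers of `π`. -/
lemma exists_of_of_eq {q : Q} {n : ℕ} {z : WeakCompletion π Q} (h : of π Q q = π ^ n • z) :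
    ∃ y, q = π ^ n • y := by
  have := eval_eq_zero_iff.2 ⟨z, h⟩
  rwa [eval_of, Ideal.Quotient.eq_zero_iff_mem, mem_adicIdeal_pow] at this

lemma eq_zero_of_forall_pow {z : WeakCompletion π Q} (h : ∀ n, ∃ z', z = π ^ n • z') : z = 0 :=
  eval_ext fun n => by rw [eval_eq_zero_iff.2 (h n), map_zero]

/-- If `z = q + π ^ n z'` is killed by `π`, then `π q` is divisible by `π ^ (n + 1)`, hence `q` by
`π ^ n`. So `z` is divisible by all powers of `π`. -/
lemma smul_eq_zero (htf : ∀ x : Q, π • x = 0 → x = 0) {z : WeakCompletion π Q}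
    (h : π • z = 0) : z = 0 := by
  refine eq_zero_of_forall_pow fun n => ?_
  obtain ⟨q, z', rfl⟩ := exists_eq_of_add z n
  have h' : of π Q (π • q) = π ^ (n + 1) • (-z') := by
    rw [map_smul, smul_neg, ← add_eq_zero_iff_eq_neg, pow_succ', mul_smul, ← smul_add]
    exact h
  obtain ⟨y, hy⟩ := exists_of_of_eq h'
  have : q = π ^ n • y := by
    rw [← sub_eq_zero]
    refine htf _ ?_
    rw [smul_sub, hy, pow_succ', mul_smul, sub_self]
  exact ⟨of π Q y + z', by rw [this, map_smul, smul_add]⟩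

/-- The inverse is computed as a formal power series. In the recursion for its coefficients `v`, a
product `w i * v j` with `i + j = n` has degree at most `c (i + 1) + c j = c (n + 1)`, so linear
growth persists. Consequently `π` lies in the Jacobson radical. -/
lemma isUnit_one_add (x : WeakCompletion π Q) : IsUnit (1 + π • x) := by
  obtain ⟨M, c, w, hM, h1, hw, hx⟩ := exists_series x
  let φ : PowerSeries Q := 1 + PowerSeries.X * PowerSeries.mk w
  let ψ : PowerSeries Q := PowerSeries.invOfUnit φ 1
  have hφψ : ψ + PowerSeries.X * (PowerSeries.mk w * ψ) = 1 := by
    rw [← mul_assoc, ← one_add_mul]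
    exact PowerSeries.mul_invOfUnit φ 1 (by simp [φ])
  let v : ℕ → Q := fun n => PowerSeries.coeff n ψ
  have hv0 : v 0 = 1 := by
    simpa [v] using congrArg (PowerSeries.coeff 0) hφψ
  have hvs : ∀ n, v (n + 1) = -∑ p ∈ Finset.HasAntidiagonal.antidiagonal n, w p.1 * v p.2 := by
    intro n
    have := congrArg (PowerSeries.coeff (n + 1)) hφψ
    rw [map_add, PowerSeries.coeff_succ_X_mul, PowerSeries.coeff_mul, PowerSeries.coeff_one,
      if_neg n.succ_ne_zero] at this
    simpa [v] using eq_neg_of_add_eq_zero_left this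
  clear_value v
  have hv : ∀ n, v n ∈ M ^ (c * n) := by
    intro n
    induction n using Nat.strong_induction_on with
    | _ n ih =>
      rcases n with _ | n
      · rw [hv0, mul_zero, pow_zero]; exact Submodule.one_le.1 le_rfl
      · rw [hvs]
        refine neg_mem (sum_mem fun p hp => ?_)
        rw [Finset.HasAntidiagonal.mem_antidiagonal] at hp
        have := Submodule.mul_mem_mul (hw p.1) (ih p.2 (by omega))
        rwa [← pow_add, ← mul_add, show p.1 + 1 + p.2 = n + 1 by omega] at this
  obtain ⟨y, hy⟩ := exists_hasSeries (π := π) hM h1 (a := c) (d := 0) (u := v) hv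
  have h1x : HasSeries π (fun k => Nat.casesOn k 1 w) (1 + π • x) := by
    intro n
    change eval π Q n (1 + π • x) = _
    rw [map_add, map_smul, hx.eval, map_one]
    change 1 + π • Ideal.Quotient.mkₐ V _ _ = _
    rw [← map_smul, Ideal.Quotient.mkₐ_eq_mk, ← map_one (Ideal.Quotient.mk _), ← map_add]
    refine Ideal.Quotient.eq.2 ?_
    have := partialSum_add (π := π) (fun k => Nat.casesOn (motive := fun _ => Q) k 1 w) 1 n
    rw [add_comm 1 n, partialSum_succ] at this
    simp only [partialSum, Finset.sum_range_one, pow_zero, one_smul, pow_one] at this ⊢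
    refine (congrArg (· ∈ adicIdeal π Q ^ n) (sub_eq_of_eq_add' this.symm)).mpr ?_
    exact pow_smul_mem_adicIdeal π le_rfl _
  refine IsUnit.of_mul_eq_one y ((h1x.mul hy).unique ?_)
  have e : (fun k => ∑ p ∈ Finset.HasAntidiagonal.antidiagonal k,
      (Nat.casesOn (motive := fun _ => Q) p.1 1 w) * v p.2) = Pi.single 0 1 := by
    funext k
    rcases k with _ | k
    · simp [hv0]
    · rw [Finset.Nat.sum_antidiagonal_succ, hvs]
      simp
  rw [e]
  exact map_one (of π Q) ▸ hasSeries_of 1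

end Basics

end WeakCompletion

/-! ### Weak completions of finitely generated algebras are Noetherian -/

namespace WeakCompletion

section Noetherian

variable {V : Type*} [CommRing V] {π : V} {Q : Type*} [CommRing Q] [Algebra V Q]

lemma HasSeries.of_mul (q : Q) {u : ℕ → Q} {x : WeakCompletion π Q} (hx : HasSeries π u x) :
    HasSeries π (fun k => q * u k) (of π Q q * x) := fun n => by
  change WeakCompletion.eval π Q n _ = _
  rw [map_mul, eval_of, hx.eval, ← map_mul]
  simp [partialSum, Finset.mul_sum]

lemma hasSeries_zero : HasSeries π 0 (0 : WeakCompletion π Q) := fun n => by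
  change eval π Q n 0 = _
  simp [partialSum]

lemma HasSeries.sum {ι : Type*} (s : Finset ι) {u : ι → ℕ → Q} {x : ι → WeakCompletion π Q}
    (hx : ∀ i, HasSeries π (u i) (x i)) : HasSeries π (∑ i ∈ s, u i) (∑ i ∈ s, x i) := by
  classical
  induction s using Finset.induction_on with
  | empty => simpa using hasSeries_zero
  | insert i s hi ih =>
    rw [Finset.sum_insert hi, Finset.sum_insert hi]
    exact (hx i).add ih

variable (π) in
/-- `z` is a series `∑ π ^ k u k` with `u k ∈ M ^ (a k + d)`. -/
def HasGrowth (M : Submodule V Q) (a d : ℕ) (z : WeakCompletion π Q) : Prop :=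
  ∃ u : ℕ → Q, (∀ k, u k ∈ M ^ (a * k + d)) ∧ HasSeries π u z

/-- The first digit of `z` is expressed through the first digits of the `f i`, up to a multiple of
`π`; the rest is divided by `π`, and saturation keeps it in `p`. The loss of degree is `c` from the
division and `2 * b` from multiplication by the shifted digits of `f`. A slope `e ≥ c + 2 * b`
absorbs it: the slope of the remainder is still `e` and its constant grows by `e`. -/
lemma exists_division_step {M : Submodule V Q} (hM : IsGenerating M) {p : Ideal (WeakCompletion π Q)}
    (hp : ∀ z, π • z ∈ p → z ∈ p) {ι : Type*} [Fintype ι] {f : ι → WeakCompletion π Q}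
    (hf : ∀ i, f i ∈ p) {u : ι → ℕ → Q} {b c e : ℕ} (hu : ∀ i k, u i k ∈ M ^ (b * k + b))
    (huf : ∀ i, HasSeries π (u i) (f i))
    (hc : ∀ k, ∀ x ∈ M ^ k, (∃ y, of π Q x + π • y ∈ p) → ∃ (a : ι → Q) (r : Q),
      (∀ i, a i ∈ M ^ (k + c)) ∧ r ∈ M ^ (k + c) ∧ x = ∑ i, a i * u i 0 + π • r)
    (he : c + 2 * b ≤ e) {d : ℕ} {z : WeakCompletion π Q} (hz : z ∈ p) (hzd : HasGrowth π M e d z) :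
    ∃ (a : ι → Q) (z' : WeakCompletion π Q), (∀ i, a i ∈ M ^ (d + c)) ∧ z' ∈ p ∧
      HasGrowth π M e (e + d) z' ∧ z = ∑ i, of π Q (a i) * f i + π • z' := by
  obtain ⟨v, hv, hvz⟩ := hzd
  obtain ⟨t, -, ht⟩ := hvz.exists_tail hM.fg hM.one_mem hv 1
  have hv0 : of π Q (v 0) + π • t ∈ p := by
    have e : z = of π Q (v 0) + π • t := by simpa [partialSum] using ht
    rwa [← e]
  obtain ⟨a, r, ha, hr, hx⟩ := hc d (v 0) (by simpa using hv 0) ⟨t, hv0⟩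
  have hU : HasSeries π (v - ∑ i, fun k => a i * u i k) (z - ∑ i, of π Q (a i) * f i) :=
    hvz.sub (HasSeries.sum _ fun i => (huf i).of_mul (a i))
  have hUM : ∀ k, (v - ∑ i, fun k => a i * u i k) k ∈ M ^ (e * k + (d + c + b)) := by
    intro k
    rw [Pi.sub_apply, Finset.sum_apply]
    refine sub_mem (hM.pow_mono (by omega) (hv k)) (sum_mem fun i _ => ?_)
    have := Submodule.mul_mem_mul (ha i) (hu i k)
    rw [← pow_add] at this
    have h2 := Nat.mul_le_mul_right k (show b ≤ e by omega)
    exact hM.pow_mono (by omega) this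
  obtain ⟨s, hs, hs'⟩ := hU.exists_tail hM.fg hM.one_mem hUM 1
  have h0 : partialSum π (v - ∑ i, fun k => a i * u i k) 1 = π • r := by
    simp [partialSum, hx, Finset.sum_apply]
  have hz' : z - ∑ i, of π Q (a i) * f i = π • (of π Q r + s) := by
    rw [hs', h0, map_smul, smul_add, pow_one]
  refine ⟨a, of π Q r + s, ha, hp _ ?_, ⟨_, fun k => ?_, (hasSeries_of r).add hs⟩, ?_⟩
  · rw [← hz']
    exact sub_mem hz (sum_mem fun i _ => p.mul_mem_left _ (hf i))
  · rw [Pi.add_apply, Pi.sub_apply, Finset.sum_apply]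
    refine add_mem ?_ (sub_mem ?_ (sum_mem fun i _ => ?_))
    · rcases k with _ | k
      · rw [Pi.single_eq_same]
        exact hM.pow_mono (by omega) hr
      · simp
    · exact hM.pow_mono (by rw [mul_add, mul_one, add_assoc]) (hv (k + 1))
    · have := Submodule.mul_mem_mul (ha i) (hu i (k + 1))
      rw [← pow_add] at this
      have h2 := Nat.mul_le_mul_right k (show b ≤ e by omega)
      exact hM.pow_mono (by rw [mul_add, mul_one]; omega) this
  · rw [← hz']
    abel

/-- When the division step is iterated, the constant of the `n`-th remainder is `e * n + d`. So the
quotients found at step `n` grow linearly in `n` and are the digits of elements of the weak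
completion. These are the coefficients of `z`, because the error is divisible by every power of `π`.
-/
lemma exists_division {M : Submodule V Q} (hM : IsGenerating M) {p : Ideal (WeakCompletion π Q)}
    (hp : ∀ z, π • z ∈ p → z ∈ p) {ι : Type*} [Fintype ι] {f : ι → WeakCompletion π Q}
    (hf : ∀ i, f i ∈ p) {u : ι → ℕ → Q} {b c : ℕ} (hu : ∀ i k, u i k ∈ M ^ (b * k + b))
    (huf : ∀ i, HasSeries π (u i) (f i))
    (hc : ∀ k, ∀ x ∈ M ^ k, (∃ y, of π Q x + π • y ∈ p) → ∃ (a : ι → Q) (r : Q),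
      (∀ i, a i ∈ M ^ (k + c)) ∧ r ∈ M ^ (k + c) ∧ x = ∑ i, a i * u i 0 + π • r)
    {z : WeakCompletion π Q} (hz : z ∈ p) : z ∈ Ideal.span (Set.range f) := by
  obtain ⟨d, v, hv, hvz⟩ := exists_digits hM z
  let e := max d (c + 2 * b)
  have hzd : HasGrowth π M e d z := ⟨v, fun k => hM.pow_mono (by
    have := Nat.mul_le_mul_right k (le_max_left d (c + 2 * b))
    exact Nat.add_le_add_right this d) (hv k), hvz⟩
  have step := fun (n : ℕ) (x : {x // x ∈ p ∧ HasGrowth π M e (e * n + d) x}) =>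
    exists_division_step hM hp hf hu huf hc (le_max_right d (c + 2 * b)) x.2.1 x.2.2
  choose a z' ha hz'p hz'g hz' using step
  let Z : ∀ n : ℕ, {x // x ∈ p ∧ HasGrowth π M e (e * n + d) x} := fun n =>
    Nat.rec ⟨z, hz, by simpa using hzd⟩ (fun n x => ⟨z' n x, hz'p n x, by
      have := hz'g n x
      rwa [← add_assoc, add_comm e, show e * n + e = e * (n + 1) by ring] at this⟩) n
  have hZ : ∀ n, (Z n).1 = ∑ i, of π Q (a n (Z n) i) * f i + π • (Z (n + 1)).1 :=
    fun n => hz' n (Z n)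
  have hZN : ∀ N, z = ∑ i, of π Q (partialSum π (fun n => a n (Z n) i) N) * f i +
      π ^ N • (Z N).1 := by
    intro N
    induction N with
    | zero => simp [partialSum, Z]
    | succ N ih =>
      simp only [partialSum_succ, map_add, add_mul, Finset.sum_add_distrib, map_smul,
        smul_mul_assoc, ← Finset.smul_sum]
      rw [add_assoc, pow_succ, mul_smul, ← smul_add, ← hZ N]
      exact ih
  have hA : ∀ i, ∃ y : WeakCompletion π Q, HasSeries π (fun n => a n (Z n) i) y := fun i =>
    exists_hasSeries hM.fg hM.one_mem (a := e) (d := d + c) fun n => by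
      rw [← add_assoc]; exact ha n (Z n) i
  choose A hA using hA
  have hzA : z = ∑ i, A i * f i := by
    rw [← sub_eq_zero]
    refine eq_zero_of_forall_pow fun N => ?_
    have hAN : ∀ i, ∃ t, A i = of π Q (partialSum π (fun n => a n (Z n) i) N) + π ^ N • t := by
      intro i
      obtain ⟨t, -, ht⟩ := (hA i).exists_tail hM.fg hM.one_mem (a := e) (d := d + c) (fun n => by
        rw [← add_assoc]; exact ha n (Z n) i) N
      exact ⟨t, ht⟩
    choose t ht using hAN
    refine ⟨(Z N).1 - ∑ i, t i * f i, ?_⟩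
    rw [smul_sub, Finset.smul_sum]
    conv_lhs => rw [hZN N]
    simp only [ht, add_mul, smul_mul_assoc, Finset.sum_add_distrib]
    abel
  rw [hzA]
  exact sum_mem fun i _ => Ideal.mul_mem_left _ _ (Ideal.subset_span ⟨i, rfl⟩)

/-- The first digits of elements of `p` form an ideal of the Noetherian ring `Q`. Lifts to `p` of
finitely many generators of it generate `p` by the division algorithm. -/
lemma fg_of_saturated [IsNoetherianRing V] {M : Submodule V Q} (hM : IsGenerating M)
    [IsNoetherianRing Q] {p : Ideal (WeakCompletion π Q)} (hp : ∀ z, π • z ∈ p → z ∈ p) : p.FG := by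
  classical
  let I : Ideal Q :=
    { carrier := {q | ∃ y, of π Q q + π • y ∈ p}
      add_mem' := by
        rintro q r ⟨y, hy⟩ ⟨z, hz⟩
        refine ⟨y + z, ?_⟩
        have := add_mem hy hz
        rwa [add_add_add_comm, ← smul_add, ← map_add] at this
      zero_mem' := ⟨0, by simp⟩
      smul_mem' := by
        rintro q r ⟨y, hy⟩
        refine ⟨of π Q q * y, ?_⟩
        have := p.mul_mem_left (of π Q q) hy
        rwa [mul_add, mul_smul_comm, ← map_mul] at this }
  obtain ⟨s, hs⟩ := (isNoetherianRing_iff_ideal_fg Q).1 inferInstance I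
  have hsI : ∀ q : s, ∃ y, of π Q q + π • y ∈ p := fun q =>
    show q.1 ∈ I from hs ▸ Ideal.subset_span q.2
  choose y hy using hsI
  choose c u hu huy using fun q : s => exists_digits hM (of π Q q + π • y q)
  -- The chosen expansion of a lift of `q` need not begin with `q`, since digits are not unique; its
  -- first digit is `q` only modulo `π`. For this reason `π` joins the generators below, as the
  -- index `none`.
  have hu0 : ∀ q : s, ∃ t : Q, q.1 = u q 0 + π • t := by
    intro q
    obtain ⟨t, -, ht⟩ := (huy q).exists_tail hM.fg hM.one_mem (hu q) 1
    have e : of π Q (q.1 - u q 0) = π ^ 1 • (t - y q) := by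
      simp only [partialSum, Finset.sum_range_one, pow_zero, one_smul, pow_one] at ht
      rw [map_sub, pow_one, smul_sub]
      linear_combination (exp := 1) ht
    obtain ⟨t, ht⟩ := exists_of_of_eq e
    exact ⟨t, by rw [pow_one] at ht; rw [← ht]; ring⟩
  choose t ht using hu0
  let b := Finset.univ.sup c
  have hu' : ∀ q k, u q k ∈ M ^ (b * k + b) := fun q k => by
    have : c q ≤ b := Finset.le_sup (Finset.mem_univ q)
    exact hM.pow_mono (add_le_add (Nat.mul_le_mul_right k this) this) (hu q k)
  obtain ⟨d, hd⟩ := hM.exists_bound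
    (fun o : Option s => o.elim (algebraMap V Q π) (fun q => u q 0))
  have hle : I ≤ Ideal.span (Set.range
      fun o : Option s => o.elim (algebraMap V Q π) (fun q => u q 0)) := by
    rw [← hs, Ideal.span_le]
    intro q hq
    rw [SetLike.mem_coe, show q = _ from ht ⟨q, hq⟩, Algebra.smul_def]
    exact add_mem (Ideal.subset_span ⟨some ⟨q, hq⟩, rfl⟩)
      (Ideal.mul_mem_right _ _ (Ideal.subset_span ⟨none, rfl⟩))
  refine ⟨Finset.univ.image fun q : s => of π Q q + π • y q, ?_⟩
  rw [Finset.coe_image, Finset.coe_univ, Set.image_univ]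
  refine le_antisymm (Ideal.span_le.2 ?_) fun z hz =>
    exists_division hM hp hy hu' huy (c := d) (fun k x hx hxp => ?_) hz
  · rintro _ ⟨q, rfl⟩
    exact hy q
  · obtain ⟨a, ha, e⟩ := hd k x hx (hle hxp)
    refine ⟨fun q => a (some q), a none, fun q => ha _, ha _, ?_⟩
    rw [e, Fintype.sum_option, add_comm, Algebra.smul_def, mul_comm (a none)]
    rfl

-- By Cohen's theorem it suffices to treat prime ideals. A prime that contains `π` is generated by
-- `π` and its preimage in `Q`; any other prime is saturated with respect to `π`.
variable (π Q) in
theorem isNoetherianRing [IsNoetherianRing V] [Algebra.FiniteType V Q] :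
    IsNoetherianRing (WeakCompletion π Q) := by
  classical
  have : IsNoetherianRing Q := Algebra.FiniteType.isNoetherianRing V Q
  obtain ⟨M, hM⟩ := exists_isGenerating V Q
  refine IsNoetherianRing.of_prime fun p hp => ?_
  by_cases hπ : algebraMap V (WeakCompletion π Q) π ∈ p
  · obtain ⟨s, hs⟩ := (isNoetherianRing_iff_ideal_fg Q).1 inferInstance (p.comap (of π Q))
    refine ⟨insert (algebraMap V _ π) (s.image (of π Q)), le_antisymm (Ideal.span_le.2 ?_) ?_⟩
    · intro z hz
      rw [Finset.coe_insert, Finset.coe_image, Set.mem_insert_iff] at hz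
      obtain rfl | ⟨q, hq, rfl⟩ := hz
      · exact hπ
      · exact show q ∈ p.comap (of π Q) from hs ▸ Ideal.subset_span hq
    · intro z hz
      obtain ⟨q, z', rfl⟩ := exists_eq_of_add z 1
      rw [pow_one, Algebra.smul_def] at hz ⊢
      refine add_mem ?_ (Ideal.mul_mem_right _ _ (Ideal.subset_span (by simp)))
      have hq : q ∈ p.comap (of π Q) := (Ideal.add_mem_iff_left _ (Ideal.mul_mem_right _ _ hπ)).1 hz
      rw [← hs] at hq
      have := Ideal.mem_map_of_mem (of π Q) hq
      rw [Ideal.map_span] at this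
      exact Ideal.span_mono (by simp) this
  · exact fg_of_saturated hM fun z hz => by
      rw [Algebra.smul_def] at hz
      exact (hp.mem_or_mem hz).resolve_left hπ

variable (π Q) in
lemma algebraMap_mem_jacobson :
    algebraMap V (WeakCompletion π Q) π ∈ (⊥ : Ideal (WeakCompletion π Q)).jacobson := by
  rw [Ideal.mem_jacobson_bot]
  intro y
  have := isUnit_one_add (π := π) y
  rwa [Algebra.smul_def, add_comm] at this

end Noetherian

end WeakCompletion

/-! ### Flatness from flat approximations modulo powers of `π` -/

section Flatness

/-- This is Krull's intersection theorem for the finite module `P ⧸ N`: submodules are closed in the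
`ϖ`-adic topology. -/
lemma mem_of_forall_mem_add_pow_smul {T : Type*} [CommRing T] [IsNoetherianRing T] {ϖ : T}
    (hϖ : ϖ ∈ (⊥ : Ideal T).jacobson) {P : Type*} [AddCommGroup P] [Module T P] [Module.Finite T P]
    {N : Submodule T P} {x : P} (h : ∀ k : ℕ, ∃ n ∈ N, ∃ t, x = n + ϖ ^ k • t) : x ∈ N := by
  have hI : Ideal.span {ϖ} ≤ (⊥ : Ideal T).jacobson := (Ideal.span_singleton_le_iff_mem _).2 hϖ
  have := IsHausdorff.of_le_jacobson (Ideal.span {ϖ}) (P ⧸ N) hI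
  rw [← Submodule.Quotient.mk_eq_zero]
  refine IsHausdorff.haus this _ fun k => ?_
  obtain ⟨n, hn, t, rfl⟩ := h k
  rw [SModEq.zero, Submodule.Quotient.mk_add, (Submodule.Quotient.mk_eq_zero N).2 hn, zero_add,
    Submodule.Quotient.mk_smul]
  exact Submodule.smul_mem_smul (Ideal.pow_mem_pow (Ideal.mem_span_singleton_self _) k) trivial

/-- The ideals `(I : ϖ ^ n)` form an increasing chain, which stabilizes. -/
lemma exists_torsion_bound {S : Type*} [CommRing S] [IsNoetherianRing S] (ϖ : S) (I : Ideal S) :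
    ∃ e : ℕ, ∀ k s, ϖ ^ k * s ∈ I → ϖ ^ e * s ∈ I := by
  let f : ℕ →o Ideal S :=
    { toFun := fun n =>
        { carrier := {s | ϖ ^ n * s ∈ I}
          add_mem' := fun {a b} ha hb => by
            change _ * (a + b) ∈ I
            rw [mul_add]; exact add_mem ha hb
          zero_mem' := by simp
          smul_mem' := fun c s hs => by
            change _ * (c * s) ∈ I
            rw [mul_left_comm]; exact I.mul_mem_left _ hs }
      monotone' := fun m n hmn s (hs : ϖ ^ m * s ∈ I) => by
        change ϖ ^ n * s ∈ I
        obtain ⟨d, rfl⟩ := Nat.exists_eq_add_of_le hmn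
        rw [pow_add, mul_right_comm]
        exact I.mul_mem_right _ hs }
  obtain ⟨e, he⟩ := monotone_stabilizes_iff_noetherian.2 ‹IsNoetherianRing S› f
  refine ⟨e, fun k s hs => ?_⟩
  have h : s ∈ f (max e k) := f.monotone (le_max_right e k) hs
  rwa [← he _ (le_max_left e k)] at h

lemma exists_trivial_of_flat {A B : Type*} [CommRing A] [CommRing B] {f : A →+* B} (hf : f.Flat)
    {ι : Type*} [Fintype ι] {a : ι → A} {b : ι → B} (h : ∑ i, f (a i) * b i = 0) :
    ∃ (k : ℕ) (c : ι → Fin k → A) (y : Fin k → B), (∀ i, b i = ∑ j, f (c i j) * y j) ∧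
      ∀ j, ∑ i, a i * c i j = 0 := by
  algebraize [f]
  exact Module.Flat.isTrivialRelation_of_sum_smul_eq_zero (R := A) h

lemma flat_of_exists_trivial {A B : Type*} [CommRing A] [CommRing B] {f : A →+* B}
    (h : ∀ (l : ℕ) (a : Fin l → A) (b : Fin l → B), ∑ i, f (a i) * b i = 0 →
      ∃ (k : ℕ) (c : Fin l → Fin k → A) (y : Fin k → B), (∀ i, b i = ∑ j, f (c i j) * y j) ∧
      ∀ j, ∑ i, a i * c i j = 0) : f.Flat := by
  algebraize [f]
  exact Module.Flat.of_forall_isTrivialRelation fun {l F x} hFx => h l F x hFx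

variable {V : Type*} [CommRing V] (π : V) {A B S T : Type*} [CommRing A] [CommRing B] [CommRing S]
  [CommRing T] [Algebra V A] [Algebra V B] [Algebra V S] [Algebra V T]

/-- A local criterion for flatness over Noetherian rings: if `S → T` is approximated modulo the
powers of `π` by a flat map `A → B`, then it is flat. -/
theorem flat_of_flat_approximation [IsNoetherianRing S] [IsNoetherianRing T]
    (hπ : algebraMap V T π ∈ (⊥ : Ideal T).jacobson)
    (f : A →ₐ[V] B) (hf : f.toRingHom.Flat) (α : A →ₐ[V] S) (β : B →ₐ[V] T) (g : S →ₐ[V] T)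
    (hg : ∀ a, g (α a) = β (f a))
    (hS : ∀ (s : S) (k : ℕ), ∃ a s', s = α a + π ^ k • s')
    (hT : ∀ (t : T) (k : ℕ), ∃ b t', t = β b + π ^ k • t')
    (hB : ∀ (b : B) (k : ℕ) (t : T), β b = π ^ k • t → ∃ b', b = π ^ k • b') :
    g.toRingHom.Flat := by
  refine flat_of_exists_trivial fun l F x hFx => ?_
  -- By the equational criterion, the relation `x` over `T` must be a `T`-combination of relations
  -- over `S` among the `F i`. The span `N'` of these is closed, so approximation of `x` by `N'`
  -- modulo each `π ^ k` suffices.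
  let N : Submodule S (Fin l → S) := LinearMap.ker (Fintype.linearCombination S F)
  have memN : ∀ n : Fin l → S, n ∈ N ↔ ∑ i, F i * n i = 0 := fun n => by
    rw [LinearMap.mem_ker, Fintype.linearCombination_apply]
    simp [mul_comm]
  let N' : Submodule T (Fin l → T) := Submodule.span T ((fun (n : Fin l → S) i => g (n i)) '' N)
  suffices hx : x ∈ N' by
    obtain ⟨k, t, n, hn⟩ := Submodule.mem_span_set'.1 hx
    choose m hm hmn using fun j => (n j).2
    refine ⟨k, fun i j => m j i, t, fun i => ?_, fun j => (memN _).1 (hm j)⟩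
    rw [← hn, Finset.sum_apply]
    refine Finset.sum_congr rfl fun j _ => ?_
    rw [Pi.smul_apply, ← hmn j, smul_eq_mul, mul_comm]
    rfl
  -- The torsion of `S ⧸ (F)` is killed by `π ^ e`. This is the precision that is lost below, so
  -- everything is approximated modulo `π ^ (k + e)`.
  obtain ⟨e, he⟩ := exists_torsion_bound (algebraMap V S π) (Ideal.span (Set.range F))
  refine mem_of_forall_mem_add_pow_smul hπ fun k => ?_
  choose a s' hs' using fun i => hS (F i) (k + e)
  choose b t' ht' using fun i => hT (x i) (k + e)
  have h1 : β (∑ i, f (a i) * b i) =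
      π ^ (k + e) • -(∑ i, (g (s' i) * x i + g (α (a i)) * t' i)) := by
    rw [smul_neg, eq_neg_iff_add_eq_zero, ← hFx, map_sum, Finset.smul_sum, ← Finset.sum_add_distrib]
    refine Finset.sum_congr rfl fun i _ => ?_
    change _ = g (F i) * x i
    conv_rhs => rw [hs' i]
    rw [map_add, map_smul, map_mul, ← hg, smul_add, add_mul, smul_mul_assoc]
    conv_rhs => rw [show g (α (a i)) * x i = g (α (a i)) * (β (b i) + π ^ (k + e) • t' i) by
      rw [← ht' i], mul_add, mul_smul_comm]
    abel
  obtain ⟨b', hb'⟩ := hB _ _ _ h1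
  -- The relation over `B` holds only modulo `π ^ (k + e)`. It becomes exact with one more unknown
  -- `b'`, whose coefficient is `-π ^ (k + e)`; flatness of `f` then resolves it by relations over
  -- `A`.
  have h2 : ∑ o : Option (Fin l), f.toRingHom (o.elim (-algebraMap V A π ^ (k + e)) a) *
      (o.elim b' b : B) = 0 := by
    rw [Fintype.sum_option]
    change f (-algebraMap V A π ^ (k + e)) * b' + ∑ i, f (a i) * b i = 0
    rw [hb', map_neg, map_pow, f.commutes, Algebra.smul_def, map_pow]
    ring
  obtain ⟨m, c, y, hc, hc'⟩ := exists_trivial_of_flat hf h2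
  -- The resolving relations over `A` hold for `F` only up to `π ^ (k + e)` times an element. That
  -- multiple lies in the ideal `(F)`, so the torsion bound puts already `π ^ e` times the element
  -- there. Subtracting `π ^ k * r` turns the relations into exact ones.
  have h3 : ∀ j, ∃ r : Fin l → S, algebraMap V S π ^ e * (α (c none j) +
      ∑ i, s' i * α (c (some i) j)) = ∑ i, F i * r i := by
    intro j
    have h : algebraMap V S π ^ (k + e) * (α (c none j) + ∑ i, s' i * α (c (some i) j)) =
        ∑ i, F i * α (c (some i) j) := by
      have h := congrArg α (hc' j)
      rw [Fintype.sum_option, map_add, map_sum, map_zero] at h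
      simp only [Option.elim_none, Option.elim_some, map_mul, map_neg, map_pow,
        AlgHom.commutes] at h
      have h' : ∑ i, F i * α (c (some i) j) = ∑ i, α (a i) * α (c (some i) j) +
          algebraMap V S π ^ (k + e) * ∑ i, s' i * α (c (some i) j) := by
        rw [Finset.mul_sum, ← Finset.sum_add_distrib]
        refine Finset.sum_congr rfl fun i _ => ?_
        rw [hs' i, Algebra.smul_def, map_pow]
        ring
      rw [h']
      linear_combination -h
    have h' := he (k + e) _ (by
      rw [h]
      exact sum_mem fun i _ => Ideal.mul_mem_right _ _ (Ideal.subset_span ⟨i, rfl⟩))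
    obtain ⟨r, hr⟩ := (Submodule.mem_span_range_iff_exists_fun S).1 h'
    exact ⟨r, by rw [← hr]; simp [mul_comm]⟩
  choose r hr using h3
  refine ⟨∑ j, β (y j) • fun i => g (α (c (some i) j) - algebraMap V S π ^ k * r j i),
    sum_mem fun j _ => Submodule.smul_mem _ _ (Submodule.subset_span
      ⟨fun i => α (c (some i) j) - algebraMap V S π ^ k * r j i, (memN _).2 ?_, rfl⟩),
    fun i => algebraMap V T π ^ e * t' i + ∑ j, β (y j) * g (r j i), ?_⟩
  · have h := congrArg α (hc' j)
    rw [Fintype.sum_option, map_add, map_sum, map_zero] at h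
    simp only [Option.elim_none, Option.elim_some, map_mul, map_neg, map_pow,
      AlgHom.commutes] at h
    simp only [mul_sub, Finset.sum_sub_distrib]
    have e1 : ∑ i, F i * (algebraMap V S π ^ k * r j i) = algebraMap V S π ^ k * ∑ i, F i * r j i := by
      rw [Finset.mul_sum]
      exact Finset.sum_congr rfl fun i _ => by ring
    have h' : ∑ i, F i * α (c (some i) j) = ∑ i, α (a i) * α (c (some i) j) +
        algebraMap V S π ^ (k + e) * ∑ i, s' i * α (c (some i) j) := by
      rw [Finset.mul_sum, ← Finset.sum_add_distrib]
      refine Finset.sum_congr rfl fun i _ => ?_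
      rw [hs' i, Algebra.smul_def, map_pow]
      ring
    rw [e1, ← hr j, h', pow_add]
    rw [pow_add] at h
    linear_combination h
  · funext i
    have hbi : b i = ∑ j, f (c (some i) j) * y j := hc (some i)
    rw [Pi.add_apply, Finset.sum_apply, Pi.smul_apply]
    simp only [Pi.smul_apply, smul_eq_mul, map_sub, map_mul, map_pow, AlgHom.commutes]
    rw [ht' i, hbi, map_sum, Algebra.smul_def, map_pow, mul_add, Finset.mul_sum, pow_add, ← add_assoc,
      add_right_comm, ← Finset.sum_add_distrib, mul_assoc]
    congr 1
    refine Finset.sum_congr rfl fun j _ => ?_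
    rw [map_mul, ← hg]
    ring

end Flatness

/-! ### Flat maps and kernels under weak completion -/

namespace WeakCompletion

variable {V : Type*} [CommRing V] (π : V) {A B : Type*} [CommRing A]
  [CommRing B] [Algebra V A] [Algebra V B]

lemma map_of' (f : A →ₐ[V] B) (x : A) : map π f (of π A x) = of π B (f x) :=
  eval_ext fun n => (adicEval_adicMap π f n _).trans rfl

lemma HasSeries.map {f : A →ₐ[V] B} {u : ℕ → A} {z : WeakCompletion π A} (h : HasSeries π u z) :
    HasSeries π (fun k => f (u k)) (map π f z) := fun n => by
  refine (adicEval_adicMap π f n _).trans ((congrArg _ (h n)).trans ?_)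
  change Ideal.Quotient.mk _ (f _) = _
  simp [partialSum]

lemma map_id (z : WeakCompletion π A) : map π (AlgHom.id V A) z = z := by
  obtain ⟨M, c, u, hM, h1, hu, hz⟩ := exists_series z
  exact (hz.map π).unique hz

lemma map_map {C : Type*} [CommRing C] [Algebra V C] (g : B →ₐ[V] C) (f : A →ₐ[V] B)
    (z : WeakCompletion π A) : map π g (map π f z) = map π (g.comp f) z := by
  obtain ⟨M, c, u, hM, h1, hu, hz⟩ := exists_series z
  exact ((hz.map π).map π).unique (hz.map π)

variable [IsNoetherianRing V]

/-- Modulo each power of `π` the completed map is the reduction of `f`, so the flatness criterion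
applies with the canonical maps as approximations. -/
theorem flat_map [Algebra.FiniteType V A] [Algebra.FiniteType V B] (f : A →ₐ[V] B)
    (hf : f.toRingHom.Flat) : (map π f).toRingHom.Flat := by
  have := isNoetherianRing π A
  have := isNoetherianRing π B
  exact flat_of_flat_approximation π (algebraMap_mem_jacobson π B) f hf (of π A) (of π B) (map π f)
    (map_of' π f) exists_eq_of_add exists_eq_of_add (fun _ _ _ h => exists_of_of_eq h)

variable (A) in
theorem flat_of [Algebra.FiniteType V A] : (of π A).toRingHom.Flat := by
  have := isNoetherianRing π A
  have : IsNoetherianRing A := Algebra.FiniteType.isNoetherianRing V A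
  exact flat_of_flat_approximation π (algebraMap_mem_jacobson π A) (AlgHom.id V A)
    (RingHom.Flat.id A) (AlgHom.id V A) (of π A) (of π A) (fun _ => rfl)
    (fun s k => ⟨s, 0, by simp⟩) exists_eq_of_add (fun _ _ _ h => exists_of_of_eq h)

/-- The kernel of the map of weak completions induced by a surjective map is generated by the kernel
of the latter. -/
theorem ker_map [Algebra.FiniteType V A] (f : A →ₐ[V] B) (hf : Function.Surjective f) :
    RingHom.ker (map π f) = (RingHom.ker f).map (of π A) := by
  have := isNoetherianRing π A
  refine le_antisymm (fun z hz => ?_) ?_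
  -- Since extended ideals are closed, it is enough to work modulo `π ^ k`. If `q + π ^ k z'` is in
  -- the kernel, then `f q` is divisible by `π ^ k`; a lift of the quotient through `f` corrects `q`
  -- to an element of `ker f`.
  · refine mem_of_forall_mem_add_pow_smul (algebraMap_mem_jacobson π A) fun k => ?_
    obtain ⟨q, z', rfl⟩ := exists_eq_of_add z k
    rw [RingHom.mem_ker, map_add, map_of', map_smul, add_eq_zero_iff_eq_neg, ← smul_neg] at hz
    obtain ⟨y, hy⟩ := exists_of_of_eq hz
    obtain ⟨x, rfl⟩ := hf y
    rw [← map_smul] at hy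
    refine ⟨of π A (q - π ^ k • x), Ideal.mem_map_of_mem _ ?_, of π A x + z', ?_⟩
    · rw [RingHom.mem_ker, map_sub, hy, sub_self]
    · rw [map_sub, map_smul, ← map_pow, algebraMap_smul, smul_add]
      abel
  · rw [Ideal.map_le_iff_le_comap]
    intro a ha
    rw [Ideal.mem_comap, RingHom.mem_ker, map_of', (RingHom.mem_ker).1 ha, map_zero]

end WeakCompletion

open ConvexBornology AlgBornology

/-! ### The bornology on `Q` that completes to `Q†` -/

section DaggerBornology

variable {V : Type*} [CommRing V] (π : V) {Q : Type*} [CommRing Q] [Algebra V Q]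

/-- The submodule `∑ π ^ j M ^ (c (j + 1))`. -/
def daggerBall (M : Submodule V Q) (c : ℕ) : Submodule V Q := ⨆ j : ℕ, π ^ j • M ^ (c * (j + 1))

variable {π}

lemma pow_smul_mem_daggerBall {M : Submodule V Q} {c j : ℕ} {x : Q} (hx : x ∈ M ^ (c * (j + 1))) :
    π ^ j • x ∈ daggerBall π M c :=
  Submodule.mem_iSup_of_mem j (Submodule.smul_mem_pointwise_smul _ _ _ hx)

lemma daggerBall_le {M : Submodule V Q} {c : ℕ} {N : Submodule V Q}
    (h : ∀ j, ∀ x ∈ M ^ (c * (j + 1)), π ^ j • x ∈ N) : daggerBall π M c ≤ N := by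
  refine iSup_le fun j x hx => ?_
  obtain ⟨m, hm, rfl⟩ := (Submodule.mem_smul_pointwise_iff_exists _ _ _).1 hx
  exact h j m hm

lemma daggerBall_mono {M N : Submodule V Q} (h : M ≤ N) (h1 : (1 : Q) ∈ N) {c d : ℕ}
    (hcd : c ≤ d) : daggerBall π M c ≤ daggerBall π N d :=
  daggerBall_le fun _ _ hx =>
    pow_smul_mem_daggerBall (pow_mono_of_one_mem h h1 (Nat.mul_le_mul_right _ hcd) hx)

lemma daggerBall_mul_le {M N : Submodule V Q} (hM : (1 : Q) ∈ M) (c d : ℕ) :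
    daggerBall π M c * daggerBall π N d ≤ daggerBall π (M ⊔ N) (c + d) := by
  have h1 : (1 : Q) ∈ M ⊔ N := Submodule.mem_sup_left hM
  rw [daggerBall, Submodule.iSup_mul]
  refine iSup_le fun i => ?_
  rw [daggerBall, Submodule.mul_iSup]
  refine iSup_le fun j => Submodule.mul_le.2 fun x hx y hy => ?_
  obtain ⟨m, hm, rfl⟩ := (Submodule.mem_smul_pointwise_iff_exists _ _ _).1 hx
  obtain ⟨n, hn, rfl⟩ := (Submodule.mem_smul_pointwise_iff_exists _ _ _).1 hy
  rw [smul_mul_smul_comm, ← pow_add]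
  refine pow_smul_mem_daggerBall ?_
  rw [add_mul, pow_add]
  exact Submodule.mul_mem_mul
    (pow_mono_of_one_mem le_sup_left h1 (Nat.mul_le_mul_left _ (by omega)) hm)
    (pow_mono_of_one_mem le_sup_right h1 (Nat.mul_le_mul_left _ (by omega)) hn)

lemma map_daggerBall_le {S : Type*} [CommRing S] [Algebra V S] (f : Q →ₐ[V] S) (M : Submodule V Q)
    (c : ℕ) : (daggerBall π M c).map f.toLinearMap ≤ daggerBall π (M.map f.toLinearMap) c := by
  rw [Submodule.map_le_iff_le_comap]
  refine daggerBall_le fun j x hx => ?_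
  rw [Submodule.mem_comap, map_smul]
  refine pow_smul_mem_daggerBall ?_
  rw [← Submodule.map_pow]
  exact Submodule.mem_map_of_mem hx

/-- Elements of the supremum are finite sums, hence terminating series with controlled digits. This
lets estimates for series be applied to them. -/
lemma exists_partialSum_of_mem_daggerBall {M : Submodule V Q} {c : ℕ} {x : Q}
    (hx : x ∈ daggerBall π M c) : ∃ (v : ℕ → Q) (L : ℕ), (∀ j, v j ∈ M ^ (c * (j + 1))) ∧
      ∀ n ≥ L, partialSum π v n = x := by
  induction hx using Submodule.iSup_induction' with
  | mem j x hx =>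
    obtain ⟨m, hm, rfl⟩ := (Submodule.mem_smul_pointwise_iff_exists _ _ _).1 hx
    refine ⟨Pi.single j m, j + 1, fun i => ?_, fun n hn => ?_⟩
    · by_cases h : i = j
      · subst h; rwa [Pi.single_eq_same]
      · rw [Pi.single_eq_of_ne h]; exact zero_mem _
    · rw [partialSum, Finset.sum_eq_single j]
      · simp
      · intro i _ hi; simp [hi]
      · intro h; exact absurd (Finset.mem_range.2 (by omega)) h
  | zero => exact ⟨0, 0, fun j => zero_mem _, fun n _ => by simp [partialSum]⟩
  | add x y _ _ hx hy =>
    obtain ⟨v, L, hv, hvx⟩ := hx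
    obtain ⟨w, L', hw, hwy⟩ := hy
    refine ⟨v + w, max L L', fun j => add_mem (hv j) (hw j), fun n hn => ?_⟩
    rw [← hvx n (le_of_max_le_left hn), ← hwy n (le_of_max_le_right hn)]
    simp [partialSum, Finset.sum_add_distrib]

lemma partialSum_mem_daggerBall {M : Submodule V Q} {c : ℕ} {v : ℕ → Q}
    (hv : ∀ j, v j ∈ M ^ (c * (j + 1))) (n : ℕ) : partialSum π v n ∈ daggerBall π M c :=
  sum_mem fun j _ => pow_smul_mem_daggerBall (hv j)

/-- For an exponent of at least `2 * k`, half of it remains after `π ^ k` is split off. So doubling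
`c` compensates for the lost factor. -/
lemma partialSum_sub_mem {M : Submodule V Q} (h1 : (1 : Q) ∈ M) {c : ℕ} {v : ℕ → Q}
    (hv : ∀ j, v j ∈ M ^ (c * (j + 1))) {k m n : ℕ} (hm : 2 * k ≤ m) (hmn : m ≤ n) :
    partialSum π v n - partialSum π v m ∈ π ^ k • daggerBall π M (2 * c) := by
  obtain ⟨d, rfl⟩ := Nat.exists_eq_add_of_le hmn
  rw [WeakCompletion.partialSum_add, add_sub_cancel_left, partialSum, Finset.smul_sum]
  refine sum_mem fun j _ => ?_
  rw [smul_smul, ← pow_add, show m + j = k + (m + j - k) by omega, pow_add, mul_smul]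
  refine Submodule.smul_mem_pointwise_smul _ _ _ (pow_smul_mem_daggerBall ?_)
  refine pow_mono_of_one_mem le_rfl h1 ?_ (hv (j + m))
  rw [mul_comm 2, mul_assoc]
  exact Nat.mul_le_mul_left _ (by omega)

/-- Elements of `daggerBall π M c` that are divisible by a power of `π` remain controlled after
division by half of that power. -/
lemma IsGenerating.exists_daggerBall_strict [IsNoetherianRing V] {M : Submodule V Q}
    (h : IsGenerating M) (htf : ∀ x : Q, π • x = 0 → x = 0) (c : ℕ) :
    ∃ c', ∀ k, ∀ x ∈ daggerBall π M c, (∃ y, x = π ^ (2 * k) • y) →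
      x ∈ π ^ k • daggerBall π M c' := by
  obtain ⟨e, he⟩ := h.exists_saturation htf
  -- The terms from `2 * k` on contribute the constant `2 * c`. The sum of the first `2 * k` terms
  -- has degree `2 * c * k` and is `π ^ (2 * k) • t`; by saturation `t` has degree `2 * c * k + 2 *
  -- e * k`, and `π ^ k • t` lies in the ball with constant `2 * c + 2 * e`.
  refine ⟨2 * c + 2 * e, fun k x hx => ?_⟩
  rintro ⟨y, hy⟩
  obtain ⟨v, L, hv, hvx⟩ := exists_partialSum_of_mem_daggerBall hx
  have h1 := partialSum_sub_mem (π := π) h.one_mem hv (le_refl (2 * k)) (Nat.le_add_right _ L)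
  rw [hvx _ (Nat.le_add_left _ _)] at h1
  obtain ⟨t, ht⟩ : ∃ t, partialSum π v (2 * k) = π ^ (2 * k) • t := by
    have h2 := WeakCompletion.partialSum_add (π := π) v (2 * k) L
    rw [hvx _ (Nat.le_add_left _ _), hy] at h2
    exact ⟨_, by rw [smul_sub]; exact eq_sub_of_add_eq h2.symm⟩
  have h3 : partialSum π v (2 * k) ∈ M ^ (c * (2 * k)) := by
    refine sum_mem fun j hj => Submodule.smul_mem _ _ (h.pow_mono ?_ (hv j))
    exact Nat.mul_le_mul_left _ (Finset.mem_range.1 hj)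
  rw [ht] at h3
  have h4 := he _ _ _ h3
  have h5 : π ^ (2 * k) • t ∈ π ^ k • daggerBall π M (2 * c + 2 * e) := by
    rw [two_mul k, pow_add, mul_smul]
    refine Submodule.smul_mem_pointwise_smul _ _ _ (pow_smul_mem_daggerBall (h.pow_mono ?_ h4))
    ring_nf
    omega
  have h6 := ConvexBornology.pow_smul_mono π
    (daggerBall_mono (π := π) le_rfl h.one_mem (Nat.le_add_right (2 * c) (2 * e))) k h1
  have := add_mem h6 h5
  rwa [ht, sub_add_cancel] at this

variable (π Q) in
/-- The bornology on `Q` whose completion is the weak completion. -/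
def dagger : AlgBornology V Q :=
  .ofSubmodules {N | ∃ M : Submodule V Q, M.FG ∧ (1 : Q) ∈ M ∧ ∃ c, N = daggerBall π M c}
    (fun x => ⟨_, ⟨Submodule.span V {1, x}, Submodule.fg_span (by simp),
      Submodule.subset_span (by simp), 1, rfl⟩, by
        have := pow_smul_mem_daggerBall (π := π) (M := Submodule.span V {1, x}) (c := 1) (j := 0)
          (x := x) (by simpa using Submodule.subset_span (by simp))
        simpa using this⟩)
    (by
      rintro _ ⟨M, hM, hM1, c, rfl⟩ _ ⟨N, hN, -, d, rfl⟩
      have h1 : (1 : Q) ∈ M ⊔ N := Submodule.mem_sup_left hM1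
      exact ⟨_, ⟨M ⊔ N, hM.sup hN, h1, max c d, rfl⟩,
        daggerBall_mono le_sup_left h1 (le_max_left _ _),
        daggerBall_mono le_sup_right h1 (le_max_right _ _)⟩)
    (by
      rintro _ ⟨M, hM, hM1, c, rfl⟩ _ ⟨N, hN, -, d, rfl⟩
      exact ⟨_, ⟨M ⊔ N, hM.sup hN, Submodule.mem_sup_left hM1, c + d, rfl⟩,
        daggerBall_mul_le hM1 c d⟩)

lemma bdd_daggerBall {M : Submodule V Q} (hM : M.FG) (h1 : (1 : Q) ∈ M) (c : ℕ) :
    (dagger π Q).Bdd (daggerBall π M c) :=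
  (bdd_ofSubmodules' _).2 ⟨_, ⟨M, hM, h1, c, rfl⟩, subset_rfl⟩

lemma IsGenerating.exists_le_daggerBall {M : Submodule V Q} (h : IsGenerating M) {S : Set Q}
    (hS : (dagger π Q).Bdd S) : ∃ c, S ⊆ daggerBall π M c := by
  obtain ⟨_, ⟨N, hN, -, c, rfl⟩, hS⟩ := (bdd_ofSubmodules' _).1 hS
  obtain ⟨k, hk⟩ := h.exists_pow hN
  refine ⟨k * c, hS.trans (daggerBall_le fun j x hx => pow_smul_mem_daggerBall ?_)⟩
  have := pow_le_pow_left' hk (c * (j + 1)) hx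
  rwa [← pow_mul, ← mul_assoc] at this

lemma bounded_dagger {S : Type*} [CommRing S] [Algebra V S] (f : Q →ₐ[V] S) :
    BoundedMap (dagger π Q).toConvexBornology (dagger π S).toConvexBornology f := by
  intro T hT
  obtain ⟨_, ⟨N, hN, h1, c, rfl⟩, hT⟩ := (bdd_ofSubmodules' _).1 hT
  refine (bdd_ofSubmodules' _).2 ⟨_, ⟨N.map f.toLinearMap, hN.map _, ⟨1, h1, map_one f⟩, c, rfl⟩, ?_⟩
  rintro _ ⟨x, hx, rfl⟩
  exact map_daggerBall_le f N c ⟨x, hT hx, rfl⟩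

/-- A bounded sequence is a Cauchy sequence for the bornology `dagger π Q` once it is a
Cauchy sequence for the `π`-adic topology. -/
lemma IsGenerating.exists_isCauchyIn [IsNoetherianRing V] {M : Submodule V Q}
    (h : IsGenerating M) (htf : ∀ x : Q, π • x = 0 → x = 0) (c : ℕ) :
    ∃ c', ∀ x : ℕ → Q, (∀ n, x n ∈ daggerBall π M c) →
      (∀ k, ∃ N, ∀ n ≥ N, ∀ m ≥ N, ∃ y, x n - x m = π ^ k • y) →
      IsCauchyIn π (daggerBall π M c') x := by
  obtain ⟨d, hd⟩ := h.exists_daggerBall_strict htf c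
  refine ⟨max c d, fun x hx hxk =>
    ⟨fun n => daggerBall_mono le_rfl h.one_mem (le_max_left c d) (hx n), fun k => ?_⟩⟩
  obtain ⟨N, hN⟩ := hxk (2 * k)
  exact ⟨N, fun n hn m hm => ConvexBornology.pow_smul_mono π
    (daggerBall_mono le_rfl h.one_mem (le_max_right c d)) k
    (hd k _ (sub_mem (hx n) (hx m)) (hN n hn m hm))⟩

lemma IsGenerating.converges_zero [IsNoetherianRing V] {M : Submodule V Q}
    (h : IsGenerating M) (htf : ∀ x : Q, π • x = 0 → x = 0) {c : ℕ} {x : ℕ → Q}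
    (hx : ∀ n, x n ∈ daggerBall π M c)
    (hxk : ∀ k, ∃ N, ∀ n ≥ N, ∃ y, x n = π ^ k • y) : (dagger π Q).Converges π x 0 := by
  obtain ⟨d, hd⟩ := h.exists_daggerBall_strict htf c
  refine ⟨_, bdd_daggerBall h.fg h.one_mem d, fun k => ?_⟩
  obtain ⟨N, hN⟩ := hxk (2 * k)
  exact ⟨N, fun n hn => by rw [sub_zero]; exact hd k _ (hx n) (hN n hn)⟩

end DaggerBornology

/-! ### Limits of Cauchy sequences in the weak completion -/

namespace WeakCompletion

section Limits

variable {V : Type*} [CommRing V] {π : V} {Q : Type*} [CommRing Q] [Algebra V Q]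

variable (π) in
/-- The sequence `x` converges to `z` in the `π`-adic topology. -/
def IsLimit (x : ℕ → Q) (z : WeakCompletion π Q) : Prop :=
  ∀ k, ∃ N, ∀ n ≥ N, eval π Q k z = Ideal.Quotient.mk _ (x n)

lemma HasSeries.isLimit {u : ℕ → Q} {z : WeakCompletion π Q} (h : HasSeries π u z) :
    IsLimit π (partialSum π u) z := fun k => ⟨k, fun n hn => by
  rw [h.eval, Ideal.Quotient.eq]
  obtain ⟨d, rfl⟩ := Nat.exists_eq_add_of_le hn
  rw [partialSum_add, sub_add_cancel_left]
  exact neg_mem (pow_smul_mem_adicIdeal π le_rfl _)⟩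

lemma IsLimit.add {x y : ℕ → Q} {z w : WeakCompletion π Q} (hx : IsLimit π x z)
    (hy : IsLimit π y w) : IsLimit π (x + y) (z + w) := fun k => by
  obtain ⟨N, hN⟩ := hx k
  obtain ⟨L, hL⟩ := hy k
  exact ⟨max N L, fun n hn => by
    rw [map_add, hN n (le_of_max_le_left hn), hL n (le_of_max_le_right hn), ← map_add]; rfl⟩

lemma IsLimit.mul {x y : ℕ → Q} {z w : WeakCompletion π Q} (hx : IsLimit π x z)
    (hy : IsLimit π y w) : IsLimit π (x * y) (z * w) := fun k => by
  obtain ⟨N, hN⟩ := hx k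
  obtain ⟨L, hL⟩ := hy k
  exact ⟨max N L, fun n hn => by
    rw [map_mul, hN n (le_of_max_le_left hn), hL n (le_of_max_le_right hn), ← map_mul]; rfl⟩

lemma isLimit_const (q : Q) : IsLimit π (fun _ => q) (of π Q q) :=
  fun k => ⟨0, fun _ _ => eval_of k q⟩

lemma IsLimit.exists_sub {x y : ℕ → Q} {z : WeakCompletion π Q} (hx : IsLimit π x z)
    (hy : IsLimit π y z) (k : ℕ) : ∃ N, ∀ n ≥ N, ∃ t, x n - y n = π ^ k • t := by
  obtain ⟨N, hN⟩ := hx k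
  obtain ⟨L, hL⟩ := hy k
  refine ⟨max N L, fun n hn => ?_⟩
  have h := (hN n (le_of_max_le_left hn)).symm.trans (hL n (le_of_max_le_right hn))
  exact mem_adicIdeal_pow.1 (Ideal.Quotient.eq.1 h)

lemma IsLimit.map {B : Type*} [CommRing B] [Algebra V B] {f : Q →ₐ[V] B} {x : ℕ → Q}
    {z : WeakCompletion π Q} (h : IsLimit π x z) :
    IsLimit π (fun n => f (x n)) (WeakCompletion.map π f z) := fun k => by
  obtain ⟨N, hN⟩ := h k
  exact ⟨N, fun n hn => (adicEval_adicMap π f k _).trans (congrArg _ (hN n hn))⟩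

lemma IsLimit.eq_zero {x : ℕ → Q} {z : WeakCompletion π Q} (h : IsLimit π x z)
    (h0 : ∀ k, ∃ N, ∀ n ≥ N, ∃ t, x n = π ^ k • t) : z = 0 := by
  refine eval_ext fun k => ?_
  obtain ⟨N, hN⟩ := h k
  obtain ⟨L, hL⟩ := h0 k
  rw [hN _ (le_max_left N L), map_zero, Ideal.Quotient.eq_zero_iff_mem, mem_adicIdeal_pow]
  exact hL _ (le_max_right N L)

/-- A sequence that is Cauchy in `daggerBall π M c` has a limit in the weak completion. -/
lemma exists_isLimit {M : Submodule V Q} (hM : M.FG) (h1 : (1 : Q) ∈ M) {c : ℕ} {x : ℕ → Q}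
    (hx : IsCauchyIn π (daggerBall π M c) x) :
    ∃ z : WeakCompletion π Q, val π Q z ∈ weakBall π M c ∧ IsLimit π x z := by
  choose N hN using hx.2
  -- A modulus of convergence that is monotone in `k`.
  let N' : ℕ → ℕ := fun k => (Finset.range (k + 1)).sup N
  have hN' : ∀ j k, j ≤ k → N j ≤ N' k := fun j k hjk =>
    Finset.le_sup (f := N) (Finset.mem_range.2 (by omega))
  have hd : ∀ k, ∃ d ∈ daggerBall π M c, π ^ k • d = x (N' (k + 1)) - x (N' k) := fun k =>
    (Submodule.mem_smul_pointwise_iff_exists _ _ _).1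
      (hN k _ (hN' _ _ (Nat.le_succ k)) _ (hN' _ _ le_rfl))
  choose d hd hdx using hd
  choose v L hv hvL using fun k => exists_partialSum_of_mem_daggerBall (hd k)
  obtain ⟨w, L', hw, hwL⟩ := exists_partialSum_of_mem_daggerBall (hx.1 (N' 0))
  -- The limit is `x (N' 0)` plus the sum of all `π ^ k • d k`. Collecting the `i`-th digit of `d k`
  -- at the exponent `k + i` gives digits `U m` of degree at most `c * (m + 1)`, so the constant `c`
  -- does not grow.
  let U : ℕ → Q := fun m => ∑ k ∈ Finset.range (m + 1), v k (m - k)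
  have hU : ∀ j, (w + U) j ∈ M ^ (c * (j + 1)) := fun j => add_mem (hw j) (sum_mem fun k _ =>
    pow_mono_of_one_mem le_rfl h1 (Nat.mul_le_mul_left _ (by omega)) (hv k (j - k)))
  obtain ⟨z, hz⟩ := exists_hasSeries (π := π) hM h1 (a := c) (d := c) (u := w + U) (fun k => by
    have := hU k; rwa [mul_add, mul_one] at this)
  have hsum : ∀ n, x (N' n) = x (N' 0) + ∑ k ∈ Finset.range n, π ^ k • d k := by
    intro n
    induction n with
    | zero => simp
    | succ n ih => rw [Finset.sum_range_succ, ← add_assoc, ← ih, hdx]; abel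
  have htail : ∀ (v : ℕ → Q) (y : Q) (L : ℕ), (∀ n ≥ L, partialSum π v n = y) → ∀ m,
      ∃ t, y - partialSum π v m = π ^ m • t := by
    intro v y L h m
    rw [← h (m + L) (Nat.le_add_left _ _), partialSum_add, add_sub_cancel_left]
    exact ⟨_, rfl⟩
  refine ⟨z, ⟨_, hU, hz⟩, fun k => ⟨N' k, fun n hn => ?_⟩⟩
  have hUk : partialSum π U k = ∑ j ∈ Finset.range k, π ^ j • partialSum π (v j) (k - j) := by
    have := Finset.sum_range_diag_flip k (fun j i => π ^ (j + i) • v j i)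
    simp only [partialSum, Finset.smul_sum, smul_smul, ← pow_add, U]
    rw [← this]
    refine Finset.sum_congr rfl fun m _ => Finset.sum_congr rfl fun j hj => ?_
    rw [Finset.mem_range] at hj
    rw [show j + (m - j) = m by omega]
  have e1 : x (N' k) - partialSum π (w + U) k ∈ adicIdeal π Q ^ k := by
    have e2 : x (N' k) - partialSum π (w + U) k = (x (N' 0) - partialSum π w k) +
        ∑ j ∈ Finset.range k, π ^ j • (d j - partialSum π (v j) (k - j)) := by
      have : partialSum π (w + U) k = partialSum π w k + partialSum π U k := by
        simp [partialSum, Finset.sum_add_distrib]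
      rw [this, hUk, hsum k]
      simp only [smul_sub, Finset.sum_sub_distrib]
      abel
    rw [e2]
    obtain ⟨t, ht⟩ := htail w _ L' hwL k
    refine add_mem (ht ▸ pow_smul_mem_adicIdeal π le_rfl t) (sum_mem fun j hj => ?_)
    rw [Finset.mem_range] at hj
    obtain ⟨t, ht⟩ := htail (v j) _ (L j) (hvL j) (k - j)
    rw [ht, smul_smul, ← pow_add]
    exact pow_smul_mem_adicIdeal π (by omega) t
  have e2 : x n - x (N' k) ∈ adicIdeal π Q ^ k := by
    have hNk := hN' k k le_rfl
    obtain ⟨t, -, ht⟩ := (Submodule.mem_smul_pointwise_iff_exists _ _ _).1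
      (hN k n (hNk.trans hn) _ hNk)
    exact ht ▸ pow_smul_mem_adicIdeal π le_rfl t
  rw [hz.eval, eq_comm, Ideal.Quotient.eq]
  have := add_mem e2 e1
  rwa [sub_add_sub_cancel] at this

end Limits

end WeakCompletion

open ConvexBornology AlgBornology

/-! ### Bornological completions that are localized weak completions -/

section Lift

variable {V : Type*} [CommRing V] {π : V} {Q : Type*} [CommRing Q] [Algebra V Q]
  {A : Type*} [CommRing A] [Algebra V A] {𝓑 : AlgBornology V A}

lemma exists_cauchy_isLimit (z : WeakCompletion π Q) :
    ∃ x : cauchy π (dagger π Q), WeakCompletion.IsLimit π x.1 z := by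
  obtain ⟨M, c, u, hM, h1, hu, hz⟩ := WeakCompletion.exists_series z
  refine ⟨⟨partialSum π u, _, bdd_daggerBall hM h1 (2 * c), fun n =>
    daggerBall_mono le_rfl h1 (by omega) (partialSum_mem_daggerBall hu n), fun k => ⟨2 * k, ?_⟩⟩,
    hz.isLimit⟩
  intro n hn m hm
  rcases le_total m n with h | h
  · exact partialSum_sub_mem h1 hu hm h
  · rw [← neg_sub]
    exact neg_mem (partialSum_sub_mem h1 hu hn h)

lemma smul_mem_pow_smul {S : Submodule V A} {k : ℕ} {x : A} (hx : x ∈ π ^ k • S) (r : V) :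
    r • x ∈ π ^ k • S := Submodule.smul_mem _ r hx

lemma pow_smul_mem_of_le {S : Submodule V A} {k l : ℕ} (hkl : k ≤ l) {x : A} (hx : x ∈ π ^ l • S) :
    x ∈ π ^ k • S := by
  obtain ⟨t, ht, rfl⟩ := (Submodule.mem_smul_pointwise_iff_exists _ _ _).1 hx
  obtain ⟨d, rfl⟩ := Nat.exists_eq_add_of_le hkl
  rw [pow_add, mul_smul]
  exact Submodule.smul_mem_pointwise_smul _ _ _ (S.smul_mem _ ht)

lemma smul_pow_left_cancel {s : V} {X : Type*} [CommRing X] [Algebra V X]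
    (hs : IsUnit (algebraMap V X s)) (l : ℕ) {y : X} (h : s ^ l • y = 0) : y = 0 := by
  rw [Algebra.smul_def, map_pow] at h
  exact (hs.pow l).mul_right_eq_zero.1 h

variable [IsNoetherianRing V] [Algebra.FiniteType V Q] (htf : ∀ x : Q, π • x = 0 → x = 0)

-- A bounded sequence that tends to zero `π`-adically also tends to zero bornologically, because
-- bounded submodules inherit divisibility up to halving the exponent. Hence the class of a Cauchy
-- sequence in the completion depends only on its `π`-adic limit, which makes `preLift` well
-- defined.
include htf in
lemma sub_mem_null_of_forall {x : cauchy π (dagger π Q)}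
    (h : ∀ k, ∃ N, ∀ n ≥ N, ∃ t, x.1 n = π ^ k • t) : x ∈ null π (dagger π Q) := by
  obtain ⟨M, hM⟩ := exists_isGenerating V Q
  obtain ⟨S, hS, hx⟩ := x.2
  obtain ⟨c, hc⟩ := hM.exists_le_daggerBall hS
  exact hM.converges_zero htf (fun n => hc (hx.1 n)) h

variable (ψ : Q →ₐ[V] A)
  (hψ : BoundedMap (dagger π Q).toConvexBornology 𝓑.toConvexBornology ψ)

include htf in
lemma preCompletion_mk_eq {x y : cauchy π (dagger π Q)} {z : WeakCompletion π Q}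
    (hx : WeakCompletion.IsLimit π x.1 z) (hy : WeakCompletion.IsLimit π y.1 z) :
    PreCompletion.mk π 𝓑 (Completion.cauchyMap π ψ hψ x) =
      PreCompletion.mk π 𝓑 (Completion.cauchyMap π ψ hψ y) := by
  have h : x - y ∈ null π (dagger π Q) := sub_mem_null_of_forall htf (hx.exists_sub hy)
  have h' : PreCompletion.mk π (dagger π Q) x = PreCompletion.mk π (dagger π Q) y :=
    Ideal.Quotient.eq.2 h
  exact congrArg (Completion.preMap π ψ hψ) h'

/-- The homomorphism from a weak completion to the pre-completion of a bornological algebra. -/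
def preLift : WeakCompletion π Q →ₐ[V] PreCompletion π 𝓑 where
  toFun z := PreCompletion.mk π 𝓑 (Completion.cauchyMap π ψ hψ (exists_cauchy_isLimit z).choose)
  map_one' := (preCompletion_mk_eq htf ψ hψ (z := 1) (exists_cauchy_isLimit _).choose_spec
    (y := 1) (map_one (WeakCompletion.of π Q) ▸ WeakCompletion.isLimit_const 1)).trans
      (by rw [map_one, map_one])
  map_mul' z w := (preCompletion_mk_eq htf ψ hψ (exists_cauchy_isLimit _).choose_spec
    (y := _ * _) ((exists_cauchy_isLimit z).choose_spec.mul
      (exists_cauchy_isLimit w).choose_spec)).trans (by rw [map_mul, map_mul])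
  map_zero' := (preCompletion_mk_eq htf ψ hψ (z := 0) (exists_cauchy_isLimit _).choose_spec
    (y := 0) (map_zero (WeakCompletion.of π Q) ▸ WeakCompletion.isLimit_const 0)).trans
      (by rw [map_zero, map_zero])
  map_add' z w := (preCompletion_mk_eq htf ψ hψ (exists_cauchy_isLimit _).choose_spec
    (y := _ + _) ((exists_cauchy_isLimit z).choose_spec.add
      (exists_cauchy_isLimit w).choose_spec)).trans (by rw [map_add, map_add])
  commutes' r := (preCompletion_mk_eq htf ψ hψ (z := algebraMap V _ r)
    (exists_cauchy_isLimit _).choose_spec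
    (y := algebraMap V _ r) ((WeakCompletion.of π Q).commutes r ▸
      WeakCompletion.isLimit_const (algebraMap V Q r))).trans (by
        rw [AlgHom.commutes, AlgHom.commutes])

lemma preLift_eq {x : cauchy π (dagger π Q)} {z : WeakCompletion π Q}
    (hx : WeakCompletion.IsLimit π x.1 z) : preLift htf ψ hψ z =
      PreCompletion.mk π 𝓑 (Completion.cauchyMap π ψ hψ x) :=
  preCompletion_mk_eq htf ψ hψ (exists_cauchy_isLimit z).choose_spec hx

/-- The homomorphism from a weak completion to the completion of a bornological algebra. -/
def lift : WeakCompletion π Q →ₐ[V] AlgBornology.Completion π 𝓑 :=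
  (Completion.proj π 𝓑).comp (preLift htf ψ hψ)

lemma lift_eq {x : cauchy π (dagger π Q)} {z : WeakCompletion π Q}
    (hx : WeakCompletion.IsLimit π x.1 z) : lift htf ψ hψ z =
      Completion.mk π 𝓑 (Completion.cauchyMap π ψ hψ x) :=
  congrArg _ (preLift_eq htf ψ hψ hx)

lemma lift_of (q : Q) : lift htf ψ hψ (WeakCompletion.of π Q q) = Completion.of π 𝓑 (ψ q) :=
  lift_eq htf ψ hψ (x := Completion.const π _ q) (WeakCompletion.isLimit_const q)

lemma map_lift {Q' : Type*} [CommRing Q'] [Algebra V Q'] [Algebra.FiniteType V Q']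
    (htf' : ∀ x : Q', π • x = 0 → x = 0) {A' : Type*} [CommRing A'] [Algebra V A']
    {𝓑' : AlgBornology V A'} (ψ' : Q' →ₐ[V] A')
    (hψ' : BoundedMap (dagger π Q').toConvexBornology 𝓑'.toConvexBornology ψ')
    (f : Q →ₐ[V] Q') (g : A →ₐ[V] A')
    (hg : BoundedMap 𝓑.toConvexBornology 𝓑'.toConvexBornology g) (h : g.comp ψ = ψ'.comp f)
    (z : WeakCompletion π Q) : Completion.map π g hg (lift htf ψ hψ z) =
      lift htf' ψ' hψ' (WeakCompletion.map π f z) := by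
  obtain ⟨x, hx⟩ := exists_cauchy_isLimit z
  rw [lift_eq htf ψ hψ hx, lift_eq htf' ψ' hψ' (x := Completion.cauchyMap π f (bounded_dagger f) x)
    hx.map, Completion.map_mk]
  congr 1
  exact Subtype.ext (funext fun n => DFunLike.congr_fun h (x.1 n))

omit [IsNoetherianRing V] in
lemma bdd_completion_iff (T : Set (AlgBornology.Completion π 𝓑)) :
    (Completion.bornology π 𝓑).Bdd T ↔ ∃ S : Submodule V A, 𝓑.Bdd S ∧
      T ⊆ (PreCompletion.ball π 𝓑 S).map (Completion.proj π 𝓑).toLinearMap := by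
  constructor
  · intro hT
    rw [Completion.bornology, AlgBornology.map] at hT
    obtain ⟨_, ⟨N, hN, rfl⟩, hTN⟩ := (bdd_ofSubmodules' _).1 hT
    obtain ⟨_, ⟨S, hS, rfl⟩, hNS⟩ := (bdd_ofSubmodules' _).1 hN
    exact ⟨S, hS, hTN.trans (Submodule.map_mono hNS)⟩
  · rintro ⟨S, hS, hT⟩
    rw [Completion.bornology, AlgBornology.map]
    exact (bdd_ofSubmodules' _).2 ⟨_, ⟨_, (bdd_ofSubmodules' _).2 ⟨_, ⟨S, hS, rfl⟩, subset_rfl⟩,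
      rfl⟩, hT⟩

/-- `ψ : Q → A` identifies the bornological completion of `A` with the localization at `s` of the
weak completion of `Q`. -/
structure IsDaggerDense (s : V) (𝓑 : AlgBornology V A) (ψ : Q →ₐ[V] A) : Prop where
  isUnit : IsUnit (algebraMap V A s)
  bounded : BoundedMap (dagger π Q).toConvexBornology 𝓑.toConvexBornology ψ
  dense : ∀ S : Submodule V A, 𝓑.Bdd S → ∃ (l : ℕ) (D : Submodule V Q) (S' : Submodule V A),
    (dagger π Q).Bdd D ∧ 𝓑.Bdd S' ∧ ∀ x ∈ S, ∀ k : ℕ, ∃ d ∈ D, s ^ l • x - ψ d ∈ π ^ k • S'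
  strict : ∃ N : Submodule V A, (∀ S : Submodule V A, 𝓑.Bdd S → ∃ l : ℕ, ∀ x ∈ S, π ^ l • x ∈ N) ∧
    ∀ (q : Q) (k : ℕ), ψ q ∈ π ^ k • N → ∃ q', q = π ^ k • q'

variable {s : V} {ψ}

include htf in
/-- A bounded Cauchy sequence in `A` is approximated by one that comes from `Q`, with control. -/
lemma IsDaggerDense.exists_approx (h : IsDaggerDense (π := π) s 𝓑 ψ) {S : Submodule V A}
    (hS : 𝓑.Bdd S) : ∃ (l : ℕ) (M : Submodule V Q) (c : ℕ), M.FG ∧ (1 : Q) ∈ M ∧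
      ∀ x : ℕ → A, IsCauchyIn π S x → ∃ e : ℕ → Q, IsCauchyIn π (daggerBall π M c) e ∧
        𝓑.Converges π (fun n => s ^ l • x n - ψ (e n)) 0 := by
  obtain ⟨M, hM⟩ := exists_isGenerating V Q
  obtain ⟨l, D, S', hD, hS', hd⟩ := h.dense S hS
  obtain ⟨c, hc⟩ := hM.exists_le_daggerBall hD
  obtain ⟨c', hc'⟩ := hM.exists_isCauchyIn htf c
  obtain ⟨N, hN, hN'⟩ := h.strict
  -- The term `x n` is approximated with precision `n`. Differences of the approximations lie in `π
  -- ^ (k + l') • (S ⊔ S')`, hence in `π ^ k • N`; strictness makes them divisible by `π ^ k` in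
  -- `Q`. A bounded sequence in `Q` with this property is Cauchy for the bornology.
  obtain ⟨l', hl'⟩ := hN _ (hS.sup hS')
  refine ⟨l, M, c', hM.fg, hM.one_mem, fun x hx => ?_⟩
  choose e he he' using fun n => hd (x n) (hx.1 n) n
  refine ⟨e, hc' e (fun n => hc (he n)) fun k => ?_, S', hS', fun k => ⟨k, fun n hn => ?_⟩⟩
  · obtain ⟨L, hL⟩ := hx.2 (k + l')
    refine ⟨max L (k + l'), fun n hn m hm => ?_⟩
    have h1 := hL n (le_of_max_le_left hn) m (le_of_max_le_left hm)
    have h2 := pow_smul_mem_of_le (le_of_max_le_right hn) (he' n)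
    have h3 := pow_smul_mem_of_le (le_of_max_le_right hm) (he' m)
    have h4 : ψ (e n - e m) ∈ π ^ (k + l') • (S ⊔ S') := by
      have h5 := sub_mem (ConvexBornology.pow_smul_mono π (le_sup_left : S ≤ S ⊔ S') _
        (smul_mem_pow_smul h1 (s ^ l)))
        (ConvexBornology.pow_smul_mono π (le_sup_right : S' ≤ S ⊔ S') _ (sub_mem h2 h3))
      rw [map_sub]
      have e1 : s ^ l • (x n - x m) - (s ^ l • x n - ψ (e n) - (s ^ l • x m - ψ (e m))) =
        ψ (e n) - ψ (e m) := by rw [smul_sub]; abel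
      rwa [e1] at h5
    obtain ⟨t, ht, htn⟩ := (Submodule.mem_smul_pointwise_iff_exists _ _ _).1 h4
    obtain ⟨q, hq⟩ := hN' (e n - e m) k (by
      rw [← htn, pow_add, mul_smul]
      exact Submodule.smul_mem_pointwise_smul _ _ _ (hl' t ht))
    exact ⟨q, hq⟩
  · rw [sub_zero]
    exact pow_smul_mem_of_le hn (he' n)

-- Up to a null sequence, the image of `e` is `π ^ (k + l)` times a sequence in `S`. For large `n`
-- the multiple and the error both lie in `π ^ k • N`, and strictness brings the divisibility back
-- to `Q`.
omit [IsNoetherianRing V] [Algebra.FiniteType V Q] in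
lemma IsDaggerDense.eq_pow_smul_of_mem_ball (h : IsDaggerDense (π := π) s 𝓑 ψ)
    {e : cauchy π (dagger π Q)} {S : Submodule V A} {l k : ℕ} {N : Submodule V A}
    (hN : ∀ S : Submodule V A, 𝓑.Bdd S → ∃ l : ℕ, ∀ x ∈ S, π ^ l • x ∈ N)
    (hN' : ∀ (q : Q) (k : ℕ), ψ q ∈ π ^ k • N → ∃ q', q = π ^ k • q')
    (hl : ∀ x ∈ S, π ^ l • x ∈ N)
    (he : PreCompletion.mk π 𝓑 (Completion.cauchyMap π ψ h.bounded e) ∈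
      π ^ (k + l) • PreCompletion.ball π 𝓑 S) :
    ∃ L, ∀ n ≥ L, ∃ t, e.1 n = π ^ k • t := by
  obtain ⟨_, ⟨x, hx, rfl⟩, hxe⟩ := (Submodule.mem_smul_pointwise_iff_exists _ _ _).1 he
  have h0 : Completion.cauchyMap π ψ h.bounded e - π ^ (k + l) • x ∈ null π 𝓑 := by
    refine Ideal.Quotient.eq.1 ?_
    change PreCompletion.mk π 𝓑 _ = PreCompletion.mk π 𝓑 _
    rw [map_smul]
    exact hxe.symm
  obtain ⟨T, hT, hTc⟩ := h0
  obtain ⟨m, hm⟩ := hN T hT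
  obtain ⟨L, hL⟩ := hTc (k + m)
  refine ⟨L, fun n hn => hN' _ k ?_⟩
  have h1 := hL n hn
  rw [sub_zero] at h1
  obtain ⟨t, ht, htn⟩ := (Submodule.mem_smul_pointwise_iff_exists _ _ _).1 h1
  have h2 : ψ (e.1 n) = π ^ k • (π ^ l • x.1 n + π ^ m • t) := by
    rw [smul_add, smul_smul, smul_smul, ← pow_add, ← pow_add, htn]
    change _ = _ + (ψ (e.1 n) - π ^ (k + l) • x.1 n)
    abel
  rw [h2]
  exact Submodule.smul_mem_pointwise_smul _ _ _ (add_mem (hl _ (hx.1 n)) (hm t ht))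

-- The inductive limit is already separated. After multiplication by a power of `s`, a point that is
-- divisible by all powers of `π` inside one ball comes from a sequence in `Q`. The terms of that
-- sequence tend to zero, and `s` is invertible.
include htf in
lemma IsDaggerDense.closureZero_eq_bot (h : IsDaggerDense (π := π) s 𝓑 ψ) :
    (PreCompletion.bornology π 𝓑).closureZero π = ⊥ := by
  rw [eq_bot_iff]
  refine sInf_le fun x y hx hxy => ?_
  obtain ⟨T, hT, hxy⟩ := hxy
  obtain ⟨_, ⟨S, hS, rfl⟩, hTS⟩ := (bdd_ofSubmodules' _).1 hT
  have hy : ∀ k, y ∈ π ^ k • PreCompletion.ball π 𝓑 S := by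
    intro k
    obtain ⟨L, hL⟩ := hxy k
    have := hL L le_rfl
    rw [(Submodule.mem_bot V).1 (hx L), zero_sub, neg_mem_iff] at this
    exact ConvexBornology.pow_smul_mono π hTS k this
  obtain ⟨x, rfl⟩ := PreCompletion.mk_surjective π 𝓑 y
  obtain ⟨S₀, hS₀, hx₀⟩ := x.2
  obtain ⟨l, M, c, hM, h1, happ⟩ := h.exists_approx htf hS₀
  obtain ⟨e, he, hxe⟩ := happ x.1 hx₀
  let e' : cauchy π (dagger π Q) := ⟨e, _, bdd_daggerBall hM h1 c, he⟩
  have h2 : s ^ l • PreCompletion.mk π 𝓑 x =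
      PreCompletion.mk π 𝓑 (Completion.cauchyMap π ψ h.bounded e') := by
    rw [← map_smul]
    exact Ideal.Quotient.eq.2 hxe
  obtain ⟨N, hN, hN'⟩ := h.strict
  obtain ⟨m, hm⟩ := hN S hS
  have h3 : e' ∈ null π (dagger π Q) := sub_mem_null_of_forall htf fun k =>
    h.eq_pow_smul_of_mem_ball hN hN' hm (h2 ▸ Submodule.smul_mem _ _ (hy (k + m)))
  have h4 : PreCompletion.mk π (dagger π Q) e' = 0 := Ideal.Quotient.eq_zero_iff_mem.2 h3
  have h5 : s ^ l • PreCompletion.mk π 𝓑 x = 0 := by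
    rw [h2]
    exact (congrArg (Completion.preMap π ψ h.bounded) h4).trans (map_zero _)
  refine (Submodule.mem_bot V).2 (smul_pow_left_cancel ?_ l h5)
  have := h.isUnit.map ((PreCompletion.mk π 𝓑).comp (Completion.const π 𝓑))
  rwa [AlgHom.commutes] at this

include htf in
lemma IsDaggerDense.proj_injective (h : IsDaggerDense (π := π) s 𝓑 ψ) :
    Function.Injective (Completion.proj π 𝓑) := by
  rw [injective_iff_map_eq_zero]
  intro y hy
  have h1 : y ∈ closureZeroIdeal π (PreCompletion.bornology π 𝓑) :=
    Ideal.Quotient.eq_zero_iff_mem.1 hy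
  have h2 : y ∈ (PreCompletion.bornology π 𝓑).closureZero π := h1
  rwa [h.closureZero_eq_bot htf, Submodule.mem_bot] at h2

theorem IsDaggerDense.lift_injective (h : IsDaggerDense (π := π) s 𝓑 ψ) :
    Function.Injective (lift htf ψ h.bounded) := by
  rw [injective_iff_map_eq_zero]
  intro z hz
  obtain ⟨x, hx⟩ := exists_cauchy_isLimit z
  have h1 : preLift htf ψ h.bounded z = 0 :=
    h.proj_injective htf (hz.trans (map_zero (Completion.proj π 𝓑)).symm)
  rw [preLift_eq htf ψ h.bounded hx] at h1
  obtain ⟨N, hN, hN'⟩ := h.strict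
  refine hx.eq_zero fun k => h.eq_pow_smul_of_mem_ball (S := ⊥) (l := 0) hN hN' ?_ (h1 ▸ zero_mem _)
  intro x hx
  rw [(Submodule.mem_bot V).1 hx, smul_zero]
  exact zero_mem _

theorem IsDaggerDense.exists_lift_eq (h : IsDaggerDense (π := π) s 𝓑 ψ)
    {T : Set (AlgBornology.Completion π 𝓑)} (hT : (Completion.bornology π 𝓑).Bdd T) :
    ∃ (l : ℕ) (M : Submodule V Q) (c : ℕ), M.FG ∧ (1 : Q) ∈ M ∧ ∀ y ∈ T,
      ∃ z : WeakCompletion π Q, WeakCompletion.val π Q z ∈ weakBall π M c ∧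
        s ^ l • y = lift htf ψ h.bounded z := by
  obtain ⟨S, hS, hTS⟩ := (bdd_completion_iff _).1 hT
  obtain ⟨l, M, c, hM, h1, happ⟩ := h.exists_approx htf hS
  refine ⟨l, M, c, hM, h1, fun y hy => ?_⟩
  obtain ⟨_, ⟨x, hx, rfl⟩, rfl⟩ := hTS hy
  obtain ⟨e, he, hxe⟩ := happ x.1 hx
  obtain ⟨z, hz, hez⟩ := WeakCompletion.exists_isLimit hM h1 he
  let e' : cauchy π (dagger π Q) := ⟨e, _, bdd_daggerBall hM h1 c, he⟩
  refine ⟨z, hz, ?_⟩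
  rw [lift_eq htf ψ h.bounded (x := e') hez]
  have h2 : s ^ l • PreCompletion.mk π 𝓑 x =
      PreCompletion.mk π 𝓑 (Completion.cauchyMap π ψ h.bounded e') := by
    rw [← map_smul]
    exact Ideal.Quotient.eq.2 hxe
  exact (map_smul (Completion.proj π 𝓑) _ _).symm.trans (congrArg (Completion.proj π 𝓑) h2)

lemma bounded_lift (hψ : BoundedMap (dagger π Q).toConvexBornology 𝓑.toConvexBornology ψ) :
    BoundedMap (WeakCompletion.bornology π Q).toConvexBornology
      (Completion.bornology π 𝓑).toConvexBornology (lift htf ψ hψ) := by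
  intro T hT
  obtain ⟨_, ⟨M, hM, h1, c, rfl⟩, hT⟩ := (bdd_ofSubmodules' _).1 hT
  have hb := bdd_daggerBall (π := π) hM h1 (2 * c)
  refine (bdd_completion_iff _).2 ⟨_,
    BoundedMap.exists_submodule (f := ψ.toLinearMap) hψ hb, ?_⟩
  rintro _ ⟨z, hz, rfl⟩
  obtain ⟨u, hu, hzu⟩ := hT hz
  have hc : IsCauchyIn π (daggerBall π M (2 * c)) (partialSum π u) := by
    refine ⟨fun n => daggerBall_mono le_rfl h1 (by omega) (partialSum_mem_daggerBall hu n),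
      fun k => ⟨2 * k, fun n hn m hm => ?_⟩⟩
    rcases le_total m n with h | h
    · exact partialSum_sub_mem h1 hu hm h
    · rw [← neg_sub]
      exact neg_mem (partialSum_sub_mem h1 hu hn h)
  let x : cauchy π (dagger π Q) := ⟨partialSum π u, _, hb, hc⟩
  refine ⟨_, ⟨Completion.cauchyMap π ψ hψ x, hc.map ψ.toLinearMap, rfl⟩, ?_⟩
  exact (lift_eq htf ψ hψ (x := x) (WeakCompletion.HasSeries.isLimit hzu)).symm

end Lift

/-! ### Tensor powers as coproducts -/

namespace TPow

variable {V : Type u} [CommRing V] {A : Type u} [CommRing A] [Algebra V A] {B : Type u} [CommRing B]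
  [Algebra V B]

variable (V A) in
/-- The inclusion of a tensor factor. -/
def incl {n : ℕ} (i : Fin n) : A →ₐ[V] TPow V A n :=
  PiTensorProduct.singleAlgHom (R := V) (A := fun _ : Fin n => A) i

lemma incl_apply {n : ℕ} (i : Fin n) (a : A) :
    incl V A i a = PiTensorProduct.tprod V (Pi.mulSingle i a) := rfl

lemma tprod_eq_prod {n : ℕ} (a : Fin n → A) :
    PiTensorProduct.tprod V a = ∏ i, incl V A i (a i) := by
  simp only [incl_apply]
  rw [← PiTensorProduct.tprod_prod]
  congr 1
  exact (Finset.univ_prod_mulSingle a).symm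

lemma hom_ext_incl {n : ℕ} {S : Type*} [CommRing S] [Algebra V S] {f g : TPow V A n →ₐ[V] S}
    (h : ∀ i a, f (incl V A i a) = g (incl V A i a)) : f = g :=
  PiTensorProduct.algHom_ext fun i => AlgHom.ext (h i)

/-- The homomorphism with prescribed restrictions to the tensor factors. -/
def desc {n : ℕ} {S : Type*} [CommRing S] [Algebra V S] (g : Fin n → A →ₐ[V] S) :
    TPow V A n →ₐ[V] S :=
  PiTensorProduct.liftAlgHom
    ((MultilinearMap.mkPiAlgebra V (Fin n) S).compLinearMap fun i => (g i).toLinearMap)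
    (by simp) (fun a b => by simp [Finset.prod_mul_distrib])

lemma desc_tprod {n : ℕ} {S : Type*} [CommRing S] [Algebra V S] (g : Fin n → A →ₐ[V] S)
    (a : Fin n → A) : desc g (PiTensorProduct.tprod V a) = ∏ i, g i (a i) :=
  (PiTensorProduct.lift.tprod a).trans (by simp)

@[simp] lemma desc_incl {n : ℕ} {S : Type*} [CommRing S] [Algebra V S] (g : Fin n → A →ₐ[V] S)
    (i : Fin n) (a : A) : desc g (incl V A i a) = g i a := by
  rw [incl_apply, desc_tprod, Finset.prod_eq_single i]
  · rw [Pi.mulSingle_eq_same]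
  · intro j _ hj
    rw [Pi.mulSingle_eq_of_ne hj, map_one]
  · simp

@[simp] lemma map_incl {m n : ℕ} (f : Fin m → Fin n) (i : Fin m) (a : A) :
    map V f (incl V A i a) = incl V A (f i) a := by
  rw [incl_apply, incl_apply, map_tprod]
  congr 1
  ext j
  rw [merge, Finset.prod_filter]
  by_cases hj : f i = j
  · subst hj
    rw [Pi.mulSingle_eq_same, Finset.prod_eq_single i]
    · rw [if_pos rfl, Pi.mulSingle_eq_same]
    · intro k _ hk
      rw [Pi.mulSingle_eq_of_ne hk, ite_self]
    · simp
  · rw [Pi.mulSingle_eq_of_ne (fun h => hj h.symm)]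
    refine Finset.prod_eq_one fun k _ => ?_
    by_cases hk : k = i
    · rw [hk, if_neg hj]
    · rw [Pi.mulSingle_eq_of_ne hk, ite_self]

@[simp] lemma mapHom_incl {n : ℕ} (g : A →ₐ[V] B) (i : Fin n) (a : A) :
    mapHom n g (incl V A i a) = incl V B i (g a) := by
  rw [incl_apply, incl_apply, mapHom_tprod]
  congr 1
  ext j
  by_cases hj : j = i
  · subst hj; simp
  · simp [Pi.mulSingle_eq_of_ne hj]

lemma mapHom_comp {C : Type u} [CommRing C] [Algebra V C] (n : ℕ) (h : B →ₐ[V] C) (g : A →ₐ[V] B) :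
    (mapHom n h).comp (mapHom n g) = mapHom n (h.comp g) :=
  hom_ext_incl fun i a => by simp

lemma single_bijective : Function.Bijective (single V A) := by
  refine Function.bijective_iff_has_inverse.2 ⟨prod V A 1, fun a => ?_, fun x => ?_⟩
  · rw [single_apply, prod_tprod]; simp
  · have h : (single V A).comp (prod V A 1) = AlgHom.id V _ := hom_ext fun a => by
      rw [AlgHom.comp_apply, prod_tprod, single_apply, AlgHom.id_apply]
      congr 1
      ext i
      simp [Subsingleton.elim i 0]
    exact DFunLike.congr_fun h x

/-- The decomposition of a tensor power along a decomposition of the index set. -/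
def sumEquiv {m n k : ℕ} (e : Fin m ⊕ Fin n ≃ Fin k) :
    TPow V A m ⊗[V] TPow V A n ≃ₐ[V] TPow V A k :=
  AlgEquiv.ofAlgHom
    (Algebra.TensorProduct.productMap (map V (e ∘ Sum.inl)) (map V (e ∘ Sum.inr)))
    (desc fun i => Sum.elim
      (fun j => (Algebra.TensorProduct.includeLeft : TPow V A m →ₐ[V] _).comp (incl V A j))
      (fun j => (Algebra.TensorProduct.includeRight : TPow V A n →ₐ[V] _).comp (incl V A j))
      (e.symm i))
    (hom_ext_incl fun i a => by
      obtain ⟨i | i, rfl⟩ := e.surjective i <;> simp)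
    (Algebra.TensorProduct.ext
      (hom_ext_incl fun i a => by simp) (hom_ext_incl fun i a => by simp))

lemma sumEquiv_tmul_one {m n k : ℕ} (e : Fin m ⊕ Fin n ≃ Fin k) (x : TPow V A m) :
    sumEquiv (V := V) (A := A) e (x ⊗ₜ (1 : TPow V A n)) = map V (e ∘ Sum.inl) x := by
  simp [sumEquiv]

lemma pair_bijective : Function.Bijective (pair V A) := by
  let e : Fin 1 ⊕ Fin 1 ≃ Fin 2 := finSumFinEquiv
  let s : A ≃ₐ[V] TPow V A 1 := AlgEquiv.ofBijective _ single_bijective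
  have h : pair V A = (sumEquiv e).toAlgHom.comp (Algebra.TensorProduct.congr s s).toAlgHom := by
    refine Algebra.TensorProduct.ext ?_ ?_
    · ext a
      have h1 : s a = incl V A 0 a := rfl
      have h0 : e (Sum.inl 0) = 0 := rfl
      have h2 : (PiTensorProduct.singleAlgHom (R := V) (A := fun _ : Fin 2 => A) 0) a =
        incl V A 0 a := rfl
      simp [pair, sumEquiv, h1, h0, h2, -PiTensorProduct.singleAlgHom_apply]
    · ext a
      have h1 : s a = incl V A 0 a := rfl
      have h0 : e (Sum.inr 0) = 1 := rfl
      have h2 : (PiTensorProduct.singleAlgHom (R := V) (A := fun _ : Fin 2 => A) 1) a =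
        incl V A 1 a := rfl
      simp [pair, sumEquiv, h1, h0, h2, -PiTensorProduct.singleAlgHom_apply]
  rw [h]
  exact (sumEquiv e).bijective.comp (Algebra.TensorProduct.congr s s).bijective

instance finiteType [Algebra.FiniteType V A] (n : ℕ) : Algebra.FiniteType V (TPow V A n) := by
  induction n with
  | zero =>
    let f : V →ₐ[V] TPow V A 0 := Algebra.ofId V _
    refine Algebra.FiniteType.of_surjective f fun x => ?_
    have h : f.comp (desc fun i : Fin 0 => i.elim0) = AlgHom.id V _ :=
      hom_ext_incl fun i => i.elim0
    exact ⟨_, DFunLike.congr_fun h x⟩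
  | succ n ih =>
    have h1 : Algebra.FiniteType V (TPow V A 1) :=
      Algebra.FiniteType.of_surjective (single V A) single_bijective.2
    have : Algebra.FiniteType (TPow V A n) (TPow V A n ⊗[V] TPow V A 1) :=
      Algebra.FiniteType.baseChange _
    exact ((Algebra.FiniteType.trans ih this).equiv (sumEquiv finSumFinEquiv))

instance flat [Module.Flat V A] (n : ℕ) : Module.Flat V (TPow V A n) := by
  induction n with
  | zero =>
    let e : (⨂[V] _ : Fin 0, A) ≃ₗ[V] V := PiTensorProduct.isEmptyEquiv (Fin 0)
    exact Module.Flat.of_linearEquiv e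
  | succ n ih =>
    have h1 : Module.Flat V (TPow V A 1) := Module.Flat.of_linearEquiv
      (AlgEquiv.ofBijective _ (single_bijective (V := V) (A := A))).symm.toLinearEquiv
    have : Module.Flat V (TPow V A n ⊗[V] TPow V A 1) := inferInstance
    exact Module.Flat.of_linearEquiv
      (sumEquiv (finSumFinEquiv : Fin n ⊕ Fin 1 ≃ Fin (n + 1))).symm.toLinearEquiv

/-- The tensor factors outside the range of `f` split off, so the map is the base change of the flat
`V`-module they form. -/
lemma flat_map_of_injective [Module.Flat V A] {m k : ℕ} (f : Fin m → Fin k)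
    (hf : Function.Injective f) : (map V (A := A) f).toRingHom.Flat := by
  obtain ⟨n, ⟨g⟩⟩ : ∃ n, Nonempty (Fin n ≃ ((Set.range f)ᶜ : Set (Fin k))) :=
    ⟨_, ⟨(Fintype.equivFin _).symm⟩⟩
  classical
  let e : Fin m ⊕ Fin n ≃ Fin k :=
    ((Equiv.ofInjective f hf).sumCongr g).trans (Equiv.Set.sumCompl (Set.range f))
  have he : e ∘ Sum.inl = f := by
    ext i
    simp [e]
  have h : (map V (A := A) f).toRingHom = (sumEquiv e).toRingEquiv.toRingHom.comp
      (algebraMap (TPow V A m) (TPow V A m ⊗[V] TPow V A n)) := by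
    ext x : 1
    refine (DFunLike.congr_fun (congrArg (fun f => map V (A := A) f) he) x).symm.trans ?_
    exact (sumEquiv_tmul_one (V := V) (A := A) e x).symm
  rw [h]
  refine RingHom.Flat.comp ?_ (RingHom.Flat.of_bijective (sumEquiv e).bijective)
  rw [RingHom.flat_algebraMap_iff]
  infer_instance

lemma endpoints_injective (n : ℕ) : Function.Injective (endpoints n) := by
  intro i j h
  have h' := congrArg Fin.val h
  simp only [endpoints] at h'
  ext
  split_ifs at h' <;> omega

end TPow

/-- The map of index sets that identifies the last element with the first one. -/
def closeUp (n : ℕ) (j : Fin (n + 2)) : Fin (n + 1) :=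
  ⟨if (j : ℕ) = n + 1 then 0 else j, by split_ifs <;> omega⟩

lemma closeUp_castSucc (n : ℕ) : closeUp n ∘ Fin.castSucc = id := by
  ext j
  have := j.2
  simp only [closeUp, Function.comp_apply, Fin.val_castSucc, id]
  split_ifs <;> omega

lemma closeUp_endpoints (n : ℕ) :
    closeUp n ∘ endpoints n = (fun _ : Fin 1 => (0 : Fin (n + 1))) ∘ fun _ : Fin 2 => (0 : Fin 1) := by
  ext j
  fin_cases j <;> simp [closeUp, endpoints]

/-- This is why closing up is a chain map from the bar complex to the Hochschild complex. The last
face of the bar complex becomes the cyclic face. -/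
lemma closeUp_barFace (n : ℕ) (i : Fin (n + 2)) :
    closeUp n ∘ barFace n i = hochschildFace n i ∘ closeUp (n + 1) := by
  ext j
  have := i.2
  have := j.2
  simp only [closeUp, barFace, hochschildFace, Function.comp_apply]
  split_ifs <;> omega

namespace TPow

variable {V : Type u} [CommRing V] {A : Type u} [CommRing A] [Algebra V A]

/-- Modulo the ideal on the right, the last tensor factor may be moved to the first. So the quotient
map factors through closing up, with `Fin.castSucc` as a section. -/
lemma ker_closeUp_le (n : ℕ) : RingHom.ker (map V (A := A) (closeUp n)) ≤
    (RingHom.ker (map V (A := A) (fun _ : Fin 2 => (0 : Fin 1)))).map (map V (endpoints n)) := by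
  intro x hx
  set I := (RingHom.ker (map V (A := A) (fun _ : Fin 2 => (0 : Fin 1)))).map
    (map V (A := A) (endpoints n))
  have h : (Ideal.Quotient.mkₐ V I).comp ((map V Fin.castSucc).comp (map V (closeUp n))) =
      Ideal.Quotient.mkₐ V I := hom_ext_incl fun i a => by
    simp only [AlgHom.comp_apply, map_incl]
    by_cases hi : (i : ℕ) = n + 1
    · refine Ideal.Quotient.eq.2 ?_
      have e : incl V A (closeUp n i).castSucc a - incl V A i a =
          map V (endpoints n) (incl V A 0 a - incl V A 1 a) := by
        rw [map_sub, map_incl, map_incl]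
        have e1 : (closeUp n i).castSucc = endpoints n 0 := by
          ext; simp [closeUp, endpoints, hi]
        have e2 : i = endpoints n 1 := by
          ext; simp [endpoints, hi]
        rw [e1, ← e2]
      rw [e]
      refine Ideal.mem_map_of_mem _ ?_
      rw [RingHom.mem_ker, map_sub, map_incl, map_incl, sub_self]
    · congr 2
      ext
      simp [closeUp, hi]
  have h' := DFunLike.congr_fun h x
  rw [AlgHom.comp_apply, AlgHom.comp_apply, (RingHom.mem_ker).1 hx, map_zero, map_zero] at h'
  exact Ideal.Quotient.eq_zero_iff_mem.1 h'.symm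

end TPow

/-! ### Localization at an element of the ground ring -/

section Away

variable {V : Type*} [CommRing V] {X : Type*} [CommRing X] [Algebra V X] {Y : Type*} [CommRing Y]
  [Algebra V Y] {Z : Type*} [CommRing Z] [Algebra V Z]

/-- `f : X → Y` is an injective localization at the element `s` of the ground ring. -/
structure IsAway (s : V) (f : X →ₐ[V] Y) : Prop where
  isUnit : IsUnit (algebraMap V Y s)
  injective : Function.Injective f
  exists_smul : ∀ y, ∃ (l : ℕ) (x : X), s ^ l • y = f x

variable {s : V} {f : X →ₐ[V] Y}

lemma isAway_one (hf : Function.Bijective f) : IsAway 1 f :=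
  ⟨by simp, hf.1, fun y => by
    obtain ⟨x, rfl⟩ := hf.2 y
    exact ⟨0, x, by simp⟩⟩

lemma IsAway.isLocalization (h : IsAway s f) : letI := f.toRingHom.toAlgebra
    IsLocalization.Away (algebraMap V X s) Y := by
  let := f.toRingHom.toAlgebra
  have hf : ∀ x, algebraMap X Y x = f x := fun _ => rfl
  refine ⟨?_, ?_, ?_⟩
  · rintro ⟨_, l, rfl⟩
    simp only [map_pow, hf, AlgHom.commutes]
    exact h.isUnit.pow l
  · intro y
    obtain ⟨l, x, hx⟩ := h.exists_smul y
    refine ⟨(x, ⟨_, l, rfl⟩), ?_⟩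
    simp only [map_pow, hf, AlgHom.commutes]
    rw [← hx, Algebra.smul_def, map_pow, mul_comm]
  · intro x y hxy
    exact ⟨1, by rw [h.injective hxy]⟩

lemma IsAway.flat (h : IsAway s f) : f.toRingHom.Flat := by
  let := f.toRingHom.toAlgebra
  have := h.isLocalization
  exact IsLocalization.flat Y (Submonoid.powers (algebraMap V X s))

lemma IsAway.flat_of_comp (h : IsAway s f) (g : Y →ₐ[V] Z) (hg : (g.comp f).toRingHom.Flat) :
    g.toRingHom.Flat := by
  let := f.toRingHom.toAlgebra
  let := g.toRingHom.toAlgebra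
  let := (g.comp f).toRingHom.toAlgebra
  have := h.isLocalization
  have : IsScalarTower X Y Z := IsScalarTower.of_algebraMap_eq fun _ => rfl
  exact (Module.flat_iff_of_isLocalization Y (Submonoid.powers (algebraMap V X s)) Z).2 hg

lemma IsAway.exists_lift (h : IsAway s f) (g : X →ₐ[V] Z) (hs : IsUnit (algebraMap V Z s)) :
    ∃ k : Y →ₐ[V] Z, k.comp f = g := by
  let := f.toRingHom.toAlgebra
  have := h.isLocalization
  have : IsScalarTower V X Y := IsScalarTower.of_algebraMap_eq fun r => (f.commutes r).symm
  have hu : ∀ y : Submonoid.powers (algebraMap V X s), IsUnit (g y) := by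
    rintro ⟨_, l, rfl⟩
    rw [map_pow, AlgHom.commutes]
    exact hs.pow l
  refine ⟨IsLocalization.liftAlgHom hu, AlgHom.ext fun x => ?_⟩
  exact IsLocalization.lift_eq (S := Y) (g := (g : X →+* Z)) hu x

lemma exists_isAway (s : V) (hs : ∀ x : X, s • x = 0 → x = 0) :
    IsAway s (Algebra.algHom V X (Localization.Away (algebraMap V X s))) := by
  refine ⟨?_, ?_, fun y => ?_⟩
  · have h : IsUnit (algebraMap X (Localization.Away (algebraMap V X s)) (algebraMap V X s)) :=
      IsLocalization.Away.algebraMap_isUnit _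
    rwa [← IsScalarTower.algebraMap_apply] at h
  · rw [injective_iff_map_eq_zero]
    intro x hx
    obtain ⟨⟨_, l, rfl⟩, hl⟩ := (IsLocalization.map_eq_zero_iff
      (Submonoid.powers (algebraMap V X s)) _ x).1 hx
    simp only at hl
    clear hx
    induction l with
    | zero => simpa using hl
    | succ l ih =>
      refine ih (hs _ ?_)
      rw [Algebra.smul_def, ← mul_assoc, ← pow_succ', hl]
  · obtain ⟨⟨x, ⟨_, l, rfl⟩⟩, hx⟩ := IsLocalization.surj
      (Submonoid.powers (algebraMap V X s)) y
    refine ⟨l, x, ?_⟩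
    simp only [map_pow, ← IsScalarTower.algebraMap_apply] at hx
    rw [Algebra.smul_def, map_pow, mul_comm]
    exact hx

lemma IsAway.smul_cancel (h : IsAway s f) {l : ℕ} {y y' : Y} (e : s ^ l • y = s ^ l • y') :
    y = y' := by
  rw [← sub_eq_zero]
  exact smul_pow_left_cancel h.isUnit l (by rw [smul_sub, e, sub_self])

end Away

/-- For injectivity, each inclusion of a factor extends from `X` to `Y` once the tensor power of `X`
is localized at `s`. The extensions combine to a map on the tensor power of `Y` whose composite with
`mapHom` is the injective localization map. Denominators are cleared factor by factor. -/
lemma TPow.isAway_mapHom {V : Type u} [CommRing V] {X : Type u} [CommRing X] [Algebra V X]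
    {Y : Type u} [CommRing Y] [Algebra V Y] {s : V} {f : X →ₐ[V] Y} (h : IsAway s f) {n : ℕ}
    (hs : ∀ x : TPow V X n, s • x = 0 → x = 0) (hn : IsUnit (algebraMap V (TPow V Y n) s)) :
    IsAway s (TPow.mapHom n f) := by
  have hL := exists_isAway s hs
  set L := Localization.Away (algebraMap V (TPow V X n) s)
  choose g hg using fun i => h.exists_lift
    ((Algebra.algHom V (TPow V X n) L).comp (TPow.incl V X i)) hL.isUnit
  have hd : (TPow.desc g).comp (TPow.mapHom n f) = Algebra.algHom V (TPow V X n) L :=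
    hom_ext_incl fun i a => by
      simp only [AlgHom.comp_apply, mapHom_incl, desc_incl]
      exact DFunLike.congr_fun (hg i) a
  refine ⟨hn, fun x y hxy => hL.injective ?_, fun y => ?_⟩
  · rw [← hd, AlgHom.comp_apply, hxy, AlgHom.comp_apply]
  · induction y using PiTensorProduct.induction_on with
    | smul_tprod r a =>
      choose l x hx using fun i => h.exists_smul (a i)
      refine ⟨∑ i, l i, r • PiTensorProduct.tprod V x, ?_⟩
      rw [map_smul, mapHom_tprod, smul_comm, ← Finset.prod_pow_eq_pow_sum,
        ← MultilinearMap.map_smul_univ]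
      simp only [hx]
    | add x y hx hy =>
      obtain ⟨l, x', hx⟩ := hx
      obtain ⟨m, y', hy⟩ := hy
      refine ⟨l + m, s ^ m • x' + s ^ l • y', ?_⟩
      rw [map_add, map_smul, map_smul, ← hx, ← hy, smul_add, smul_smul, smul_smul, pow_add,
        mul_comm (s ^ l)]

/-! ### Exact complexes of flat modules -/

section FlatComplexes

variable {E : Type u} [CommRing E]

lemma mem_ideal_smul_top_iff {C : Type*} [AddCommGroup C] [Module E C] (I : Ideal E) (x : C) :
    x ∈ I • (⊤ : Submodule E C) ↔ ∃ (k : ℕ) (a : Fin k → E) (c : Fin k → C),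
      (∀ i, a i ∈ I) ∧ x = ∑ i, a i • c i := by
  constructor
  · intro hx
    induction hx using Submodule.smul_induction_on' with
    | smul r hr n _ => exact ⟨1, fun _ => r, fun _ => n, fun _ => hr, by simp⟩
    | add x _ y _ hx hy =>
      obtain ⟨k, a, c, ha, rfl⟩ := hx
      obtain ⟨l, b, d, hb, rfl⟩ := hy
      refine ⟨k + l, Fin.append a b, Fin.append c d, fun i => ?_, ?_⟩
      · refine Fin.addCases (fun i => ?_) (fun i => ?_) i
        · simpa using ha i
        · simpa using hb i
      · simp [Fin.sum_univ_add]
  · rintro ⟨k, a, c, ha, rfl⟩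
    exact Submodule.sum_mem _ fun i _ => Submodule.smul_mem_smul (ha i) trivial

/-- A submodule with flat quotient is pure. -/
lemma mem_smul_of_flat_range {C D : Type*} [AddCommGroup C] [Module E C] [AddCommGroup D]
    [Module E D] (p : C →ₗ[E] D) [Module.Flat E (LinearMap.range p)] (I : Ideal E) {x : C}
    (hx : x ∈ I • (⊤ : Submodule E C)) (hpx : p x = 0) : x ∈ I • LinearMap.ker p := by
  obtain ⟨k, a, c, ha, rfl⟩ := (mem_ideal_smul_top_iff I x).1 hx
  have h0 : ∑ i, a i • p.rangeRestrict (c i) = 0 := by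
    rw [← Subtype.coe_inj]
    simpa [map_sum] using hpx
  -- The relation among the images is trivial because the range is flat. Subtracting lifts of the
  -- resolving elements moves each `c i` into the kernel without changing the sum.
  obtain ⟨κ, m, y, hy, hm⟩ := Module.Flat.isTrivialRelation_of_sum_smul_eq_zero h0
  choose y' hy' using fun j => p.surjective_rangeRestrict (y j)
  have e : ∑ i, a i • c i = ∑ i, a i • (c i - ∑ j, m i j • y' j) := by
    simp only [smul_sub, Finset.sum_sub_distrib, Finset.smul_sum, smul_smul]
    rw [Finset.sum_comm (s := Finset.univ (α := Fin k)), eq_comm, sub_eq_self]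
    refine Finset.sum_eq_zero fun j _ => ?_
    rw [← Finset.sum_smul, hm j, zero_smul]
  rw [e]
  refine Submodule.sum_mem _ fun i _ => Submodule.smul_mem_smul (ha i) ?_
  have h1 : p.rangeRestrict (c i - ∑ j, m i j • y' j) = 0 := by
    rw [map_sub, map_sum]
    simp only [map_smul, hy']
    rw [← hy i, sub_self]
  exact congrArg Subtype.val h1

/-- As the range is flat, tensoring the inclusion of the kernel with `I` stays injective. So `I ⊗
ker p` embeds into `I ⊗ C` and further into `E ⊗ C`, and this map factors through `E ⊗ ker p`. -/
lemma flat_ker_of_flat_range {C D : Type u} [AddCommGroup C] [Module E C] [AddCommGroup D]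
    [Module E D] (p : C →ₗ[E] D) [Module.Flat E C] [Module.Flat E (LinearMap.range p)] :
    Module.Flat E (LinearMap.ker p) := by
  rw [Module.Flat.iff_rTensor_injective']
  intro I
  have h1 : Function.Injective ((LinearMap.ker p).subtype.lTensor I) :=
    LinearMap.lTensor_injective_of_exact_of_flat p.rangeRestrict p.surjective_rangeRestrict _
      (Submodule.injective_subtype _) (by
        intro x
        rw [← Subtype.coe_inj]
        simp) _
  have h2 : Function.Injective (LinearMap.rTensor C I.subtype) :=
    Module.Flat.rTensor_preserves_injective_linearMap _ (Submodule.injective_subtype I)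
  have h3 : (LinearMap.ker p).subtype.lTensor E ∘ₗ LinearMap.rTensor (LinearMap.ker p) I.subtype =
      LinearMap.rTensor C I.subtype ∘ₗ (LinearMap.ker p).subtype.lTensor I := by
    rw [LinearMap.lTensor_comp_rTensor, LinearMap.rTensor_comp_lTensor]
  refine Function.Injective.of_comp (f := (LinearMap.ker p).subtype.lTensor E) ?_
  rw [← LinearMap.coe_comp, h3, LinearMap.coe_comp]
  exact h2.comp h1

/-- A bounded below exact complex of flat modules stays exact modulo an ideal. -/
theorem exact_mod_ideal (C : ℕ → ModuleCat.{u} E) (d : ∀ n, C (n + 1) →ₗ[E] C n)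
    (hflat : ∀ n, Module.Flat E (C n)) (h0 : Function.Surjective (d 0))
    (hd : ∀ n, Function.Exact (d (n + 1)) (d n)) (I : Ideal E) (n : ℕ) {c : C (n + 1)}
    (hc : d n c ∈ I • (⊤ : Submodule E (C n))) :
    ∃ c', c - d (n + 1) c' ∈ I • (⊤ : Submodule E (C (n + 1))) := by
  -- Induction starting from the end of the complex, where the range is everything. By exactness the
  -- next range is a kernel with flat image; it is therefore flat, and pure in the next term.
  have key : ∀ n, Module.Flat E (LinearMap.range (d n)) ∧
      ∀ x ∈ LinearMap.range (d n), x ∈ I • (⊤ : Submodule E (C n)) →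
        x ∈ I • LinearMap.range (d n) := by
    intro n
    induction n with
    | zero =>
      rw [LinearMap.range_eq_top.2 h0]
      have := hflat 0
      exact ⟨Module.Flat.of_linearEquiv Submodule.topEquiv, fun x _ hx => hx⟩
    | succ n ih =>
      have := ih.1
      have := hflat (n + 1)
      rw [← (hd n).linearMap_ker_eq]
      exact ⟨flat_ker_of_flat_range _, fun x hx hx' => mem_smul_of_flat_range _ I hx' hx⟩
  have h1 := (key n).2 _ ⟨c, rfl⟩ hc
  rw [LinearMap.range_eq_map, ← Submodule.map_smul''] at h1
  obtain ⟨c₁, hc₁, hc₁'⟩ := h1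
  obtain ⟨c', hc'⟩ := (hd n (c - c₁)).1 (by rw [map_sub, hc₁', sub_self])
  exact ⟨c', by rw [hc', sub_sub_cancel]; exact hc₁⟩

variable {P P' : ChainComplex (ModuleCat.{u} E) ℕ} {N : ModuleCat.{u} E} {ε : P.X 0 ⟶ N}
  {ε' : P'.X 0 ⟶ N}

variable (P P') in
/-- The terms of the mapping cone of a chain map between non-negative complexes. -/
def ConeX : ℕ → ModuleCat.{u} E
  | 0 => P'.X 0
  | n + 1 => ModuleCat.of E (P'.X (n + 1) × P.X n)

/-- The differential of the mapping cone of a chain map between non-negative complexes. -/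
def coneD (φ : P ⟶ P') : ∀ n, ConeX P P' (n + 1) →ₗ[E] ConeX P P' n
  | 0 => (P'.d 1 0).hom.coprod (φ.f 0).hom
  | n + 1 => LinearMap.prod ((P'.d (n + 2) (n + 1)).hom.coprod (φ.f (n + 1)).hom)
      (-((P.d (n + 1) n).hom ∘ₗ LinearMap.snd E _ _))

lemma d_d_apply (P : ChainComplex (ModuleCat.{u} E) ℕ) {i j k : ℕ} (x : P.X i) :
    P.d j k (P.d i j x) = 0 := by
  rw [← ConcreteCategory.comp_apply, P.d_comp_d]
  rfl

lemma hom_comm_apply (φ : P ⟶ P') (i j : ℕ) (x : P.X i) :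
    P'.d i j (φ.f i x) = φ.f j (P.d i j x) := by
  rw [← ConcreteCategory.comp_apply, φ.comm, ConcreteCategory.comp_apply]

/-- A chain map between two resolutions that is compatible with the augmentations is a
quasi-isomorphism, and its cone is exact. -/
lemma IsFlatResolution.exact (hP : IsFlatResolution P ε) (hP' : IsFlatResolution P' ε')
    (φ : P ⟶ P') (hφ : ∀ x, ε' (φ.f 0 x) = ε x) :
    Function.Surjective (coneD φ 0) ∧ ∀ n, Function.Exact (coneD φ (n + 1)) (coneD φ n) := by
  refine ⟨fun (y : P'.X 0) => ?_, fun n => ?_⟩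
  · obtain ⟨x, hx⟩ := hP.surjective (ε' y)
    obtain ⟨y', hy'⟩ := (hP'.exact_zero (y - φ.f 0 x)).1 (by rw [map_sub, hφ, hx, sub_self])
    refine ⟨(y', x), ?_⟩
    change P'.d 1 0 y' + φ.f 0 x = y
    rw [hy', sub_add_cancel]
  · rintro ⟨y, x⟩
    constructor
    · intro h
      -- In degree zero the augmentation takes the place of the missing differential: `ε x = ε' (φ
      -- x)` vanishes because `φ x` is a boundary.
      obtain ⟨x', rfl⟩ : ∃ x', P.d (n + 1) n x' = x := by
        rcases n with _ | n
        · refine (hP.exact_zero x).1 ?_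
          have h' : P'.d 1 0 y + φ.f 0 x = 0 := h
          rw [← hφ, eq_neg_of_add_eq_zero_right h', map_neg, neg_eq_zero]
          exact hP'.exact_zero.apply_apply_eq_zero y
        · refine (hP.exact_succ n x).1 ?_
          exact neg_eq_zero.1 (congrArg Prod.snd h)
      have h2 : P'.d (n + 1) n (y + φ.f (n + 1) x') = 0 := by
        rw [map_add, hom_comm_apply]
        rcases n with _ | n
        · exact h
        · exact congrArg Prod.fst h
      obtain ⟨y', hy'⟩ : ∃ y', P'.d (n + 2) (n + 1) y' = y + φ.f (n + 1) x' := by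
        rcases n with _ | n
        · refine (hP'.exact_succ 0 _).1 h2
        · exact (hP'.exact_succ _ _).1 h2
      refine ⟨(y', -x'), Prod.ext ?_ ?_⟩
      · change P'.d (n + 2) (n + 1) y' + φ.f (n + 1) (-x') = y
        rw [hy', map_neg, add_neg_cancel_right]
      · change -(P.d (n + 1) n (-x')) = _
        rw [map_neg, neg_neg]
    · rintro ⟨⟨y', x'⟩, h⟩
      obtain rfl : P'.d (n + 2) (n + 1) y' + φ.f (n + 1) x' = y := congrArg Prod.fst h
      obtain rfl : -(P.d (n + 1) n x') = x := congrArg Prod.snd h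
      have h1 : P'.d (n + 1) n (P'.d (n + 2) (n + 1) y' + φ.f (n + 1) x') +
          φ.f n (-(P.d (n + 1) n x')) = 0 := by
        rw [map_add, d_d_apply, zero_add, hom_comm_apply, map_neg, add_neg_cancel]
      rcases n with _ | n
      · exact h1
      · refine Prod.ext h1 ?_
        change -(P.d (n + 1) n (-(P.d (n + 2) (n + 1) x'))) = 0
        rw [map_neg, neg_neg, d_d_apply]

lemma flat_prod (X Y : Type*) [AddCommGroup X] [Module E X] [AddCommGroup Y] [Module E Y]
    [Module.Flat E X] [Module.Flat E Y] : Module.Flat E (X × Y) := by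
  refine Module.Flat.of_forall_isTrivialRelation fun {l f x} h => ?_
  obtain ⟨k, a, y, hy, ha⟩ := Module.Flat.isTrivialRelation_of_sum_smul_eq_zero
    (f := f) (x := fun i => (x i).1) (by simpa [Prod.fst_sum] using congrArg Prod.fst h)
  obtain ⟨m, b, z, hz, hb⟩ := Module.Flat.isTrivialRelation_of_sum_smul_eq_zero
    (f := f) (x := fun i => (x i).2) (by simpa [Prod.snd_sum] using congrArg Prod.snd h)
  refine ⟨k + m, fun i => Fin.append (a i) (b i),
    Fin.append (fun j => (y j, 0)) (fun j => (0, z j)), fun i => Prod.ext ?_ ?_, fun j => ?_⟩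
  · simp [Fin.sum_univ_add, hy, Prod.fst_sum]
  · simp [Fin.sum_univ_add, hz, Prod.snd_sum]
  · refine Fin.addCases (fun j => ?_) (fun j => ?_) j
    · simpa using ha j
    · simpa using hb j

lemma flat_coneX (hP : IsFlatResolution P ε) (hP' : IsFlatResolution P' ε') (n : ℕ) :
    Module.Flat E (ConeX P P' n) := by
  rcases n with _ | n
  · exact hP'.flat 0
  · have := hP.flat n
    have := hP'.flat (n + 1)
    exact flat_prod (P'.X (n + 1)) (P.X n)

lemma mem_smul_top_prod {X Y : Type*} [AddCommGroup X] [Module E X] [AddCommGroup Y] [Module E Y]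
    {I : Ideal E} {z : X × Y} :
    z ∈ I • (⊤ : Submodule E (X × Y)) ↔
      z.1 ∈ I • (⊤ : Submodule E X) ∧ z.2 ∈ I • (⊤ : Submodule E Y) := by
  have hX : ∀ x : X, x ∈ I • (⊤ : Submodule E X) →
      ((x, 0) : X × Y) ∈ I • (⊤ : Submodule E (X × Y)) := fun x hx =>
    Submodule.smul_mono le_rfl le_top
      (Submodule.map_smul'' I ⊤ (LinearMap.inl E X Y) ▸ Submodule.mem_map_of_mem hx)
  have hY : ∀ y : Y, y ∈ I • (⊤ : Submodule E Y) →
      ((0, y) : X × Y) ∈ I • (⊤ : Submodule E (X × Y)) := fun y hy =>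
    Submodule.smul_mono le_rfl le_top
      (Submodule.map_smul'' I ⊤ (LinearMap.inr E X Y) ▸ Submodule.mem_map_of_mem hy)
  constructor
  · intro hz
    exact ⟨Submodule.smul_mono le_rfl le_top (Submodule.map_smul'' I ⊤ (LinearMap.fst E X Y) ▸
      Submodule.mem_map_of_mem hz), Submodule.smul_mono le_rfl le_top
      (Submodule.map_smul'' I ⊤ (LinearMap.snd E X Y) ▸ Submodule.mem_map_of_mem hz)⟩
  · rintro ⟨h1, h2⟩
    have := add_mem (hX _ h1) (hY _ h2)
    simpa using this

variable (hP : IsFlatResolution P ε) (hP' : IsFlatResolution P' ε') (φ : P ⟶ P')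
  (hφ : ∀ x, ε' (φ.f 0 x) = ε x) (I : Ideal E)

include hP hP' hφ

/-- Reduction modulo an ideal of a map between flat resolutions of the same module is injective
on homology. -/
theorem IsFlatResolution.injective_mod_ideal (n : ℕ) (x : P.X n) (y : P'.X (n + 1))
    (hx : ∀ j, P.d n j x ∈ I • (⊤ : Submodule E (P.X j)))
    (hxy : φ.f n x - P'.d (n + 1) n y ∈ I • (⊤ : Submodule E (P'.X n))) :
    ∃ x', x - P.d (n + 1) n x' ∈ I • (⊤ : Submodule E (P.X n)) := by
  obtain ⟨h0, hd⟩ := hP.exact hP' φ hφ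
  -- The pair `(-y, x)` is a cycle of the cone modulo `I`. The second component of a chain that
  -- bounds it modulo `I` bounds `x`, up to a sign.
  have hc : coneD φ n (-y, x) ∈ I • (⊤ : Submodule E (ConeX P P' n)) := by
    have h1 : P'.d (n + 1) n (-y) + φ.f n x ∈ I • (⊤ : Submodule E (P'.X n)) := by
      rwa [map_neg, neg_add_eq_sub]
    rcases n with _ | n
    · exact h1
    · exact mem_smul_top_prod.2 ⟨h1, neg_mem (hx n)⟩
  obtain ⟨c', hc'⟩ := exact_mod_ideal _ (coneD φ) (flat_coneX hP hP') h0 hd I n hc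
  refine ⟨-c'.2, ?_⟩
  have := (mem_smul_top_prod.1 hc').2
  change x - -(P.d (n + 1) n c'.2) ∈ _ at this
  rwa [map_neg]

/-- Reduction modulo an ideal of a map between flat resolutions of the same module is surjective
on homology. -/
theorem IsFlatResolution.surjective_mod_ideal (n : ℕ) (y : P'.X n)
    (hy : ∀ j, P'.d n j y ∈ I • (⊤ : Submodule E (P'.X j))) :
    ∃ (x : P.X n) (y' : P'.X (n + 1)), (∀ j, P.d n j x ∈ I • (⊤ : Submodule E (P.X j))) ∧
      y - φ.f n x - P'.d (n + 1) n y' ∈ I • (⊤ : Submodule E (P'.X n)) := by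
  obtain ⟨h0, hd⟩ := hP.exact hP' φ hφ
  rcases n with _ | n
  · obtain ⟨⟨y', x⟩, h⟩ := h0 y
    refine ⟨x, y', fun j => ?_, ?_⟩
    · rw [P.shape _ _ (by simp)]
      exact zero_mem _
    · have h' : P'.d 1 0 y' + φ.f 0 x = y := h
      rw [← h', add_sub_cancel_right, sub_self]
      exact zero_mem _
  · have hc : coneD φ n (y, 0) ∈ I • (⊤ : Submodule E (ConeX P P' n)) := by
      have h1 : P'.d (n + 1) n y + φ.f n 0 ∈ I • (⊤ : Submodule E (P'.X n)) := by
        rw [map_zero, add_zero]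
        exact hy n
      rcases n with _ | n
      · exact h1
      · refine mem_smul_top_prod.2 ⟨h1, ?_⟩
        change -(P.d (n + 1) n 0) ∈ _
        rw [map_zero, neg_zero]
        exact zero_mem _
    obtain ⟨⟨y', x⟩, hc'⟩ := exact_mod_ideal _ (coneD φ) (flat_coneX hP hP') h0 hd I n hc
    have h := mem_smul_top_prod.1 hc'
    refine ⟨x, y', fun j => ?_, ?_⟩
    · by_cases hj : j = n
      · subst hj
        have := h.2
        change 0 - -(P.d (j + 1) j x) ∈ _ at this
        rwa [zero_sub, neg_neg] at this
      · rw [P.shape _ _ (by simpa using hj)]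
        exact zero_mem _
    · have := h.1
      change y - (P'.d (n + 2) (n + 1) y' + φ.f (n + 1) x) ∈ _ at this
      rwa [sub_sub, add_comm (φ.f (n + 1) x)]

end FlatComplexes

/-! ### Kernels of tensor products of semilinear surjections -/

section Tensor

/-- The kernel of a tensor product of two surjective maps that are semilinear for a surjective
ring homomorphism. -/
lemma mem_of_tensor_eq_zero {E A U X W Y : Type*} [CommRing E] [CommRing A] [AddCommGroup U]
    [Module E U] [AddCommGroup X] [Module E X] [AddCommGroup W] [Module A W] [AddCommGroup Y]
    [Module A Y] (k : E →+* A) (hk : Function.Surjective k) (r : U →+ W)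
    (hr : Function.Surjective r) (c : X →+ Y) (hc : Function.Surjective c)
    (hrk : ∀ e u, r (e • u) = k e • r u) (hck : ∀ e x, c (e • x) = k e • c x)
    (q : U ⊗[E] X →+ W ⊗[A] Y) (hq : ∀ u x, q (u ⊗ₜ x) = r u ⊗ₜ c x) (K : AddSubgroup (U ⊗[E] X))
    (h1 : ∀ u x, r u = 0 → u ⊗ₜ x ∈ K) (h2 : ∀ u x, c x = 0 → u ⊗ₜ x ∈ K) {t : U ⊗[E] X}
    (ht : q t = 0) : t ∈ K := by
  have h3 : ∀ u u' x x', r u = r u' → c x = c x' →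
      QuotientAddGroup.mk' K (u ⊗ₜ x) = QuotientAddGroup.mk' K (u' ⊗ₜ x') := by
    intro u u' x x' hu hx
    rw [← sub_eq_zero, ← map_sub]
    refine (QuotientAddGroup.eq_zero_iff _).2 ?_
    have e : u ⊗ₜ[E] x - u' ⊗ₜ x' = (u - u') ⊗ₜ x + u' ⊗ₜ (x - x') := by
      rw [TensorProduct.sub_tmul, TensorProduct.tmul_sub]; abel
    rw [e]
    exact add_mem (h1 _ _ (by rw [map_sub, hu, sub_self])) (h2 _ _ (by rw [map_sub, hx, sub_self]))
  -- A left inverse of `q` modulo `K`, built from arbitrary preimages. By `h3` the choices do not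
  -- matter modulo `K`, which yields additivity and balancedness.
  let p₀ : W →+ Y →+ (U ⊗[E] X) ⧸ K := AddMonoidHom.mk'
    (fun w => AddMonoidHom.mk' (fun y => QuotientAddGroup.mk' K
      (Function.surjInv hr w ⊗ₜ Function.surjInv hc y)) (fun y y' => by
        rw [← map_add, ← TensorProduct.tmul_add]
        exact h3 _ _ _ _ rfl (by simp only [map_add, Function.surjInv_eq])))
    (fun w w' => by
      ext y
      change QuotientAddGroup.mk' K _ = QuotientAddGroup.mk' K _ + QuotientAddGroup.mk' K _
      rw [← map_add, ← TensorProduct.add_tmul]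
      exact h3 _ _ _ _ (by simp only [map_add, Function.surjInv_eq]) rfl)
  let p : W ⊗[A] Y →+ (U ⊗[E] X) ⧸ K := TensorProduct.liftAddHom p₀ (fun a w y => by
    obtain ⟨e, rfl⟩ := hk a
    change QuotientAddGroup.mk' K _ = QuotientAddGroup.mk' K _
    refine (h3 _ (e • Function.surjInv hr w) _ (Function.surjInv hc y) ?_ rfl).trans ?_
    · rw [hrk, Function.surjInv_eq hr, Function.surjInv_eq hr]
    · rw [TensorProduct.smul_tmul]
      refine h3 _ _ _ _ rfl ?_
      rw [hck, Function.surjInv_eq hc, Function.surjInv_eq hc])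
  have hpq : ∀ t, p (q t) = QuotientAddGroup.mk' K t := fun t => by
    induction t using TensorProduct.induction_on with
    | zero => rw [map_zero, map_zero, map_zero]
    | tmul u x =>
      rw [hq]
      exact h3 _ _ _ _ (Function.surjInv_eq hr _) (Function.surjInv_eq hc _)
    | add x y hx hy => rw [map_add, map_add, map_add, hx, hy]
  refine (QuotientAddGroup.eq_zero_iff t).1 ((hpq t).symm.trans ?_)
  rw [ht, map_zero]

end Tensor

/-! ### Homology of complexes of modules in terms of elements -/

section Homology

variable {S : Type u} [CommRing S] {C D : ChainComplex (ModuleCat.{u} S) ℕ}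

lemma exists_cycle (n : ℕ) {x : C.X n} (hx : ∀ j, C.d n j x = 0) :
    ∃ z : C.cycles n, C.iCycles n z = x := by
  let k : ModuleCat.of S S ⟶ C.X n := ModuleCat.ofHom (LinearMap.toSpanSingleton S _ x)
  have hk : k ≫ C.d n ((ComplexShape.down ℕ).next n) = 0 := by
    ext
    simp [k, hx]
  refine ⟨C.liftCycles k _ rfl hk (1 : S), ?_⟩
  rw [← ConcreteCategory.comp_apply, HomologicalComplex.liftCycles_i]
  simp [k]

lemma homologyπ_surjective (C : ChainComplex (ModuleCat.{u} S) ℕ) (n : ℕ) :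
    Function.Surjective (C.homologyπ n) :=
  (ModuleCat.epi_iff_surjective _).1 inferInstance

lemma iCycles_injective (C : ChainComplex (ModuleCat.{u} S) ℕ) (n : ℕ) :
    Function.Injective (C.iCycles n) :=
  (ModuleCat.mono_iff_injective _).1 inferInstance

lemma d_iCycles_apply (n j : ℕ) (z : C.cycles n) : C.d n j (C.iCycles n z) = 0 := by
  rw [← ConcreteCategory.comp_apply, HomologicalComplex.iCycles_d]
  rfl

lemma homologyπ_eq_zero_iff (n : ℕ) (z : C.cycles n) :
    C.homologyπ n z = 0 ↔ ∃ y, C.d (n + 1) n y = C.iCycles n z := by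
  have h := ShortComplex.exact_of_g_is_cokernel
    (ShortComplex.mk (C.toCycles (n + 1) n) (C.homologyπ n) (by simp))
    (C.homologyIsCokernel (n + 1) n (by simp))
  rw [ShortComplex.ShortExact.moduleCat_exact_iff_function_exact] at h
  refine (h z).trans ⟨fun ⟨y, hy⟩ => ⟨y, ?_⟩, fun ⟨y, hy⟩ => ⟨y, iCycles_injective C n ?_⟩⟩
  · rw [← hy]
    dsimp only
    rw [← ConcreteCategory.comp_apply, HomologicalComplex.toCycles_i]
  · dsimp only
    rw [← ConcreteCategory.comp_apply, HomologicalComplex.toCycles_i, hy]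

lemma quasiIso_of_elements (f : C ⟶ D)
    (inj : ∀ n (x : C.X n) (y : D.X (n + 1)), (∀ j, C.d n j x = 0) →
      f.f n x = D.d (n + 1) n y → ∃ x', C.d (n + 1) n x' = x)
    (surj : ∀ n (y : D.X n), (∀ j, D.d n j y = 0) → ∃ (x : C.X n) (y' : D.X (n + 1)),
      (∀ j, C.d n j x = 0) ∧ y = f.f n x + D.d (n + 1) n y') : QuasiIso f := by
  refine ⟨fun n => ?_⟩
  rw [quasiIsoAt_iff_isIso_homologyMap, ConcreteCategory.isIso_iff_bijective]
  have hcomm : ∀ z, D.iCycles n (HomologicalComplex.cyclesMap f n z) = f.f n (C.iCycles n z) := by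
    intro z
    rw [← ConcreteCategory.comp_apply, HomologicalComplex.cyclesMap_i, ConcreteCategory.comp_apply]
  have hπ : ∀ z, HomologicalComplex.homologyMap f n (C.homologyπ n z) =
      D.homologyπ n (HomologicalComplex.cyclesMap f n z) := by
    intro z
    rw [← ConcreteCategory.comp_apply, HomologicalComplex.homologyπ_naturality,
      ConcreteCategory.comp_apply]
  constructor
  · refine (injective_iff_map_eq_zero _).2 fun w hw => ?_
    obtain ⟨z, rfl⟩ := homologyπ_surjective C n w
    rw [hπ, homologyπ_eq_zero_iff] at hw
    obtain ⟨y, hy⟩ := hw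
    rw [homologyπ_eq_zero_iff]
    exact inj n _ y (fun j => d_iCycles_apply n j z) (by rw [hy, hcomm])
  · intro w
    obtain ⟨z, rfl⟩ := homologyπ_surjective D n w
    obtain ⟨x, y', hx, hxy⟩ := surj n _ (fun j => d_iCycles_apply n j z)
    obtain ⟨z', rfl⟩ := exists_cycle n hx
    refine ⟨C.homologyπ n z', ?_⟩
    rw [hπ, ← sub_eq_zero, ← map_sub, homologyπ_eq_zero_iff]
    exact ⟨-y', by rw [map_neg, map_sub, hcomm, hxy]; abel⟩

end Homology

/-! ### Homology and flat extension of scalars -/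

section FlatExtension

variable {A S : Type u} [CommRing A] [CommRing S] {f : A →+* S}

open ModuleCat in
lemma preservesHomology_extendScalars (hf : f.Flat) :
    (extendScalars.{u, u, u} f).PreservesHomology := by
  algebraize [f]
  have := hf
  refine Functor.preservesHomology_of_map_exact _ fun T hT => ?_
  rw [ShortComplex.ShortExact.moduleCat_exact_iff_function_exact] at hT ⊢
  exact Module.Flat.lTensor_exact S hT

variable {C : ChainComplex (ModuleCat.{u} A) ℕ} {D : ChainComplex (ModuleCat.{u} S) ℕ}

lemma homologyπ_mapHomologyIso {𝒜 ℬ : Type*} [Category 𝒜] [Category ℬ]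
    [Limits.HasZeroMorphisms 𝒜] [Limits.HasZeroMorphisms ℬ] (L : 𝒜 ⥤ ℬ) [L.PreservesZeroMorphisms]
    (T : ShortComplex 𝒜) [T.HasHomology] [(T.map L).HasHomology] [L.PreservesLeftHomologyOf T] :
    (T.map L).homologyπ ≫ (T.mapHomologyIso L).hom =
      (T.mapCyclesIso L).hom ≫ L.map T.homologyπ := by
  have h1 : T.leftHomologyData.cyclesIso.inv = 𝟙 T.cycles :=
    (cancel_mono T.iCycles).1 ((ShortComplex.LeftHomologyData.cyclesIso_inv_comp_iCycles _).trans
      (Category.id_comp _).symm)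
  have h2 : T.leftHomologyData.π ≫ T.leftHomologyData.homologyIso.inv = T.homologyπ :=
    (ShortComplex.LeftHomologyData.π_comp_homologyIso_inv (S := T) _).trans
      ((congrArg (· ≫ T.homologyπ) h1).trans (Category.id_comp _))
  rw [T.leftHomologyData.mapHomologyIso_eq L]
  have h3 := ShortComplex.LeftHomologyData.homologyπ_comp_homologyIso_hom
    (h := T.leftHomologyData.map L)
  have h4 := congrArg (fun g : (T.map L).cycles ⟶ L.obj T.leftHomologyData.H =>
    g ≫ L.map T.leftHomologyData.homologyIso.inv) h3
  refine (Category.assoc _ _ _).symm.trans (h4.trans ((Category.assoc _ _ _).trans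
    (congrArg ((T.mapCyclesIso L).hom ≫ ·) ?_)))
  rw [← h2]
  exact (L.map_comp _ _).symm

/-- Adjunct maps of short complexes induce adjunct maps on homology. -/
lemma homologyMap_adjunct {𝒜 ℬ : Type*} [Category 𝒜] [Category ℬ] [Preadditive 𝒜] [Preadditive ℬ]
    [CategoryWithHomology 𝒜] [CategoryWithHomology ℬ] {L : 𝒜 ⥤ ℬ} {G : ℬ ⥤ 𝒜} (adj : L ⊣ G)
    [L.PreservesZeroMorphisms] [G.PreservesZeroMorphisms] [L.PreservesHomology]
    [G.PreservesHomology] {T : ShortComplex 𝒜} {T' : ShortComplex ℬ} (φ : T ⟶ T'.map G)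
    (ψ : T.map L ⟶ T') (h : ψ.τ₂ = (adj.homEquiv T.X₂ T'.X₂).symm φ.τ₂) :
    (adj.homEquiv _ _).symm (ShortComplex.homologyMap φ ≫ (T'.mapHomologyIso G).hom) =
      (T.mapHomologyIso L).inv ≫ ShortComplex.homologyMap ψ := by
  have hL : L.map T.homologyπ ≫ (T.mapHomologyIso L).inv =
      (T.mapCyclesIso L).inv ≫ (T.map L).homologyπ := by
    rw [Iso.comp_inv_eq, Category.assoc, homologyπ_mapHomologyIso, Iso.inv_hom_id_assoc]
  let φ₂ : T.X₂ ⟶ G.obj T'.X₂ := φ.τ₂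
  let ψ₂ : L.obj T.X₂ ⟶ T'.X₂ := ψ.τ₂
  have hi : (ShortComplex.cyclesMap φ ≫ (T'.mapCyclesIso G).hom) ≫ G.map T'.iCycles =
      T.iCycles ≫ φ₂ :=
    (Category.assoc _ _ _).trans ((congrArg (ShortComplex.cyclesMap φ ≫ ·)
      (ShortComplex.mapCyclesIso_hom_iCycles T' G)).trans (ShortComplex.cyclesMap_i φ))
  have hi' : ((T.mapCyclesIso L).inv ≫ ShortComplex.cyclesMap ψ) ≫ T'.iCycles =
      L.map T.iCycles ≫ ψ₂ := by
    rw [Category.assoc, Iso.inv_comp_eq, ← Category.assoc]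
    exact (ShortComplex.cyclesMap_i ψ).trans (congrArg (· ≫ ψ₂)
      (ShortComplex.mapCyclesIso_hom_iCycles T L).symm)
  have hcyc : (adj.homEquiv _ _).symm (ShortComplex.cyclesMap φ ≫ (T'.mapCyclesIso G).hom) =
      (T.mapCyclesIso L).inv ≫ ShortComplex.cyclesMap ψ := by
    rw [← cancel_mono T'.iCycles, ← Adjunction.homEquiv_naturality_right_symm, hi, hi',
      Adjunction.homEquiv_naturality_left_symm]
    exact congrArg (L.map T.iCycles ≫ ·) h.symm
  -- A left adjoint preserves the epimorphism from cycles to homology. So the identity may be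
  -- checked on cycles, where it is `hcyc`.
  have : Epi (L.map T.homologyπ) := by
    have := adj.isLeftAdjoint
    infer_instance
  rw [← cancel_epi (L.map T.homologyπ), ← Adjunction.homEquiv_naturality_left_symm,
    ShortComplex.homologyπ_naturality_assoc, homologyπ_mapHomologyIso, ← Category.assoc,
    Adjunction.homEquiv_naturality_right_symm, hcyc, ← Category.assoc, hL, Category.assoc,
    Category.assoc, ShortComplex.homologyπ_naturality]

/-- By flatness `S ⊗ Hₙ(C)` is `Hₙ(S ⊗ C)`. Under this identification the map is the one induced on
homology by `extendHom φ`. -/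
theorem isIso_extendHomology (hf : f.Flat) (φ : C ⟶ restrictComplex f D)
    (h : QuasiIso (extendHom φ)) (n : ℕ) : IsIso (extendHomology φ n) := by
  have := preservesHomology_extendScalars hf
  have e := homologyMap_adjunct (ModuleCat.extendRestrictScalarsAdj.{u, u, u} f)
    (T := C.sc n) (T' := D.sc n) ((HomologicalComplex.shortComplexFunctor _ _ n).map φ)
    ((HomologicalComplex.shortComplexFunctor _ _ n).map (extendHom φ)) rfl
  have h1 : IsIso (HomologicalComplex.homologyMap (extendHom φ) n) := inferInstance
  have h2 := IsIso.comp_isIso' (Iso.isIso_inv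
    ((C.sc n).mapHomologyIso (ModuleCat.extendScalars.{u, u, u} f))) h1
  exact (congrArg (fun g => IsIso g) e).mpr h2

end FlatExtension

/-! ### Base change of flat resolutions -/

section BaseChange

variable {A S : Type u} [CommRing A] [CommRing S] {f : A →+* S}
  {C : ChainComplex (ModuleCat.{u} A) ℕ}

theorem IsFlatResolution.extend (hf : f.Flat) {N₀ : ModuleCat.{u} A} {ε : C.X 0 ⟶ N₀}
    (h : IsFlatResolution C ε) {N : ModuleCat.{u} S}
    (j : N₀ ⟶ (ModuleCat.restrictScalars.{u, u, u} f).obj N)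
    (hj : Function.Bijective
      (((ModuleCat.extendRestrictScalarsAdj.{u, u, u} f).homEquiv N₀ N).symm j)) :
    IsFlatResolution (extendComplex f C)
      (((ModuleCat.extendRestrictScalarsAdj.{u, u, u} f).homEquiv (C.X 0) N).symm (ε ≫ j)) := by
  algebraize [f]
  rw [Adjunction.homEquiv_naturality_left_symm]
  refine ⟨fun n => ?_, ?_, ?_, fun n => ?_⟩
  · have := h.flat n
    exact inferInstanceAs (Module.Flat S (S ⊗[A] C.X n))
  · exact hj.2.comp (LinearMap.lTensor_surjective S (g := ε.hom) h.surjective)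
  · intro x
    have h1 := lTensor_exact S (f := (C.d 1 0).hom) (g := ε.hom) h.exact_zero h.surjective
    refine Iff.trans ?_ (h1 x)
    exact map_eq_zero_iff
      (((ModuleCat.extendRestrictScalarsAdj.{u, u, u} f).homEquiv N₀ N).symm j).hom hj.1
  · exact Module.Flat.lTensor_exact S (f := (C.d (n + 2) (n + 1)).hom)
      (g := (C.d (n + 1) n).hom) (h.exact_succ n)

/-- Every element of the extended module has the form `s ⊗ x`. If its image `s • y` vanishes, then
`s` lies in the extension of an ideal that kills `x`. This is used for algebras regarded as modules
over their tensor squares, with `x = 1` and `y = 1`. -/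
lemma bijective_of_cyclic {N₀ : ModuleCat.{u} A} {N : ModuleCat.{u} S}
    (j : N₀ ⟶ (ModuleCat.restrictScalars.{u, u, u} f).obj N) (x : N₀) (y : N) (hy : j x = y)
    (hx : ∀ n, ∃ a : A, a • x = n) (hy' : ∀ n, ∃ s : S, s • y = n) (I : Ideal A)
    (hI : ∀ a ∈ I, a • x = 0) (hk : ∀ s : S, s • y = 0 → s ∈ I.map f) :
    Function.Bijective
      (((ModuleCat.extendRestrictScalarsAdj.{u, u, u} f).homEquiv N₀ N).symm j) := by
  let U := (ModuleCat.restrictScalars.{u, u, u} f).obj (ModuleCat.of S S)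
  have hU : ∀ (a : A) (s : U), a • s = (show U from f a * (show S from s)) := fun _ _ => rfl
  have h1 : ∀ t : TensorProduct A U N₀, ∃ s : U, t = s ⊗ₜ x := by
    intro t
    induction t using TensorProduct.induction_on with
    | zero => exact ⟨0, (TensorProduct.zero_tmul _ _).symm⟩
    | tmul s n =>
      obtain ⟨a, rfl⟩ := hx n
      exact ⟨a • s, (TensorProduct.smul_tmul a s x).symm⟩
    | add t t' ht ht' =>
      obtain ⟨s, rfl⟩ := ht
      obtain ⟨s', rfl⟩ := ht'
      exact ⟨s + s', (TensorProduct.add_tmul _ _ _).symm⟩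
  constructor
  · refine (injective_iff_map_eq_zero _).2 fun t ht => ?_
    obtain ⟨s, rfl⟩ := h1 t
    have h2 := hk s ((congrArg (fun z : N => (show S from s) • z) hy.symm).trans ht)
    change (s : U) ⊗ₜ[A] x = 0
    have h3 : ∀ s : S, s ∈ I.map f → (show U from s) ⊗ₜ[A] x = 0 := by
      intro s hs
      refine Submodule.span_induction ?_ ?_ ?_ ?_ hs
      · rintro _ ⟨a, ha, rfl⟩
        have h4 : (show U from f a) = a • (show U from (1 : S)) := by
          rw [hU]
          exact (mul_one (f a)).symm
        rw [h4, TensorProduct.smul_tmul, hI a ha, TensorProduct.tmul_zero]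
      · exact TensorProduct.zero_tmul _ _
      · intro s s' _ _ h h'
        refine (TensorProduct.add_tmul (show U from s) (show U from s') x).trans ?_
        rw [h, h', add_zero]
      · intro r s _ h
        have h5 := congrArg (LinearMap.lsmul S ((ModuleCat.extendScalars.{u, u, u} f).obj N₀) r) h
        exact h5.trans (map_zero _)
    exact h3 _ h2
  · intro n
    obtain ⟨s, rfl⟩ := hy' n
    exact ⟨(show U from s) ⊗ₜ[A] x, congrArg (fun z : N => s • z) hy⟩

end BaseChange

/-! ### The bar resolution for functors on finite sets -/

section Bar

variable {V : Type u} [CommRing V]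

lemma BarChains.b'_apply (F : FinAlgebra V) {E : Type u} [CommRing E] [Algebra V E]
    (v : E →ₐ[V] F.X 2) (n : ℕ) (x : F.X (n + 3)) :
    BarChains.b' F v n x = ∑ i : Fin (n + 2), (-1 : ℤ) ^ (i : ℕ) • F.map (barFace n i) x := by
  refine (LinearMap.sum_apply _ _ _).trans (Finset.sum_congr rfl fun i _ => ?_)
  rfl

lemma barOf_d (F : FinAlgebra V) {E : Type u} [CommRing E] [Algebra V E] (v : E →ₐ[V] F.X 2)
    (n : ℕ) : (barOf F v).d (n + 1) n = ModuleCat.ofHom (BarChains.b' F v n) :=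
  ChainComplex.of_d (fun n => ModuleCat.of E (BarChains F v n))
    (fun n => ModuleCat.ofHom (BarChains.b' F v n)) _

lemma FinAlgebra.map_map_apply (F : FinAlgebra V) {l m n : ℕ} (f : Fin m → Fin n)
    (g : Fin l → Fin m) (x : F.X l) : F.map f (F.map g x) = F.map (f ∘ g) x :=
  DFunLike.congr_fun (F.map_comp f g) x

lemma FinAlgebra.map_id_apply (F : FinAlgebra V) {n : ℕ} (x : F.X n) :
    F.map (id : Fin n → Fin n) x = x :=
  DFunLike.congr_fun (F.map_id n) x

lemma barFace_zero_succ (n : ℕ) : barFace n 0 ∘ Fin.succ = id := by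
  ext j
  simp [barFace]

lemma barFace_succ_succ (n : ℕ) (i : Fin (n + 2)) :
    barFace (n + 1) i.succ ∘ Fin.succ = Fin.succ ∘ barFace n i := by
  ext j
  simp only [barFace, Function.comp_apply, Fin.val_succ]
  split_ifs <;> omega

lemma barFace_one_succ : barFace 0 1 ∘ Fin.succ =
    (fun _ : Fin 1 => (1 : Fin 2)) ∘ fun _ : Fin 2 => (0 : Fin 1) := by
  ext j
  fin_cases j <;> simp [barFace]

/-- The map for `Fin.succ` puts a factor `1` in front. The zeroth face undoes it, and the other
faces commute with it up to a shift of the index, which changes the sign. Additivity of this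
contraction suffices; it need not be linear over the outer factors. -/
lemma b'_contraction (F : FinAlgebra V) {E : Type u} [CommRing E] [Algebra V E]
    (v : E →ₐ[V] F.X 2) (n : ℕ) (x : F.X (n + 3)) (hx : BarChains.b' F v n x = 0) :
    BarChains.b' F v (n + 1) (F.map (Fin.succ : Fin (n + 3) → Fin (n + 4)) x) = x := by
  rw [BarChains.b'_apply] at hx
  have h1 := congrArg (F.map (Fin.succ : Fin (n + 2) → Fin (n + 3))) hx
  have h2 := h1.trans (map_zero (F.map (Fin.succ : Fin (n + 2) → Fin (n + 3))))
  rw [map_sum] at h2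
  rw [BarChains.b'_apply, Fin.sum_univ_succ, F.map_map_apply, barFace_zero_succ, F.map_id_apply]
  have h3 : ∑ i : Fin (n + 2), (-1 : ℤ) ^ (i.succ : ℕ) • F.map (barFace (n + 1) i.succ)
      (F.map (Fin.succ : Fin (n + 3) → Fin (n + 4)) x) = 0 := by
    refine Eq.trans ?_ ((congrArg Neg.neg h2).trans neg_zero)
    rw [← Finset.sum_neg_distrib]
    refine Finset.sum_congr rfl fun i _ => ?_
    rw [F.map_map_apply, barFace_succ_succ, ← F.map_map_apply, map_zsmul, Fin.val_succ, pow_succ]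
    simp
  simp only [Fin.val_zero, pow_zero, one_smul]
  exact (congrArg (x + ·) h3).trans (add_zero x)

/-- In the lowest degree the remaining face factors through the multiplication, so the augmentation
plays the role of the differential. -/
lemma b'_contraction_zero (F : FinAlgebra V) {E : Type u} [CommRing E] [Algebra V E]
    (v : E →ₐ[V] F.X 2) (x : F.X 2) (hx : F.map (fun _ => (0 : Fin 1)) x = 0) :
    BarChains.b' F v 0 (F.map (Fin.succ : Fin 2 → Fin 3) x) = x := by
  rw [BarChains.b'_apply, Fin.sum_univ_two, F.map_map_apply, F.map_map_apply, barFace_zero_succ,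
    barFace_one_succ, ← F.map_map_apply (fun _ : Fin 1 => (1 : Fin 2)), hx, F.map_id_apply]
  simp
  rfl

lemma map_zero_b' (F : FinAlgebra V) {E : Type u} [CommRing E] [Algebra V E]
    (v : E →ₐ[V] F.X 2) (y : F.X 3) :
    F.map (fun _ : Fin 2 => (0 : Fin 1)) (BarChains.b' F v 0 y) = 0 := by
  refine (congrArg (F.map (fun _ : Fin 2 => (0 : Fin 1))) (BarChains.b'_apply F v 0 y)).trans ?_
  rw [Fin.sum_univ_two, map_add, map_zsmul, map_zsmul, F.map_map_apply, F.map_map_apply]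
  simp [Function.comp_def]

/-- Exactness is formal, from the contraction, and therefore also available for completed tensor
powers. Flatness of the terms is the only analytic input. -/
theorem isFlatResolution_barOf (F : FinAlgebra V) {E : Type u} [CommRing E] [Algebra V E]
    (v : E →ₐ[V] F.X 2) (hv : Function.Bijective v)
    (hflat : ∀ n, (F.map (endpoints n)).toRingHom.Flat) {N : ModuleCat.{u} E}
    (ε : (barOf F v).X 0 ⟶ N) (hε : Function.Surjective ε)
    (hker : ∀ x : F.X 2, ε x = 0 ↔ F.map (fun _ => (0 : Fin 1)) x = 0) :
    IsFlatResolution (barOf F v) ε := by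
  refine ⟨fun n => ?_, hε, fun x => ⟨fun hx => ?_, ?_⟩, fun n x => ⟨fun hx => ?_, ?_⟩⟩
  · exact RingHom.Flat.comp (f := v.toRingHom) (g := (F.map (endpoints n)).toRingHom)
      (RingHom.Flat.of_bijective hv) (hflat n)
  · rw [barOf_d]
    exact ⟨_, b'_contraction_zero F v x ((hker x).1 hx)⟩
  · rintro ⟨y, rfl⟩
    rw [barOf_d]
    exact (hker _).2 (map_zero_b' F v y)
  · rw [barOf_d] at hx ⊢
    exact ⟨_, b'_contraction F v n x hx⟩
  · rintro ⟨y, rfl⟩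
    exact d_d_apply _ y

/-- The chain map between bar complexes induced by a natural transformation. -/
def barMap {F G : FinAlgebra V} (η : F.Hom G) :
    barOf F (AlgHom.id V (F.X 2)) ⟶
      restrictComplex (η.app 2).toRingHom (barOf G (AlgHom.id V (G.X 2))) where
  f n := ModuleCat.ofHom
    (Y := (ModuleCat.restrictScalars (η.app 2).toRingHom).obj
      (ModuleCat.of (G.X 2) (BarChains G (AlgHom.id V (G.X 2)) n)))
    { toFun := fun x => (η.app (n + 2)).toFun x
      map_add' := fun x y => map_add (η.app (n + 2)) x y
      map_smul' := fun a x => by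
        have h₁ := DFunLike.congr_fun (η.naturality (endpoints n)) a
        have h₃ := map_mul (η.app (n + 2)) (F.map (endpoints n) a) x
        refine h₃.trans ?_
        rw [AlgHom.comp_apply, AlgHom.comp_apply] at h₁
        rw [h₁]
        rfl }
  comm' i j hij := by
    obtain rfl : j + 1 = i := hij
    have e₃ : (restrictComplex (η.app 2).toRingHom (barOf G (AlgHom.id V (G.X 2)))).d (j + 1) j =
        (ModuleCat.restrictScalars (η.app 2).toRingHom).map
          ((barOf G (AlgHom.id V (G.X 2))).d (j + 1) j) := rfl
    rw [barOf_d, e₃, barOf_d]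
    refine ModuleCat.hom_ext (LinearMap.ext fun x => ?_)
    change BarChains.b' G _ j (η.app (j + 3) x) = η.app (j + 2) (BarChains.b' F _ j x)
    refine (BarChains.b'_apply G _ j _).trans ?_
    refine Eq.trans ?_ (congrArg (η.app (j + 2)) (BarChains.b'_apply F _ j x)).symm
    refine Eq.trans (Finset.sum_congr rfl fun i _ => ?_) (map_sum (η.app (j + 2)) _ _).symm
    refine Eq.trans ?_ (map_zsmul (η.app (j + 2)) _ _).symm
    exact congrArg _ (DFunLike.congr_fun (η.naturality (barFace j i)) x).symm

end Bar

/-! ### Reductions of flat resolutions modulo an ideal -/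

section Quotients

variable {E S : Type u} [CommRing E] [CommRing S] {P P' : ChainComplex (ModuleCat.{u} E) ℕ}
  {N : ModuleCat.{u} E} {ε : P.X 0 ⟶ N} {ε' : P'.X 0 ⟶ N}
  {C D : ChainComplex (ModuleCat.{u} S) ℕ}

/-- `q` identifies the complex `C` with the reduction of `P` modulo the ideal `I`. -/
structure IsReduction (I : Ideal E) (q : ∀ n, P.X n →+ C.X n) : Prop where
  surjective : ∀ n, Function.Surjective (q n)
  eq_zero_iff : ∀ n x, q n x = 0 ↔ x ∈ I • (⊤ : Submodule E (P.X n))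
  comm : ∀ n x, q n (P.d (n + 1) n x) = C.d (n + 1) n (q (n + 1) x)

lemma IsReduction.d_eq_zero_iff {I : Ideal E} {q : ∀ n, P.X n →+ C.X n} (hq : IsReduction I q)
    {n : ℕ} {x : P.X n} : (∀ j, C.d n j (q n x) = 0) ↔
      ∀ j, P.d n j x ∈ I • (⊤ : Submodule E (P.X j)) := by
  refine forall_congr' fun j => ?_
  by_cases hj : j + 1 = n
  · subst hj
    rw [← hq.comm, hq.eq_zero_iff]
  · rw [C.shape _ _ hj, P.shape _ _ hj]
    exact iff_of_true rfl (zero_mem _)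

/-- Cycles and boundaries of the reduced complexes lift to cycles and boundaries modulo `I` of the
resolutions, where the exactness of the cone modulo `I` applies. -/
theorem quasiIso_of_isReduction (hP : IsFlatResolution P ε) (hP' : IsFlatResolution P' ε')
    (φ : P ⟶ P') (hφ : ∀ x, ε' (φ.f 0 x) = ε x) (I : Ideal E) (f : C ⟶ D)
    {q : ∀ n, P.X n →+ C.X n} (hq : IsReduction I q) {q' : ∀ n, P'.X n →+ D.X n}
    (hq' : IsReduction I q') (h : ∀ n x, q' n (φ.f n x) = f.f n (q n x)) : QuasiIso f := by
  refine quasiIso_of_elements f (fun n x y hx hxy => ?_) (fun n y hy => ?_)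
  · obtain ⟨x, rfl⟩ := hq.surjective n x
    obtain ⟨y, rfl⟩ := hq'.surjective _ y
    obtain ⟨x', hx'⟩ := hP.injective_mod_ideal hP' φ hφ I n x y (hq.d_eq_zero_iff.1 hx) (by
      rw [← hq'.eq_zero_iff, map_sub, hq'.comm, h, hxy, sub_self])
    rw [← hq.eq_zero_iff, map_sub, hq.comm, sub_eq_zero] at hx'
    exact ⟨_, hx'.symm⟩
  · obtain ⟨y, rfl⟩ := hq'.surjective n y
    obtain ⟨x, y', hx, hy'⟩ := hP.surjective_mod_ideal hP' φ hφ I n y (hq'.d_eq_zero_iff.1 hy)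
    rw [← hq'.eq_zero_iff, map_sub, map_sub, hq'.comm, h, sub_sub, sub_eq_zero] at hy'
    exact ⟨_, _, hq.d_eq_zero_iff.2 hx, hy'⟩

end Quotients

section SemilinearTensor

variable {E A U X W Y : Type*} [CommRing E] [CommRing A] [AddCommGroup U]
    [Module E U] [AddCommGroup X] [Module E X] [AddCommGroup W] [Module A W] [AddCommGroup Y]
    [Module A Y] {k : E →+* A} {r : U →+ W} {c : X →+ Y}

/-- The tensor product of two semilinear maps. -/
def semilinearTensor (hrk : ∀ e u, r (e • u) = k e • r u) (hck : ∀ e x, c (e • x) = k e • c x) :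
    U ⊗[E] X →+ W ⊗[A] Y :=
  TensorProduct.liftAddHom
    { toFun := fun u =>
        { toFun := fun x => r u ⊗ₜ c x
          map_zero' := by rw [map_zero, TensorProduct.tmul_zero]
          map_add' := fun x y => by rw [map_add, TensorProduct.tmul_add] }
      map_zero' := by
        ext x
        exact (congrArg (fun w => w ⊗ₜ[A] c x) (map_zero r)).trans (TensorProduct.zero_tmul _ _)
      map_add' := fun u v => by
        ext x
        exact (congrArg (fun w => w ⊗ₜ[A] c x) (map_add r u v)).trans
          (TensorProduct.add_tmul _ _ _) }
    (fun e u x => by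
      change r (e • u) ⊗ₜ[A] c x = r u ⊗ₜ[A] c (e • x)
      rw [hrk, hck, TensorProduct.smul_tmul])

lemma semilinearTensor_surjective (hrk : ∀ e u, r (e • u) = k e • r u)
    (hck : ∀ e x, c (e • x) = k e • c x) (hr : Function.Surjective r)
    (hc : Function.Surjective c) : Function.Surjective (semilinearTensor hrk hck) := by
  intro t
  induction t using TensorProduct.induction_on with
  | zero => exact ⟨0, map_zero _⟩
  | tmul w y =>
    obtain ⟨u, rfl⟩ := hr w
    obtain ⟨x, rfl⟩ := hc y
    exact ⟨u ⊗ₜ x, rfl⟩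
  | add t t' ht ht' =>
    obtain ⟨x, rfl⟩ := ht
    obtain ⟨y, rfl⟩ := ht'
    exact ⟨x + y, map_add _ _ _⟩

end SemilinearTensor

/-! ### The Hochschild complex as the bar complex modulo the diagonal ideal -/

section Reduction

variable {V : Type u} [CommRing V]

/-- The augmentation of the bar complex by the multiplication map. -/
def barAug (F : FinAlgebra V) : (barOf F (AlgHom.id V (F.X 2))).X 0 ⟶
    (ModuleCat.restrictScalars (F.map (fun _ : Fin 2 => (0 : Fin 1))).toRingHom).obj
      (ModuleCat.of (F.X 1) (F.X 1)) :=
  ModuleCat.ofHom (X := BarChains F (AlgHom.id V (F.X 2)) 0)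
    (Y := (ModuleCat.restrictScalars (F.map (fun _ : Fin 2 => (0 : Fin 1))).toRingHom).obj
      (ModuleCat.of (F.X 1) (F.X 1)))
    { toFun := fun x => F.map (fun _ : Fin 2 => (0 : Fin 1)) x
      map_add' := fun x y => map_add (F.map (fun _ : Fin 2 => (0 : Fin 1))) x y
      map_smul' := fun a x => by
        have h₁ : F.map (endpoints 0) a = a := by
          rw [endpoints_zero]
          exact F.map_id_apply a
        exact (map_mul (F.map (fun _ : Fin 2 => (0 : Fin 1))) (F.map (endpoints 0) a) x).trans
          (congrArg (fun a => F.map (fun _ : Fin 2 => (0 : Fin 1)) a *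
            F.map (fun _ : Fin 2 => (0 : Fin 1)) x) h₁) }

lemma FinAlgebra.map_surjective (F : FinAlgebra V) {m n : ℕ} (f : Fin m → Fin n)
    (g : Fin n → Fin m) (h : f ∘ g = id) : Function.Surjective (F.map f) := fun x =>
  ⟨F.map g x, by rw [F.map_map_apply, h, F.map_id_apply]⟩

lemma FinAlgebra.map_const_surjective (F : FinAlgebra V) :
    Function.Surjective (F.map (fun _ : Fin 2 => (0 : Fin 1))) :=
  F.map_surjective _ (fun _ => 0) (funext fun _ => Subsingleton.elim _ _)

theorem isFlatResolution_barAug (F : FinAlgebra V)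
    (hflat : ∀ n, (F.map (endpoints n)).toRingHom.Flat) :
    IsFlatResolution (barOf F (AlgHom.id V (F.X 2))) (barAug F) :=
  isFlatResolution_barOf F _ Function.bijective_id hflat _ F.map_const_surjective fun _ => Iff.rfl

lemma closeUp_surjective (F : FinAlgebra V) (n : ℕ) : Function.Surjective (F.map (closeUp n)) :=
  F.map_surjective _ Fin.castSucc (closeUp_castSucc n)

lemma closeUp_smul (F : FinAlgebra V) {E : Type u} [CommRing E] [Algebra V E] (v : E →ₐ[V] F.X 2)
    {A : Type u} [CommRing A] [Algebra V A] (u : A →ₐ[V] F.X 1) (n : ℕ) (e : E) (a : A)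
    (h : u a = F.map (fun _ => 0) (v e)) (x : BarChains F v n) :
    F.map (closeUp n) (e • x) =
      (show HochschildChains F u n from a • (show HochschildChains F u n from
        F.map (closeUp n) x)) := by
  refine (map_mul (F.map (closeUp n)) (F.map (endpoints n) (v e)) x).trans ?_
  refine congrArg (fun z : F.X (n + 1) => z * F.map (closeUp n) x) ?_
  change _ = F.map _ (u a)
  rw [h, F.map_map_apply, F.map_map_apply, closeUp_endpoints]

lemma closeUp_b' (F : FinAlgebra V) {E : Type u} [CommRing E] [Algebra V E] (v : E →ₐ[V] F.X 2)
    {A : Type u} [CommRing A] [Algebra V A] (u : A →ₐ[V] F.X 1) (n : ℕ) (x : F.X (n + 3)) :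
    F.map (closeUp n) (BarChains.b' F v n x) =
      HochschildChains.b F u n (F.map (closeUp (n + 1)) x) := by
  refine (congrArg (F.map (closeUp n)) (BarChains.b'_apply F v n x)).trans ?_
  refine Eq.trans ?_ (HochschildChains.b_apply F u n _).symm
  rw [map_sum]
  refine Finset.sum_congr rfl fun i _ => ?_
  rw [map_zsmul, F.map_map_apply, closeUp_barFace, ← F.map_map_apply]
  rfl

/-- After closing up, an element of the tensor square acts through its product, so the diagonal
ideal goes to zero. By `hk` nothing else does. -/
theorem isReduction_closeUp (G : FinAlgebra V) {S : Type u} [CommRing S] [Algebra V S]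
    (w : S →ₐ[V] G.X 1)
    (hk : ∀ n, RingHom.ker (G.map (closeUp n)) ≤
      (RingHom.ker (G.map (fun _ : Fin 2 => (0 : Fin 1)))).map (G.map (endpoints n))) :
    IsReduction (P := barOf G (AlgHom.id V (G.X 2))) (C := hochschildOf G w)
      (RingHom.ker (G.map (fun _ : Fin 2 => (0 : Fin 1))))
      (fun n => (G.map (closeUp n)).toRingHom.toAddMonoidHom) := by
  refine ⟨closeUp_surjective G, fun n x => ⟨fun hx => ?_, fun hx => ?_⟩, fun n x => ?_⟩
  · have h1 := hk n hx
    have h2 := Ideal.smul_top_eq_map (R := G.X 2) (S := BarChains G (AlgHom.id V (G.X 2)) n)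
      (RingHom.ker (G.map (fun _ : Fin 2 => (0 : Fin 1))))
    exact (SetLike.ext_iff.1 h2 _).2 h1
  · induction hx using Submodule.smul_induction_on' with
    | smul r hr x _ =>
      refine (map_mul (G.map (closeUp n)) (G.map (endpoints n) r) x).trans ?_
      have h1 : G.map (closeUp n) (G.map (endpoints n) r) = 0 := by
        rw [G.map_map_apply, closeUp_endpoints]
        have h2 := congrArg (G.map (fun _ : Fin 1 => (0 : Fin (n + 1)))) hr
        rw [map_zero, G.map_map_apply] at h2
        exact h2
      exact (congrArg (fun z : G.X (n + 1) => z * G.map (closeUp n) x) h1).trans (zero_mul _)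
    | add x _ y _ hx hy =>
      refine (map_add (G.map (closeUp n)) x y).trans ?_
      exact (congrArg₂ (· + ·) hx hy).trans (add_zero _)
  · rw [barOf_d, hochschildOf_d]
    exact closeUp_b' G _ w n x

end Reduction

/-! ### Hochschild complexes along a natural transformation of functors on finite sets -/

section Comparison

variable {V : Type u} [CommRing V] {F G : FinAlgebra V} (η : F.Hom G)

lemma FinAlgebra.Hom.naturality_apply {m n : ℕ} (f : Fin m → Fin n) (x : F.X m) :
    η.app n (F.map f x) = G.map f (η.app m x) :=
  DFunLike.congr_fun (η.naturality f) x

/-- The map between the targets of the augmentations of bar complexes. -/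
def barAugMap : (ModuleCat.restrictScalars (F.map (fun _ : Fin 2 => (0 : Fin 1))).toRingHom).obj
      (ModuleCat.of (F.X 1) (F.X 1)) ⟶
    (ModuleCat.restrictScalars (η.app 2).toRingHom).obj
      ((ModuleCat.restrictScalars (G.map (fun _ : Fin 2 => (0 : Fin 1))).toRingHom).obj
        (ModuleCat.of (G.X 1) (G.X 1))) :=
  ModuleCat.ofHom
    (X := (ModuleCat.restrictScalars (F.map (fun _ : Fin 2 => (0 : Fin 1))).toRingHom).obj
      (ModuleCat.of (F.X 1) (F.X 1)))
    (Y := (ModuleCat.restrictScalars (η.app 2).toRingHom).obj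
      ((ModuleCat.restrictScalars (G.map (fun _ : Fin 2 => (0 : Fin 1))).toRingHom).obj
        (ModuleCat.of (G.X 1) (G.X 1))))
    { toFun := fun x => η.app 1 x
      map_add' := fun x y => map_add (η.app 1) x y
      map_smul' := fun a x => by
        refine (map_mul (η.app 1) (F.map (fun _ : Fin 2 => (0 : Fin 1)) a) x).trans ?_
        exact congrArg (fun z : G.X 1 => z * η.app 1 x) (η.naturality_apply _ a) }

/-- As modules over their tensor squares, `F.X 1` and `G.X 1` are generated by `1` with annihilator
the kernel of the multiplication. The hypothesis says that the kernel for `G` is generated by that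
for `F`. -/
lemma bijective_barAugMap
    (hker : RingHom.ker (G.map (fun _ : Fin 2 => (0 : Fin 1))) ≤
      (RingHom.ker (F.map (fun _ : Fin 2 => (0 : Fin 1)))).map (η.app 2)) :
    Function.Bijective (((ModuleCat.extendRestrictScalarsAdj.{u, u, u}
      (η.app 2).toRingHom).homEquiv _ _).symm (barAugMap η)) := by
  refine bijective_of_cyclic (f := (η.app 2).toRingHom) (barAugMap η) (1 : F.X 1) (1 : G.X 1)
    (map_one (η.app 1)) (fun n => ?_) (fun n => ?_)
    (RingHom.ker (F.map (fun _ : Fin 2 => (0 : Fin 1)))) (fun a ha => ?_) (fun s hs => hker ?_)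
  · obtain ⟨a, ha⟩ := F.map_const_surjective n
    exact ⟨a, (mul_one (F.map (fun _ : Fin 2 => (0 : Fin 1)) a)).trans ha⟩
  · obtain ⟨a, ha⟩ := G.map_const_surjective n
    exact ⟨a, (mul_one (G.map (fun _ : Fin 2 => (0 : Fin 1)) a)).trans ha⟩
  · exact (mul_one (F.map (fun _ : Fin 2 => (0 : Fin 1)) a)).trans ha
  · exact (mul_one (G.map (fun _ : Fin 2 => (0 : Fin 1)) s)).symm.trans hs

/-- The map induced by a natural transformation from the extended bar complex of `F` to the bar
complex of `G` is compatible with the augmentations. -/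
lemma barMap_barAug (x : (extendComplex (η.app 2).toRingHom (barOf F (AlgHom.id V (F.X 2)))).X 0) :
    barAug G ((extendHom (barMap η)).f 0 x) =
      ((ModuleCat.extendRestrictScalarsAdj.{u, u, u} (η.app 2).toRingHom).homEquiv _ _).symm
        (barAug F ≫ barAugMap η) x := by
  have h1 := (ModuleCat.extendRestrictScalarsAdj.{u, u, u}
    (η.app 2).toRingHom).homEquiv_naturality_right_symm ((barMap η).f 0) (barAug G)
  have h2 : (barMap η).f 0 ≫ (ModuleCat.restrictScalars (η.app 2).toRingHom).map (barAug G) =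
      barAug F ≫ barAugMap η := by
    refine ModuleCat.hom_ext (LinearMap.ext fun x => ?_)
    exact (η.naturality_apply (fun _ : Fin 2 => (0 : Fin 1)) x).symm
  have h3 := h1.symm.trans (congrArg _ h2)
  exact congrArg (fun g : (extendComplex (η.app 2).toRingHom (barOf F (AlgHom.id V (F.X 2)))).X 0 ⟶
    _ => g x) h3

variable {A S : Type u} [CommRing A] [Algebra V A] [CommRing S] [Algebra V S] (f : A →ₐ[V] S)
  (u : A →ₐ[V] F.X 1) (w : S →ₐ[V] G.X 1) (h : w.comp f = (η.app 1).comp u)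

/-- Over `G.X 2` there are two flat resolutions of `G.X 1`: the bar complex of `G` and the base
change of the bar complex of `F`. Their reductions modulo the diagonal ideal are the Hochschild
complex of `G` and the base change to `S` of that of `F`. -/
theorem quasiIso_hochschild (hu : Function.Bijective u) (hw : Function.Bijective w)
    (hF : ∀ n, (F.map (endpoints n)).toRingHom.Flat)
    (hG : ∀ n, (G.map (endpoints n)).toRingHom.Flat) (hη : (η.app 2).toRingHom.Flat)
    (hkF : ∀ n, RingHom.ker (F.map (closeUp n)) ≤
      (RingHom.ker (F.map (fun _ : Fin 2 => (0 : Fin 1)))).map (F.map (endpoints n)))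
    (hkG : ∀ n, RingHom.ker (G.map (closeUp n)) ≤
      (RingHom.ker (G.map (fun _ : Fin 2 => (0 : Fin 1)))).map (G.map (endpoints n)))
    (hker : RingHom.ker (G.map (fun _ : Fin 2 => (0 : Fin 1))) ≤
      (RingHom.ker (F.map (fun _ : Fin 2 => (0 : Fin 1)))).map (η.app 2)) :
    QuasiIso (extendHom (hochschildMap η f u w h)) := by
  let P := barOf F (AlgHom.id V (F.X 2))
  let C := hochschildOf F u
  let U := (ModuleCat.restrictScalars.{u, u, u} (η.app 2).toRingHom).obj
    (ModuleCat.of (G.X 2) (G.X 2))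
  let W := (ModuleCat.restrictScalars.{u, u, u} f.toRingHom).obj (ModuleCat.of S S)
  let eu := AlgEquiv.ofBijective u hu
  let ew := AlgEquiv.ofBijective w hw
  have heu : ∀ x, u (eu.symm x) = x := eu.apply_symm_apply
  have hew : ∀ x, w (ew.symm x) = x := ew.apply_symm_apply
  let k : F.X 2 →+* A :=
    (eu.symm.toAlgHom.comp (F.map (fun _ : Fin 2 => (0 : Fin 1)))).toRingHom
  let r₀ : G.X 2 →+* S :=
    (ew.symm.toAlgHom.comp (G.map (fun _ : Fin 2 => (0 : Fin 1)))).toRingHom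
  have hk : ∀ e, u (k e) = F.map (fun _ => 0) e := fun e => heu _
  have hr : ∀ g, w (r₀ g) = G.map (fun _ => 0) g := fun e => hew _
  let r : U →+ W := r₀.toAddMonoidHom
  let c : ∀ n, P.X n →+ C.X n := fun n => (F.map (closeUp n)).toRingHom.toAddMonoidHom
  have hrk : ∀ (e : F.X 2) (g : U), r (e • g) = k e • r g := by
    intro e g
    have h1 : r₀ (η.app 2 e) = f (k e) := hw.1 (by
      rw [hr, ← AlgHom.comp_apply w f, h, AlgHom.comp_apply, hk, η.naturality_apply])
    exact (map_mul r₀ (η.app 2 e) g).trans (congrArg (fun z : S => z * r₀ g) h1)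
  have hck : ∀ n (e : F.X 2) (x : P.X n), c n (e • x) = k e • c n x := fun n e x =>
    closeUp_smul F (AlgHom.id V (F.X 2)) u n e (k e) (hk e) x
  have hr₀ : Function.Surjective r₀ := fun s => by
    obtain ⟨g, hg⟩ := G.map_const_surjective (w s)
    exact ⟨g, hw.1 ((hr g).trans hg)⟩
  have hk₀ : Function.Surjective k := fun a => by
    obtain ⟨g, hg⟩ := F.map_const_surjective (u a)
    exact ⟨g, hu.1 ((hk g).trans hg)⟩
  have hri : ∀ g : G.X 2, r₀ g = 0 ↔ g ∈ RingHom.ker (G.map (fun _ : Fin 2 => (0 : Fin 1))) := by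
    intro g
    rw [RingHom.mem_ker, ← hr, map_eq_zero_iff w hw.1]
  let Q := extendComplex (η.app 2).toRingHom P
  let I := RingHom.ker (G.map (fun _ : Fin 2 => (0 : Fin 1)))
  let tm : ∀ n, G.X 2 → P.X n → Q.X n := fun n g x => TensorProduct.tmul (F.X 2) (M := U) g x
  have htm : ∀ n (g g' : G.X 2) (x : P.X n), g • tm n g' x = tm n (g * g') x :=
    fun _ _ _ _ => rfl
  have hind : ∀ n (p : Q.X n → Prop), p 0 → (∀ g x, p (tm n g x)) →
      (∀ x y, p x → p y → p (x + y)) → ∀ x, p x := fun n p h0 h1 h2 x =>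
    TensorProduct.induction_on (R := F.X 2) (M := U) (N := P.X n) (motive := p) x h0 h1 h2
  have htmI : ∀ n (g : G.X 2) (x : P.X n), g ∈ I → tm n g x ∈ I • (⊤ : Submodule (G.X 2) (Q.X n)) := by
    intro n g x hg
    have h1 := Submodule.smul_mem_smul hg (Submodule.mem_top (x := tm n 1 x))
    rwa [htm, mul_one] at h1
  -- The multiplication on the coefficients, tensored with closing up on chains. Both factors are
  -- semilinear for the multiplication map `k`.
  let q : ∀ n, Q.X n →+ (extendComplex f.toRingHom C).X n := fun n =>
    semilinearTensor hrk (hck n)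
  have hq : IsReduction (P := Q) (C := extendComplex f.toRingHom C) I q := by
    refine ⟨fun n => semilinearTensor_surjective hrk (hck n) hr₀ (closeUp_surjective F n),
      fun n x => ⟨fun hx => ?_, fun hx => ?_⟩, fun n x => ?_⟩
    -- The kernel of `q` consists of sums of tensors with one factor in a kernel. On the left this
    -- means a coefficient in `I`. On the right, `hkF` writes the chain through the diagonal ideal
    -- of `F`, whose elements move across the tensor sign into `I`.
    · refine mem_of_tensor_eq_zero k hk₀ r hr₀ (c n) (closeUp_surjective F n) hrk (hck n) (q n)
        (fun _ _ => rfl) (Submodule.toAddSubgroup (I • (⊤ : Submodule (G.X 2) (Q.X n))))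
        (fun g x hg => htmI n g x ((hri g).1 hg)) (fun g x hx => ?_) hx
      have h2 := (SetLike.ext_iff.1 (Ideal.smul_top_eq_map (R := F.X 2)
        (S := BarChains F (AlgHom.id V (F.X 2)) n)
        (RingHom.ker (F.map (fun _ : Fin 2 => (0 : Fin 1))))) _).2 (hkF n hx)
      change x ∈ RingHom.ker (F.map (fun _ : Fin 2 => (0 : Fin 1))) •
        (⊤ : Submodule (F.X 2) (P.X n)) at h2
      obtain ⟨g', rfl⟩ : ∃ g' : G.X 2, g' = g := ⟨g, rfl⟩
      change tm n g' x ∈ _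
      clear hx
      induction h2 using Submodule.smul_induction_on' with
      | smul e he x _ =>
        have h3 : tm n g' (e • x) = tm n (η.app 2 e * g') x :=
          (TensorProduct.smul_tmul (R := F.X 2) (M := U) e g' x).symm
        rw [h3]
        refine htmI n _ _ (I.mul_mem_right _ ?_)
        rw [RingHom.mem_ker] at he ⊢
        rw [← η.naturality_apply, he, map_zero]
      | add x _ y _ hx hy =>
        have h3 : tm n g' (x + y) = tm n g' x + tm n g' y :=
          TensorProduct.tmul_add (R := F.X 2) (M := U) g' x y
        rw [h3]
        exact add_mem hx hy
    · induction hx using Submodule.smul_induction_on' with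
      | smul g hg x _ =>
        refine hind n (fun x => q n (g • x) = 0) ?_ (fun g' x => ?_) (fun x y hx hy => ?_) x
        · rw [smul_zero, map_zero]
        · rw [htm]
          have h3 : r (g * g') = 0 := by
            refine (map_mul r₀ g g').trans ?_
            rw [(hri g).2 hg, zero_mul]
            rfl
          exact (congrArg (fun z : W => z ⊗ₜ[A] c n x) h3).trans (TensorProduct.zero_tmul _ _)
        · rw [smul_add, map_add, hx, hy, add_zero]
      | add x _ y _ hx hy => rw [map_add, hx, hy, add_zero]
    · refine hind (n + 1) (fun x => q n (Q.d (n + 1) n x) =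
        (extendComplex f.toRingHom C).d (n + 1) n (q (n + 1) x)) ?_ (fun g x => ?_)
        (fun x y hx hy => ?_) x
      · simp only [map_zero]
      · change (r g : W) ⊗ₜ[A] c n (P.d (n + 1) n x) =
          (r g : W) ⊗ₜ[A] (C.d (n + 1) n (c (n + 1) x))
        refine congrArg (fun z => (r g : W) ⊗ₜ[A] z) ?_
        rw [barOf_d, hochschildOf_d]
        exact closeUp_b' F _ u n x
      · simp only [map_add]
        rw [hx, hy]
  refine quasiIso_of_isReduction
    ((isFlatResolution_barAug F hF).extend hη (barAugMap η) (bijective_barAugMap η hker))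
    (isFlatResolution_barAug G hG) (extendHom (barMap η)) (barMap_barAug η) _ _ hq
    (isReduction_closeUp G w hkG) (fun n x => ?_)
  let qG : (barOf G (AlgHom.id V (G.X 2))).X n →+ (hochschildOf G w).X n :=
    (G.map (closeUp n)).toRingHom.toAddMonoidHom
  refine hind n (fun x => qG ((extendHom (barMap η)).f n x) =
      (extendHom (hochschildMap η f u w h)).f n (q n x)) ?_ (fun g x => ?_) (fun x y hx hy => ?_) x
  · simp only [map_zero]
  · refine (closeUp_smul G (AlgHom.id V (G.X 2)) w n g (r₀ g) (hr g) (η.app (n + 2) x)).trans ?_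
    refine congrArg (fun z : HochschildChains G w n => (r₀ g : S) • z) ?_
    exact (η.naturality_apply (closeUp n) x).symm
  · simp only [map_add]
    rw [hx, hy]

end Comparison

open ConvexBornology AlgBornology

/-! ### Approximation of bounded sets in a weak completion -/

section Approximation

variable {V : Type*} [CommRing V] {π : V} {Q : Type*} [CommRing Q] [Algebra V Q]

variable (π) in
/-- The bounded submodules of a weak completion. -/
def weakBallSubmodule (M : Submodule V Q) (c : ℕ) : Submodule V (WeakCompletion π Q) :=
  (weakBall π M c).comap (WeakCompletion.val π Q).toLinearMap

lemma bdd_weakBallSubmodule {M : Submodule V Q} (hM : M.FG) (h1 : (1 : Q) ∈ M) (c : ℕ) :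
    (WeakCompletion.bornology π Q).Bdd (weakBallSubmodule π M c) :=
  (bdd_ofSubmodules' _).2 ⟨_, ⟨M, hM, h1, c, rfl⟩, subset_rfl⟩

lemma WeakCompletion.exists_of_bdd {T : Set (WeakCompletion π Q)}
    (hT : (WeakCompletion.bornology π Q).Bdd T) : ∃ (M : Submodule V Q) (c : ℕ), M.FG ∧
      (1 : Q) ∈ M ∧ T ⊆ weakBallSubmodule π M c := by
  obtain ⟨_, ⟨M, hM, h1, c, rfl⟩, h⟩ := (bdd_ofSubmodules' _).1 hT
  exact ⟨M, c, hM, h1, h⟩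

/-- The remainder divided by `π ^ k` is the series with the digits moved down by `k`, zero below the
index `n - k`. Since `n - k ≥ k`, this shift at most doubles the required degree, whence the
constant `2 * c`. -/
lemma WeakCompletion.HasSeries.sub_of_mem {M : Submodule V Q} (hM : M.FG) (h1 : (1 : Q) ∈ M) {c : ℕ}
    {u : ℕ → Q} (hu : ∀ j, u j ∈ M ^ (c * (j + 1))) {z : WeakCompletion π Q}
    (hz : HasSeries π u z) {k n : ℕ} (hn : 2 * k ≤ n) :
    z - of π Q (partialSum π u n) ∈ π ^ k • weakBallSubmodule π M (2 * c) := by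
  obtain ⟨z', hz', hzz⟩ := hz.exists_tail hM h1 (a := c) (d := c) (fun k => by
    have := hu k; rwa [mul_add, mul_one] at this) n
  let v : ℕ → Q := fun i => if i < n - k then 0 else u (i + k)
  have hv : ∀ i, v i ∈ M ^ (2 * c * (i + 1)) := by
    intro i
    by_cases hi : i < n - k
    · simp only [v, if_pos hi]
      exact zero_mem _
    · simp only [v, if_neg hi]
      refine pow_mono_of_one_mem le_rfl h1 ?_ (hu _)
      rw [mul_comm 2 c, mul_assoc]
      exact Nat.mul_le_mul_left _ (by omega)
  obtain ⟨y, hy⟩ := exists_hasSeries (π := π) hM h1 (a := 2 * c) (d := 2 * c) (u := v) (fun k => by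
    have := hv k; rwa [mul_add, mul_one] at this)
  obtain ⟨y', hy', hyy⟩ := hy.exists_tail hM h1 (a := 2 * c) (d := 2 * c) (fun k => by
    have := hv k; rwa [mul_add, mul_one] at this) (n - k)
  have e0 : partialSum π v (n - k) = 0 := Finset.sum_eq_zero fun i hi => by
    simp only [v, if_pos (Finset.mem_range.1 hi), smul_zero]
  have e1 : (fun i => v (i + (n - k))) = fun i => u (i + n) := by
    ext i
    simp only [v, if_neg (show ¬ i + (n - k) < n - k by omega)]
    congr 1
    omega
  rw [e1] at hy'
  have e2 := hy'.unique hz'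
  rw [e0, map_zero, zero_add, e2] at hyy
  have e3 : z - of π Q (partialSum π u n) = π ^ k • y := by
    rw [hyy, smul_smul, ← pow_add, show k + (n - k) = n by omega, hzz, add_sub_cancel_left]
  rw [e3]
  exact Submodule.smul_mem_pointwise_smul _ _ _ ⟨v, hv, hy⟩

lemma exists_sub_of_mem {M : Submodule V Q} (hM : M.FG) (h1 : (1 : Q) ∈ M) {c : ℕ}
    {z : WeakCompletion π Q} (hz : z ∈ weakBallSubmodule π M c) (k : ℕ) :
    ∃ d ∈ daggerBall π M c, z - WeakCompletion.of π Q d ∈ π ^ k • weakBallSubmodule π M (2 * c) := by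
  obtain ⟨u, hu, hz⟩ := hz
  exact ⟨_, partialSum_mem_daggerBall hu (2 * k),
    WeakCompletion.HasSeries.sub_of_mem hM h1 hu hz le_rfl⟩

lemma of_mem_weakBallSubmodule {M : Submodule V Q} (hM : M.FG) (h1 : (1 : Q) ∈ M) {c : ℕ} {x : Q}
    (hx : x ∈ daggerBall π M c) : WeakCompletion.of π Q x ∈ weakBallSubmodule π M c := by
  obtain ⟨v, L, hv, hL⟩ := exists_partialSum_of_mem_daggerBall hx
  obtain ⟨z, hz⟩ := WeakCompletion.exists_hasSeries (π := π) hM h1 (a := c) (d := c) (u := v)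
    (fun k => by have := hv k; rwa [mul_add, mul_one] at this)
  have e : z = WeakCompletion.of π Q x := WeakCompletion.eval_ext fun n => by
    obtain ⟨N, hN⟩ := hz.isLimit n
    rw [hN _ (le_max_left N L), hL _ (le_max_right N L), WeakCompletion.eval_of]
  rw [← e]
  exact ⟨v, hv, hz⟩

lemma bounded_of_dagger : BoundedMap (dagger π Q).toConvexBornology
    (WeakCompletion.bornology π Q).toConvexBornology (WeakCompletion.of π Q) := by
  intro T hT
  obtain ⟨_, ⟨M, hM, h1, c, rfl⟩, hT⟩ := (bdd_ofSubmodules' _).1 hT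
  refine (bdd_weakBallSubmodule hM h1 c).subset ?_
  rintro _ ⟨x, hx, rfl⟩
  exact of_mem_weakBallSubmodule hM h1 (hT hx)

lemma BoundedMap.comp {X Y Z : Type*} [AddCommGroup X] [Module V X] [AddCommGroup Y] [Module V Y]
    [AddCommGroup Z] [Module V Z] {𝓑 : ConvexBornology V X} {𝓒 : ConvexBornology V Y}
    {𝓓 : ConvexBornology V Z} {g : Y → Z} {f : X → Y} (hg : BoundedMap 𝓒 𝓓 g)
    (hf : BoundedMap 𝓑 𝓒 f) : BoundedMap 𝓑 𝓓 (g ∘ f) := fun S hS => by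
  rw [Set.image_comp]
  exact hg _ (hf _ hS)

variable [IsNoetherianRing V] [Algebra.FiniteType V Q] (htf : ∀ x : Q, π • x = 0 → x = 0)
  {A : Type*} [CommRing A] [Algebra V A] {𝓑 : AlgBornology V A}

/-- A bounded homomorphism on the weak completion maps the partial sums of a series to a sequence
that converges to the image of its sum. So it is determined by its restriction to `Q`, up to the
canonical map to the completion. -/
lemma lift_eq_of_bounded {ψ : Q →ₐ[V] A}
    (hψ : BoundedMap (dagger π Q).toConvexBornology 𝓑.toConvexBornology ψ)
    {χ : WeakCompletion π Q →ₐ[V] A} (hχ : BoundedMap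
      (WeakCompletion.bornology π Q).toConvexBornology 𝓑.toConvexBornology χ)
    (h : χ.comp (WeakCompletion.of π Q) = ψ) (z : WeakCompletion π Q) :
    lift htf ψ hψ z = Completion.of π 𝓑 (χ z) := by
  obtain ⟨M, c, u, hM, h1, hu, hz⟩ := WeakCompletion.exists_series z
  have hx : IsCauchyIn π (daggerBall π M (2 * c)) (partialSum π u) := by
    refine ⟨fun n => daggerBall_mono le_rfl h1 (by omega) (partialSum_mem_daggerBall hu n),
      fun k => ⟨2 * k, fun n hn m hm => ?_⟩⟩
    rcases le_total m n with h | h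
    · exact partialSum_sub_mem h1 hu hm h
    · rw [← neg_sub]
      exact neg_mem (partialSum_sub_mem h1 hu hn h)
  let x : cauchy π (dagger π Q) := ⟨partialSum π u, _, bdd_daggerBall hM h1 (2 * c), hx⟩
  rw [lift_eq htf ψ hψ (x := x) hz.isLimit]
  have h2 : Completion.cauchyMap π ψ hψ x - Completion.const π 𝓑 (χ z) ∈ null π 𝓑 := by
    refine ⟨_, BoundedMap.exists_submodule (f := χ.toLinearMap) hχ
      (bdd_weakBallSubmodule hM h1 (2 * c)), fun k => ⟨2 * k, fun n hn => ?_⟩⟩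
    have h3 := neg_mem (map_pow_smul_mem π χ.toLinearMap (fun s hs => Submodule.mem_map_of_mem hs)
      (WeakCompletion.HasSeries.sub_of_mem hM h1 hu hz hn))
    have h4 : (Completion.cauchyMap π ψ hψ x - Completion.const π 𝓑 (χ z) : cauchy π 𝓑).1 n - 0 =
        -χ (z - WeakCompletion.of π Q (partialSum π u n)) := by
      rw [map_sub, neg_sub, sub_zero]
      exact congrArg (· - χ z) (DFunLike.congr_fun h (partialSum π u n)).symm
    rw [h4]
    exact h3
  exact congrArg (Completion.proj π 𝓑) (Ideal.Quotient.eq.2 h2)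

end Approximation

open ConvexBornology AlgBornology

/-! ### Bornologies on tensor powers -/

namespace TPow

variable {V : Type u} [CommRing V] {π : V} {A : Type u} [CommRing A] [Algebra V A] {B : Type u}
  [CommRing B] [Algebra V B]

lemma tprod_mem_pureSpan {n : ℕ} {S : Submodule V A} {a : Fin n → A} (ha : ∀ i, a i ∈ S) :
    PiTensorProduct.tprod V a ∈ pureSpan n S := Submodule.subset_span ⟨a, ha, rfl⟩

lemma pureSpan_le {n : ℕ} {S : Submodule V A} {N : Submodule V (TPow V A n)}
    (h : ∀ a : Fin n → A, (∀ i, a i ∈ S) → PiTensorProduct.tprod V a ∈ N) : pureSpan n S ≤ N :=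
  Submodule.span_le.2 (by rintro _ ⟨a, ha, rfl⟩; exact h a ha)

lemma pureSpan_mul_le (n : ℕ) (S T : Submodule V A) :
    pureSpan n S * pureSpan n T ≤ pureSpan n (S * T) := by
  rw [pureSpan, pureSpan, Submodule.span_mul_span, Submodule.span_le]
  rintro _ ⟨_, ⟨a, ha, rfl⟩, _, ⟨b, hb, rfl⟩, rfl⟩
  exact Submodule.subset_span ⟨a * b, fun i => Submodule.mul_mem_mul (ha i) (hb i),
    PiTensorProduct.tprod_mul_tprod a b⟩

lemma pureSpan_pow_le (n : ℕ) (S : Submodule V A) (k : ℕ) :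
    pureSpan n S ^ k ≤ pureSpan n (S ^ k) := by
  induction k with
  | zero =>
    rw [pow_zero, pow_zero, Submodule.one_le]
    exact tprod_mem_pureSpan fun i => Submodule.one_le.1 le_rfl
  | succ k ih =>
    rw [pow_succ, pow_succ]
    exact (mul_le_mul' ih le_rfl).trans (pureSpan_mul_le n _ _)

lemma bdd_pureSpan (𝓑 : AlgBornology V A) {S : Submodule V A} (hS : 𝓑.Bdd S) (n : ℕ) :
    (bornology 𝓑 n).Bdd (pureSpan n S) :=
  (bdd_ofSubmodules' _).2 ⟨_, ⟨S, hS, rfl⟩, subset_rfl⟩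

lemma exists_of_bdd {𝓑 : AlgBornology V A} {n : ℕ} {T : Set (TPow V A n)}
    (hT : (bornology 𝓑 n).Bdd T) : ∃ S : Submodule V A, 𝓑.Bdd S ∧ T ⊆ pureSpan n S := by
  obtain ⟨_, ⟨S, hS, rfl⟩, h⟩ := (bdd_ofSubmodules' _).1 hT
  exact ⟨S, hS, h⟩

lemma bounded_incl (𝓑 : AlgBornology V A) {n : ℕ} (i : Fin n) :
    BoundedMap 𝓑.toConvexBornology (bornology 𝓑 n).toConvexBornology (incl V A i) := by
  intro S hS
  have h1 : 𝓑.Bdd (1 : Submodule V A) := by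
    rw [Submodule.one_eq_span]
    exact (𝓑.bdd_finite (Set.finite_singleton _)).span
  refine (bdd_pureSpan 𝓑 (hS.span.sup h1) n).subset ?_
  rintro _ ⟨x, hx, rfl⟩
  rw [SetLike.mem_coe, incl_apply]
  refine tprod_mem_pureSpan fun j => ?_
  by_cases hj : j = i
  · subst hj
    rw [Pi.mulSingle_eq_same]
    exact Submodule.mem_sup_left (Submodule.subset_span hx)
  · rw [Pi.mulSingle_eq_of_ne hj]
    exact Submodule.mem_sup_right (Submodule.one_le.1 le_rfl)

lemma exists_le_pureSpan_pow {M : Submodule V A} (hM : IsGenerating M) {n : ℕ}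
    {N : Submodule V (TPow V A n)} (hN : N.FG) : ∃ k, N ≤ pureSpan n (M ^ k) := by
  obtain ⟨s, rfl⟩ := hN
  obtain ⟨S, hS, hs⟩ := exists_of_bdd ((bornology (fine V A) n).bdd_finite s.finite_toSet)
  obtain ⟨S', hS', hSS⟩ := (bdd_ofSubmodules' _).1 hS
  obtain ⟨k, hk⟩ := hM.exists_pow hS'
  refine ⟨k, Submodule.span_le.2 (hs.trans (pureSpan_mono n ?_))⟩
  exact le_trans hSS hk

/-- The scalar `π ^ j` is distributed over the tensor factors: each receives `j / n` powers of `π`,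
and `j % n` powers stay in front. Then `c * (j + 1)` is at most `c * n * (j / n + 1)`. -/
lemma daggerBall_pureSpan_le {n : ℕ} (hn : 0 < n) {M : Submodule V A} (h1 : (1 : A) ∈ M) (c : ℕ) :
    daggerBall π (pureSpan n M) c ≤ pureSpan n (daggerBall π M (c * n)) := by
  refine daggerBall_le fun j x hx => ?_
  have h2 : pureSpan n (M ^ (c * (j + 1))) ≤
      (pureSpan n (daggerBall π M (c * n))).comap (π ^ j • LinearMap.id) := by
    refine pureSpan_le fun a ha => ?_
    have e : π ^ j • PiTensorProduct.tprod V a =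
        π ^ (j % n) • PiTensorProduct.tprod V fun i => π ^ (j / n) • a i := by
      rw [MultilinearMap.map_smul_univ, Finset.prod_const, Finset.card_univ, Fintype.card_fin,
        smul_smul, ← pow_mul, ← pow_add, mul_comm, Nat.mod_add_div]
    change π ^ j • PiTensorProduct.tprod V a ∈ pureSpan n (daggerBall π M (c * n))
    rw [e]
    refine Submodule.smul_mem _ _ (tprod_mem_pureSpan fun i => pow_smul_mem_daggerBall ?_)
    refine pow_mono_of_one_mem le_rfl h1 ?_ (ha i)
    rw [mul_assoc]
    refine Nat.mul_le_mul_left _ ?_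
    rw [mul_add, mul_one]
    have := Nat.lt_mul_div_succ j hn
    rw [mul_add, mul_one] at this
    omega
  exact h2 (pureSpan_pow_le n M _ hx)

/-- Telescoping: the entries are replaced one at a time, and each replacement changes the tensor by
a multiple of `π ^ k`. -/
lemma tprod_sub_mem {n k : ℕ} {S : Submodule V A} {a b : Fin n → A} (ha : ∀ i, a i ∈ S)
    (hb : ∀ i, b i ∈ S) (hab : ∀ i, a i - b i ∈ π ^ k • S) :
    PiTensorProduct.tprod V a - PiTensorProduct.tprod V b ∈ π ^ k • pureSpan n S := by
  classical
  have key : ∀ s : Finset (Fin n), PiTensorProduct.tprod V (s.piecewise a b) -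
      PiTensorProduct.tprod V b ∈ π ^ k • pureSpan n S := by
    intro s
    induction s using Finset.induction_on with
    | empty => simp
    | insert i s hi ih =>
      rw [← sub_add_sub_cancel _ (PiTensorProduct.tprod V (s.piecewise a b))]
      refine add_mem ?_ ih
      obtain ⟨t, ht, hti⟩ := (Submodule.mem_smul_pointwise_iff_exists _ _ _).1 (hab i)
      have e : s.piecewise a b = Function.update (s.piecewise a b) i (b i) := by
        rw [eq_comm, Function.update_eq_self_iff, Finset.piecewise_eq_of_notMem _ _ _ hi]
      rw [Finset.piecewise_insert]
      nth_rewrite 2 [e]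
      rw [← MultilinearMap.map_update_sub, ← hti, MultilinearMap.map_update_smul]
      refine Submodule.smul_mem_pointwise_smul _ _ _ (tprod_mem_pureSpan fun j => ?_)
      by_cases hj : j = i
      · subst hj
        rwa [Function.update_self]
      · rw [Function.update_of_ne hj]
        by_cases hjs : j ∈ s
        · rw [Finset.piecewise_eq_of_mem _ _ _ hjs]
          exact ha j
        · rw [Finset.piecewise_eq_of_notMem _ _ _ hjs]
          exact hb j
  have := key Finset.univ
  rwa [Finset.piecewise_univ] at this

/-- An elementary tensor is the product of the images of its entries under the inclusions, which are
bounded, as is the multiplication. -/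
lemma bdd_dagger_pureSpan {n : ℕ} {D : Submodule V A} (hD : (dagger π A).Bdd D) :
    (dagger π (TPow V A n)).Bdd (pureSpan n D) := by
  have h1 : ∀ s : Finset (Fin n), (dagger π (TPow V A n)).Bdd
      ((∏ i ∈ s, D.map (incl V A i).toLinearMap : Submodule V (TPow V A n)) : Set (TPow V A n)) := by
    intro s
    induction s using Finset.induction_on with
    | empty =>
      rw [Finset.prod_empty, Submodule.one_eq_span]
      exact ((dagger π _).bdd_finite (Set.finite_singleton _)).span
    | insert i s hi ih =>
      rw [Finset.prod_insert hi]
      exact (dagger π _).bdd_mul_submodule (BoundedMap.exists_submodule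
        (f := (incl V A i).toLinearMap) (bounded_dagger _) hD) ih
  refine (h1 Finset.univ).subset (pureSpan_le fun a ha => ?_)
  rw [tprod_eq_prod]
  have h2 : ∀ s : Finset (Fin n), ∏ i ∈ s, incl V A i (a i) ∈
      ∏ i ∈ s, D.map (incl V A i).toLinearMap := by
    intro s
    induction s using Finset.induction_on with
    | empty => simpa using Submodule.one_le.1 (le_refl (1 : Submodule V (TPow V A n)))
    | insert i s hi ih =>
      rw [Finset.prod_insert hi, Finset.prod_insert hi]
      exact Submodule.mul_mem_mul (Submodule.mem_map_of_mem (ha i)) ih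
  exact h2 Finset.univ

end TPow

/-- `θ` identifies the bornological algebra `T` with the localization at `s` of the weak completion
of `Q`. -/
structure IsDaggerAway {V : Type*} [CommRing V] {π : V} (s : V) {Q : Type*} [CommRing Q]
    [Algebra V Q] {T : Type*} [CommRing T] [Algebra V T] (𝓣 : AlgBornology V T)
    (θ : WeakCompletion π Q →ₐ[V] T) : Prop where
  away : IsAway s θ
  bounded : BoundedMap (WeakCompletion.bornology π Q).toConvexBornology 𝓣.toConvexBornology θ
  exists_ball : ∀ S : Set T, 𝓣.Bdd S → ∃ (l : ℕ) (M : Submodule V Q) (c : ℕ), M.FG ∧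
    (1 : Q) ∈ M ∧ ∀ y ∈ S, ∃ z ∈ weakBallSubmodule π M c, s ^ l • y = θ z

/-! ### Completed tensor powers as localized weak completions -/

section

variable {V : Type u} [CommRing V] {π s : V} {Q : Type u} [CommRing Q] [Algebra V Q] {T : Type u}
  [CommRing T] [Algebra V T] {𝓣 : AlgBornology V T} {θ : WeakCompletion π Q →ₐ[V] T}

/-- The homomorphism between tensor powers induced by `θ`. -/
abbrev powHom (n : ℕ) (θ : WeakCompletion π Q →ₐ[V] T) : TPow V Q n →ₐ[V] TPow V T n :=
  TPow.mapHom n (θ.comp (WeakCompletion.of π Q))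

lemma IsDaggerAway.bdd_map (h : IsDaggerAway s 𝓣 θ) {D : Submodule V Q} (hD : (dagger π Q).Bdd D) :
    𝓣.Bdd (D.map (θ.comp (WeakCompletion.of π Q)).toLinearMap : Submodule V T) := by
  have h1 := BoundedMap.comp h.bounded (bounded_of_dagger (π := π) (Q := Q))
  exact BoundedMap.exists_submodule (f := (θ.comp (WeakCompletion.of π Q)).toLinearMap) h1 hD

lemma IsDaggerAway.bounded_powHom [Algebra.FiniteType V Q] (h : IsDaggerAway s 𝓣 θ) {n : ℕ}
    (hn : 0 < n) : BoundedMap (dagger π (TPow V Q n)).toConvexBornology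
      (TPow.bornology 𝓣 n).toConvexBornology (powHom n θ) := by
  obtain ⟨M, hM⟩ := exists_isGenerating V Q
  intro S hS
  obtain ⟨_, ⟨N, hN, -, c, rfl⟩, hS⟩ := (bdd_ofSubmodules' _).1 hS
  obtain ⟨k, hk⟩ := TPow.exists_le_pureSpan_pow hM hN
  have h1 : (1 : Q) ∈ M ^ k := by simpa using Submodule.pow_mem_pow M hM.one_mem k
  refine (TPow.bdd_pureSpan 𝓣 (h.bdd_map (bdd_daggerBall (hM.fg.pow k) h1 (c * n))) n).subset ?_
  have h2 : TPow.pureSpan n (daggerBall π (M ^ k) (c * n)) ≤ (TPow.pureSpan n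
      ((daggerBall π (M ^ k) (c * n)).map (θ.comp (WeakCompletion.of π Q)).toLinearMap)).comap
      (powHom n θ).toLinearMap := TPow.pureSpan_le fun a ha => by
    refine Submodule.mem_comap.2 ?_
    change powHom n θ (PiTensorProduct.tprod V a) ∈ TPow.pureSpan n
      ((daggerBall π (M ^ k) (c * n)).map (θ.comp (WeakCompletion.of π Q)).toLinearMap)
    rw [TPow.mapHom_tprod]
    exact TPow.tprod_mem_pureSpan fun i => Submodule.mem_map_of_mem (ha i)
  rintro _ ⟨x, hx, rfl⟩
  exact h2 (TPow.daggerBall_pureSpan_le hn h1 c (daggerBall_mono hk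
    (TPow.tprod_mem_pureSpan fun _ => h1) le_rfl (hS hx)))

lemma IsDaggerAway.exists_approx (h : IsDaggerAway s 𝓣 θ) {S : Submodule V T} (hS : 𝓣.Bdd S) :
    ∃ (l : ℕ) (D : Submodule V Q) (S' : Submodule V T), (dagger π Q).Bdd D ∧ 𝓣.Bdd S' ∧
      ∀ x ∈ S, ∀ k : ℕ, ∃ d ∈ D, s ^ l • x - θ (WeakCompletion.of π Q d) ∈ π ^ k • S' := by
  obtain ⟨l, M, c, hM, h1, hz⟩ := h.exists_ball S hS
  refine ⟨l, daggerBall π M c, _, bdd_daggerBall hM h1 c, BoundedMap.exists_submodule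
    (f := θ.toLinearMap) h.bounded (bdd_weakBallSubmodule hM h1 (2 * c)), fun x hx k => ?_⟩
  obtain ⟨z, hz, e⟩ := hz x hx
  obtain ⟨d, hd, hzd⟩ := exists_sub_of_mem hM h1 hz k
  refine ⟨d, hd, ?_⟩
  rw [e, ← map_sub]
  exact map_pow_smul_mem π θ.toLinearMap (fun s hs => Submodule.mem_map_of_mem hs) hzd

/-- The entries of elementary tensors are approximated separately. Each of the `n` entries needs the
factor `s ^ l`, which makes `s ^ (l * n)` in total. -/
lemma IsDaggerAway.dense_powHom (h : IsDaggerAway s 𝓣 θ) {n : ℕ} {S : Submodule V (TPow V T n)}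
    (hS : (TPow.bornology 𝓣 n).Bdd S) : ∃ (l : ℕ) (D : Submodule V (TPow V Q n))
      (S' : Submodule V (TPow V T n)), (dagger π (TPow V Q n)).Bdd D ∧
      (TPow.bornology 𝓣 n).Bdd S' ∧
      ∀ x ∈ S, ∀ k : ℕ, ∃ d ∈ D, s ^ l • x - powHom n θ d ∈ π ^ k • S' := by
  obtain ⟨S₀, hS₀, hSS⟩ := TPow.exists_of_bdd hS
  obtain ⟨l, D, S₁, hD, hS₁, happ⟩ := h.exists_approx hS₀
  have hb : 𝓣.Bdd (D.map (θ.comp (WeakCompletion.of π Q)).toLinearMap : Submodule V T) :=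
    h.bdd_map hD
  refine ⟨l * n, TPow.pureSpan n D, _, TPow.bdd_dagger_pureSpan hD,
    TPow.bdd_pureSpan 𝓣 ((hS₀.sup hS₁).sup hb) n, fun x hx k => ?_⟩
  set S₂ := S₀ ⊔ S₁ ⊔ D.map (θ.comp (WeakCompletion.of π Q)).toLinearMap
  have hx' : x ∈ TPow.pureSpan n S₀ := hSS hx
  clear hx
  induction hx' using Submodule.span_induction with
  | mem x hx =>
    obtain ⟨a, ha, rfl⟩ := hx
    choose d hd hda using fun i => happ (a i) (ha i) k
    refine ⟨_, TPow.tprod_mem_pureSpan hd, ?_⟩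
    have e : s ^ (l * n) • PiTensorProduct.tprod V a =
        PiTensorProduct.tprod V fun i => s ^ l • a i := by
      rw [MultilinearMap.map_smul_univ, Finset.prod_const, Finset.card_univ, Fintype.card_fin,
        pow_mul]
    rw [e, TPow.mapHom_tprod]
    exact TPow.tprod_sub_mem
      (fun i => Submodule.mem_sup_left (Submodule.mem_sup_left (S₀.smul_mem _ (ha i))))
      (fun i => Submodule.mem_sup_right (Submodule.mem_map_of_mem (hd i)))
      (fun i => ConvexBornology.pow_smul_mono π (le_sup_right.trans le_sup_left) k (hda i))
  | zero => exact ⟨0, zero_mem _, by simp⟩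
  | add x y _ _ hx hy =>
    obtain ⟨d, hd, hx⟩ := hx
    obtain ⟨d', hd', hy⟩ := hy
    refine ⟨d + d', add_mem hd hd', ?_⟩
    have := add_mem hx hy
    rwa [sub_add_sub_comm, ← smul_add, ← map_add] at this
  | smul r x _ hx =>
    obtain ⟨d, hd, hx⟩ := hx
    refine ⟨r • d, Submodule.smul_mem _ r hd, ?_⟩
    have := Submodule.smul_mem _ r hx
    rwa [smul_sub, smul_comm, ← map_smul] at this

end

open ConvexBornology AlgBornology

section

variable {V : Type u} [CommRing V] {π s : V} {Q : Type u} [CommRing Q] [Algebra V Q] {T : Type u}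
  [CommRing T] [Algebra V T] {𝓣 : AlgBornology V T} {θ : WeakCompletion π Q →ₐ[V] T}

lemma isUnit_algebraMap_tPow {n : ℕ} (hn : 0 < n) (h : IsUnit (algebraMap V T s)) :
    IsUnit (algebraMap V (TPow V T n) s) := by
  have := h.map (TPow.incl V T (⟨0, hn⟩ : Fin n))
  rwa [AlgHom.commutes] at this

lemma smul_eq_zero_of_dvd {X : Type*} [AddCommGroup X] [Module V X] (hs : s ∣ π)
    (htf : ∀ x : X, π • x = 0 → x = 0) (x : X) (hx : s • x = 0) : x = 0 := by
  obtain ⟨t, rfl⟩ := hs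
  exact htf x (by rw [mul_comm, mul_smul, hx, smul_zero])

/-- The inclusions of the factors extend to a map from the tensor power of `T` to the localization
at `s` of the weak completion of the tensor power of `Q`. The preimage of that weak completion
serves as `N`. It absorbs bounded sets because `s` divides `π`, and it detects divisibility because
weak completion does not change quotients modulo `π ^ k`. -/
lemma IsDaggerAway.strict_powHom (h : IsDaggerAway s 𝓣 θ) (hs : s ∣ π) {n : ℕ}
    (htf : ∀ x : TPow V Q n, π • x = 0 → x = 0) : ∃ N : Submodule V (TPow V T n),
      (∀ S : Submodule V (TPow V T n), (TPow.bornology 𝓣 n).Bdd S →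
        ∃ l : ℕ, ∀ x ∈ S, π ^ l • x ∈ N) ∧
      ∀ (q : TPow V Q n) (k : ℕ), powHom n θ q ∈ π ^ k • N → ∃ q', q = π ^ k • q' := by
  have htf' : ∀ z : WeakCompletion π (TPow V Q n), π • z = 0 → z = 0 := fun z hz =>
    WeakCompletion.smul_eq_zero htf hz
  have hL := exists_isAway s (smul_eq_zero_of_dvd hs htf')
  set L := Localization.Away (algebraMap V (WeakCompletion π (TPow V Q n)) s)
  set ι := Algebra.algHom V (WeakCompletion π (TPow V Q n)) L
  choose ρ hρ using fun i => h.away.exists_lift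
    (ι.comp (WeakCompletion.map π (TPow.incl V Q (i : Fin n)))) hL.isUnit
  have hρψ : (TPow.desc ρ).comp (powHom n θ) = ι.comp (WeakCompletion.of π (TPow V Q n)) :=
    TPow.hom_ext_incl fun i a => by
      simp only [AlgHom.comp_apply, TPow.mapHom_incl, TPow.desc_incl]
      have h1 := DFunLike.congr_fun (hρ i) (WeakCompletion.of π Q a)
      simp only [AlgHom.comp_apply, WeakCompletion.map_of'] at h1
      exact h1
  refine ⟨(LinearMap.range ι.toLinearMap).comap (TPow.desc ρ).toLinearMap, fun S hS => ?_,
    fun q k hq => ?_⟩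
  · obtain ⟨S₀, hS₀, hSS⟩ := TPow.exists_of_bdd hS
    obtain ⟨l, M, c, -, -, hz⟩ := h.exists_ball S₀ hS₀
    refine ⟨l * n, fun x hx => ?_⟩
    have h1 : TPow.pureSpan n S₀ ≤ ((LinearMap.range ι.toLinearMap).comap
        (TPow.desc ρ).toLinearMap).comap (s ^ (l * n) • LinearMap.id) := by
      refine TPow.pureSpan_le fun a ha => ?_
      choose z _ hza using fun i => hz (a i) (ha i)
      refine ⟨∏ i, WeakCompletion.map π (TPow.incl V Q i) (z i), ?_⟩
      change ι (∏ i, WeakCompletion.map π (TPow.incl V Q i) (z i)) = TPow.desc ρ (s ^ (l * n) • PiTensorProduct.tprod V a)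
      have e : s ^ (l * n) • PiTensorProduct.tprod V a =
          PiTensorProduct.tprod V fun i => s ^ l • a i := by
        rw [MultilinearMap.map_smul_univ, Finset.prod_const, Finset.card_univ, Fintype.card_fin,
          pow_mul]
      rw [e, TPow.desc_tprod, map_prod]
      refine Finset.prod_congr rfl fun i _ => ?_
      rw [hza]
      exact (DFunLike.congr_fun (hρ i) (z i)).symm
    obtain ⟨t, ht⟩ := pow_dvd_pow_of_dvd hs (l * n)
    rw [ht, mul_comm, mul_smul]
    exact Submodule.smul_mem _ t (h1 (hSS hx))
  · obtain ⟨t, ⟨w, hw⟩, htq⟩ := (Submodule.mem_smul_pointwise_iff_exists _ _ _).1 hq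
    refine WeakCompletion.exists_of_of_eq (z := w) (hL.injective ?_)
    change ι _ = ι _
    rw [map_smul]
    refine (DFunLike.congr_fun hρψ q).symm.trans ?_
    rw [AlgHom.comp_apply, ← htq, map_smul]
    exact congrArg (π ^ k • ·) hw.symm

theorem IsDaggerAway.isDaggerDense_powHom [Algebra.FiniteType V Q] (h : IsDaggerAway s 𝓣 θ)
    (hs : s ∣ π) {n : ℕ} (hn : 0 < n) (htf : ∀ x : TPow V Q n, π • x = 0 → x = 0) :
    IsDaggerDense (π := π) s (TPow.bornology 𝓣 n) (powHom n θ) :=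
  ⟨isUnit_algebraMap_tPow hn h.away.isUnit, h.bounded_powHom hn, fun _ hS => h.dense_powHom hS,
    h.strict_powHom hs htf⟩

theorem IsDaggerDense.isDaggerAway_lift [IsNoetherianRing V] [Algebra.FiniteType V Q]
    (htf : ∀ x : Q, π • x = 0 → x = 0) {ψ : Q →ₐ[V] T} (h : IsDaggerDense (π := π) s 𝓣 ψ) :
    IsDaggerAway s (Completion.bornology π 𝓣) (lift htf ψ h.bounded) := by
  refine ⟨⟨?_, h.lift_injective htf, fun y => ?_⟩, bounded_lift htf h.bounded, fun S hS => ?_⟩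
  · have := h.isUnit.map (Completion.of π 𝓣)
    rwa [AlgHom.commutes] at this
  · obtain ⟨l, M, c, -, -, hz⟩ := h.exists_lift_eq htf
      ((Completion.bornology π 𝓣).bdd_finite (Set.finite_singleton y))
    obtain ⟨z, -, hz⟩ := hz y rfl
    exact ⟨l, z, hz⟩
  · obtain ⟨l, M, c, hM, h1, hz⟩ := h.exists_lift_eq htf hS
    exact ⟨l, M, c, hM, h1, hz⟩

/-- The case without localization, which serves for the weak completion itself. -/
lemma isDaggerAway_id : IsDaggerAway (1 : V) (WeakCompletion.bornology π Q)
    (AlgHom.id V (WeakCompletion π Q)) := by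
  refine ⟨isAway_one Function.bijective_id, fun S hS => by simpa using hS, fun S hS => ?_⟩
  obtain ⟨M, c, hM, h1, h⟩ := WeakCompletion.exists_of_bdd hS
  exact ⟨0, M, c, hM, h1, fun y hy => ⟨y, h hy, by simp⟩⟩

lemma tPow_smul_eq_zero [IsDomain V] [Module.Flat V Q] (hπ : π ≠ 0) (n : ℕ) (x : TPow V Q n)
    (h : π • x = 0) : x = 0 :=
  (smul_eq_zero_iff_right hπ).1 h

end

open ConvexBornology AlgBornology

/-! ### Bijectivity and kernels along localizations -/

section Away

variable {V : Type*} [CommRing V] {X : Type*} [CommRing X] [Algebra V X] {Y : Type*} [CommRing Y]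
  [Algebra V Y] {Z : Type*} [CommRing Z] [Algebra V Z] {W : Type*} [CommRing W] [Algebra V W]
  {s : V} {f : X →ₐ[V] Y}

lemma IsAway.bijective_of_comp (h : IsAway s f) (k : Y →ₐ[V] Z) (hk : IsAway s (k.comp f)) :
    Function.Bijective k := by
  refine ⟨(injective_iff_map_eq_zero k).2 fun y hy => ?_, fun z => ?_⟩
  · obtain ⟨l, x, hx⟩ := h.exists_smul y
    have h1 : (k.comp f) x = 0 := by rw [AlgHom.comp_apply, ← hx, map_smul, hy, smul_zero]
    rw [(map_eq_zero_iff _ hk.injective).1 h1, map_zero] at hx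
    exact smul_pow_left_cancel h.isUnit l hx
  · obtain ⟨l, x, hx⟩ := hk.exists_smul z
    obtain ⟨v, hv⟩ := h.isUnit.pow l
    refine ⟨↑v⁻¹ * f x, hk.smul_cancel (l := l) ?_⟩
    rw [← map_smul, Algebra.smul_def, map_pow, ← hv, v.mul_inv_cancel_left, hx, AlgHom.comp_apply]

/-- A power of the unit `s` moves a kernel element into `X`, where injectivity of `f'` puts it in
`ker φ`. -/
lemma IsAway.ker_le (h : IsAway s f) {f' : Z →ₐ[V] W} (hf' : Function.Injective f')
    (φ : X →ₐ[V] Z) (Φ : Y →ₐ[V] W) (hΦ : ∀ x, Φ (f x) = f' (φ x)) {J : Ideal Y}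
    (hJ : RingHom.ker φ ≤ J.comap f) : RingHom.ker Φ ≤ J := by
  intro y hy
  obtain ⟨l, x, hx⟩ := h.exists_smul y
  have h1 : f' (φ x) = 0 := by rw [← hΦ, ← hx, map_smul, RingHom.mem_ker.1 hy, smul_zero]
  have h2 := hJ (RingHom.mem_ker.2 ((map_eq_zero_iff _ hf').1 h1))
  rw [Ideal.mem_comap, ← hx, Algebra.smul_def, map_pow] at h2
  exact (Ideal.unit_mul_mem_iff_mem J (h.isUnit.pow l)).1 h2

lemma isAway_comp_bijective {k : Z →ₐ[V] X} (hk : Function.Bijective k) (h : IsAway s f) :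
    IsAway s (f.comp k) :=
  ⟨h.isUnit, h.injective.comp hk.1, fun y => by
    obtain ⟨l, x, hx⟩ := h.exists_smul y
    obtain ⟨z, rfl⟩ := hk.2 x
    exact ⟨l, z, hx⟩⟩

end Away

lemma WeakCompletion.map_bijective {V : Type*} [CommRing V] (π : V) {A B : Type*} [CommRing A]
    [CommRing B] [Algebra V A] [Algebra V B] {f : A →ₐ[V] B} (hf : Function.Bijective f) :
    Function.Bijective (WeakCompletion.map π f) := by
  let e := AlgEquiv.ofBijective f hf
  have h1 : e.symm.toAlgHom.comp f = AlgHom.id V A := AlgHom.ext e.symm_apply_apply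
  have h2 : f.comp e.symm.toAlgHom = AlgHom.id V B := AlgHom.ext e.apply_symm_apply
  refine Function.bijective_iff_has_inverse.2 ⟨WeakCompletion.map π e.symm.toAlgHom,
    fun x => ?_, fun x => ?_⟩
  · rw [WeakCompletion.map_map, h1, WeakCompletion.map_id]
  · rw [WeakCompletion.map_map, h2, WeakCompletion.map_id]

/-! ### Hochschild homology of localized weak completions -/

section

variable {V : Type u} [CommRing V] [IsDomain V] [IsNoetherianRing V] {π s : V} {Q : Type u}
  [CommRing Q] [Algebra V Q] [Algebra.FiniteType V Q] [Module.Flat V Q] {T : Type u}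
  [CommRing T] [Algebra V T] {𝓣 : AlgBornology V T} {θ : WeakCompletion π Q →ₐ[V] T}
  (hπ : π ≠ 0) (h : IsDaggerAway s 𝓣 θ)

/-- The comparison map from the weak completion of a tensor power to a completed tensor power. -/
def IsDaggerAway.powLift {n : ℕ} (hn : 0 < n) :
    WeakCompletion π (TPow V Q n) →ₐ[V] CPow V π 𝓣 n :=
  lift (tPow_smul_eq_zero hπ n) (powHom n θ) (h.bounded_powHom hn)

lemma IsDaggerAway.powLift_of {n : ℕ} (hn : 0 < n) (x : TPow V Q n) :
    h.powLift hπ hn (WeakCompletion.of π _ x) = Completion.of π _ (powHom n θ x) :=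
  lift_of _ _ _ x

lemma IsDaggerAway.isDaggerAway_powLift (hs : s ∣ π) {n : ℕ} (hn : 0 < n) :
    IsDaggerAway s (Completion.bornology π (TPow.bornology 𝓣 n)) (h.powLift hπ hn) :=
  (h.isDaggerDense_powHom hs hn (tPow_smul_eq_zero hπ n)).isDaggerAway_lift _

lemma IsDaggerAway.map_powLift {m n : ℕ} (hm : 0 < m) (hn : 0 < n) (f : Fin m → Fin n)
    (z : WeakCompletion π (TPow V Q m)) : CPow.map V π 𝓣 f (h.powLift hπ hm z) =
      h.powLift hπ hn (WeakCompletion.map π (TPow.map V f) z) :=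
  map_lift _ _ _ _ _ _ _ _ _ (TPow.mapHom_map _ f).symm z

/-- Both sides extend one map on `Q`, and the right-hand side comes from a bounded homomorphism, so
`lift_eq_of_bounded` identifies it with the lift. -/
lemma IsDaggerAway.powLift_incl {n : ℕ} (hn : 0 < n) (i : Fin n) (z : WeakCompletion π Q) :
    h.powLift hπ hn (WeakCompletion.map π (TPow.incl V Q i) z) =
      Completion.of π _ (TPow.incl V T i (θ z)) := by
  have htf : ∀ x : Q, π • x = 0 → x = 0 := fun x hx => (smul_eq_zero_iff_right hπ).1 hx
  have hχ := BoundedMap.comp (TPow.bounded_incl 𝓣 i) h.bounded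
  have hψ := BoundedMap.comp hχ (bounded_of_dagger (π := π) (Q := Q))
  have h1 := lift_eq_of_bounded htf (ψ := ((TPow.incl V T i).comp θ).comp (WeakCompletion.of π Q))
    (𝓑 := TPow.bornology 𝓣 n) hψ (χ := (TPow.incl V T i).comp θ) hχ rfl z
  refine Eq.trans ?_ h1
  have hid : BoundedMap (TPow.bornology 𝓣 n).toConvexBornology
      (TPow.bornology 𝓣 n).toConvexBornology (AlgHom.id V (TPow V T n)) := fun S hS => by
    have e : (AlgHom.id V (TPow V T n)) '' S = S := Set.image_id S
    rwa [e]
  -- Naturality of the lift along the inclusion of the `i`-th factor, with the identity on the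
  -- target.
  have h2 := map_lift htf (((TPow.incl V T i).comp θ).comp (WeakCompletion.of π Q)) hψ
    (tPow_smul_eq_zero hπ n) (powHom n θ)
    (h.bounded_powHom hn) (TPow.incl V Q i) (AlgHom.id V _) hid
    (AlgHom.ext fun x => (TPow.mapHom_incl (θ.comp (WeakCompletion.of π Q)) i x).symm) z
  refine h2.symm.trans ?_
  obtain ⟨x, hx⟩ := Completion.mk_surjective π _
    (lift htf (((TPow.incl V T i).comp θ).comp (WeakCompletion.of π Q)) hψ z)
  rw [← hx]
  exact Completion.map_mk π _ hid x

-- In other words, `T` is complete: composed with `θ`, the map becomes the localization at `s` of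
-- the weak completion of the first tensor power of `Q`.
include hπ h in
lemma IsDaggerAway.completedSingle_bijective (hs : s ∣ π) :
    Function.Bijective (completedSingle π 𝓣) := by
  have h1 : (completedSingle π 𝓣).comp θ =
      (h.powLift hπ one_pos).comp (WeakCompletion.map π (TPow.single V Q)) :=
    AlgHom.ext fun z => (h.powLift_incl hπ one_pos 0 z).symm
  refine h.away.bijective_of_comp _ ?_
  rw [h1]
  exact isAway_comp_bijective (WeakCompletion.map_bijective π TPow.single_bijective)
    (h.isDaggerAway_powLift hπ hs one_pos).away

-- Before localization this is the weak completion of the inclusion of two tensor factors, which is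
-- flat algebraically. Localizing at `s` on both sides keeps flatness.
include hπ h in
lemma IsDaggerAway.flat_map_endpoints (hs : s ∣ π) (n : ℕ) :
    ((completedPowers π 𝓣).map (endpoints n)).toRingHom.Flat := by
  refine (h.isDaggerAway_powLift hπ hs (n := 2) two_pos).away.flat_of_comp
    (CPow.map V π 𝓣 (endpoints n)) ?_
  have e : (CPow.map V π 𝓣 (endpoints n)).comp (h.powLift hπ two_pos) =
      (h.powLift hπ (n + 1).succ_pos).comp (WeakCompletion.map π (TPow.map V (endpoints n))) :=
    AlgHom.ext fun z => h.map_powLift hπ two_pos (n + 1).succ_pos _ z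
  rw [e]
  exact RingHom.Flat.comp (f := (WeakCompletion.map π (TPow.map V (A := Q) (endpoints n))).toRingHom)
    (g := (h.powLift hπ (n + 1).succ_pos).toRingHom)
    (WeakCompletion.flat_map π _ (TPow.flat_map_of_injective _ (TPow.endpoints_injective n)))
    (h.isDaggerAway_powLift hπ hs _).away.flat

-- On weak completions the kernel is generated by the algebraic one, where `TPow.ker_closeUp_le`
-- applies; `IsAway.ker_le` carries the inclusion to the localization.
include hπ h in
lemma IsDaggerAway.ker_closeUp_le (hs : s ∣ π) (n : ℕ) :
    RingHom.ker ((completedPowers π 𝓣).map (closeUp n)) ≤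
      (RingHom.ker ((completedPowers π 𝓣).map (fun _ : Fin 2 => (0 : Fin 1)))).map
        ((completedPowers π 𝓣).map (endpoints n)) := by
  let J : Ideal (CPow V π 𝓣 (n + 2)) :=
    (RingHom.ker ((completedPowers π 𝓣).map (fun _ : Fin 2 => (0 : Fin 1)))).map
        ((completedPowers π 𝓣).map (endpoints n))
  refine (h.isDaggerAway_powLift hπ hs (n + 1).succ_pos).away.ker_le (J := J)
    (h.isDaggerAway_powLift hπ hs n.succ_pos).away.injective
    (WeakCompletion.map π (TPow.map V (closeUp n))) _ (fun x => h.map_powLift hπ _ _ _ x) ?_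
  rw [WeakCompletion.ker_map π (TPow.map V (closeUp n)) (closeUp_surjective (tensorPowers V Q) n), Ideal.map_le_iff_le_comap]
  refine (TPow.ker_closeUp_le n).trans (Ideal.map_le_iff_le_comap.2 fun x hx => ?_)
  simp only [Ideal.mem_comap]
  rw [← WeakCompletion.map_of', ← h.map_powLift hπ two_pos]
  refine Ideal.mem_map_of_mem ((completedPowers π 𝓣).map (endpoints n)) ?_
  refine (h.map_powLift hπ two_pos one_pos (fun _ => 0) _).trans ?_
  rw [WeakCompletion.map_of', RingHom.mem_ker.1 hx, map_zero, map_zero]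
  rfl

variable {A : Type u} [CommRing A] [Algebra V A] {i : Q →ₐ[V] A} (hi : IsAway s i) {g : A →ₐ[V] T}
  (hg : g.comp i = θ.comp (WeakCompletion.of π Q))

omit [IsDomain V] [IsNoetherianRing V] [Algebra.FiniteType V Q] in
lemma IsAway.module_flat {i : Q →ₐ[V] A} (hi : IsAway s i) : Module.Flat V A := by
  rw [← RingHom.flat_algebraMap_iff]
  have e : algebraMap V A = i.toRingHom.comp (algebraMap V Q) :=
    RingHom.ext fun r => (i.commutes r).symm
  rw [e]
  exact RingHom.Flat.comp (RingHom.flat_algebraMap_iff.2 inferInstance) hi.flat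

include hg in
lemma IsDaggerAway.toCompletedPowers_app {n : ℕ} (hn : 0 < n) (x : TPow V Q n) :
    (toCompletedPowers π 𝓣 g).app n (TPow.mapHom n i x) =
      h.powLift hπ hn (WeakCompletion.of π _ x) := by
  rw [h.powLift_of]
  refine congrArg (Completion.of π _) ((DFunLike.congr_fun (TPow.mapHom_comp n g i) x).trans ?_)
  rw [hg]

omit [IsNoetherianRing V] [Algebra.FiniteType V Q] in
lemma IsAway.mapHom (hs : s ∣ π) (hπ : π ≠ 0) {i : Q →ₐ[V] A} (hi : IsAway s i) {n : ℕ}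
    (hn : 0 < n) : IsAway s (TPow.mapHom n i) :=
  TPow.isAway_mapHom hi (smul_eq_zero_of_dvd hs (tPow_smul_eq_zero hπ n))
    (isUnit_algebraMap_tPow hn hi.isUnit)

-- Restricted along the localization from the tensor power of `Q`, the map is the flat map to the
-- weak completion followed by a localization.
include hπ h hi hg in
lemma IsDaggerAway.flat_app (hs : s ∣ π) {n : ℕ} (hn : 0 < n) :
    ((toCompletedPowers π 𝓣 g).app n).toRingHom.Flat := by
  refine (hi.mapHom hs hπ hn).flat_of_comp
    ((Completion.of π (TPow.bornology 𝓣 n)).comp (TPow.mapHom n g)) ?_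
  have e : ((Completion.of π (TPow.bornology 𝓣 n)).comp (TPow.mapHom n g)).comp (TPow.mapHom n i) =
      (h.powLift hπ hn).comp (WeakCompletion.of π _) :=
    AlgHom.ext fun x => h.toCompletedPowers_app hπ hg hn x
  rw [e]
  exact RingHom.Flat.comp (f := (WeakCompletion.of π (TPow V Q n)).toRingHom)
    (g := (h.powLift hπ hn).toRingHom) (WeakCompletion.flat_of π _)
    (h.isDaggerAway_powLift hπ hs hn).away.flat

include hπ h hg in
lemma IsDaggerAway.ker_const_le (hs : s ∣ π) :
    RingHom.ker ((completedPowers π 𝓣).map (fun _ : Fin 2 => (0 : Fin 1))) ≤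
      (RingHom.ker ((tensorPowers V A).map (fun _ : Fin 2 => (0 : Fin 1)))).map
        ((toCompletedPowers π 𝓣 g).app 2) := by
  let J : Ideal (CPow V π 𝓣 2) :=
    (RingHom.ker ((tensorPowers V A).map (fun _ : Fin 2 => (0 : Fin 1)))).map
        ((toCompletedPowers π 𝓣 g).app 2)
  refine (h.isDaggerAway_powLift hπ hs two_pos).away.ker_le (J := J)
    (h.isDaggerAway_powLift hπ hs one_pos).away.injective
    (WeakCompletion.map π (TPow.map V (fun _ : Fin 2 => (0 : Fin 1)))) _
    (fun x => h.map_powLift hπ _ _ _ x) ?_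
  rw [WeakCompletion.ker_map π (TPow.map V (fun _ : Fin 2 => (0 : Fin 1)))
    (tensorPowers V Q).map_const_surjective, Ideal.map_le_iff_le_comap]
  intro x hx
  simp only [Ideal.mem_comap]
  rw [← h.toCompletedPowers_app hπ hg]
  refine Ideal.mem_map_of_mem _ ?_
  have h1 := DFunLike.congr_fun (TPow.mapHom_map i (fun _ : Fin 2 => (0 : Fin 1))) x
  refine h1.symm.trans ?_
  rw [AlgHom.comp_apply, RingHom.mem_ker.1 hx, map_zero]
  rfl

include hπ h hi hg in
theorem IsDaggerAway.quasiIso_hochschildComparison (hs : s ∣ π) :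
    QuasiIso (extendHom (hochschildComparison π 𝓣 g)) := by
  have := hi.module_flat
  exact quasiIso_hochschild (toCompletedPowers π 𝓣 g) g (tensorSingle V A) (completedSingle π 𝓣) _
    TPow.single_bijective (h.completedSingle_bijective hπ hs)
    (fun n => TPow.flat_map_of_injective _ (TPow.endpoints_injective n))
    (h.flat_map_endpoints hπ hs) (h.flat_app hπ hi hg hs two_pos) TPow.ker_closeUp_le
    (h.ker_closeUp_le hπ hs) (h.ker_const_le hπ hg hs)

omit [IsDomain V] [Module.Flat V Q] in
include h hi hg in
theorem IsDaggerAway.flat : g.toRingHom.Flat := by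
  refine hi.flat_of_comp g ?_
  rw [hg]
  exact RingHom.Flat.comp (f := (WeakCompletion.of π Q).toRingHom) (g := θ.toRingHom)
    (WeakCompletion.flat_of π Q) h.away.flat

include hπ h hi hg in
theorem IsDaggerAway.isIso_extendHomology (hs : s ∣ π) (n : ℕ) :
    IsIso (extendHomology (hochschildComparison π 𝓣 g) n) :=
  BornHH.isIso_extendHomology (h.flat hi hg) _
    (h.quasiIso_hochschildComparison hπ hi hg hs) n

end

open ConvexBornology AlgBornology

lemma flat_of_smul_eq_zero {V : Type*} [CommRing V] [IsDomain V] [IsDiscreteValuationRing V] {π : V}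
    (hπ : Irreducible π) {X : Type*} [AddCommGroup X] [Module V X]
    (htf : ∀ x : X, π • x = 0 → x = 0) : Module.Flat V X := by
  have : Module.IsTorsionFree V X := by
    refine ⟨fun r hr => ?_⟩
    obtain ⟨n, w, rfl⟩ := IsDiscreteValuationRing.eq_unit_mul_pow_irreducible hr.ne_zero hπ
    refine (IsSMulRegular.mul ?_ (IsSMulRegular.pow n ?_))
    · exact w.isUnit.isSMulRegular X
    · exact fun x y h => sub_eq_zero.1 (htf _ (by rw [smul_sub]; exact sub_eq_zero.2 h))
  infer_instance

lemma bounded_weakCompletionMap {V : Type*} [CommRing V] {π : V} {A B : Type*} [CommRing A]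
    [CommRing B] [Algebra V A] [Algebra V B] (f : A →ₐ[V] B) :
    BoundedMap (WeakCompletion.bornology π A).toConvexBornology
      (WeakCompletion.bornology π B).toConvexBornology (WeakCompletion.map π f) := by
  intro S hS
  obtain ⟨M, c, hM, h1, hS⟩ := WeakCompletion.exists_of_bdd hS
  refine (bdd_weakBallSubmodule (hM.map f.toLinearMap) ⟨1, h1, map_one f⟩ c).subset ?_
  rintro _ ⟨z, hz, rfl⟩
  exact WeakCompletion.adicMap_mem_weakBall π f (hS hz)

lemma IsAway.bijective_of_one {V : Type*} [CommRing V] {X : Type*} [CommRing X] [Algebra V X]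
    {Y : Type*} [CommRing Y] [Algebra V Y] {f : X →ₐ[V] Y} (h : IsAway 1 f) :
    Function.Bijective f :=
  ⟨h.injective, fun y => by
    obtain ⟨l, x, hx⟩ := h.exists_smul y
    exact ⟨x, by rw [← hx, one_pow, one_smul]⟩⟩

/-! ### The completed tensor square of a weak completion -/

namespace WeakCompletion

section

variable {V : Type u} [CommRing V] {π : V} (R : Type u) [CommRing R] [Algebra V R]

lemma mulDagger_includeLeft (x : WeakCompletion π R) :
    mulDagger π R (WeakCompletion.map π Algebra.TensorProduct.includeLeft x) = x := by
  rw [mulDagger, map_map]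
  have e : (Algebra.TensorProduct.lmul' V : R ⊗[V] R →ₐ[V] R).comp
      Algebra.TensorProduct.includeLeft = AlgHom.id V R := by ext; simp
  rw [e, map_id]

lemma mulDagger_includeRight (x : WeakCompletion π R) :
    mulDagger π R (WeakCompletion.map π Algebra.TensorProduct.includeRight x) = x := by
  rw [mulDagger, map_map]
  have e : (Algebra.TensorProduct.lmul' V : R ⊗[V] R →ₐ[V] R).comp
      Algebra.TensorProduct.includeRight = AlgHom.id V R := by ext; simp
  rw [e, map_id]

end

variable {V : Type u} [CommRing V] [IsDomain V] [IsNoetherianRing V] {π : V} (hπ : π ≠ 0)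
  (R : Type u) [CommRing R] [Algebra V R] [Algebra.FiniteType V R] [Module.Flat V R]

/-- The isomorphism between the weak completion of `R ⊗ R` and the completed tensor square of the
weak completion of `R`. -/
def tensorEquiv : WeakCompletion π (R ⊗[V] R) ≃ₐ[V]
    (completedPowers π (WeakCompletion.bornology π R)).X 2 :=
  AlgEquiv.ofBijective
    (((isDaggerAway_id (π := π) (Q := R)).powLift hπ two_pos).comp
      (WeakCompletion.map π (TPow.pair V R)))
    (((isDaggerAway_id (π := π) (Q := R)).isDaggerAway_powLift hπ
      (one_dvd _) two_pos).away.bijective_of_one.comp (map_bijective π TPow.pair_bijective))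

lemma tensorEquiv_apply (z : WeakCompletion π (R ⊗[V] R)) : tensorEquiv hπ R z =
    (isDaggerAway_id (π := π) (Q := R)).powLift hπ two_pos
      (WeakCompletion.map π (TPow.pair V R) z) := rfl

lemma bounded_tensorEquiv : BoundedMap (WeakCompletion.bornology π (R ⊗[V] R)).toConvexBornology
    (Completion.bornology π (TPow.bornology (WeakCompletion.bornology π R) 2)).toConvexBornology
    (tensorEquiv hπ R) := by
  have h1 := ((isDaggerAway_id (π := π) (Q := R)).isDaggerAway_powLift hπ
    (one_dvd _) two_pos).bounded
  intro S hS
  have h2 := h1 _ (bounded_weakCompletionMap (TPow.pair V R) S hS)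
  rwa [← Set.image_comp] at h2

lemma bounded_tensorEquiv_symm : BoundedMap
    (Completion.bornology π (TPow.bornology (WeakCompletion.bornology π R) 2)).toConvexBornology
    (WeakCompletion.bornology π (R ⊗[V] R)).toConvexBornology (tensorEquiv hπ R).symm := by
  intro S hS
  obtain ⟨l, M, c, hM, h1, hz⟩ := ((isDaggerAway_id (π := π) (Q := R)).isDaggerAway_powLift hπ
    (one_dvd _) two_pos).exists_ball S hS
  let e := AlgEquiv.ofBijective (TPow.pair V R) TPow.pair_bijective
  refine (bounded_weakCompletionMap e.symm.toAlgHom _ (bdd_weakBallSubmodule hM h1 c)).subset ?_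
  rintro _ ⟨y, hy, rfl⟩
  obtain ⟨z, hz, hzy⟩ := hz y hy
  refine ⟨z, hz, ?_⟩
  rw [one_pow, one_smul] at hzy
  refine (tensorEquiv hπ R).injective ((tensorEquiv_apply hπ R _).trans ?_)
  have h2 : (TPow.pair V R).comp e.symm.toAlgHom = AlgHom.id V _ := AlgHom.ext e.apply_symm_apply
  rw [map_map, h2, map_id, ← hzy]
  exact ((tensorEquiv hπ R).apply_symm_apply y).symm

lemma tensorEquiv_of_tmul (a b : R) : tensorEquiv hπ R (of π (R ⊗[V] R) (a ⊗ₜ b)) =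
    completedPair π (WeakCompletion.bornology π R) (of π R a ⊗ₜ of π R b) := by
  rw [tensorEquiv_apply, map_of', IsDaggerAway.powLift_of, TPow.pair_tmul]
  refine congrArg (Completion.of π _) ?_
  rw [TPow.mapHom_tprod]
  refine Eq.trans ?_ (TPow.pair_tmul V (WeakCompletion π R) _ _).symm
  congr 1
  ext i
  fin_cases i <;> rfl

lemma completedPair_tmul_one (x : WeakCompletion π R) :
    completedPair π (WeakCompletion.bornology π R) (x ⊗ₜ 1) =
      tensorEquiv hπ R (WeakCompletion.map π Algebra.TensorProduct.includeLeft x) := by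
  rw [tensorEquiv_apply, map_map]
  have e : (TPow.pair V R).comp Algebra.TensorProduct.includeLeft = TPow.incl V R 0 :=
    Algebra.TensorProduct.productMap_left _ _
  rw [e, IsDaggerAway.powLift_incl]
  exact congrArg (Completion.of π _) (DFunLike.congr_fun
    (Algebra.TensorProduct.productMap_left _ _ : (TPow.pair V (WeakCompletion π R)).comp
      Algebra.TensorProduct.includeLeft = TPow.incl V (WeakCompletion π R) 0) x)

lemma completedPair_one_tmul (x : WeakCompletion π R) :
    completedPair π (WeakCompletion.bornology π R) (1 ⊗ₜ x) =
      tensorEquiv hπ R (WeakCompletion.map π Algebra.TensorProduct.includeRight x) := by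
  rw [tensorEquiv_apply, map_map]
  have e : (TPow.pair V R).comp Algebra.TensorProduct.includeRight = TPow.incl V R 1 :=
    Algebra.TensorProduct.productMap_right _ _
  rw [e, IsDaggerAway.powLift_incl]
  exact congrArg (Completion.of π _) (DFunLike.congr_fun
    (Algebra.TensorProduct.productMap_right _ _ : (TPow.pair V (WeakCompletion π R)).comp
      Algebra.TensorProduct.includeRight = TPow.incl V (WeakCompletion π R) 1) x)

lemma mulDagger_tensorEquiv_symm (x y : WeakCompletion π R) : mulDagger π R
    ((tensorEquiv hπ R).symm (completedPair π (WeakCompletion.bornology π R) (x ⊗ₜ y))) = x * y := by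
  have e : x ⊗ₜ[V] y = (x ⊗ₜ 1) * (1 ⊗ₜ y) := by simp
  rw [e, map_mul, completedPair_tmul_one hπ, completedPair_one_tmul hπ, map_mul, map_mul,
    AlgEquiv.symm_apply_apply, AlgEquiv.symm_apply_apply, mulDagger_includeLeft,
    mulDagger_includeRight]

/-- This matches the augmentation by `mulDagger` with the multiplication of the functor of completed
powers, for which the bar resolution is formal. -/
lemma map_const_tensorEquiv (z : WeakCompletion π (R ⊗[V] R)) :
    (completedPowers π (WeakCompletion.bornology π R)).map (fun _ : Fin 2 => (0 : Fin 1))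
      (tensorEquiv hπ R z) = completedSingle π (WeakCompletion.bornology π R) (mulDagger π R z) := by
  refine ((isDaggerAway_id (π := π) (Q := R)).map_powLift hπ two_pos one_pos _ _).trans ?_
  have e : (TPow.map V (fun _ : Fin 2 => (0 : Fin 1))).comp (TPow.pair V R) =
      (TPow.incl V R (0 : Fin 1)).comp (Algebra.TensorProduct.lmul' V) := by
    refine Algebra.TensorProduct.ext ?_ ?_
    · ext a
      have h0 : TPow.pair V R (a ⊗ₜ 1) = TPow.incl V R 0 a := DFunLike.congr_fun
        (Algebra.TensorProduct.productMap_left _ _ : (TPow.pair V R).comp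
          Algebra.TensorProduct.includeLeft = TPow.incl V R 0) a
      simp [h0]
    · ext a
      have h0 : TPow.pair V R (1 ⊗ₜ a) = TPow.incl V R 1 a := DFunLike.congr_fun
        (Algebra.TensorProduct.productMap_right _ _ : (TPow.pair V R).comp
          Algebra.TensorProduct.includeRight = TPow.incl V R 1) a
      simp [h0]
  refine (congrArg _ ((map_map ..).trans ((congrArg (fun f => WeakCompletion.map π f z) e).trans
    (map_map ..).symm))).trans ?_
  exact IsDaggerAway.powLift_incl hπ _ one_pos _ _

theorem isFlatResolution_completedBar : IsFlatResolution
    (completedBar π (WeakCompletion.bornology π R) (tensorEquiv hπ R).toAlgHom)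
    (completedBarAugmentation (tensorEquiv hπ R)) := by
  have h := isDaggerAway_id (π := π) (Q := R)
  refine isFlatResolution_barOf _ _ (tensorEquiv hπ R).bijective
    (h.flat_map_endpoints hπ (one_dvd _)) _ (fun y => ?_) (fun x => ?_)
  · refine ⟨tensorEquiv hπ R (WeakCompletion.map π Algebra.TensorProduct.includeLeft y), ?_⟩
    refine Eq.trans ?_ (mulDagger_includeLeft R y)
    exact congrArg (mulDagger π R) ((tensorEquiv hπ R).symm_apply_apply _)
  · obtain ⟨z, rfl⟩ := (tensorEquiv hπ R).surjective x
    rw [map_const_tensorEquiv, map_eq_zero_iff _ (h.completedSingle_bijective hπ (one_dvd _)).1]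
    refine Eq.congr_left ?_
    exact congrArg (mulDagger π R) ((tensorEquiv hπ R).symm_apply_apply z)

end WeakCompletion

/-! ### The bar complex extended to `(R ⊗ R)†` -/

section ExtendedBar

variable (V : Type u) [CommRing V] (π : V) (R : Type u) [CommRing R] [Algebra V R]

/-- `R` as a module over `R ⊗ R`. -/
abbrev diagonalModule : ModuleCat.{u} (R ⊗[V] R) :=
  (ModuleCat.restrictScalars (Algebra.TensorProduct.lmul' V : R ⊗[V] R →ₐ[V] R).toRingHom).obj
    (ModuleCat.of R R)

/-- The augmentation of the bar complex. -/
def barAugmentation : (bar V R).X 0 ⟶ diagonalModule V R :=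
  ModuleCat.ofHom (X := BarChains (tensorPowers V R) (tensorPair V R) 0)
    (Y := diagonalModule V R)
    { toFun := fun x => TPow.prod V R 2 x
      map_add' := map_add (TPow.prod V R 2)
      map_smul' := fun a x => by
        have h₁ : TPow.map V (endpoints 0) (TPow.pair V R a) = TPow.pair V R a := by
          rw [endpoints_zero]
          exact DFunLike.congr_fun (TPow.map_id V 2) _
        have h₂ := map_mul (TPow.prod V R 2) (TPow.map V (endpoints 0) (TPow.pair V R a)) x
        have h₃ := DFunLike.congr_fun (prod_comp_pair (V := V) R) a
        rw [AlgHom.comp_apply] at h₃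
        exact h₂.trans (congrArg (· * _) ((congrArg (TPow.prod V R 2) h₁).trans h₃)) }

lemma TPow.single_prod (x : TPow V R 2) :
    TPow.single V R (TPow.prod V R 2 x) = TPow.map V (fun _ => (0 : Fin 1)) x := by
  have e : (TPow.single V R).comp (TPow.prod V R 2) = TPow.map V (fun _ => (0 : Fin 1)) := by
    refine TPow.hom_ext fun a => ?_
    rw [AlgHom.comp_apply, TPow.prod_tprod, TPow.single_apply, TPow.map_tprod]
    congr 1
    ext i
    simp [merge, Subsingleton.elim i 0]
  exact DFunLike.congr_fun e x

theorem isFlatResolution_bar [Module.Flat V R] :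
    IsFlatResolution (bar V R) (barAugmentation V R) := by
  refine isFlatResolution_barOf (tensorPowers V R) (tensorPair V R) TPow.pair_bijective
    (fun n => TPow.flat_map_of_injective _ (TPow.endpoints_injective n)) _ (fun r => ?_)
    (fun x => ?_)
  · refine ⟨TPow.pair V R (r ⊗ₜ 1), (DFunLike.congr_fun (prod_comp_pair (V := V) R) _).trans ?_⟩
    exact (Algebra.TensorProduct.lmul'_apply_tmul (S := R) r 1).trans (mul_one (M := R) r)
  · refine (map_eq_zero_iff _ (TPow.single_bijective (V := V) (A := R)).1).symm.trans ?_
    exact Eq.congr_left (TPow.single_prod V R x)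

variable {V}

/-- The inclusion of `R` into its weak completion, as a map of `R ⊗ R`-modules. -/
def toDaggerModule : diagonalModule V R ⟶
    (ModuleCat.restrictScalars (WeakCompletion.of π (R ⊗[V] R)).toRingHom).obj
      (daggerModule π R) :=
  ModuleCat.ofHom (X := diagonalModule V R)
    (Y := (ModuleCat.restrictScalars (WeakCompletion.of π (R ⊗[V] R)).toRingHom).obj
      (daggerModule π R))
    { toFun := WeakCompletion.of π R
      map_add' := map_add (WeakCompletion.of π R)
      map_smul' := fun a x => by
        have h := WeakCompletion.map_of π (R ⊗[V] R) (Algebra.TensorProduct.lmul' V) a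
        exact (map_mul (WeakCompletion.of π R) (Algebra.TensorProduct.lmul' V a) x).trans
          (congrArg (· * WeakCompletion.of π R x) h.symm) }

/-- The map `R ⊗ R → (R ⊗ R)†` is flat, and `ker μ†` is generated by `ker μ`. So the bar resolution
stays exact and the extension of `R` is `R†`. -/
theorem isFlatResolution_extendedBar [IsNoetherianRing V] [Algebra.FiniteType V R]
    [Module.Flat V R] :
    IsFlatResolution (extendedBar π R) (extendedBarAugmentation π R) := by
  have : Algebra.FiniteType V (R ⊗[V] R) := Algebra.FiniteType.trans (S := R) ‹_› inferInstance
  refine IsFlatResolution.extend (WeakCompletion.flat_of π (R ⊗[V] R))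
    (isFlatResolution_bar V R) (toDaggerModule π R) ?_
  refine bijective_of_cyclic _ (1 : R) (1 : WeakCompletion π R)
    (map_one (WeakCompletion.of π R)) (fun r => ⟨r ⊗ₜ 1, ?_⟩)
    (fun s => ⟨WeakCompletion.map π Algebra.TensorProduct.includeLeft s, ?_⟩)
    (RingHom.ker (Algebra.TensorProduct.lmul' V : R ⊗[V] R →ₐ[V] R)) (fun a ha => ?_)
    (fun s hs => ?_)
  · exact (congrArg (· * (1 : R)) (Algebra.TensorProduct.lmul'_apply_tmul (S := R) r 1)).trans
      ((mul_one (M := R) _).trans (mul_one (M := R) r))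
  · exact (mul_one (mulDagger π R _)).trans (WeakCompletion.mulDagger_includeLeft R s)
  · exact (mul_one (M := R) _).trans ha
  · have h := WeakCompletion.ker_map (π := π) (Algebra.TensorProduct.lmul' V : R ⊗[V] R →ₐ[V] R)
      (fun r => ⟨r ⊗ₜ 1, by simp⟩)
    refine h.le ?_
    exact (mul_one (mulDagger π R s)).symm.trans hs

end ExtendedBar

open ConvexBornology AlgBornology

/-! ### Bornologies governed by a finitely generated subalgebra -/

section Adjoin

variable {V : Type*} [CommRing V] {π : V} {A : Type*} [CommRing A] [Algebra V A]

lemma adjoin_exhausts {M : Submodule V A} (h1 : (1 : A) ∈ M) {x : A}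
    (hx : x ∈ Algebra.adjoin V (M : Set A)) : ∃ k, x ∈ M ^ k := by
  induction hx using Algebra.adjoin_induction with
  | mem x hx => exact ⟨1, by simpa using hx⟩
  | algebraMap r =>
    refine ⟨1, ?_⟩
    rw [pow_one, Algebra.algebraMap_eq_smul_one]
    exact M.smul_mem r h1
  | add x y _ _ hx hy =>
    obtain ⟨k, hk⟩ := hx
    obtain ⟨l, hl⟩ := hy
    exact ⟨max k l, add_mem (pow_mono_of_one_mem le_rfl h1 (le_max_left k l) hk)
      (pow_mono_of_one_mem le_rfl h1 (le_max_right k l) hl)⟩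
  | mul x y _ _ hx hy =>
    obtain ⟨k, hk⟩ := hx
    obtain ⟨l, hl⟩ := hy
    exact ⟨k + l, pow_add M k l ▸ Submodule.mul_mem_mul hk hl⟩

/-- The submodule `M` of the algebra that it generates. -/
def adjoinGenerators (M : Submodule V A) : Submodule V (Algebra.adjoin V (M : Set A)) :=
  M.comap (Algebra.adjoin V (M : Set A)).val.toLinearMap

lemma map_adjoinGenerators (M : Submodule V A) :
    (adjoinGenerators M).map (Algebra.adjoin V (M : Set A)).val.toLinearMap = M := by
  refine Submodule.map_comap_eq_of_le fun x hx => ⟨⟨x, Algebra.subset_adjoin hx⟩, rfl⟩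

lemma map_adjoinGenerators_pow (M : Submodule V A) (k : ℕ) :
    (adjoinGenerators M ^ k).map (Algebra.adjoin V (M : Set A)).val.toLinearMap = M ^ k := by
  have h := Submodule.map_pow (adjoinGenerators M) (Algebra.adjoin V (M : Set A)).val k
  exact h.trans (congrArg (· ^ k) (map_adjoinGenerators M))

lemma isGenerating_adjoinGenerators {M : Submodule V A} (hM : M.FG) (h1 : (1 : A) ∈ M) :
    IsGenerating (adjoinGenerators M) := by
  refine ⟨Submodule.fg_of_fg_map_injective _ Subtype.val_injective
    ((map_adjoinGenerators M).symm ▸ hM), h1, fun x => ?_⟩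
  obtain ⟨k, hk⟩ := adjoin_exhausts h1 x.2
  rw [← map_adjoinGenerators_pow] at hk
  obtain ⟨y, hy, hyx⟩ := hk
  exact ⟨k, Subtype.val_injective hyx ▸ hy⟩

lemma finiteType_adjoin {M : Submodule V A} (hM : M.FG) :
    Algebra.FiniteType V (Algebra.adjoin V (M : Set A)) := by
  obtain ⟨s, rfl⟩ := hM
  rw [Algebra.adjoin_span]
  exact (Subalgebra.fg_iff_finiteType _).1 ⟨s, rfl⟩

lemma daggerBall_le_map_adjoin (M : Submodule V A) (c : ℕ) : daggerBall π M c ≤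
    (daggerBall π (adjoinGenerators M) c).map (Algebra.adjoin V (M : Set A)).val.toLinearMap := by
  refine daggerBall_le fun j x hx => ?_
  rw [← map_adjoinGenerators_pow] at hx
  obtain ⟨y, hy, rfl⟩ := hx
  exact ⟨π ^ j • y, pow_smul_mem_daggerBall hy, map_smul _ _ _⟩

/-- Bounded sets come from the subalgebra after multiplication by a power of `π`, without any error
of approximation. The subalgebra itself is the lattice that gives strictness. -/
theorem isDaggerDense_adjoin (hπ : IsUnit (algebraMap V A π)) {𝓑 : AlgBornology V A}
    {M : Submodule V A} (hM : M.FG) (h1 : (1 : A) ∈ M)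
    (hb : ∀ c, 𝓑.Bdd (daggerBall π M c))
    (hd : ∀ S : Submodule V A, 𝓑.Bdd S → ∃ l c : ℕ, ∀ x ∈ S, π ^ l • x ∈ daggerBall π M c) :
    IsDaggerDense (π := π) π 𝓑 (Algebra.adjoin V (M : Set A)).val := by
  have hg := isGenerating_adjoinGenerators hM h1
  refine ⟨hπ, fun S hS => ?_, fun S hS => ?_, (Algebra.adjoin V (M : Set A)).toSubmodule,
    fun S hS => ?_, fun q k hq => ?_⟩
  · obtain ⟨c, hc⟩ := hg.exists_le_daggerBall hS
    refine (hb c).subset ?_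
    rintro _ ⟨x, hx, rfl⟩
    have h := map_daggerBall_le (π := π) (Algebra.adjoin V (M : Set A)).val (adjoinGenerators M) c
      (Submodule.mem_map_of_mem (hc hx))
    rwa [map_adjoinGenerators] at h
  · obtain ⟨l, c, h⟩ := hd S hS
    refine ⟨l, daggerBall π (adjoinGenerators M) c, S, bdd_daggerBall hg.fg hg.one_mem c, hS,
      fun x hx k => ?_⟩
    obtain ⟨d, hd, hdx⟩ := daggerBall_le_map_adjoin M c (h x hx)
    refine ⟨d, hd, ?_⟩
    rw [← hdx]
    have e : (Algebra.adjoin V (M : Set A)).val.toLinearMap d -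
        (Algebra.adjoin V (M : Set A)).val d = 0 := sub_self (d : A)
    exact e ▸ zero_mem _
  · obtain ⟨l, c, h⟩ := hd S hS
    refine ⟨l, fun x hx => ?_⟩
    obtain ⟨d, hd, hdx⟩ := daggerBall_le_map_adjoin M c (h x hx)
    exact hdx ▸ d.2
  · obtain ⟨y, hy, hyq⟩ := (Submodule.mem_smul_pointwise_iff_exists _ _ _).1 hq
    exact ⟨⟨y, hy⟩, Subtype.ext hyq.symm⟩

end Adjoin

open ConvexBornology AlgBornology

/-! ### Spectral radius estimates for blow-up generators -/

section TubeEstimates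

variable {V : Type u} [CommRing V] {K : Type u} [Field K] [Algebra V K] {ε : ℝ} {π : V}
  {X : Type u} [CommRing X] [Algebra V X] [Algebra K X] [IsScalarTower V K X]

lemma pow_le_smul_pow {M N : Submodule V X} {a : K} (h : N ≤ a • M) (n : ℕ) :
    N ^ n ≤ a ^ n • M ^ n := by
  induction n with
  | zero => simp
  | succ n ih =>
    rw [pow_succ, pow_succ, pow_succ]
    exact (mul_le_mul' ih h).trans (smul_mul_smul_submodule _ _ _ _)

lemma nsmul_le {L T : Submodule V X} (hL : L ≤ T) (k : ℕ) : k • L ≤ T := by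
  induction k with
  | zero => rw [zero_smul]; exact bot_le
  | succ k ih => rw [succ_nsmul]; exact sup_le ih hL

lemma sup_pow_le {P Q T : Submodule V X} {n : ℕ} (h : ∀ a b, a + b = n → P ^ a * Q ^ b ≤ T) :
    (P ⊔ Q) ^ n ≤ T := by
  rw [← Submodule.add_eq_sup, add_pow]
  refine Finset.sum_induction _ (· ≤ T) (fun _ _ => sup_le) bot_le fun m hm => ?_
  have hm' := Finset.mem_range.1 hm
  rw [← nsmul_eq_mul']
  exact nsmul_le (h m (n - m) (by omega)) _

lemma le_zpow_smul (h0 : algebraMap V K π ≠ 0) {N T : Submodule V X} {i : ℤ}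
    (h : algebraMap V K π ^ i • N ≤ T) : N ≤ algebraMap V K π ^ (-i) • T := by
  have h' := field_smul_mono (algebraMap V K π ^ (-i)) h
  rwa [smul_smul, ← zpow_add₀ h0, neg_add_cancel, zpow_zero, one_smul] at h'

lemma zpow_smul_pow_le_scaleSum (h0 : algebraMap V K π ≠ 0) {r : ℝ} {M : Submodule V X} {n : ℕ}
    {i : ℤ} (hi : -(n * Real.logb ε r) ≤ i) :
    algebraMap V K π ^ i • M ^ n ≤ scaleSum K ε π r M := by
  refine le_trans (zpow_smul_le h0 (Int.ceil_le.2 ?_) _)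
    (le_iSup (fun n : ℕ => scale K ε π (r ^ n)⁻¹ (M ^ n)) n)
  rwa [Real.logb_inv, Real.logb_pow]

/-- A product of `c * (j + 1)` generators has `b` factors from `U` and `a` from `π⁻ᵖ Gᑫ`. Grouping
the former into blocks of `4 * c` costs about `b / (4 * c)` powers of `π`. Lowering the slope `p /
q` by `1 / (4 * q * c)` costs about `a / (4 * c)` powers for the latter. Together this stays below
the available `j`, up to the constant `3`. -/
lemma daggerBall_le_scaleSum (h0 : algebraMap V K π ≠ 0) {G U M : Submodule V X}
    (h1 : (1 : X) ∈ U) {p q c : ℕ} (hq : 0 < q) (hc : 0 < c) (hG : G ≤ M)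
    (hU : U ^ (4 * c) ≤ algebraMap V K π ^ (-1 : ℤ) • M) {r : ℝ}
    (hr : Real.logb ε r = p / q - 1 / (4 * q * c)) :
    daggerBall π (U ⊔ algebraMap V K π ^ (-(p : ℤ)) • G ^ q) c ≤
      algebraMap V K π ^ (-3 : ℤ) • scaleSum K ε π r M := by
  refine daggerBall_le fun j x hx => ?_
  suffices h : (U ⊔ algebraMap V K π ^ (-(p : ℤ)) • G ^ q) ^ (c * (j + 1)) ≤
      algebraMap V K π ^ (-(j : ℤ)) • algebraMap V K π ^ (-3 : ℤ) • scaleSum K ε π r M by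
    obtain ⟨y, hy, rfl⟩ := (Submodule.mem_smul_pointwise_iff_exists _ _ _).1 (h hx)
    rw [← algebraMap_smul K (π ^ j) (_ • y), smul_smul, map_pow, ← zpow_natCast,
      ← zpow_add₀ h0, add_neg_cancel, zpow_zero, one_smul]
    exact hy
  refine sup_pow_le fun b a hab => ?_
  -- The number of blocks `U ^ (4 * c)`, rounded up. Each block lies in `π⁻¹ M`.
  let h := b / (4 * c) + 1
  have hbh : b ≤ 4 * c * h := (Nat.lt_mul_div_succ b (by omega)).le
  have e1 : U ^ b ≤ algebraMap V K π ^ (-(h : ℤ)) • M ^ h := by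
    refine (pow_mono_of_one_mem le_rfl h1 hbh).trans ?_
    rw [pow_mul]
    refine (pow_le_smul_pow hU h).trans_eq ?_
    rw [← zpow_natCast, ← zpow_mul, neg_one_mul]
  have e2 : (algebraMap V K π ^ (-(p : ℤ)) • G ^ q) ^ a ≤
      algebraMap V K π ^ (-((p * a : ℕ) : ℤ)) • M ^ (q * a) := by
    refine (pow_le_smul_pow le_rfl a).trans ?_
    rw [← zpow_natCast, ← zpow_mul, Nat.cast_mul, ← neg_mul, ← pow_mul]
    exact field_smul_mono _ (pow_le_pow_left' hG _)
  refine (mul_le_mul' e1 e2).trans ((smul_mul_smul_submodule _ _ _ _).trans ?_)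
  rw [← zpow_add₀ h0, ← pow_add, smul_smul, ← zpow_add₀ h0]
  have e3 : (-(h : ℤ) + -((p * a : ℕ) : ℤ)) =
      (-(j : ℤ) + -3) + ((j : ℤ) + 3 - h - (p * a : ℕ)) := by ring
  rw [e3, zpow_add₀ h0, mul_smul]
  refine field_smul_mono _ (zpow_smul_pow_le_scaleSum h0 ?_)
  rw [hr]
  have hq' : (0 : ℝ) < q := Nat.cast_pos.2 hq
  have hc' : (0 : ℝ) < c := Nat.cast_pos.2 hc
  have hc1 : (1 : ℝ) ≤ c := Nat.one_le_cast.2 hc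
  have hq1 : (1 : ℝ) ≤ q := Nat.one_le_cast.2 hq
  have hh : (h : ℝ) ≤ (j + 1) / 4 + 1 := by
    have h2 : b / (4 * c) * (4 * c) ≤ c * (j + 1) := (Nat.div_mul_le_self b _).trans (by omega)
    have h3 : (((b / (4 * c) : ℕ) : ℝ)) * (4 * c) ≤ c * (j + 1) := by exact_mod_cast h2
    have h4 : (((b / (4 * c) : ℕ) : ℝ)) ≤ (j + 1) / 4 := by
      rw [le_div_iff₀ (by norm_num)]
      nlinarith
    push_cast [h]
    linarith
  have ha : (a : ℝ) / (4 * c) ≤ (j + 1) / 4 := by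
    have h2 : (a : ℝ) ≤ c * (j + 1) := by exact_mod_cast (by omega : a ≤ c * (j + 1))
    rw [div_le_div_iff₀ (by positivity) (by norm_num)]
    nlinarith
  have hδ : 1 / (4 * (q : ℝ) * c) ≤ 1 / 4 := by
    refine one_div_le_one_div_of_le (by norm_num) ?_
    nlinarith
  have hp : (0 : ℝ) ≤ p / q := by positivity
  have e4 : (((h + q * a : ℕ) : ℝ)) * (p / q - 1 / (4 * q * c)) =
      h * (p / q) - h * (1 / (4 * q * c)) + p * a - a / (4 * c) := by
    push_cast
    field_simp
    ring
  rw [e4]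
  push_cast
  have hh0 : (0 : ℝ) ≤ h := Nat.cast_nonneg _
  have := mul_nonneg hh0 hp
  have := mul_le_mul_of_nonneg_left hδ hh0
  have : (0 : ℝ) ≤ j := Nat.cast_nonneg _
  linarith

/-- With `a = n / q`, the power `M ^ n` gains `p * a` powers of `π`, since `M ^ q` lies in `Gᑫ`
times a power of `U`. The scaling uses up only about `q * a * logb ε r` of them. As `logb ε r < p /
q`, a surplus proportional to `a` remains, while the number of generators used is linear in `a`. -/
lemma exists_smul_scaleSum_le_daggerBall (h0 : algebraMap V K π ≠ 0) {G U M : Submodule V X}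
    (h1 : (1 : X) ∈ U) {p q s t : ℕ} (hq : 0 < q) (hs : M ≤ U ^ s) (ht : M ≤ G * U ^ t) {r : ℝ}
    (hr : Real.logb ε r < p / q) (l : ℤ) :
    ∃ L c : ℕ, algebraMap V K π ^ (L : ℤ) • algebraMap V K π ^ l • scaleSum K ε π r M ≤
      daggerBall π (U ⊔ algebraMap V K π ^ (-(p : ℤ)) • G ^ q) c := by
  let β := Real.logb ε r
  let M' := U ⊔ algebraMap V K π ^ (-(p : ℤ)) • G ^ q
  have hq' : (0 : ℝ) < q := Nat.cast_pos.2 hq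
  have hβ : 0 < p - q * β := by
    have := (lt_div_iff₀ hq').1 hr
    have e : β * q = q * β := mul_comm _ _
    change β * q < p at this
    linarith
  -- The surplus of powers of `π` is `a * (p - q * β)`, so `d` is chosen to make it at least `a /
  -- d`.
  obtain ⟨d, hd⟩ := exists_nat_gt (1 / (p - q * β))
  have hd' : (0 : ℝ) < d := (one_div_pos.2 hβ).trans hd
  have hd0 : 0 < d := Nat.cast_pos.1 hd'
  -- `L` pays for the remainder of `n` modulo `q` and for the shift `l`.
  obtain ⟨L, hL⟩ := exists_nat_gt (q * |β| - l)
  refine ⟨L, d * (1 + t * q) + s * q, ?_⟩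
  rw [smul_smul, ← zpow_add₀ h0]
  suffices h : scaleSum K ε π r M ≤ algebraMap V K π ^ (-((L : ℤ) + l)) •
      daggerBall π M' (d * (1 + t * q) + s * q) by
    have h2 := field_smul_mono (algebraMap V K π ^ ((L : ℤ) + l)) h
    rwa [smul_smul, ← zpow_add₀ h0, add_neg_cancel, zpow_zero, one_smul] at h2
  refine iSup_le fun n => le_zpow_smul h0 ?_
  rw [scale, smul_smul, ← zpow_add₀ h0, Real.logb_inv, Real.logb_pow]
  have hU' : U ≤ M' := le_sup_left
  have h1' : (1 : X) ∈ M' := hU' h1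
  let a := n / q
  have hG : G ^ q ≤ algebraMap V K π ^ (p : ℤ) • M' := by
    have := le_zpow_smul h0 (i := -(p : ℤ)) (N := G ^ q) (T := M') le_sup_right
    rwa [neg_neg] at this
  have e1 : (M ^ q) ^ a ≤ algebraMap V K π ^ ((p * a : ℕ) : ℤ) • M' ^ (a * (1 + t * q)) := by
    have e2 : M ^ q ≤ algebraMap V K π ^ (p : ℤ) • M' ^ (1 + t * q) := by
      refine (pow_le_pow_left' ht q).trans ?_
      rw [mul_pow, ← pow_mul, pow_add, pow_one]
      refine (mul_le_mul' hG (pow_le_pow_left' hU' _)).trans ?_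
      have := smul_mul_smul_submodule (algebraMap V K π ^ (p : ℤ)) (1 : K) M' (M' ^ (t * q))
      rwa [one_smul, mul_one] at this
    refine (pow_le_smul_pow e2 a).trans_eq ?_
    rw [← pow_mul, mul_comm a, ← zpow_natCast (algebraMap V K π ^ (p : ℤ)), ← zpow_mul]
    push_cast
    rfl
  have e3 : M ^ (n % q) ≤ M' ^ (s * q) := by
    refine (pow_le_pow_left' (hs.trans (pow_le_pow_left' hU' s)) _).trans ?_
    rw [← pow_mul]
    exact pow_mono_of_one_mem le_rfl h1' (Nat.mul_le_mul_left s (Nat.mod_lt n hq).le)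
  have e4 : M ^ n ≤ algebraMap V K π ^ ((p * a : ℕ) : ℤ) • M' ^ (a * (1 + t * q) + s * q) := by
    conv_lhs => rw [← Nat.div_add_mod n q]
    rw [pow_add, pow_mul, pow_add]
    refine (mul_le_mul' e1 e3).trans ?_
    have := smul_mul_smul_submodule (algebraMap V K π ^ ((p * a : ℕ) : ℤ)) (1 : K)
      (M' ^ (a * (1 + t * q))) (M' ^ (s * q))
    rwa [one_smul, mul_one] at this
  refine (field_smul_mono _ e4).trans ?_
  rw [smul_smul, ← zpow_add₀ h0]
  let j := a / d
  have hj : a * (1 + t * q) + s * q ≤ (d * (1 + t * q) + s * q) * (j + 1) := by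
    have h2 : a ≤ d * (j + 1) := (Nat.lt_mul_div_succ a hd0).le
    calc a * (1 + t * q) + s * q ≤ d * (j + 1) * (1 + t * q) + s * q * (j + 1) :=
          Nat.add_le_add (Nat.mul_le_mul_right _ h2) (Nat.le_mul_of_pos_right _ (Nat.succ_pos j))
      _ = _ := by ring
  refine le_trans ?_ (le_iSup (fun j => π ^ j • M' ^ ((d * (1 + t * q) + s * q) * (j + 1))) j)
  refine (field_smul_mono _ (pow_mono_of_one_mem le_rfl h1' hj)).trans ?_
  have e5 : ∀ N : Submodule V X, algebraMap V K π ^ (j : ℤ) • N ≤ π ^ j • N := fun N x hx => by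
    obtain ⟨y, hy, rfl⟩ := (Submodule.mem_smul_pointwise_iff_exists _ _ _).1 hx
    rw [zpow_natCast, ← map_pow, algebraMap_smul]
    exact Submodule.smul_mem_pointwise_smul _ _ _ hy
  refine le_trans (zpow_smul_le h0 ?_ _) (e5 _)
  have h3 : (j : ℝ) ≤ a * (p - q * β) := by
    have h4 : (j : ℝ) * d ≤ a := by exact_mod_cast Nat.div_mul_le_self a d
    have h5 : 1 ≤ d * (p - q * β) := ((div_lt_iff₀ hβ).1 hd).le
    calc (j : ℝ) = j * 1 := (mul_one _).symm
      _ ≤ j * (d * (p - q * β)) := mul_le_mul_of_nonneg_left h5 (Nat.cast_nonneg _)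
      _ = j * d * (p - q * β) := by ring
      _ ≤ a * (p - q * β) := mul_le_mul_of_nonneg_right h4 hβ.le
  have h6 : (n : ℝ) = q * a + (n % q : ℕ) := by exact_mod_cast (Nat.div_add_mod n q).symm
  have h7 : ((n % q : ℕ) : ℝ) * β ≤ q * |β| := by
    refine (mul_le_mul_of_nonneg_left (le_abs_self β) (Nat.cast_nonneg _)).trans ?_
    refine mul_le_mul_of_nonneg_right ?_ (abs_nonneg β)
    exact_mod_cast (Nat.mod_lt n hq).le
  have h8 := Int.le_ceil (-(n * β))
  have h9 : (j : ℝ) ≤ ((L + l + ⌈-(n * β)⌉ + (p * a : ℕ) : ℤ) : ℝ) := by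
    push_cast
    rw [h6] at h8 ⊢
    nlinarith
  exact_mod_cast h9

end TubeEstimates

open ConvexBornology AlgBornology

/-! ### Degrees of coefficients in ideals -/

section IdealGenerators

variable {V : Type*} [CommRing V] {R : Type*} [CommRing R] [Algebra V R]

lemma IsGenerating.exists_le_mul_pow {U G M : Submodule V R} (hU : IsGenerating U) (hM : M.FG)
    (h : (M : Set R) ⊆ Ideal.span (G : Set R)) : ∃ t, M ≤ G * U ^ t := by
  have h1 : ∀ x ∈ Ideal.span (G : Set R), ∃ t, x ∈ G * U ^ t := fun x hx => by
    induction hx using Submodule.span_induction with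
    | mem x hx => exact ⟨0, by simpa using hx⟩
    | zero => exact ⟨0, zero_mem _⟩
    | add x y _ _ hx hy =>
      obtain ⟨k, hk⟩ := hx
      obtain ⟨l, hl⟩ := hy
      exact ⟨max k l, add_mem (mul_le_mul_right (hU.pow_mono (le_max_left k l)) G hk)
        (mul_le_mul_right (hU.pow_mono (le_max_right k l)) G hl)⟩
    | smul r x _ hx =>
      obtain ⟨k, hk⟩ := hx
      obtain ⟨l, hl⟩ := hU.exhausts r
      refine ⟨k + l, ?_⟩
      rw [smul_eq_mul, mul_comm r, pow_add, ← mul_assoc]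
      exact Submodule.mul_mem_mul hk hl
  obtain ⟨s, rfl⟩ := hM
  choose! f hf using h1
  exact ⟨s.sup f, Submodule.span_le.2 fun x hx =>
    mul_le_mul_right (hU.pow_mono (Finset.le_sup hx)) G (hf x (h (Submodule.subset_span hx)))⟩

lemma pow_le_adjoin (M : Submodule V R) (k : ℕ) :
    M ^ k ≤ Subalgebra.toSubmodule (Algebra.adjoin V (M : Set R)) := by
  induction k with
  | zero =>
    rw [pow_zero]
    exact Submodule.one_le.2 (one_mem (Algebra.adjoin V (M : Set R)))
  | succ k ih =>
    rw [pow_succ]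
    exact Submodule.mul_le.2 fun x hx y hy =>
      (Algebra.adjoin V (M : Set R)).mul_mem (ih hx) (Algebra.subset_adjoin hy)

end IdealGenerators

/-! ### The tube bornology and the blow-up algebra -/

section Tube

variable {V : Type u} [CommRing V] [IsDomain V] [IsDiscreteValuationRing V] (K : Type u) [Field K]
  [Algebra V K] [IsFractionRing V K] {ε : ℝ} {π : V} (hπ : Irreducible π) (hε0 : 0 < ε)
  (hε1 : ε < 1) {R : Type u} [CommRing R] [Algebra V R] {J : Ideal R}
  (hJ : algebraMap V R π ∈ J)

omit [IsDomain V] [IsDiscreteValuationRing V] [IsFractionRing V K] in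
lemma image_mul (M N : Submodule V R) : image K (M * N) = image K M * image K N :=
  Submodule.map_mul M N _

omit [IsDomain V] [IsDiscreteValuationRing V] [IsFractionRing V K] in
lemma image_pow (M : Submodule V R) (n : ℕ) : image K (M ^ n) = image K M ^ n :=
  Submodule.map_pow M _ n

/-- The generators of the blow-up algebra `R[π⁻ᵖ Gᑫ]` in `K ⊗ R`, where `R` is generated
by `U`. -/
def blowUpGenerators (π : V) (U G : Submodule V R) (p q : ℕ) : Submodule V (K ⊗[V] R) :=
  image K U ⊔ algebraMap V K π ^ (-(p : ℤ)) • image K G ^ q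

omit [IsDomain V] [IsDiscreteValuationRing V] [IsFractionRing V K] in
lemma fg_blowUpGenerators (π : V) {U G : Submodule V R} (hU : U.FG) (hG : G.FG) (p q : ℕ) :
    (blowUpGenerators K π U G p q).FG :=
  (hU.map _).sup (((hG.map _).pow q).map _)

omit [IsDomain V] [IsDiscreteValuationRing V] [IsFractionRing V K] in
lemma one_mem_blowUpGenerators (π : V) {U G : Submodule V R} (hU : 1 ∈ U) (p q : ℕ) :
    1 ∈ blowUpGenerators K π U G p q :=
  Submodule.mem_sup_left ⟨1, hU, rfl⟩

variable {K} {U G : Submodule V R} (hU : IsGenerating U) (hG : G.FG)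
  (hGJ : Ideal.span (G : Set R) = J) {p q : ℕ} (hq : 0 < q) {α : ℝ} (hα : α = p / q)

include hU hG hGJ hq hα

lemma bdd_daggerBall_blowUp (c : ℕ) :
    (tubeBornology (K := K) hπ hε0 hε1 (fine V R) hJ α).Bdd
      (daggerBall π (blowUpGenerators K π U G p q) c) := by
  have h0 : algebraMap V K π ≠ 0 := (map_ne_zero_iff _ (IsFractionRing.injective V K)).2 hπ.ne_zero
  have hq' : (0 : ℝ) < q := Nat.cast_pos.2 hq
  refine (bdd_tubeConvexBornology_iff hπ hε0 hε1 hJ _).2 ?_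
  -- This submodule contains `G` and `π U ^ (4 * (c + 1))`, as the estimate requires, and it lies in
  -- `J` because `π ∈ J`. The use of `c + 1` avoids the constant zero.
  let M : Submodule V R := G ⊔ π • U ^ (4 * (c + 1))
  have hMJ : (M : Set R) ⊆ J := by
    refine sup_subset (hGJ ▸ Ideal.subset_span) fun x hx => ?_
    obtain ⟨y, -, rfl⟩ := (Submodule.mem_smul_pointwise_iff_exists _ _ _).1 hx
    rw [Algebra.smul_def]
    exact J.mul_mem_right y hJ
  refine ⟨_, ⟨-3, ε ^ (α - 1 / (4 * q * (c + 1 : ℕ))), M, ?_, ?_, hMJ, rfl⟩, ?_⟩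
  · refine Real.rpow_lt_rpow_of_exponent_gt hε0 hε1 (sub_lt_self _ ?_)
    positivity
  · exact (bdd_ofSubmodules' _).2 ⟨M, hG.sup ((hU.fg.pow _).map _), subset_rfl⟩
  · refine le_trans (daggerBall_mono le_rfl (one_mem_blowUpGenerators K π hU.one_mem p q)
      (Nat.le_succ c)) ?_
    refine daggerBall_le_scaleSum h0 (U := image K U) ⟨1, hU.one_mem, rfl⟩ hq (Nat.succ_pos c)
      (image_sup_left _ _) ?_ ?_
    · refine le_zpow_smul h0 (i := 1) ?_
      rw [← image_pow]
      intro x hx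
      obtain ⟨y, ⟨z, hz, rfl⟩, rfl⟩ := (Submodule.mem_smul_pointwise_iff_exists _ _ _).1 hx
      refine ⟨π • z, Submodule.mem_sup_right (Submodule.smul_mem_pointwise_smul _ _ _ hz), ?_⟩
      rw [zpow_one, algebraMap_smul, map_smul]
    · rw [Real.logb_rpow hε0 hε1.ne, hα]

omit hG in
lemma exists_smul_mem_daggerBall_blowUp (S : Submodule V (K ⊗[V] R))
    (hS : (tubeBornology (K := K) hπ hε0 hε1 (fine V R) hJ α).Bdd S) :
    ∃ l c : ℕ, ∀ x ∈ S, π ^ l • x ∈ daggerBall π (blowUpGenerators K π U G p q) c := by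
  have h0 : algebraMap V K π ≠ 0 := (map_ne_zero_iff _ (IsFractionRing.injective V K)).2 hπ.ne_zero
  obtain ⟨_, ⟨l, r, M, hr, hM, hMJ, rfl⟩, hS⟩ := (bdd_tubeConvexBornology_iff hπ hε0 hε1 hJ _).1 hS
  obtain ⟨M', hM', hMM'⟩ := (bdd_ofSubmodules' _).1 hM
  -- As `V` is Noetherian, submodules that are bounded for the fine bornology are finitely
  -- generated. Hence `M` has bounded degree, both in `R` and with respect to the generators of `J`.
  have := isNoetherian_of_fg_of_noetherian M' hM'
  have hMfg : M.FG := isNoetherian_submodule.1 this M hMM'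
  obtain ⟨s, hs⟩ := hU.exists_pow hMfg
  obtain ⟨t, ht⟩ := hU.exists_le_mul_pow hMfg (hGJ.symm ▸ hMJ)
  have hs' : image K M ≤ image K U ^ s := image_pow K U s ▸ image_mono hs
  have ht' : image K M ≤ image K G * image K U ^ t := by
    rw [← image_pow, ← image_mul]
    exact image_mono ht
  have hpos := Real.rpow_pos_of_pos hε0 α
  have hr' : Real.logb ε r < p / q := by
    rw [← hα, ← Real.logb_rpow hε0 hε1.ne (x := α)]
    exact (Real.logb_lt_logb_iff_of_base_lt_one hε0 hε1 (hpos.trans hr) hpos).2 hr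
  obtain ⟨L, c, h⟩ := exists_smul_scaleSum_le_daggerBall h0 (G := image K G) (U := image K U)
    (M := image K M) (p := p) ⟨1, hU.one_mem, rfl⟩ hq hs' ht' hr' l
  refine ⟨L, c, fun x hx => h ?_⟩
  rw [← algebraMap_smul K (π ^ L) x, map_pow, ← zpow_natCast]
  exact Submodule.smul_mem_pointwise_smul _ _ _ (hS hx)

/-- The two estimates show that up to powers of `π` the bounded sets of the tube bornology are those
of the weak completion of the blow-up algebra. A rational exponent is needed for `π⁻ᵖ Gᑫ` to make
sense. -/
theorem isDaggerDense_blowUp :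
    IsDaggerDense (π := π) π (tubeBornology (K := K) hπ hε0 hε1 (fine V R) hJ α)
      (Algebra.adjoin V (blowUpGenerators K π U G p q : Set (K ⊗[V] R))).val := by
  have h0 : algebraMap V K π ≠ 0 := (map_ne_zero_iff _ (IsFractionRing.injective V K)).2 hπ.ne_zero
  refine isDaggerDense_adjoin ?_ (fg_blowUpGenerators K π hU.fg hG p q)
    (one_mem_blowUpGenerators K π hU.one_mem p q)
    (bdd_daggerBall_blowUp hπ hε0 hε1 hJ hU hG hGJ hq hα)
    (exists_smul_mem_daggerBall_blowUp hπ hε0 hε1 hJ hU hGJ hq hα)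
  rw [IsScalarTower.algebraMap_apply V K (K ⊗[V] R)]
  exact (isUnit_iff_ne_zero.2 h0).map _

omit hG hGJ hq hα in
include hπ in
lemma isAway_blowUp : IsAway π
    (Algebra.adjoin V (blowUpGenerators K π U G p q : Set (K ⊗[V] R))).val := by
  have h0 : algebraMap V K π ≠ 0 := (map_ne_zero_iff _ (IsFractionRing.injective V K)).2 hπ.ne_zero
  refine ⟨?_, Subtype.val_injective, fun x => ?_⟩
  · rw [IsScalarTower.algebraMap_apply V K (K ⊗[V] R)]
    exact (isUnit_iff_ne_zero.2 h0).map _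
  · obtain ⟨l, y, hy⟩ := exists_pow_smul_mem (K := K) hπ x
    obtain ⟨k, hk⟩ := hU.exhausts y
    have h1 : (1 : K) ⊗ₜ[V] y ∈
        Algebra.adjoin V (blowUpGenerators K π U G p q : Set (K ⊗[V] R)) := by
      have h2 : (1 : K) ⊗ₜ[V] y ∈ image K U ^ k := image_pow K U k ▸ ⟨y, hk, rfl⟩
      have h3 : image K U ≤ blowUpGenerators K π U G p q := le_sup_left
      exact pow_le_adjoin _ k (pow_le_pow_left' h3 k h2)
    refine ⟨l, ⟨_, h1⟩, ?_⟩
    rw [← algebraMap_smul K (π ^ l) x, map_pow, hy]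
    rfl

end Tube

/-! ### Hochschild homology of tube completions -/

section

variable {V : Type u} [CommRing V] [IsDomain V] [IsDiscreteValuationRing V] (K : Type u) [Field K]
  [Algebra V K] [IsFractionRing V K] {ε : ℝ} {π : V} (hπ : Irreducible π) (hε0 : 0 < ε)
  (hε1 : ε < 1) {R : Type u} [CommRing R] [Algebra V R] [Algebra.FiniteType V R] {J : Ideal R}
  (hJ : algebraMap V R π ∈ J)

/-- The blow-up algebra is finitely generated and, inside `K ⊗ R`, torsion-free. Inverting `π` in it
gives `K ⊗ R`, and the tube completion is the localization at `π` of its weak completion, so the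
general comparison applies with `s = π`. -/
theorem isIso_extendHomology_tube {α : ℚ} (hα : 0 ≤ α) (n : ℕ) :
    IsIso (extendHomology (hochschildComparison π
      (TubeCompletion.bornology K hπ hε0 hε1 hJ α)
      (TubeCompletion.of K hπ hε0 hε1 hJ α)) n) := by
  have h0 : algebraMap V K π ≠ 0 := (map_ne_zero_iff _ (IsFractionRing.injective V K)).2 hπ.ne_zero
  have := Algebra.FiniteType.isNoetherianRing V R
  obtain ⟨U, hU⟩ := exists_isGenerating V R
  obtain ⟨s, hs⟩ := IsNoetherian.noetherian J
  let G := Submodule.span V (s : Set R)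
  have hG : G.FG := ⟨s, rfl⟩
  have hGJ : Ideal.span (G : Set R) = J := by
    rw [← hs]
    exact Submodule.span_span_of_tower ..
  have hα' : ((α : ℚ) : ℝ) = (α.num.toNat : ℝ) / α.den := by
    have h1 : ((α.num.toNat : ℤ) : ℝ) = α.num := by rw [Int.toNat_of_nonneg (Rat.num_nonneg.2 hα)]
    rw [Rat.cast_def, ← h1, Int.cast_natCast]
  let Q := Algebra.adjoin V (blowUpGenerators K π U G α.num.toNat α.den : Set (K ⊗[V] R))
  have hQ := finiteType_adjoin (fg_blowUpGenerators K π hU.fg hG α.num.toNat α.den)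
  have hi : IsAway π Q.val := isAway_blowUp hπ hU
  have htf : ∀ x : Q, π • x = 0 → x = 0 := fun x hx =>
    hi.injective (by rw [map_zero]; exact smul_pow_left_cancel hi.isUnit 1 (by
      rw [pow_one, ← map_smul, hx, map_zero]))
  have := flat_of_smul_eq_zero hπ htf
  have hd := isDaggerDense_blowUp (K := K) hπ hε0 hε1 hJ hU hG hGJ α.den_pos hα'
  exact (hd.isDaggerAway_lift htf).isIso_extendHomology hπ.ne_zero hi
    (g := TubeCompletion.of K hπ hε0 hε1 hJ α)
    (AlgHom.ext fun q => (lift_of htf _ hd.bounded q).symm) dvd_rfl n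

end

end BornHH

end

theorem mainTheorem7 {V : Type u} [CommRing V] [IsDomain V] [IsDiscreteValuationRing V]
    [IsAdicComplete (IsLocalRing.maximalIdeal V) V] (π : V) (hπ : Irreducible π)
    (K : Type u) [Field K] [Algebra V K] [IsFractionRing V K]
    (ε : ℝ) (hε0 : 0 < ε) (hε1 : ε < 1)
    (R : Type u) [CommRing R] [Algebra V R] [Algebra.FiniteType V R]
    (htf : ∀ x : R, π • x = 0 → x = 0) :
    BornHH.IsFlatResolution (BornHH.extendedBar π R) (BornHH.extendedBarAugmentation π R) ∧
    (∃ e : BornHH.WeakCompletion π (R ⊗[V] R) ≃ₐ[V]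
        (BornHH.completedPowers π (BornHH.WeakCompletion.bornology π R)).X 2,
      BornHH.ConvexBornology.BoundedMap
        (BornHH.WeakCompletion.bornology π (R ⊗[V] R)).toConvexBornology
        (BornHH.AlgBornology.Completion.bornology π
          (BornHH.TPow.bornology (BornHH.WeakCompletion.bornology π R) 2)).toConvexBornology e ∧
      BornHH.ConvexBornology.BoundedMap
        (BornHH.AlgBornology.Completion.bornology π
          (BornHH.TPow.bornology (BornHH.WeakCompletion.bornology π R) 2)).toConvexBornology
        (BornHH.WeakCompletion.bornology π (R ⊗[V] R)).toConvexBornology e.symm ∧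
      (∀ a b : R, e (BornHH.WeakCompletion.of π (R ⊗[V] R) (a ⊗ₜ b)) =
        BornHH.completedPair π (BornHH.WeakCompletion.bornology π R)
          (BornHH.WeakCompletion.of π R a ⊗ₜ BornHH.WeakCompletion.of π R b)) ∧
      (∀ x y : BornHH.WeakCompletion π R,
        BornHH.mulDagger π R
          (e.symm (BornHH.completedPair π (BornHH.WeakCompletion.bornology π R) (x ⊗ₜ y))) =
            x * y) ∧
      BornHH.IsFlatResolution
        (BornHH.completedBar π (BornHH.WeakCompletion.bornology π R) e.toAlgHom)
        (BornHH.completedBarAugmentation e)) ∧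
    QuasiIso (BornHH.extendHom (BornHH.hochschildComparison π
      (BornHH.WeakCompletion.bornology π R) (BornHH.WeakCompletion.of π R))) ∧
    (∀ n, IsIso (BornHH.extendHomology (BornHH.hochschildComparison π
      (BornHH.WeakCompletion.bornology π R) (BornHH.WeakCompletion.of π R)) n)) ∧
    (∀ (J : Ideal R) (hJ : algebraMap V R π ∈ J) (α : ℚ), 0 ≤ α → α ≤ 1 → ∀ n,
      IsIso (BornHH.extendHomology (BornHH.hochschildComparison π
        (BornHH.TubeCompletion.bornology K hπ hε0 hε1 hJ α)
        (BornHH.TubeCompletion.of K hπ hε0 hε1 hJ α)) n)) := by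
  have := BornHH.flat_of_smul_eq_zero hπ htf
  -- For the weak completion the general comparison is applied with `Q = A = R` and `s = 1`.
  have h := BornHH.isDaggerAway_id (π := π) (Q := R)
  have hi : BornHH.IsAway (1 : V) (AlgHom.id V R) := BornHH.isAway_one Function.bijective_id
  exact ⟨BornHH.isFlatResolution_extendedBar π R,
    ⟨BornHH.WeakCompletion.tensorEquiv hπ.ne_zero R,
      BornHH.WeakCompletion.bounded_tensorEquiv hπ.ne_zero R,
      BornHH.WeakCompletion.bounded_tensorEquiv_symm hπ.ne_zero R,
      BornHH.WeakCompletion.tensorEquiv_of_tmul hπ.ne_zero R,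
      BornHH.WeakCompletion.mulDagger_tensorEquiv_symm hπ.ne_zero R,
      BornHH.WeakCompletion.isFlatResolution_completedBar hπ.ne_zero R⟩,
    h.quasiIso_hochschildComparison hπ.ne_zero hi rfl (one_dvd _),
    h.isIso_extendHomology hπ.ne_zero hi rfl (one_dvd _),
    fun _ hJ _ hα _ => BornHH.isIso_extendHomology_tube K hπ hε0 hε1 hJ hα⟩
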